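/- **Conventions.** Fix $\theta\in\mathbb R$ and put $A_\theta=(\theta-\tfrac\pi2,\theta+\tfrac\pi2)$, $\bar A_\theta=[\theta-\tfrac\pi2,\theta+\tfrac\pi2]$. A *Borel disc* is $S_\theta(\delta)=\{\hbar:\operatorname{Re}(e^{i\theta}/\hbar)>1/\delta\}$, $\delta>0$. A *sectorial domain with opening $A_\theta$* is a simply connected domain $S\subset\mathbb C\setminus\{0\}$ whose closure in the real-oriented blowup of $\mathbb C$ at $0$ meets the circle of directions exactly in $\bar A_\theta$, and which contains a Borel disc $S_\theta(\delta)$. For a function $f(x,\hbar)$ on $\mathbb U\subset\mathbb C^2$, a series $\hat f=\sum_k f_k(x)\hbar^k$ and a scale $\chi(x)$, we write "$f\simeq\hat f$ as $\hbar\to0$ along $\bar A_\theta$, wrt $\chi$, unif. $\forall x\in U$" if there are a sectorial domain $S'$ with opening $A_\theta$ and $U\times S'\subset\mathbb U$, and constants $C,M>0$, such that $|f(x,\hbar)-\sum_{k<n}f_k(x)\hbar^k|\le|\chi(x)|\,CM^n n!\,|\hbar|^n$ for all $n\ge0$, $x\in U$, $\hbar\in S'$. If $\chi$ is omitted, $\chi=1$;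 "loc. unif." means uniformly on a neighbourhood of every point. Let $\Xi_\theta(\epsilon)=\{\xi:\operatorname{dist}(\xi,e^{i\theta}\mathbb R_+)<\epsilon\}$. A series $\hat f\in\mathcal O(U)[[\hbar]]$ is *uniformly Borel summable on $U$ in the direction $\theta$* if $|f_k(x)|\le CM^kk!$ for all $k$ and all $x\in U$ (for some $C,M>0$), and for some $\epsilon>0$ its formal Borel transform $\hat\phi=\sum_n\frac{1}{n!}f_{n+1}(x)\xi^n$ continues analytically to a holomorphic function $\phi$ on $U\times\Xi_\theta(\epsilon)$ with $|\phi(x,\xi)|\le Ae^{L|\xi|}$ for some constants $A,L>0$. Its Borel resummation is $\mathcal S_\theta[\hat f]=f_0+\mathcal L_\theta[\phi]$, where $\mathcal L_\theta[\phi](x,\hbar)=\int_{e^{i\theta}\mathbb R_+}e^{-\xi/\hbar}\phi(x,\xi)\,d\xi$. We say that $F=\mathcal S_\theta[\hat f]$ uniformly on $U\times S_0$ if this identity holds for all $(x,\hbar)\in U\times S_0$ and the integral converges uniformly there. **Theorem.** Let $X\subset\mathbb C_x$ be a domain, $S\subset\mathbb C_\hbar$ a sectorial domain with opening $A_\theta$,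 and consider $$\hbar\,\partial_xf=f^2+pf+q,$$ where $p,q$ are holomorphic on $X\times S$ and admit locally uniform (in $x\in X$) Poincaré asymptotic expansions $\hat p,\hat q\in\mathcal O(X)[[\hbar]]$ as $\hbar\to0$ along the open arc $A_\theta$. Let $D_0=p_0^2-4q_0$, let $x_0\in X$ with $D_0(x_0)\ne0$, fix a holomorphic branch of $\sqrt{D_0}$ near $x_0$ and a sign $\alpha\in\{+,-\}$. Let $\Phi(x)=\int_{x_0}^x\sqrt{D_0(t)}\,dt$. Assume: 1. There is a WKB $(\theta,\alpha)$-halfstrip $W\subset X$ containing $x_0$: that is, for some $z_1\in\mathbb C$, $r>0$ with $0\in H(r)$, where $H(\rho):=\{z:\operatorname{dist}(z,z_1+e^{i\theta}\mathbb R_\alpha)<\rho\}$, the germ at $0$ of the inverse $\Phi^{-1}$ with $\Phi^{-1}(0)=x_0$ extends to a holomorphic map $\Phi^{-1}:H(r)\to X$ with $\big((\Phi^{-1})'\big)^2\cdot(D_0\circ\Phi^{-1})=1$; and $W=\Phi^{-1}(H(r))$. For $r_0\in(0,r)$ put $W_{r_0}=\Phi^{-1}(H(r_0))$. 2. As $\hbar\to0$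 along $\bar A_\theta$, uniformly for all $x\in W$: $p\simeq\hat p$ wrt $\sqrt{D_0}$ and $q\simeq\hat q$ wrt $D_0$. 3. $\partial_x\log D_0$ is bounded by $D_0$ on $W$: $|\partial_x\log D_0|\le C|D_0|$ on $W$ for some constant $C$. Then $\sqrt{D_0}$ extends from $x_0$ to a holomorphic branch on $W$; there is a unique formal solution $\hat f_\alpha=\sum_k f_k^\alpha\hbar^k\in\mathcal O(W)[[\hbar]]$ with leading term $f_0^\alpha=\tfrac12(-p_0+\alpha\sqrt{D_0})$; and there are sectorial domains $S_{r_0}\subset S$ with opening $A_\theta$ (for $r_0\in(0,r)$) and a holomorphic solution $f=f_\alpha^\theta$ on $\mathbb W=\bigcup_{r_0\in(0,r)}W_{r_0}\times S_{r_0}$ such that the following hold. * **(Halfstrip.)** $f$ is the unique holomorphic solution on $\mathbb W$ with $f\simeq\hat f_\alpha$ as $\hbar\to0$ along $\bar A_\theta$, loc. unif. $\forall x\in W$. Moreover, for each $r_0\in(0,r)$, on $W_{r_0}\times S_{r_0}$ one has $f\simeq\hat f_\alpha$ as $\hbar\to0$ along $\bar A_\theta$, wrt $\sqrt{D_0}$,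 unif. $\forall x\in W_{r_0}$. * For every domain $U_0$ compactly contained in $W$ there is a sectorial domain $S_0\subset S$ with opening $A_\theta$ and $U_0\times S_0\subset\mathbb W$ such that: * **(Existence and uniqueness.)** $f$ is the unique holomorphic solution on $U_0\times S_0$ with $f\simeq\hat f_\alpha$ as $\hbar\to0$ along $\bar A_\theta$, unif. $\forall x\in U_0$. * **(Borel summability.)** The formal Borel transform $\hat\phi_\alpha(x,\xi)=\sum_n\frac1{n!}f^\alpha_{n+1}(x)\xi^n$ converges uniformly on $U_0\times\{|\xi|<\rho\}$ for some $\rho>0$, to a holomorphic function; there are $C,M>0$ with $|f^\alpha_k(x)|\le CM^kk!$ for all $k\ge0$, $x\in U_0$; $\hat f_\alpha$ is uniformly Borel summable on $U_0$ in the direction $\theta$, and $f=\mathcal S_\theta[\hat f_\alpha]=f_0^\alpha+\mathcal L_\theta[\phi_\alpha^\theta]$ uniformly on $U_0\times S_0$. Here the continuation $\phi^\theta_\alpha$ of $\hat\phi_\alpha$ to $U_0\times\Xi_\theta(\epsilon)$ is the analytic Borel transform of $f$: for some $\delta_0>0$ with $S_\theta(\delta_0)\subset S_0$ and every $\delta\in(0,\delta_0)$,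 $$\phi_\alpha^\theta(x,\xi)=\frac1{2\pi i}\oint_\theta\big(f(x,\hbar)-f_0^\alpha(x)\big)e^{\xi/\hbar}\frac{d\hbar}{\hbar^2},\qquad \xi\in e^{i\theta}\mathbb R_{>0},$$ where $\oint_\theta$ is the Cauchy principal value at $\hbar=0$ of the integral along the boundary of $S_\theta(\delta)$ traversed anticlockwise (the limit as $T\to\infty$ of the integrals over the segments $|\operatorname{Im}(e^{i\theta}/\hbar)|\le T$), and the limit is uniform for $x\in U_0$ and $\xi$ in compact subsets of the open ray. * **(Derivatives.)** $\partial_x\hat f_\alpha$ is uniformly Borel summable on $U_0$ in the direction $\theta$, and $\partial_xf=\mathcal S_\theta[\partial_x\hat f_\alpha]$ uniformly on $U_0\times S_0$. * **(Integrals.)** Let $x_0'\in U_0$, and assume either that $\Phi^{-1}:H(r)\to W$ is injective (in which case the integrals $\int_{x_0'}^xf_k^\alpha\,dt$ are well defined on $U_0$), or that the integrals $\int_{x_0'}^xf_k^\alpha\,dt$ are path-independent in $U_0$ and the points of $U_0$ can be joined to $x_0'$ by paths in $U_0$ of bounded length. Then $\int_{x_0'}^x\hat f_\alpha\,dt$ is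 uniformly Borel summable on $U_0$ in the direction $\theta$, the integral $\int_{x_0'}^xf(t,\hbar)\,dt$ is well defined for $x\in U_0$, $\hbar\in S_0$, and it equals $\mathcal S_\theta\big[\int_{x_0'}^x\hat f_\alpha\,dt\big]$ uniformly on $U_0\times S_0$. -/

import Mathlib

open Set Filter Topology

noncomputable section

namespace Riccati

/-- The unit complex number in the direction `θ`. -/
def dir (θ : ℝ) : ℂ := Complex.exp ((θ : ℂ) * Complex.I)

/-- The Borel disc of diameter `δ` bisected by the direction `θ`. (`ħ = 0` is left out, because
`1 / 0 = 0` in Lean and `1 / δ > 0`.) -/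
def borelDisc (θ δ : ℝ) : Set ℂ := {ħ | 1 / δ < (dir θ / ħ).re}

/-- The directions (points of the unit circle) which the closure of `S` in the real-oriented blowup
of the plane at the origin meets on the boundary circle. -/
def boundaryDirections (S : Set ℂ) : Set ℂ :=
  {u | ‖u‖ = 1 ∧ MapClusterPt u (𝓝[S] 0) (fun ħ : ℂ => ħ / (‖ħ‖ : ℂ))}

/-- Sectorial domains at the origin with opening `A_θ = (θ - π/2, θ + π/2)`: simply connected domains
in the punctured plane whose closure in the real-oriented blowup meets the boundary circle in the
closed arc `[θ - π/2, θ + π/2]`, and which contain a Borel disc bisected by `θ`. -/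
structure IsSectorialDomain (θ : ℝ) (S : Set ℂ) : Prop where
  isOpen : IsOpen S
  simplyConnected : IsSimplyConnected S
  zero_notMem : (0 : ℂ) ∉ S
  directions : boundaryDirections S = {u | ‖u‖ = 1 ∧ 0 ≤ (u / dir θ).re}
  borelDisc_subset : ∃ δ : ℝ, 0 < δ ∧ borelDisc θ δ ⊆ S

/-! ### Asymptotics as `ħ → 0`

Functions of `(x, ħ)` are curried, and a formal power series `∑ fₖ(x) ħ ^ k` is given by its
coefficients `fhat k x = fₖ(x)`. -/

/-- The remainder of order `n`. -/
def remainder (f : ℂ → ℂ → ℂ) (fhat : ℕ → ℂ → ℂ) (n : ℕ) (x ħ : ℂ) : ℂ :=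
  f x ħ - ∑ k ∈ Finset.range n, fhat k x * ħ ^ k

/-- Locally uniform Poincaré asymptotics of a function on `X × S` as `ħ → 0` along the open arc
`A_θ`, with holomorphic coefficients. The arcs `{|arg ħ - θ| < η}`, `η < π/2`, are cofinal among the
subarcs that are compactly contained in `A_θ`. -/
def PoincareLoc (θ : ℝ) (X S : Set ℂ) (f : ℂ → ℂ → ℂ) (fhat : ℕ → ℂ → ℂ) : Prop :=
  (∀ k, DifferentiableOn ℂ (fhat k) X) ∧
  ∀ x₁ ∈ X, ∃ U₁ : Set ℂ, IsOpen U₁ ∧ x₁ ∈ U₁ ∧ U₁ ⊆ X ∧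
    ∀ n : ℕ, ∀ η : ℝ, 0 < η → η < Real.pi / 2 → ∃ R : ℝ, 0 < R ∧ ∃ C : ℝ,
      ∀ x ∈ U₁, ∀ ħ ∈ S, ‖ħ‖ < R → |Complex.arg (ħ / dir θ)| < η →
        ‖remainder f fhat n x ħ‖ ≤ C * ‖ħ‖ ^ n

/-- Gevrey asymptotics of a function on `𝕌 ⊆ ℂ × ℂ` as `ħ → 0` along the closed arc `Ā_θ`, with
respect to the asymptotic scale `scale`, uniformly for all `x ∈ U`. -/
def GevreyUnif (θ : ℝ) (U : Set ℂ) (𝕌 : Set (ℂ × ℂ)) (scale : ℂ → ℝ)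
    (f : ℂ → ℂ → ℂ) (fhat : ℕ → ℂ → ℂ) : Prop :=
  ∃ S' : Set ℂ, IsSectorialDomain θ S' ∧ U ×ˢ S' ⊆ 𝕌 ∧
    ∃ C M : ℝ, 0 < C ∧ 0 < M ∧ ∀ n : ℕ, ∀ x ∈ U, ∀ ħ ∈ S',
      ‖remainder f fhat n x ħ‖ ≤ scale x * (C * M ^ n * (n.factorial : ℝ) * ‖ħ‖ ^ n)

/-- Gevrey asymptotics along the closed arc `Ā_θ`, locally uniformly for all `x ∈ U`. -/
def GevreyLoc (θ : ℝ) (U : Set ℂ) (𝕌 : Set (ℂ × ℂ)) (f : ℂ → ℂ → ℂ) (fhat : ℕ → ℂ → ℂ) : Prop :=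
  ∀ x₁ ∈ U, ∃ U₁ : Set ℂ, IsOpen U₁ ∧ x₁ ∈ U₁ ∧ U₁ ⊆ U ∧ GevreyUnif θ U₁ 𝕌 (fun _ => 1) f fhat

/-! ### The monic Riccati equation -/

/-- `f` is holomorphic on `𝕌` and solves `ħ ∂ₓ f = f² + p f + q` there. -/
def IsSolution (p q : ℂ → ℂ → ℂ) (𝕌 : Set (ℂ × ℂ)) (f : ℂ → ℂ → ℂ) : Prop :=
  DifferentiableOn ℂ (fun w : ℂ × ℂ => f w.1 w.2) 𝕌 ∧
  ∀ x ħ : ℂ, (x, ħ) ∈ 𝕌 →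
    ħ * deriv (fun y => f y ħ) x = f x ħ ^ 2 + p x ħ * f x ħ + q x ħ

/-- `fhat` is a formal power series with holomorphic coefficients on `U` that solves
`ħ ∂ₓ f = f² + p f + q` order by order in `ħ`. -/
def IsFormalSolution (phat qhat : ℕ → ℂ → ℂ) (U : Set ℂ) (fhat : ℕ → ℂ → ℂ) : Prop :=
  (∀ k, DifferentiableOn ℂ (fhat k) U) ∧
  ∀ k : ℕ, ∀ x ∈ U,
    (if k = 0 then 0 else deriv (fhat (k - 1)) x) =
      (∑ ij ∈ Finset.HasAntidiagonal.antidiagonal k, fhat ij.1 x * fhat ij.2 x) +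
      (∑ ij ∈ Finset.HasAntidiagonal.antidiagonal k, phat ij.1 x * fhat ij.2 x) + qhat k x

/-- The leading-order discriminant `p₀² - 4 q₀`. -/
def discr (phat qhat : ℕ → ℂ → ℂ) (x : ℂ) : ℂ := phat 0 x ^ 2 - 4 * qhat 0 x

/-! ### WKB halfstrips -/

/-- The closed ray from `z₁` in the direction `u`. -/
def ray (z₁ u : ℂ) : Set ℂ := {z | ∃ t : ℝ, 0 ≤ t ∧ z = z₁ + (t : ℂ) * u}

/-- The halfstrip `{z | dist (z, z₁ + e^{iθ} ℝ_α) < r}`, where `ε = 1` for `α = +` and `ε = -1` for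
`α = -`. -/
def halfstrip (θ ε : ℝ) (z₁ : ℂ) (r : ℝ) : Set ℂ :=
  {z | Metric.infDist z (ray z₁ ((ε : ℂ) * dir θ)) < r}

/-- `Ψ` is the inverse `Φ⁻¹` on the halfstrip `H = halfstrip θ ε z₁ r` of the Liouville transformation
`Φ(x) = ∫_{x₀}^x √D` with basepoint `x₀`, where `s₀` is the value at `x₀` of the chosen branch of `√D`.
(`Φ` may be multivalued on the image of `H`, but `Φ⁻¹` is a single-valued local biholomorphism: it is
the holomorphic map with `Φ⁻¹(0) = x₀` whose derivative is `1 / √D`, with the branch of `√D` continued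
from `x₀`.) The WKB halfstrip is the image `Ψ '' H`; it lies in `X` and contains `x₀`. -/
structure IsWKBHalfstrip (X : Set ℂ) (D : ℂ → ℂ) (x₀ s₀ : ℂ) (θ ε : ℝ) (z₁ : ℂ) (r : ℝ)
    (Ψ : ℂ → ℂ) : Prop where
  radius_pos : 0 < r
  zero_mem : (0 : ℂ) ∈ halfstrip θ ε z₁ r
  base : Ψ 0 = x₀
  branch : deriv Ψ 0 * s₀ = 1
  differentiableOn : DifferentiableOn ℂ Ψ (halfstrip θ ε z₁ r)
  mapsTo : MapsTo Ψ (halfstrip θ ε z₁ r) X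
  liouville : ∀ z ∈ halfstrip θ ε z₁ r, deriv Ψ z ^ 2 * D (Ψ z) = 1

/-! ### Borel-Laplace theory -/

/-- The tubular neighbourhood of thickness `τ` of the ray `e^{iθ} ℝ₊`. -/
def tube (θ τ : ℝ) : Set ℂ := {ξ | Metric.infDist ξ (ray 0 (dir θ)) < τ}

/-- The coefficients `φₙ = fₙ₊₁ / n!` of the formal Borel transform. -/
def formalBorel (fhat : ℕ → ℂ → ℂ) (n : ℕ) (x : ℂ) : ℂ := fhat (n + 1) x / (n.factorial : ℂ)

/-- The formal Borel transform is a uniformly convergent power series in `ξ` on `U`, and defines a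
holomorphic function on the product of `U` with a disc. -/
def FormalBorelConverges (U : Set ℂ) (fhat : ℕ → ℂ → ℂ) : Prop :=
  ∃ ρ : ℝ, 0 < ρ ∧ ∃ φ : ℂ → ℂ → ℂ,
    DifferentiableOn ℂ (fun w : ℂ × ℂ => φ w.1 w.2) (U ×ˢ Metric.ball 0 ρ) ∧
    TendstoUniformlyOn
      (fun (N : ℕ) (w : ℂ × ℂ) => ∑ n ∈ Finset.range N, formalBorel fhat n w.1 * w.2 ^ n)
      (fun w => φ w.1 w.2) atTop (U ×ˢ Metric.ball 0 ρ)

/-- `fhat` is a uniformly Gevrey series on `U`. -/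
def UniformlyGevrey (U : Set ℂ) (fhat : ℕ → ℂ → ℂ) : Prop :=
  ∃ C M : ℝ, 0 < C ∧ 0 < M ∧ ∀ k : ℕ, ∀ x ∈ U, ‖fhat k x‖ ≤ C * M ^ k * (k.factorial : ℝ)

/-- `φ` is the analytic continuation, along the ray `e^{iθ} ℝ₊`, of the formal Borel transform of
`fhat` to the product of `U` with the tube of thickness `τ`. -/
def IsBorelContinuation (θ τ : ℝ) (U : Set ℂ) (fhat : ℕ → ℂ → ℂ) (φ : ℂ → ℂ → ℂ) : Prop :=
  DifferentiableOn ℂ (fun w : ℂ × ℂ => φ w.1 w.2) (U ×ˢ tube θ τ) ∧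
  ∃ ρ : ℝ, 0 < ρ ∧ ∀ x ∈ U, ∀ ξ ∈ Metric.ball (0 : ℂ) ρ,
    HasSum (fun n : ℕ => formalBorel fhat n x * ξ ^ n) (φ x ξ)

/-- `fhat` is a uniformly Borel summable series on `U` in the direction `θ`, and `φ` is the analytic
continuation of its formal Borel transform to the product of `U` with the tube of thickness `τ`. -/
def IsBorelSummable (θ τ : ℝ) (U : Set ℂ) (fhat : ℕ → ℂ → ℂ) (φ : ℂ → ℂ → ℂ) : Prop :=
  0 < τ ∧ (∀ k, DifferentiableOn ℂ (fhat k) U) ∧ UniformlyGevrey U fhat ∧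
  IsBorelContinuation θ τ U fhat φ ∧
  ∃ A L : ℝ, 0 < A ∧ 0 < L ∧ ∀ x ∈ U, ∀ ξ ∈ tube θ τ, ‖φ x ξ‖ ≤ A * Real.exp (L * ‖ξ‖)

/-- The integrand of the Laplace transform, on the ray parameterised by `ξ = t e^{iθ}`. -/
def laplaceIntegrand (θ : ℝ) (φ : ℂ → ℂ → ℂ) (x ħ : ℂ) (t : ℝ) : ℂ :=
  φ x ((t : ℂ) * dir θ) * Complex.exp (-((t : ℂ) * dir θ) / ħ) * dir θ

/-- The Laplace transform in the direction `θ`. -/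
def laplace (θ : ℝ) (φ : ℂ → ℂ → ℂ) (x ħ : ℂ) : ℂ :=
  ∫ t in Ioi (0 : ℝ), laplaceIntegrand θ φ x ħ t

/-- The integral defining the Laplace transform converges (absolutely, and) uniformly on `U × S`. -/
def LaplaceConverges (θ : ℝ) (U S : Set ℂ) (φ : ℂ → ℂ → ℂ) : Prop :=
  (∀ x ∈ U, ∀ ħ ∈ S, MeasureTheory.IntegrableOn (laplaceIntegrand θ φ x ħ) (Ioi 0)) ∧
  TendstoUniformlyOn (fun (T : ℝ) (w : ℂ × ℂ) => ∫ t in (0 : ℝ)..T, laplaceIntegrand θ φ w.1 w.2 t)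
    (fun w => laplace θ φ w.1 w.2) atTop (U ×ˢ S)

/-- `f` is, on `U × S`, the uniform Borel resummation in the direction `θ` of the uniformly Borel
summable series `fhat`. -/
def IsBorelResummation (θ : ℝ) (U S : Set ℂ) (fhat : ℕ → ℂ → ℂ) (f : ℂ → ℂ → ℂ) : Prop :=
  ∃ (τ : ℝ) (φ : ℂ → ℂ → ℂ), IsBorelSummable θ τ U fhat φ ∧ LaplaceConverges θ U S φ ∧
    ∀ x ∈ U, ∀ ħ ∈ S, f x ħ = fhat 0 x + laplace θ φ x ħ

/-- The boundary of the Borel disc of diameter `δ`, traversed anticlockwise from the origin to the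
origin as `t` goes from `-∞` to `∞`. -/
def borelPath (θ δ : ℝ) (t : ℝ) : ℂ := dir θ / ((1 / δ : ℝ) - Complex.I * (t : ℂ))

/-- The integral `(1 / 2πi) ∫ g(x, ħ) e^{ξ/ħ} dħ / ħ²` over the segment `[-T, T]` of the boundary of
the Borel disc of diameter `δ`. Its limit as `T → ∞` is the analytic Borel transform of `g`. -/
def truncatedBorel (θ δ : ℝ) (g : ℂ → ℂ → ℂ) (T : ℝ) (x ξ : ℂ) : ℂ :=
  (1 / (2 * (Real.pi : ℂ) * Complex.I)) *
    ∫ t in (-T)..T, g x (borelPath θ δ t) * Complex.exp (ξ / borelPath θ δ t) /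
      borelPath θ δ t ^ 2 * deriv (borelPath θ δ) t

/-- For every sufficiently small `δ` the integral defining the analytic Borel transform of `g` in the
direction `θ` converges to `φ`, uniformly for `x ∈ U` and for `ξ` in compact parts of the open ray
`e^{iθ} ℝ_{>0}`. -/
def IsAnalyticBorelTransform (θ : ℝ) (U S : Set ℂ) (g φ : ℂ → ℂ → ℂ) : Prop :=
  ∃ δ₀ : ℝ, 0 < δ₀ ∧ borelDisc θ δ₀ ⊆ S ∧
    ∀ δ : ℝ, 0 < δ → δ < δ₀ → ∀ a b : ℝ, 0 < a → a ≤ b →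
      TendstoUniformlyOn (fun (T : ℝ) (w : ℂ × ℝ) => truncatedBorel θ δ g T w.1 ((w.2 : ℂ) * dir θ))
        (fun w => φ w.1 ((w.2 : ℂ) * dir θ)) atTop (U ×ˢ Icc a b)

/-- The terms of `Fhat` are the integrals `∫_{x'}^x fₖ(t) dt` on the domain `U`. -/
def IsFormalIntegral (U : Set ℂ) (x' : ℂ) (fhat Fhat : ℕ → ℂ → ℂ) : Prop :=
  ∀ k, Fhat k x' = 0 ∧ ∀ x ∈ U, HasDerivAt (Fhat k) (fhat k x) x

/-- `F(x, ħ) = ∫_{x'}^x f(t, ħ) dt` for `x` in the domain `U` and `ħ ∈ S`. -/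
def IsIntegral (U S : Set ℂ) (x' : ℂ) (f F : ℂ → ℂ → ℂ) : Prop :=
  ∀ ħ ∈ S, F x' ħ = 0 ∧ ∀ x ∈ U, HasDerivAt (fun y => F y ħ) (f x ħ) x

/-- The points of `U` can be joined to `x'` by paths in `U` of bounded length. -/
def BoundedPaths (U : Set ℂ) (x' : ℂ) : Prop :=
  ∃ K : NNReal, ∀ x ∈ U, ∃ γ : ℝ → ℂ, LipschitzOnWith K γ (Icc 0 1) ∧ γ 0 = x' ∧ γ 1 = x ∧
    MapsTo γ (Icc 0 1) U

end Riccati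

end

noncomputable section

namespace Riccati

/-! ### Complex analysis tools -/

/-! The equation is studied in the coordinate of the Liouville transformation. With `F t = Ψ (z₁ + ε
e^{iθ} t)` the halfstrip becomes a neighbourhood `strip r` of the positive real axis, and `F'² · D ∘
F = e^{2iθ}`. Write `f = f₀ + ħ W / F'` and `ζ = e^{iθ} / ħ`. A Borel disc becomes a half plane `κ <
Re ζ`, and the equation becomes `W' = ζ (W + a) + W² + b W`, where `a` and `b` have Gevrey
expansions in `1 / ζ`, uniformly on smaller strips (`RiccatiData.exists_solution_strip`).

For `Re ζ > 0` the bounded solution of `u' = ζ u - k` is `∫₀^∞ e^{-ζ s} k(z + s) ds`, of size at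
most `sup |k| / Re ζ`. For large `Re ζ` this makes the Riccati equation a contraction
(`exists_bounded_solution`). The same inequality bounds the remainders of `W` order by order
(`norm_remainder_le`), once the formal coefficients have been bounded on shrinking strips
(`norm_formal_le`). The exact solution thus has Gevrey asymptotics on a whole Borel disc.

Borel summability is then Nevanlinna's theorem. A function with Gevrey asymptotics on a Borel disc
is the Laplace transform of its inverse Laplace transform; the remainder bounds control all
derivatives of the latter on the ray, so that its Taylor series continue it to a tube of fixed
thickness. Watson's lemma (`GevreyRHP.eq_zero`) comes out as well: a zero expansion forces the
function to vanish. It gives uniqueness, and it also glues. `F` need not be injective, but the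
formal solution lives on the image, so the solutions built over two points with the same image, or
on two strips, agree. In the same way exact integrals are path independent because the formal ones
are.

Two geometric facts about `F` are needed. Coincidences `F z = F z'` come from translations, never
from reflections (`LiouvilleMap.translate`); hence `F'`, and with it `√D`, descends to the image,
and `F` is injective on balls of a fixed radius. A distortion theorem for univalent functions
(`norm_deriv_deriv_le_of_univalent`) then bounds `F'' / F'` on smaller strips, which is the part of
`b` that `p` and `q` do not control. -/

theorem norm_deriv_le_of_ball {g : ℂ → ℂ} {c : ℂ} {R B : ℝ} (hR : 0 < R)
    (hg : DifferentiableOn ℂ g (Metric.ball c R)) (hB : ∀ z ∈ Metric.ball c R, ‖g z‖ ≤ B) :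
    ‖deriv g c‖ ≤ B / R := by
  -- Nothing is known on the circle of radius `R`, so Cauchy's inequality is used at radius `ρ < R`
  -- and then `ρ → R`.
  have key : ∀ ρ ∈ Ioo 0 R, ‖deriv g c‖ ≤ B / ρ := by
    intro ρ hρ
    refine Complex.norm_deriv_le_of_forall_mem_sphere_norm_le hρ.1 ?_ ?_
    · exact (hg.mono (Metric.closedBall_subset_ball hρ.2)).diffContOnCl_ball subset_rfl
    · intro z hz
      exact hB z (Metric.sphere_subset_closedBall.trans (Metric.closedBall_subset_ball hρ.2) hz)
  have hlim : Tendsto (fun ρ : ℝ => B / ρ) (𝓝[<] R) (𝓝 (B / R)) :=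
    (tendsto_const_nhds.div tendsto_id hR.ne').mono_left nhdsWithin_le_nhds
  refine ge_of_tendsto hlim ?_
  filter_upwards [Ioo_mem_nhdsLT hR] with ρ hρ using key ρ hρ

theorem norm_sub_le_of_ball {g : ℂ → ℂ} {c : ℂ} {R B : ℝ} (hR : 0 < R)
    (hg : DifferentiableOn ℂ g (Metric.ball c R)) (hB : ∀ z ∈ Metric.ball c R, ‖g z‖ ≤ B)
    {z w : ℂ} (hz : z ∈ Metric.ball c (R / 2)) (hw : w ∈ Metric.ball c (R / 2)) :
    ‖g z - g w‖ ≤ B / (R / 2) * ‖z - w‖ := by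
  refine Convex.norm_image_sub_le_of_norm_deriv_le (𝕜 := ℂ) (s := Metric.ball c (R / 2))
    ?_ ?_ (convex_ball _ _) hw hz
  · intro y hy
    exact hg.differentiableAt
      (Metric.isOpen_ball.mem_nhds (Metric.ball_subset_ball (by linarith) hy))
  · intro y hy
    have hsub : Metric.ball y (R / 2) ⊆ Metric.ball c R := by
      refine Metric.ball_subset_ball' ?_
      have := Metric.mem_ball.1 hy
      linarith
    exact norm_deriv_le_of_ball (by linarith) (hg.mono hsub) fun z hz => hB z (hsub hz)

/-- Osgood's lemma: a locally bounded separately holomorphic function of two complex variables is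
holomorphic. -/
theorem differentiableOn_of_separately {f : ℂ → ℂ → ℂ} {O : Set (ℂ × ℂ)} (hO : IsOpen O)
    (h1 : ∀ w ∈ O, DifferentiableAt ℂ (fun x => f x w.2) w.1)
    (h2 : ∀ w ∈ O, DifferentiableAt ℂ (fun y => f w.1 y) w.2)
    (hb : ∀ w ∈ O, ∃ B : ℝ, ∀ᶠ u in 𝓝 w, ‖f u.1 u.2‖ ≤ B) :
    DifferentiableOn ℂ (fun w : ℂ × ℂ => f w.1 w.2) O := by
  rintro ⟨x₀, y₀⟩ hw
  obtain ⟨B, hB⟩ := hb _ hw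
  obtain ⟨R, hR, hRsub⟩ := Metric.mem_nhds_iff.1 (hB.and (hO.mem_nhds hw))
  have hball : ∀ x ∈ Metric.ball x₀ R, ∀ y ∈ Metric.ball y₀ R, ‖f x y‖ ≤ B ∧ (x, y) ∈ O := by
    intro x hx y hy
    have : (x, y) ∈ Metric.ball ((x₀, y₀) : ℂ × ℂ) R := by
      rw [← ball_prod_same]; exact ⟨hx, hy⟩
    exact hRsub this
  have hx₀ : x₀ ∈ Metric.ball x₀ R := Metric.mem_ball_self hR
  have hy₀ : y₀ ∈ Metric.ball y₀ R := Metric.mem_ball_self hR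
  set C : ℝ := B / (R / 2) / (R / 2 / 2) with hC
  -- The mixed second difference is of the order of `‖x - x₀‖ ‖y - y₀‖`: the increment in `y` is
  -- `O(‖y - y₀‖)` uniformly in `x`, and it is holomorphic in `x`. It is therefore negligible, and
  -- joint differentiability reduces to the two partial ones.
  have hmixed : ∀ x ∈ Metric.ball x₀ (R / 2 / 2), ∀ y ∈ Metric.ball y₀ (R / 2),
      ‖(f x y - f x y₀) - (f x₀ y - f x₀ y₀)‖ ≤ C * ‖y - y₀‖ * ‖x - x₀‖ := by
    intro x hx y hy
    have hg : DifferentiableOn ℂ (fun x => f x y - f x y₀) (Metric.ball x₀ (R / 2)) := by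
      intro x hx
      have hx' := Metric.ball_subset_ball (by linarith : R / 2 ≤ R) hx
      have hy' := Metric.ball_subset_ball (by linarith : R / 2 ≤ R) hy
      exact ((h1 (x, y) (hball x hx' y hy').2).sub
        (h1 (x, y₀) (hball x hx' y₀ hy₀).2)).differentiableWithinAt
    have hbd : ∀ x ∈ Metric.ball x₀ (R / 2), ‖f x y - f x y₀‖ ≤ B / (R / 2) * ‖y - y₀‖ := by
      intro x hx
      have hx' := Metric.ball_subset_ball (by linarith : R / 2 ≤ R) hx
      refine norm_sub_le_of_ball hR (g := fun y => f x y) ?_ ?_ hy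
        (Metric.mem_ball_self (by linarith))
      · intro y hy
        exact (h2 (x, y) (hball x hx' y hy).2).differentiableWithinAt
      · intro y hy
        exact (hball x hx' y hy).1
    have := norm_sub_le_of_ball (by linarith) hg hbd hx (Metric.mem_ball_self (by linarith))
    refine this.trans (le_of_eq ?_)
    rw [hC]; ring
  have d1 := (h1 _ hw).hasDerivAt
  have d2 := (h2 _ hw).hasDerivAt
  set D1 := deriv (fun x => f x (x₀, y₀).2) (x₀, y₀).1
  set D2 := deriv (fun y => f (x₀, y₀).1 y) (x₀, y₀).2
  have e1 : (fun w : ℂ × ℂ => f w.1 y₀ - f x₀ y₀ - (w.1 - x₀) • D1)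
      =o[𝓝 (x₀, y₀)] fun w => w - (x₀, y₀) := by
    have := (hasDerivAt_iff_isLittleO.1 d1).comp_tendsto
      (continuous_fst.tendsto ((x₀, y₀) : ℂ × ℂ))
    exact this.trans_isBigO (Asymptotics.IsBigO.of_bound 1 (Eventually.of_forall fun w => by
      simpa using norm_fst_le (w - (x₀, y₀))))
  have e2 : (fun w : ℂ × ℂ => f x₀ w.2 - f x₀ y₀ - (w.2 - y₀) • D2)
      =o[𝓝 (x₀, y₀)] fun w => w - (x₀, y₀) := by
    have := (hasDerivAt_iff_isLittleO.1 d2).comp_tendsto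
      (continuous_snd.tendsto ((x₀, y₀) : ℂ × ℂ))
    exact this.trans_isBigO (Asymptotics.IsBigO.of_bound 1 (Eventually.of_forall fun w => by
      simpa using norm_snd_le (w - (x₀, y₀))))
  have e3 : (fun w : ℂ × ℂ => (f w.1 w.2 - f w.1 y₀) - (f x₀ w.2 - f x₀ y₀))
      =o[𝓝 (x₀, y₀)] fun w => w - (x₀, y₀) := by
    have hO2 : (fun w : ℂ × ℂ => (f w.1 w.2 - f w.1 y₀) - (f x₀ w.2 - f x₀ y₀))
        =O[𝓝 (x₀, y₀)] fun w => (‖w - (x₀, y₀)‖ * ‖w - (x₀, y₀)‖ : ℝ) := by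
      refine Asymptotics.IsBigO.of_bound |C| ?_
      filter_upwards [Metric.ball_mem_nhds ((x₀, y₀) : ℂ × ℂ) (by linarith : 0 < R / 2 / 2)]
        with w hw
      rw [← ball_prod_same] at hw
      refine (hmixed w.1 hw.1 w.2 (Metric.ball_subset_ball (by linarith) hw.2)).trans ?_
      rw [Real.norm_of_nonneg (by positivity), mul_assoc]
      have a1 : ‖w.1 - x₀‖ ≤ ‖w - (x₀, y₀)‖ := norm_fst_le (w - (x₀, y₀))
      have a2 : ‖w.2 - y₀‖ ≤ ‖w - (x₀, y₀)‖ := norm_snd_le (w - (x₀, y₀))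
      exact mul_le_mul (le_abs_self C) (mul_le_mul a2 a1 (by positivity) (by positivity))
        (by positivity) (by positivity)
    refine hO2.trans_isLittleO ?_
    have : Tendsto (fun w : ℂ × ℂ => ‖w - (x₀, y₀)‖) (𝓝 (x₀, y₀)) (𝓝 0) := by
      have : Continuous fun w : ℂ × ℂ => ‖w - (x₀, y₀)‖ := by fun_prop
      simpa using this.tendsto (x₀, y₀)
    have h := ((Asymptotics.isLittleO_one_iff ℝ).2 this).mul_isBigO
      (Asymptotics.isBigO_refl (fun w : ℂ × ℂ => ‖w - (x₀, y₀)‖) (𝓝 (x₀, y₀)))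
    simp only [one_mul] at h
    exact h.of_norm_right
  have hF : HasFDerivAt (fun w : ℂ × ℂ => f w.1 w.2)
      ((ContinuousLinearMap.fst ℂ ℂ ℂ).smulRight D1 + (ContinuousLinearMap.snd ℂ ℂ ℂ).smulRight D2)
      (x₀, y₀) := by
    refine HasFDerivAt.of_isLittleO ?_
    refine ((e3.add e1).add e2).congr_left fun w => ?_
    simp
    ring
  exact hF.differentiableAt.differentiableWithinAt

/-- Holomorphy of integrals depending on a parameter. -/
theorem hasDerivAt_integral_param {α : Type*} [MeasurableSpace α] {μ : MeasureTheory.Measure α}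
    {U : Set ℂ} (hU : IsOpen U) {F : ℂ → α → ℂ} {bound : α → ℝ}
    (hm : ∀ x ∈ U, MeasureTheory.AEStronglyMeasurable (F x) μ)
    (hd : ∀ᵐ a ∂μ, DifferentiableOn ℂ (fun x => F x a) U)
    (hb : ∀ᵐ a ∂μ, ∀ x ∈ U, ‖F x a‖ ≤ bound a) (hi : MeasureTheory.Integrable bound μ)
    {x₀ : ℂ} (hx₀ : x₀ ∈ U) :
    MeasureTheory.Integrable (fun a => deriv (fun x => F x a) x₀) μ ∧
      HasDerivAt (fun x => ∫ a, F x a ∂μ) (∫ a, deriv (fun x => F x a) x₀ ∂μ) x₀ := by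
  obtain ⟨R, hR, hsub⟩ := Metric.isOpen_iff.1 hU x₀ hx₀
  refine hasDerivAt_integral_of_dominated_loc_of_deriv_le (F' := fun x a => deriv (fun x => F x a) x)
    (Metric.ball_mem_nhds x₀ (half_pos hR)) (bound := fun a => bound a / (R / 2)) ?_ ?_ ?_ ?_ ?_ ?_
  · filter_upwards [hU.mem_nhds hx₀] with x hx using hm x hx
  · exact hi.mono' (hm x₀ hx₀) (hb.mono fun a ha => ha x₀ hx₀)
  -- The derivative is measurable in `a` as the pointwise limit of difference quotients with steps
  -- `R / (2 (n + 1))`, which stay inside the ball.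
  · have hseq : ∀ n : ℕ, (R / 2 / (n + 1) : ℝ) ≠ 0 := fun n => by positivity
    have hlim0 : Tendsto (fun n : ℕ => (R / 2 / (n + 1) : ℝ)) atTop (𝓝 0) := by
      simpa [div_eq_mul_inv] using
        (tendsto_one_div_add_atTop_nhds_zero_nat (𝕜 := ℝ)).const_mul (R / 2)
    have hmem : ∀ n : ℕ, x₀ + ((R / 2 / (n + 1) : ℝ) : ℂ) ∈ U := by
      intro n
      refine hsub ?_
      rw [Metric.mem_ball, dist_eq_norm, add_sub_cancel_left, Complex.norm_real,
        Real.norm_of_nonneg (by positivity)]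
      have : R / 2 / (n + 1) ≤ R / 2 := div_le_self (by linarith) (by simp)
      linarith
    refine aestronglyMeasurable_of_tendsto_ae (u := atTop)
      (f := fun (n : ℕ) a => (((R / 2 / (n + 1) : ℝ) : ℂ))⁻¹ •
        (F (x₀ + ((R / 2 / (n + 1) : ℝ) : ℂ)) a - F x₀ a))
      (fun n => ((hm _ (hmem n)).sub (hm _ hx₀)).const_smul (((R / 2 / (n + 1) : ℝ) : ℂ))⁻¹) ?_
    filter_upwards [hd] with a ha
    have hda := (ha.differentiableAt (hU.mem_nhds hx₀)).hasDerivAt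
    refine hda.tendsto_slope_zero.comp (tendsto_nhdsWithin_iff.2 ⟨?_, ?_⟩)
    · have := (Complex.continuous_ofReal.tendsto 0).comp hlim0
      simpa [Function.comp_def] using this
    · exact Eventually.of_forall fun n => Complex.ofReal_ne_zero.2 (hseq n)
  -- Cauchy's inequality on a disc of radius `R / 2` turns the majorant of `F` into one of its
  -- derivative.
  · filter_upwards [hd, hb] with a ha hba x hx
    have hs : Metric.ball x (R / 2) ⊆ U := by
      refine (Metric.ball_subset_ball' ?_).trans hsub
      have := Metric.mem_ball.1 hx
      linarith
    exact norm_deriv_le_of_ball (half_pos hR) (ha.mono hs) fun z hz => hba z (hs hz)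
  · exact hi.div_const _
  · filter_upwards [hd] with a ha x hx
    exact (ha.differentiableAt
      (hU.mem_nhds (hsub (Metric.ball_subset_ball (by linarith) hx)))).hasDerivAt

theorem differentiableOn_integral_param {α : Type*} [MeasurableSpace α]
    {μ : MeasureTheory.Measure α} {U : Set ℂ} (hU : IsOpen U) {F : ℂ → α → ℂ} {bound : α → ℝ}
    (hm : ∀ x ∈ U, MeasureTheory.AEStronglyMeasurable (F x) μ)
    (hd : ∀ᵐ a ∂μ, DifferentiableOn ℂ (fun x => F x a) U)
    (hb : ∀ᵐ a ∂μ, ∀ x ∈ U, ‖F x a‖ ≤ bound a) (hi : MeasureTheory.Integrable bound μ) :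
    DifferentiableOn ℂ (fun x => ∫ a, F x a ∂μ) U := fun _ hx =>
  (hasDerivAt_integral_param hU hm hd hb hi hx).2.differentiableAt.differentiableWithinAt

/-! ### Borel discs -/

theorem norm_dir (θ : ℝ) : ‖dir θ‖ = 1 := Complex.norm_exp_ofReal_mul_I θ

theorem dir_ne_zero (θ : ℝ) : dir θ ≠ 0 := Complex.exp_ne_zero _

theorem dir_mul_conj (θ : ℝ) : (dir θ).re * (dir θ).re + (dir θ).im * (dir θ).im = 1 := by
  have := Complex.normSq_eq_norm_sq (dir θ)
  rw [norm_dir, Complex.normSq_apply] at this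
  simpa using this

theorem mem_borelDisc_iff {θ δ : ℝ} (hδ : 0 < δ) {ħ : ℂ} :
    ħ ∈ borelDisc θ δ ↔
      ‖ħ‖ ^ 2 < δ * ((dir θ).re * ħ.re + (dir θ).im * ħ.im) := by
  rcases eq_or_ne ħ 0 with rfl | hh
  · simp [borelDisc, hδ.le]
  · have hn : 0 < Complex.normSq ħ := Complex.normSq_pos.2 hh
    rw [borelDisc, mem_ofPred_eq, Complex.div_re, ← add_div, div_lt_div_iff₀ hδ hn, one_mul,
      Complex.normSq_eq_norm_sq]
    ring_nf

theorem ne_zero_of_mem_borelDisc {θ δ : ℝ} (hδ : 0 < δ) {ħ : ℂ} (h : ħ ∈ borelDisc θ δ) :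
    ħ ≠ 0 := by
  rintro rfl
  simp [mem_borelDisc_iff hδ] at h

theorem borelDisc_eq_ball {θ δ : ℝ} (hδ : 0 < δ) :
    borelDisc θ δ = Metric.ball (((δ / 2 : ℝ) : ℂ) * dir θ) (δ / 2) := by
  ext ħ
  rw [mem_borelDisc_iff hδ, Metric.mem_ball, dist_eq_norm,
    ← sq_lt_sq₀ (norm_nonneg _) (by positivity), ← Complex.normSq_eq_norm_sq,
    ← Complex.normSq_eq_norm_sq, Complex.normSq_apply, Complex.normSq_apply]
  have := dir_mul_conj θ
  simp only [Complex.sub_re, Complex.sub_im, Complex.mul_re, Complex.mul_im, Complex.ofReal_re,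
    Complex.ofReal_im, zero_mul, sub_zero, add_zero]
  constructor <;> intro h <;> nlinarith

theorem borelDisc_mono {θ δ δ' : ℝ} (hδ : 0 < δ) (h : δ ≤ δ') : borelDisc θ δ ⊆ borelDisc θ δ' :=
  fun _ hx => lt_of_le_of_lt (one_div_le_one_div_of_le hδ h) hx

theorem dir_div_mem_borelDisc {θ δ : ℝ} {ζ : ℂ} (h : 1 / δ < ζ.re) :
    dir θ / ζ ∈ borelDisc θ δ := by
  rwa [borelDisc, mem_ofPred_eq, div_div_cancel₀ (dir_ne_zero θ)]

theorem isOpen_borelDisc {θ δ : ℝ} (hδ : 0 < δ) : IsOpen (borelDisc θ δ) := by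
  rw [borelDisc_eq_ball hδ]; exact Metric.isOpen_ball

theorem convex_borelDisc {θ δ : ℝ} (hδ : 0 < δ) : Convex ℝ (borelDisc θ δ) := by
  rw [borelDisc_eq_ball hδ]; exact convex_ball _ _

theorem nonempty_borelDisc {θ δ : ℝ} (hδ : 0 < δ) : (borelDisc θ δ).Nonempty := by
  rw [borelDisc_eq_ball hδ]; exact ⟨_, Metric.mem_ball_self (by positivity)⟩

/-- A Borel disc is a round disc whose boundary passes through `0` with normal `e^{iθ}`, so its
directions at `0` fill the closed half circle, the two extreme ones being reached only along
tangential sequences. Hence every sectorial domain to be produced can be taken to be a Borel disc.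
-/
theorem isSectorialDomain_borelDisc {θ δ : ℝ} (hδ : 0 < δ) :
    IsSectorialDomain θ (borelDisc θ δ) where
  isOpen := isOpen_borelDisc hδ
  simplyConnected := by
    have := (convex_borelDisc (θ := θ) hδ).contractibleSpace (nonempty_borelDisc hδ)
    exact (inferInstance : SimplyConnectedSpace (borelDisc θ δ))
  zero_notMem := fun h => ne_zero_of_mem_borelDisc hδ h rfl
  directions := by
    have hre : ∀ u : ℂ, (u / dir θ).re = (dir θ).re * u.re + (dir θ).im * u.im := by
      intro u
      rw [Complex.div_re, Complex.normSq_eq_norm_sq, norm_dir]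
      ring
    ext u
    constructor
    · rintro ⟨hu, hc⟩
      refine ⟨hu, ?_⟩
      have hcl : IsClosed {u : ℂ | 0 ≤ (u / dir θ).re} :=
        isClosed_le continuous_const (by fun_prop)
      refine hcl.mem_of_mapClusterPt hc ?_
      filter_upwards [self_mem_nhdsWithin] with ħ hħ
      have h1 := (mem_borelDisc_iff hδ).1 hħ
      have h2 : 0 < (ħ / dir θ).re := by
        rw [hre]
        exact pos_of_mul_pos_right ((sq_nonneg _).trans_lt h1) hδ.le
      change 0 ≤ (ħ / (‖ħ‖ : ℂ) / dir θ).re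
      rw [div_right_comm, Complex.div_ofReal_re]
      positivity
    · rintro ⟨hu, h0⟩
      refine ⟨hu, ?_⟩
      -- The direction `u` is tilted inwards by `1 / (n + 1)` and then shrunk by `σ n`. Since `‖a
      -- n‖² ≤ 4`, membership in the disc needs `4 σ n < δ / (n + 1)`, which explains `δ / 8`.
      set a : ℕ → ℂ := fun n => u + ((1 / ((n : ℝ) + 1) : ℝ) : ℂ) * dir θ with ha
      have hlim : Tendsto (fun n : ℕ => (1 / ((n : ℝ) + 1) : ℝ)) atTop (𝓝 0) :=
        tendsto_one_div_add_atTop_nhds_zero_nat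
      have hpos : ∀ n : ℕ, (0 : ℝ) < 1 / ((n : ℝ) + 1) := fun n => by positivity
      have hle : ∀ n : ℕ, (1 : ℝ) / ((n : ℝ) + 1) ≤ 1 := fun n => by
        rw [div_le_one (by positivity)]; simp
      have halim : Tendsto a atTop (𝓝 u) := by
        have := ((Complex.continuous_ofReal.tendsto 0).comp hlim).mul_const (dir θ)
        simpa [ha, Function.comp_def] using this.const_add u
      have har : ∀ n : ℕ, 1 / ((n : ℝ) + 1) ≤ (dir θ).re * (a n).re + (dir θ).im * (a n).im := by
        intro n
        rw [← hre]
        simp only [ha, add_div, mul_div_cancel_right₀ _ (dir_ne_zero θ), Complex.add_re,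
          Complex.ofReal_re]
        linarith
      have han : ∀ n, ‖a n‖ ≤ 2 := by
        intro n
        refine (norm_add_le _ _).trans ?_
        rw [norm_mul, norm_dir, Complex.norm_real, Real.norm_of_nonneg (hpos n).le, hu]
        linarith [hle n]
      have hane : ∀ n, a n ≠ 0 := by
        intro n h
        have := har n
        rw [h] at this
        simp only [Complex.zero_re, Complex.zero_im, mul_zero, add_zero] at this
        linarith [hpos n]
      set σ : ℕ → ℝ := fun n => δ / 8 * (1 / ((n : ℝ) + 1)) with hσ
      have hσpos : ∀ n, 0 < σ n := fun n => by positivity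
      have hσlim : Tendsto σ atTop (𝓝 0) := by
        simpa only [mul_zero] using hlim.const_mul (δ / 8)
      refine MapClusterPt.of_comp (φ := fun n : ℕ => ((σ n : ℝ) : ℂ) * a n) (p := atTop) ?_ ?_
      · refine tendsto_nhdsWithin_iff.2 ⟨?_, Eventually.of_forall fun n => ?_⟩
        · have := ((Complex.continuous_ofReal.tendsto 0).comp hσlim).mul halim
          simpa [Function.comp_def] using this
        · rw [mem_borelDisc_iff hδ, norm_mul, Complex.norm_real, Real.norm_of_nonneg (hσpos n).le]
          simp only [Complex.mul_re, Complex.mul_im, Complex.ofReal_re, Complex.ofReal_im,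
            zero_mul, sub_zero, add_zero]
          have h1 : ‖a n‖ ^ 2 ≤ 4 := by nlinarith [han n, norm_nonneg (a n)]
          have h2 : (σ n * ‖a n‖) ^ 2 ≤ σ n * (σ n * 4) := by
            nlinarith [mul_le_mul_of_nonneg_left h1 (sq_nonneg (σ n))]
          have h3 : σ n * 4 < δ * (1 / ((n : ℝ) + 1)) := by
            have : 0 < δ * (1 / ((n : ℝ) + 1)) := by positivity
            simp only [hσ]; linarith
          have h4 := mul_le_mul_of_nonneg_left (har n) hδ.le
          have h5 : σ n * (σ n * 4) <
              σ n * (δ * ((dir θ).re * (a n).re + (dir θ).im * (a n).im)) :=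
            mul_lt_mul_of_pos_left (h3.trans_le h4) (hσpos n)
          linarith
      · have : Tendsto (fun n => a n / (‖a n‖ : ℂ)) atTop (𝓝 (u / (‖u‖ : ℂ))) := by
          refine halim.div ((Complex.continuous_ofReal.tendsto _).comp halim.norm) ?_
          simp [hu]
        rw [hu] at this
        simp only [Complex.ofReal_one, div_one] at this
        refine Tendsto.mapClusterPt (this.congr fun n => ?_)
        have hs : ((σ n : ℝ) : ℂ) ≠ 0 := Complex.ofReal_ne_zero.2 (hσpos n).ne'
        simp only [Function.comp, norm_mul, Complex.norm_real, Real.norm_of_nonneg (hσpos n).le,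
          Complex.ofReal_mul]
        rw [mul_div_mul_left _ _ hs]
  borelDisc_subset := ⟨δ, hδ, subset_rfl⟩

/-! ### The model halfstrip -/

/-- The open neighbourhood of the positive real axis of thickness `r`. -/
def strip (r : ℝ) : Set ℂ := {z | ∃ t : ℝ, 0 ≤ t ∧ ‖z - (t : ℂ)‖ < r}

theorem infDist_ray_lt_iff {z z₁ u : ℂ} {r : ℝ} :
    Metric.infDist z (ray z₁ u) < r ↔ ∃ t : ℝ, 0 ≤ t ∧ ‖z - (z₁ + (t : ℂ) * u)‖ < r := by
  rw [Metric.infDist_lt_iff (⟨z₁, ⟨0, le_rfl, by simp⟩⟩ : (ray z₁ u).Nonempty)]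
  constructor
  · rintro ⟨y, ⟨t, ht, rfl⟩, h⟩
    exact ⟨t, ht, by rwa [dist_eq_norm] at h⟩
  · rintro ⟨t, ht, h⟩
    exact ⟨_, ⟨t, ht, rfl⟩, by rwa [dist_eq_norm]⟩

theorem infDist_ray_lt_iff_strip {z z₁ u : ℂ} (hu : ‖u‖ = 1) {r : ℝ} :
    Metric.infDist z (ray z₁ u) < r ↔ (z - z₁) / u ∈ strip r := by
  have hu0 : u ≠ 0 := by rintro rfl; simp at hu
  rw [infDist_ray_lt_iff]
  refine exists_congr fun t => and_congr_right fun _ => ?_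
  have : (z - z₁) / u - t = (z - (z₁ + t * u)) / u := by field_simp; ring
  rw [this, norm_div, hu, div_one]

theorem isOpen_strip (r : ℝ) : IsOpen (strip r) := by
  have : strip r = ⋃ t ∈ Ici (0 : ℝ), Metric.ball (t : ℂ) r := by
    ext z; simp [strip, dist_eq_norm]
  rw [this]
  exact isOpen_biUnion fun _ _ => Metric.isOpen_ball

theorem convex_strip (r : ℝ) : Convex ℝ (strip r) := by
  rintro z ⟨t, ht, hz⟩ w ⟨s, hs, hw⟩ a b ha hb hab
  refine ⟨a * t + b * s, by positivity, ?_⟩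
  have e : a • z + b • w - ((a * t + b * s : ℝ) : ℂ) = a • (z - t) + b • (w - s) := by
    simp [Complex.real_smul]; ring
  rw [e]
  have := (convex_ball (0 : ℂ) r) (x := z - t) (by simpa using hz) (y := w - s)
    (by simpa using hw) ha hb hab
  simpa using this

theorem strip_mono {ρ r : ℝ} (h : ρ ≤ r) : strip ρ ⊆ strip r :=
  fun _ ⟨t, ht, hz⟩ => ⟨t, ht, hz.trans_le h⟩

theorem add_mem_strip {r : ℝ} {z : ℂ} (hz : z ∈ strip r) {s : ℝ} (hs : 0 ≤ s) :
    z + s ∈ strip r := by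
  obtain ⟨t, ht, h⟩ := hz
  exact ⟨t + s, by positivity, by push_cast; rwa [add_sub_add_right_eq_sub]⟩

theorem ball_subset_strip {ρ r : ℝ} {z : ℂ} (hz : z ∈ strip ρ) :
    Metric.ball z (r - ρ) ⊆ strip r := by
  obtain ⟨t, ht, h⟩ := hz
  intro w hw
  refine ⟨t, ht, ?_⟩
  have := Metric.mem_ball.1 hw
  rw [dist_eq_norm] at this
  have h2 := norm_add_le (w - z) (z - t)
  rw [sub_add_sub_cancel] at h2
  linarith

theorem ofReal_mem_strip {r : ℝ} (hr : 0 < r) {t : ℝ} (ht : 0 ≤ t) : (t : ℂ) ∈ strip r :=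
  ⟨t, ht, by simpa using hr⟩

theorem exists_mem_strip_lt {r : ℝ} {z : ℂ} (hz : z ∈ strip r) : ∃ ρ < r, z ∈ strip ρ := by
  obtain ⟨t, ht, h⟩ := hz
  obtain ⟨ρ, h1, h2⟩ := exists_between h
  exact ⟨ρ, h2, t, ht, h1⟩

/-- `max z.re 0` is the point of the ray nearest to `z`; it will be the canonical centre of Taylor
expansions. -/
theorem norm_sub_max_lt_of_mem_strip {r : ℝ} {z : ℂ} (hz : z ∈ strip r) :
    ‖z - ((max z.re 0 : ℝ) : ℂ)‖ < r := by
  obtain ⟨t, ht, h⟩ := hz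
  refine lt_of_le_of_lt ?_ h
  rw [Complex.norm_eq_sqrt_sq_add_sq, Complex.norm_eq_sqrt_sq_add_sq]
  refine Real.sqrt_le_sqrt ?_
  simp only [Complex.sub_re, Complex.ofReal_re, Complex.sub_im, Complex.ofReal_im]
  rcases le_total z.re 0 with h0 | h0
  · rw [max_eq_right h0]; nlinarith
  · rw [max_eq_left h0]; nlinarith [sq_nonneg (z.re - t)]

/-! ### Laplace inversion -/

/-- The parametrisation of the vertical line `Re = a`. -/
def vline (a v : ℝ) : ℂ := (a : ℂ) + ((2 * Real.pi * v : ℝ) : ℂ) * Complex.I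

/-- The inverse Laplace transform `(1 / 2πi) ∫ e^{ζt} E(ζ) dζ` along the line `Re ζ = a`. -/
def invLap (E : ℂ → ℂ) (a t : ℝ) : ℂ := ∫ v : ℝ, Complex.exp (vline a v * t) * E (vline a v)

/-- Holomorphic functions on a right half plane that decay quadratically. -/
structure QuadDecay (κ K : ℝ) (E : ℂ → ℂ) : Prop where
  diff : DifferentiableOn ℂ E {s | κ < s.re}
  bound : ∀ s : ℂ, κ < s.re → ‖E s‖ ≤ K / ‖s‖ ^ 2

theorem isOpen_rhp (κ : ℝ) : IsOpen {s : ℂ | κ < s.re} :=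
  isOpen_lt continuous_const Complex.continuous_re

@[simp] theorem vline_re (a v : ℝ) : (vline a v).re = a := by simp [vline]

@[simp] theorem vline_im (a v : ℝ) : (vline a v).im = 2 * Real.pi * v := by simp [vline]

theorem continuous_vline (a : ℝ) : Continuous (vline a) := by unfold vline; fun_prop

theorem norm_vline_sq (a v : ℝ) : ‖vline a v‖ ^ 2 = a ^ 2 + (2 * Real.pi * v) ^ 2 := by
  rw [← Complex.normSq_eq_norm_sq, Complex.normSq_apply, vline_re, vline_im]; ring

theorem norm_vline_pos {a : ℝ} (ha : 0 < a) (v : ℝ) : 0 < ‖vline a v‖ :=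
  lt_of_lt_of_le ha ((le_abs_self a).trans (by simpa using Complex.abs_re_le_norm (vline a v)))

theorem integrable_norm_vline {a : ℝ} (ha : 0 < a) :
    MeasureTheory.Integrable fun v : ℝ => 1 / ‖vline a v‖ ^ 2 := by
  refine (integrable_inv_one_add_sq.const_mul (1 / min (a ^ 2) 1)).mono' ?_ ?_
  · exact Continuous.aestronglyMeasurable (continuous_const.div
      ((continuous_vline a).norm.pow 2) fun v => (pow_pos (norm_vline_pos ha v) 2).ne')
  · refine Eventually.of_forall fun v => ?_
    rw [Real.norm_of_nonneg (by positivity), ← one_div, one_div_mul_one_div]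
    have hm : 0 < min (a ^ 2) 1 := by positivity
    refine one_div_le_one_div_of_le (by positivity) ?_
    rw [norm_vline_sq]
    have hpi : 1 ≤ 2 * Real.pi := by linarith [Real.pi_gt_three]
    have : v ^ 2 ≤ (2 * Real.pi * v) ^ 2 := by
      rw [mul_pow]
      exact le_mul_of_one_le_left (sq_nonneg v) (one_le_pow₀ hpi)
    have h1 := min_le_left (a ^ 2) 1
    have h2 := mul_le_of_le_one_left (sq_nonneg v) (min_le_right (a ^ 2) 1)
    linarith

/-- The constant in the bound of the inverse Laplace transform. -/
def vlineConst (a : ℝ) : ℝ := ∫ v : ℝ, 1 / ‖vline a v‖ ^ 2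

theorem vlineConst_nonneg (a : ℝ) : 0 ≤ vlineConst a :=
  MeasureTheory.integral_nonneg fun v => by positivity

theorem vlineConst_anti {a b : ℝ} (ha : 0 < a) (h : a ≤ b) : vlineConst b ≤ vlineConst a := by
  refine MeasureTheory.integral_mono (integrable_norm_vline (ha.trans_le h))
    (integrable_norm_vline ha) fun v => ?_
  refine one_div_le_one_div_of_le (pow_pos (norm_vline_pos ha v) 2) ?_
  rw [norm_vline_sq, norm_vline_sq]
  gcongr

namespace QuadDecay

variable {κ K : ℝ} {E : ℂ → ℂ}

theorem continuous_vline (h : QuadDecay κ K E) {a : ℝ} (ha : κ < a) :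
    Continuous fun v : ℝ => E (vline a v) :=
  h.diff.continuousOn.comp_continuous (Riccati.continuous_vline a) fun v => by simpa using ha

theorem continuous_integrand (h : QuadDecay κ K E) {a : ℝ} (ha : κ < a) (t : ℝ) :
    Continuous fun v : ℝ => Complex.exp (vline a v * t) * E (vline a v) :=
  (Complex.continuous_exp.comp ((Riccati.continuous_vline a).mul continuous_const)).mul
    (h.continuous_vline ha)

theorem norm_integrand_le (h : QuadDecay κ K E) {a : ℝ} (ha : κ < a) (t v : ℝ) :
    ‖Complex.exp (vline a v * t) * E (vline a v)‖
      ≤ Real.exp (a * t) * K * (1 / ‖vline a v‖ ^ 2) := by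
  rw [norm_mul, Complex.norm_exp, Complex.re_mul_ofReal, vline_re, mul_assoc, mul_one_div]
  exact mul_le_mul_of_nonneg_left (h.bound _ (by simpa using ha)) (Real.exp_pos _).le

theorem integrable (h : QuadDecay κ K E) (hκ : 0 < κ) {a : ℝ} (ha : κ < a) (t : ℝ) :
    MeasureTheory.Integrable fun v : ℝ => Complex.exp (vline a v * t) * E (vline a v) := by
  refine ((integrable_norm_vline (hκ.trans ha)).const_mul (Real.exp (a * t) * K)).mono' ?_
    (Eventually.of_forall fun v => h.norm_integrand_le ha t v)
  exact (h.continuous_integrand ha t).aestronglyMeasurable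

theorem norm_invLap_le (h : QuadDecay κ K E) (hκ : 0 < κ) {a : ℝ} (ha : κ < a) (t : ℝ) :
    ‖invLap E a t‖ ≤ Real.exp (a * t) * K * vlineConst a := by
  rw [vlineConst, ← MeasureTheory.integral_const_mul]
  exact MeasureTheory.norm_integral_le_of_norm_le
    ((integrable_norm_vline (hκ.trans ha)).const_mul _)
    (Eventually.of_forall fun v => h.norm_integrand_le ha t v)

theorem const_nonneg (h : QuadDecay κ K E) : 0 ≤ K := by
  have h1 := h.bound ((|κ| + 1 : ℝ) : ℂ) (by simpa using (le_abs_self κ).trans_lt (lt_add_one _))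
  by_contra hK
  have := (norm_nonneg _).trans h1
  have h2 : 0 < ‖((|κ| + 1 : ℝ) : ℂ)‖ ^ 2 := by
    rw [Complex.norm_real, Real.norm_of_nonneg (by positivity)]; positivity
  exact absurd (div_neg_of_neg_of_pos (not_le.1 hK) h2) (not_lt.2 this)

theorem continuous_invLap (h : QuadDecay κ K E) (hκ : 0 < κ) {a : ℝ} (ha : κ < a) :
    Continuous (invLap E a) := by
  -- The factor `e^{at}` is split off so that the modulus of the remaining integrand does not depend
  -- on `t`, and a single majorant serves for all `t`.
  have e : invLap E a = fun t : ℝ => Complex.exp (a * t) *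
      ∫ v : ℝ, Complex.exp (((2 * Real.pi * v : ℝ) : ℂ) * Complex.I * t) * E (vline a v) := by
    ext t
    rw [invLap, ← MeasureTheory.integral_const_mul]
    refine MeasureTheory.integral_congr_ae (Eventually.of_forall fun v => ?_)
    simp only [vline, add_mul, Complex.exp_add]
    ring
  rw [e]
  have hc := h.continuous_vline ha
  refine Continuous.mul (by fun_prop) ?_
  refine MeasureTheory.continuous_of_dominated (bound := fun v => K * (1 / ‖vline a v‖ ^ 2)) (fun t => ?_)
    (fun t => ?_) ((integrable_norm_vline (hκ.trans ha)).const_mul K) ?_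
  · exact (Continuous.mul (by fun_prop) hc).aestronglyMeasurable
  · refine Eventually.of_forall fun v => ?_
    have : ‖Complex.exp (((2 * Real.pi * v : ℝ) : ℂ) * Complex.I * t)‖ = 1 := by
      rw [Complex.norm_exp]; simp
    rw [norm_mul, this, one_mul, mul_one_div]
    exact h.bound _ (by simpa using ha)
  · exact Eventually.of_forall fun v => by fun_prop

/-- The inverse Laplace transform does not depend on the line of integration. -/
theorem invLap_eq (h : QuadDecay κ K E) (hκ : 0 < κ) {a b : ℝ} (ha : κ < a) (hab : a ≤ b)
    (t : ℝ) : invLap E a t = invLap E b t := by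
  set f : ℂ → ℂ := fun s => Complex.exp (s * t) * E s with hf
  have hfd : DifferentiableOn ℂ f {s | κ < s.re} := by
    have := h.diff
    fun_prop
  have hint : ∀ c : ℝ, κ < c → MeasureTheory.Integrable (fun y : ℝ => f (c + y * Complex.I)) ∧
      invLap E c t = ((2 * Real.pi)⁻¹ : ℝ) • ∫ y : ℝ, f (c + y * Complex.I) := by
    intro c hc
    have hpi : (2 * Real.pi) ≠ 0 := by positivity
    constructor
    · have := (h.integrable hκ hc t)
      have h2 := this.comp_mul_left' (inv_ne_zero hpi)
      refine h2.congr (Eventually.of_forall fun y => ?_)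
      have e : 2 * Real.pi * ((2 * Real.pi)⁻¹ * y) = y := by field_simp
      simp only [vline, e, hf]
    · have := MeasureTheory.Measure.integral_comp_mul_left
        (fun y : ℝ => f (c + y * Complex.I)) (2 * Real.pi)
      rw [abs_of_pos (by positivity)] at this
      rw [← this]
      simp only [invLap, vline, hf, Complex.ofReal_mul]
  obtain ⟨hia, ea⟩ := hint a ha
  obtain ⟨hib, eb⟩ := hint b (ha.trans_le hab)
  rw [ea, eb]
  congr 1
  have hla := MeasureTheory.intervalIntegral_tendsto_integral hia tendsto_neg_atTop_atBot tendsto_id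
  have hlb := MeasureTheory.intervalIntegral_tendsto_integral hib tendsto_neg_atTop_atBot tendsto_id
  -- The horizontal sides of the rectangle, at heights `± T`, contribute `O(T⁻²)` by quadratic
  -- decay.
  have hhor : ∀ σ : ℝ, |σ| = 1 →
      Tendsto (fun T : ℝ => ∫ x : ℝ in a..b, f (x + ((σ * T : ℝ) : ℂ) * Complex.I)) atTop (𝓝 0) := by
    intro σ hσ
    have hb : ∀ᶠ T : ℝ in atTop, ‖∫ x : ℝ in a..b, f (x + ((σ * T : ℝ) : ℂ) * Complex.I)‖
        ≤ (Real.exp (|b| * |t|) * K * |b - a|) * (T ^ 2)⁻¹ := by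
      filter_upwards [eventually_gt_atTop 0] with T hT
      have := intervalIntegral.norm_integral_le_of_norm_le_const (a := a) (b := b)
        (f := fun x : ℝ => f (x + ((σ * T : ℝ) : ℂ) * Complex.I))
        (C := Real.exp (|b| * |t|) * (K * (T ^ 2)⁻¹)) ?_
      · refine this.trans (le_of_eq ?_); ring
      · intro x hx
        rw [uIoc_of_le hab] at hx
        have hre : ((x : ℂ) + ((σ * T : ℝ) : ℂ) * Complex.I).re = x := by simp
        have him : ((x : ℂ) + ((σ * T : ℝ) : ℂ) * Complex.I).im = σ * T := by simp
        rw [hf, norm_mul, Complex.norm_exp, Complex.re_mul_ofReal, hre]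
        have h1 : x * t ≤ |b| * |t| := by
          refine (le_abs_self _).trans ?_
          rw [abs_mul]
          have : |x| ≤ |b| := by
            rw [abs_of_pos (hκ.trans (ha.trans hx.1))]
            exact hx.2.trans (le_abs_self b)
          gcongr
        have h2 := h.bound _ (by rw [hre]; exact ha.trans hx.1 :
          κ < ((x : ℂ) + ((σ * T : ℝ) : ℂ) * Complex.I).re)
        refine mul_le_mul (Real.exp_le_exp.2 h1) (h2.trans ?_) (norm_nonneg _) (Real.exp_pos _).le
        rw [div_eq_mul_inv]
        refine mul_le_mul_of_nonneg_left (inv_anti₀ (by positivity) ?_) h.const_nonneg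
        have h3 := Complex.abs_im_le_norm ((x : ℂ) + ((σ * T : ℝ) : ℂ) * Complex.I)
        rw [him, abs_mul, hσ, one_mul, abs_of_pos hT] at h3
        gcongr
    refine squeeze_zero_norm' hb ?_
    have : Tendsto (fun T : ℝ => (T ^ 2)⁻¹) atTop (𝓝 0) :=
      (tendsto_pow_atTop two_ne_zero).inv_tendsto_atTop
    simpa using this.const_mul (Real.exp (|b| * |t|) * K * |b - a|)
  have hrect : ∀ T : ℝ, (∫ y : ℝ in (-T)..T, f (b + y * Complex.I)) -
      (∫ y : ℝ in (-T)..T, f (a + y * Complex.I)) =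
      Complex.I * ((∫ x : ℝ in a..b, f (x + ((-1 * T : ℝ) : ℂ) * Complex.I)) -
        ∫ x : ℝ in a..b, f (x + ((1 * T : ℝ) : ℂ) * Complex.I)) := by
    intro T
    have := Complex.integral_boundary_rect_eq_zero_of_differentiableOn f
      ⟨a, -T⟩ ⟨b, T⟩ (hfd.mono ?_)
    · simp only [smul_eq_mul] at this
      have hI := Complex.I_mul_I
      rw [neg_one_mul, one_mul]
      linear_combination (-Complex.I) * this + ((∫ y : ℝ in (-T)..T, f (b + y * Complex.I)) -
        (∫ y : ℝ in (-T)..T, f (a + y * Complex.I))) * hI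
    · intro s hs
      have := hs.1
      simp only [mem_preimage, uIcc_of_le hab] at this
      exact ha.trans_le this.1
  have h0 := ((hhor (-1) (by simp)).sub (hhor 1 (by simp))).const_mul Complex.I
  simp only [sub_zero, mul_zero] at h0
  have h1 := (hlb.sub hla).congr hrect
  exact (sub_eq_zero.1 (tendsto_nhds_unique h1 h0)).symm

/-- The inverse Laplace transform vanishes on the negative axis. -/
theorem invLap_of_nonpos (h : QuadDecay κ K E) (hκ : 0 < κ) {a : ℝ} (ha : κ < a) {t : ℝ}
    (ht : t ≤ 0) : invLap E a t = 0 := by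
  have hneg : ∀ t < 0, invLap E a t = 0 := by
    intro t ht
    -- For `t < 0` the line is pushed to the right: the integral of `‖s‖⁻²` does not increase with
    -- `b`, while `e^{bt} → 0`. The value at `t = 0` then follows by continuity.
    have hb : ∀ b ≥ a, ‖invLap E a t‖ ≤ Real.exp (b * t) * (K * vlineConst a) := by
      intro b hb
      rw [h.invLap_eq hκ ha hb]
      refine (h.norm_invLap_le hκ (ha.trans_le hb) t).trans ?_
      rw [mul_assoc]
      have := vlineConst_anti (hκ.trans ha) hb
      have := h.const_nonneg
      gcongr
    have hlim : Tendsto (fun b : ℝ => Real.exp (b * t) * (K * vlineConst a)) atTop (𝓝 0) := by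
      have : Tendsto (fun b : ℝ => b * t) atTop atBot := tendsto_id.atTop_mul_const_of_neg ht
      simpa using (Real.tendsto_exp_atBot.comp this).mul_const (K * vlineConst a)
    have := ge_of_tendsto hlim ((eventually_ge_atTop a).mono hb)
    simpa using this
  have hcl : IsClosed {t : ℝ | invLap E a t = 0} :=
    isClosed_eq (h.continuous_invLap hκ ha) continuous_const
  have : Iic (0 : ℝ) ⊆ {t : ℝ | invLap E a t = 0} := by
    rw [← closure_Iio]
    exact hcl.closure_subset_iff.2 hneg
  exact this ht

/-- The `2π` in `vline` turns `dζ / 2πi` into `dv` and matches the normalisation of the Fourier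
transform. -/
theorem invLap_eq_fourierInv (a t : ℝ) :
    FourierTransformInv.fourierInv (fun v : ℝ => E (vline a v)) t
      = Complex.exp (-(a * t)) * invLap E a t := by
  rw [Real.fourierInv_eq', invLap, ← MeasureTheory.integral_const_mul]
  refine MeasureTheory.integral_congr_ae (Eventually.of_forall fun v => ?_)
  simp only [vline, smul_eq_mul, ← mul_assoc, ← Complex.exp_add]
  congr 2
  simp
  ring

/-- A quadratically decaying function is the Laplace transform of its inverse Laplace transform. -/
theorem laplace_invLap (h : QuadDecay κ K E) (hκ : 0 < κ) {a : ℝ} (ha : κ < a) {ζ : ℂ}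
    (hζ : a < ζ.re) :
    E ζ = ∫ t in Ioi (0 : ℝ), Complex.exp (-(ζ * t)) * invLap E a t := by
  -- Fourier inversion is applied on the vertical line through `ζ`. There the inverse transform is
  -- `e^{-bt} invLap E a t`, which vanishes for `t ≤ 0` and is integrable because `a < b`.
  set b := ζ.re with hb
  have hκb : κ < b := ha.trans hζ
  set f : ℝ → ℂ := fun v => E (vline b v) with hf
  have hfc : Continuous f := h.continuous_vline hκb
  have hfi : MeasureTheory.Integrable f := by
    have := h.integrable hκ hκb 0
    simpa [hf] using this
  have hinv : ∀ t : ℝ, FourierTransformInv.fourierInv f t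
      = Complex.exp (-(b * t)) * invLap E a t := by
    intro t
    rw [h.invLap_eq hκ ha hζ.le, invLap_eq_fourierInv]
  have hind : (fun t : ℝ => FourierTransformInv.fourierInv f t) =
      indicator (Ioi (0 : ℝ)) fun t : ℝ => Complex.exp (-(b * t)) * invLap E a t := by
    ext t
    by_cases ht : 0 < t
    · rw [indicator_of_mem (show t ∈ Ioi (0 : ℝ) from ht), hinv]
    · rw [indicator_of_notMem (show t ∉ Ioi (0 : ℝ) from ht), hinv,
        h.invLap_of_nonpos hκ ha (not_lt.1 ht), mul_zero]
  have hci := h.continuous_invLap hκ ha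
  have hii : MeasureTheory.Integrable (FourierTransformInv.fourierInv f) := by
    change MeasureTheory.Integrable (fun t : ℝ => FourierTransformInv.fourierInv f t)
    rw [hind, MeasureTheory.integrable_indicator_iff measurableSet_Ioi]
    refine MeasureTheory.Integrable.mono'
      ((integrableOn_exp_mul_Ioi (a := a - b) (by linarith) 0).mul_const (K * vlineConst a)) ?_ ?_
    · exact Continuous.aestronglyMeasurable (by fun_prop)
    · refine Eventually.of_forall fun t => ?_
      rw [norm_mul, Complex.norm_exp]
      refine (mul_le_mul_of_nonneg_left (h.norm_invLap_le hκ ha t) (Real.exp_pos _).le).trans ?_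
      rw [mul_assoc, ← mul_assoc, ← Real.exp_add]
      refine le_of_eq ?_
      congr 2
      simp
      ring
  have hinvf := congrFun (hfc.fourier_fourierInv_eq hfi
    (by
      have e : FourierTransform.fourier f = fun w => FourierTransformInv.fourierInv f (-w) := by
        ext w
        rw [Real.fourierInv_eq_fourier_neg, neg_neg]
      rw [e]
      exact hii.comp_neg)) (ζ.im / (2 * Real.pi))
  have hpt : vline b (ζ.im / (2 * Real.pi)) = ζ := by
    have hpi : (2 * Real.pi) ≠ 0 := by positivity
    have : 2 * Real.pi * (ζ.im / (2 * Real.pi)) = ζ.im := by field_simp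
    rw [vline, this]
    exact Complex.re_add_im ζ
  simp only [hf] at hinvf
  rw [hpt] at hinvf
  rw [← hinvf, Real.fourier_eq', ← MeasureTheory.integral_indicator measurableSet_Ioi]
  refine MeasureTheory.integral_congr_ae (Eventually.of_forall fun t => ?_)
  have := congrFun hind t
  simp only [hf] at this
  simp only [this, smul_eq_mul]
  by_cases ht : 0 < t
  · rw [indicator_of_mem (show t ∈ Ioi (0 : ℝ) from ht),
      indicator_of_mem (show t ∈ Ioi (0 : ℝ) from ht), ← mul_assoc, ← Complex.exp_add]
    congr 2
    conv_rhs => rw [← Complex.re_add_im ζ, ← hb]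
    have hpi : (Real.pi : ℂ) ≠ 0 := by exact_mod_cast Real.pi_ne_zero
    simp
    field_simp
    ring
  · rw [indicator_of_notMem (show t ∉ Ioi (0 : ℝ) from ht),
      indicator_of_notMem (show t ∉ Ioi (0 : ℝ) from ht), mul_zero]

/-- Differentiation of the inverse Laplace transform. -/
theorem hasDerivAt_invLap {K' : ℝ} (h : QuadDecay κ K E) (h' : QuadDecay κ K' fun s => s * E s)
    (hκ : 0 < κ) {a : ℝ} (ha : κ < a) (t : ℝ) :
    HasDerivAt (invLap E a) (invLap (fun s => s * E s) a t) t := by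
  have hc := h.continuous_vline ha
  have hv := Riccati.continuous_vline a
  refine (hasDerivAt_integral_of_dominated_loc_of_deriv_le
    (F := fun (t : ℝ) (v : ℝ) => Complex.exp (vline a v * t) * E (vline a v))
    (F' := fun (t : ℝ) (v : ℝ) => Complex.exp (vline a v * t) * (vline a v * E (vline a v)))
    (bound := fun v => Real.exp (a * (t + 1)) * K' * (1 / ‖vline a v‖ ^ 2))
    (Metric.ball_mem_nhds t one_pos) ?_ (h.integrable hκ ha t) ?_ ?_ ?_ ?_).2
  · exact Eventually.of_forall fun s => (h.continuous_integrand ha s).aestronglyMeasurable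
  · exact (h'.continuous_integrand ha t).aestronglyMeasurable
  · refine Eventually.of_forall fun v s hs => ?_
    refine (h'.norm_integrand_le ha s v).trans ?_
    have h1 : a * s ≤ a * (t + 1) := by
      have := abs_lt.1 (Real.dist_eq s t ▸ Metric.mem_ball.1 hs)
      exact mul_le_mul_of_nonneg_left (by linarith [this.2]) (hκ.trans ha).le
    have := h'.const_nonneg
    gcongr
  · exact (integrable_norm_vline (hκ.trans ha)).const_mul _
  · refine Eventually.of_forall fun v s _ => ?_
    have h1 : HasDerivAt (fun s : ℝ => vline a v * (s : ℂ)) (vline a v) s := by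
      simpa using (Complex.ofRealCLM.hasDerivAt (x := s)).const_mul (vline a v)
    have := h1.cexp.mul_const (E (vline a v))
    exact this.congr_deriv (by ring)

end QuadDecay

theorem quadDecay_inv_sq {κ : ℝ} (hκ : 0 < κ) : QuadDecay κ 1 fun s => (s ^ 2)⁻¹ where
  diff := by
    intro s hs
    have : s ≠ 0 := by
      rintro rfl
      exact absurd (show κ < (0 : ℂ).re from hs) (by simpa using hκ.le)
    exact ((differentiableAt_id.pow 2).inv (pow_ne_zero 2 this)).differentiableWithinAt
  bound := fun s _ => by simp

theorem integrableOn_mul_exp_neg {a : ℝ} (ha : 0 < a) :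
    MeasureTheory.IntegrableOn (fun t : ℝ => t * Real.exp (-(a * t))) (Ioi 0) := by
  refine MeasureTheory.Integrable.mono'
    ((integrableOn_exp_mul_Ioi (a := -(a / 2)) (by linarith) 0).const_mul (2 / a))
    (Continuous.aestronglyMeasurable (by fun_prop)) ?_
  filter_upwards [MeasureTheory.ae_restrict_mem measurableSet_Ioi] with t ht
  have ht : 0 < t := ht
  rw [Real.norm_of_nonneg (by positivity)]
  have h1 : a / 2 * t ≤ Real.exp (a / 2 * t) := by linarith [Real.add_one_le_exp (a / 2 * t)]
  have h2 : Real.exp (-(a * t)) = Real.exp (-(a / 2) * t) * Real.exp (-(a / 2) * t) := by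
    rw [← Real.exp_add]; ring_nf
  have h3 : Real.exp (a / 2 * t) * Real.exp (-(a / 2) * t) = 1 := by
    rw [← Real.exp_add]; simp
  have h4 : t ≤ 2 / a * Real.exp (a / 2 * t) := by
    have := mul_le_mul_of_nonneg_left h1 (show 0 ≤ 2 / a by positivity)
    have e : 2 / a * (a / 2 * t) = t := by field_simp
    rwa [e] at this
  calc t * Real.exp (-(a * t)) ≤ 2 / a * Real.exp (a / 2 * t) * Real.exp (-(a * t)) := by gcongr
    _ = 2 / a * Real.exp (-(a / 2) * t) * (Real.exp (a / 2 * t) * Real.exp (-(a / 2) * t)) := by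
        rw [h2]; ring
    _ = 2 / a * Real.exp (-(a / 2) * t) := by rw [h3, mul_one]

theorem integral_mul_exp_neg {s : ℂ} (hs : 0 < s.re) :
    ∫ t in Ioi (0 : ℝ), (t : ℂ) * Complex.exp (-(s * t)) = (s ^ 2)⁻¹ := by
  have hs0 : s ≠ 0 := by rintro rfl; simp at hs
  have hd : ∀ t ∈ Ici (0 : ℝ), HasDerivAt
      (fun t : ℝ => -((t : ℂ) / s + (s ^ 2)⁻¹) * Complex.exp (-(s * t)))
      ((t : ℂ) * Complex.exp (-(s * t))) t := by
    intro t _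
    have h0 : HasDerivAt (fun t : ℝ => (t : ℂ)) 1 t := Complex.ofRealCLM.hasDerivAt (x := t)
    have h1 := ((h0.div_const s).add_const ((s ^ 2)⁻¹)).neg
    have h2 := ((h0.const_mul s).neg).cexp
    refine (h1.mul h2).congr_deriv ?_
    simp only [Pi.neg_apply]
    field_simp
    ring
  have hnorm : ∀ t : ℝ, ‖Complex.exp (-(s * t))‖ = Real.exp (-(s.re * t)) := by
    intro t; rw [Complex.norm_exp]; simp
  have hint : MeasureTheory.IntegrableOn (fun t : ℝ => (t : ℂ) * Complex.exp (-(s * t)))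
      (Ioi 0) := by
    refine MeasureTheory.Integrable.mono' (integrableOn_mul_exp_neg hs)
      (Continuous.aestronglyMeasurable (by fun_prop)) ?_
    filter_upwards [MeasureTheory.ae_restrict_mem measurableSet_Ioi] with t ht
    have ht : 0 < t := ht
    rw [norm_mul, hnorm, Complex.norm_real, Real.norm_of_nonneg ht.le]
  have hlim : Tendsto (fun t : ℝ => -((t : ℂ) / s + (s ^ 2)⁻¹) * Complex.exp (-(s * t))) atTop
      (𝓝 0) := by
    have e1 : Tendsto (fun t : ℝ => t * Real.exp (-(s.re * t))) atTop (𝓝 0) := by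
      have := Real.tendsto_pow_mul_exp_neg_atTop_nhds_zero 1
      have h2 := (this.comp (tendsto_id.const_mul_atTop hs)).const_mul (s.re)⁻¹
      simp only [mul_zero] at h2
      refine h2.congr fun t => ?_
      simp only [Function.comp, pow_one, id]
      field_simp
    have e2 : Tendsto (fun t : ℝ => Real.exp (-(s.re * t))) atTop (𝓝 0) :=
      Real.tendsto_exp_neg_atTop_nhds_zero.comp (tendsto_id.const_mul_atTop hs)
    rw [tendsto_zero_iff_norm_tendsto_zero]
    have e3 := (e1.const_mul (‖s‖⁻¹)).add (e2.const_mul (‖s ^ 2‖⁻¹))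
    simp only [mul_zero, add_zero] at e3
    refine squeeze_zero' (Eventually.of_forall fun t => norm_nonneg _) ?_ e3
    filter_upwards [eventually_ge_atTop 0] with t ht
    rw [norm_mul, hnorm, norm_neg]
    have := norm_add_le ((t : ℂ) / s) ((s ^ 2)⁻¹)
    rw [norm_div, norm_inv, Complex.norm_real, Real.norm_of_nonneg ht] at this
    calc _ ≤ (t / ‖s‖ + ‖s ^ 2‖⁻¹) * Real.exp (-(s.re * t)) := by gcongr
      _ = _ := by ring
  rw [MeasureTheory.integral_Ioi_of_hasDerivAt_of_tendsto' hd hint hlim]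
  simp

/-- Fourier inversion for `max t 0 · e^{-at}`, which is continuous on the whole line, so that the
identity holds at every point. It supplies the correction between two consecutive remainders, and
the principal value for `s⁻¹`. -/
theorem invLap_inv_sq {a t : ℝ} (ha : 0 < a) (ht : 0 ≤ t) :
    invLap (fun s => (s ^ 2)⁻¹) a t = t := by
  have hq := quadDecay_inv_sq (half_pos ha)
  have ha2 : a / 2 < a := half_lt_self ha
  set f : ℝ → ℂ := fun t => ((max t 0 : ℝ) : ℂ) * Complex.exp (-(a * t)) with hf
  have hfc : Continuous f := by
    have : Continuous fun t : ℝ => max t 0 := by fun_prop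
    fun_prop
  have hind : f = indicator (Ioi (0 : ℝ)) fun t : ℝ => (t : ℂ) * Complex.exp (-(a * t)) := by
    ext t
    by_cases h : 0 < t
    · rw [indicator_of_mem (show t ∈ Ioi (0 : ℝ) from h), hf]
      simp only [max_eq_left h.le]
    · rw [indicator_of_notMem (show t ∉ Ioi (0 : ℝ) from h), hf]
      simp only [max_eq_right (not_lt.1 h), Complex.ofReal_zero, zero_mul]
  have hfi : MeasureTheory.Integrable f := by
    rw [hind, MeasureTheory.integrable_indicator_iff measurableSet_Ioi]
    refine MeasureTheory.Integrable.mono' (integrableOn_mul_exp_neg ha)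
      (Continuous.aestronglyMeasurable (by fun_prop)) ?_
    filter_upwards [MeasureTheory.ae_restrict_mem measurableSet_Ioi] with t ht
    have ht : 0 < t := ht
    rw [norm_mul, Complex.norm_real, Real.norm_of_nonneg ht.le, Complex.norm_exp]
    simp
  have hF : FourierTransform.fourier f = fun v => ((vline a v) ^ 2)⁻¹ := by
    ext v
    rw [← integral_mul_exp_neg (by simpa using ha), Real.fourier_eq',
      ← MeasureTheory.integral_indicator measurableSet_Ioi]
    refine MeasureTheory.integral_congr_ae (Eventually.of_forall fun t => ?_)
    rw [hind]
    by_cases h : 0 < t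
    · simp only [indicator_of_mem (show t ∈ Ioi (0 : ℝ) from h), smul_eq_mul]
      rw [mul_left_comm, ← Complex.exp_add]
      congr 2
      simp [vline]
      ring
    · simp only [indicator_of_notMem (show t ∉ Ioi (0 : ℝ) from h), smul_zero]
  have hFi : MeasureTheory.Integrable (FourierTransform.fourier f) := by
    rw [hF]
    simpa using hq.integrable (half_pos ha) ha2 0
  have h1 := congrFun (hfc.fourierInv_fourier_eq hfi hFi) t
  rw [hF, QuadDecay.invLap_eq_fourierInv (E := fun s => (s ^ 2)⁻¹), hf] at h1
  simp only [max_eq_left ht] at h1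
  rw [mul_comm] at h1
  exact mul_right_cancel₀ (Complex.exp_ne_zero _) h1

/-! ### Gevrey asymptotics on a right half plane -/

/-- The remainder of order `n` of the number `f` with respect to the series `∑ c k * η ^ k`. -/
def rem (f : ℂ) (c : ℕ → ℂ) (n : ℕ) (η : ℂ) : ℂ := f - ∑ k ∈ Finset.range n, c k * η ^ k

theorem rem_zero (f : ℂ) (c : ℕ → ℂ) (η : ℂ) : rem f c 0 η = f := by simp [rem]

theorem rem_succ (f : ℂ) (c : ℕ → ℂ) (n : ℕ) (η : ℂ) :
    rem f c (n + 1) η = rem f c n η - c n * η ^ n := by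
  simp [rem, Finset.sum_range_succ]; ring

/-- Gevrey asymptotics as `s → ∞` in the half plane `κ < Re s`, in powers of `s⁻¹`. -/
structure GevreyRHP (κ C M : ℝ) (g : ℂ → ℂ) (c : ℕ → ℂ) : Prop where
  diff : DifferentiableOn ℂ g {s | κ < s.re}
  bound : ∀ (n : ℕ) (s : ℂ), κ < s.re →
    ‖rem (g s) c n s⁻¹‖ ≤ C * M ^ n * (n.factorial : ℝ) * ‖s⁻¹‖ ^ n

theorem ne_zero_of_rhp {κ : ℝ} (hκ : 0 < κ) {s : ℂ} (hs : κ < s.re) : s ≠ 0 := by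
  rintro rfl
  exact absurd hs (by simpa using hκ.le)

theorem rem_differentiableOn {κ : ℝ} (hκ : 0 < κ) {g : ℂ → ℂ} {c : ℕ → ℂ}
    (hg : DifferentiableOn ℂ g {s | κ < s.re}) (n : ℕ) :
    DifferentiableOn ℂ (fun s => rem (g s) c n s⁻¹) {s | κ < s.re} := by
  unfold rem
  refine hg.sub (DifferentiableOn.fun_sum fun k _ => ?_)
  refine (differentiableOn_const _).mul (DifferentiableOn.pow (fun s hs => ?_) k)
  exact (differentiableAt_inv (ne_zero_of_rhp hκ hs)).differentiableWithinAt

theorem add_one_le_two_pow (n : ℕ) : ((n : ℝ) + 1) ≤ 2 ^ n := by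
  exact_mod_cast Nat.lt_two_pow_self

theorem factorial_add_one_le (n : ℕ) :
    (((n + 1).factorial : ℕ) : ℝ) ≤ 2 ^ n * (n.factorial : ℝ) := by
  rw [Nat.factorial_succ]
  push_cast
  have := add_one_le_two_pow n
  gcongr

theorem factorial_add_two_le (n : ℕ) :
    (((n + 2).factorial : ℕ) : ℝ) ≤ 2 * 4 ^ n * (n.factorial : ℝ) := by
  have h1 := factorial_add_one_le (n + 1)
  have h2 := factorial_add_one_le n
  have e : (4 : ℝ) ^ n = 2 ^ n * 2 ^ n := by rw [← mul_pow]; norm_num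
  calc (((n + 2).factorial : ℕ) : ℝ) ≤ 2 ^ (n + 1) * ((n + 1).factorial : ℝ) := h1
    _ ≤ 2 ^ (n + 1) * (2 ^ n * (n.factorial : ℝ)) := by gcongr
    _ = _ := by rw [e, pow_succ]; ring

namespace GevreyRHP

variable {κ C M : ℝ} {g : ℂ → ℂ} {c : ℕ → ℂ}

theorem const_nonneg (h : GevreyRHP κ C M g c) : 0 ≤ C := by
  have := h.bound 0 ((κ + 1 : ℝ) : ℂ) (by simp)
  simpa using (norm_nonneg _).trans this

/-- `c n` is `s ^ n` times the difference of the remainders of orders `n` and `n + 1`. As `s → +∞`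
the second contribution disappears, so the constants of the expansion carry over unchanged. -/
theorem norm_coeff_le (h : GevreyRHP κ C M g c) (n : ℕ) :
    ‖c n‖ ≤ C * M ^ n * (n.factorial : ℝ) := by
  have key : ∀ᶠ x : ℝ in atTop, ‖c n‖ ≤ C * M ^ n * (n.factorial : ℝ) +
      C * M ^ (n + 1) * ((n + 1).factorial : ℝ) * x⁻¹ := by
    filter_upwards [eventually_gt_atTop (max κ 0)] with x hx
    have hx0 : 0 < x := (le_max_right _ _).trans_lt hx
    have hxκ : κ < (x : ℂ).re := by simpa using (le_max_left _ _).trans_lt hx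
    have h1 := h.bound n x hxκ
    have h2 := h.bound (n + 1) x hxκ
    have e : c n * (x : ℂ)⁻¹ ^ n = rem (g x) c n (x : ℂ)⁻¹ - rem (g x) c (n + 1) (x : ℂ)⁻¹ := by
      rw [rem_succ]; ring
    have h3 := (norm_sub_le _ _).trans (add_le_add h1 h2)
    rw [← e, norm_mul, norm_pow, norm_inv, Complex.norm_real, Real.norm_of_nonneg hx0.le] at h3
    have hp : 0 < x⁻¹ ^ n := by positivity
    refine le_of_mul_le_mul_right (h3.trans (le_of_eq ?_)) hp
    rw [pow_succ x⁻¹]; ring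
  have hlim := (tendsto_inv_atTop_zero (𝕜 := ℝ)).const_mul
    (C * M ^ (n + 1) * ((n + 1).factorial : ℝ))
  have hlim := hlim.const_add (C * M ^ n * (n.factorial : ℝ))
  simp only [mul_zero, add_zero] at hlim
  exact ge_of_tendsto hlim key

theorem mono (h : GevreyRHP κ C M g c) {κ' : ℝ} (hk : κ ≤ κ') : GevreyRHP κ' C M g c where
  diff := h.diff.mono fun _ hs => hk.trans_lt hs
  bound n s hs := h.bound n s (hk.trans_lt hs)

/-- `s ^ m` times the remainder of order `n` is `O(s ^ (m - n))`; the powers beyond the two that are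
needed are traded for powers of `κ⁻¹`. -/
theorem quadDecay_aux (h : GevreyRHP κ C M g c) (hκ : 0 < κ) (m n : ℕ) (hmn : m + 2 ≤ n) :
    QuadDecay κ (C * M ^ n * (n.factorial : ℝ) * (κ⁻¹) ^ (n - (m + 2)))
      fun s => s ^ m * rem (g s) c n s⁻¹ where
  diff := (differentiableOn_id.pow m).mul (rem_differentiableOn hκ h.diff n)
  bound := by
    intro s hs
    have hs0 : 0 < ‖s‖ := norm_pos_iff.2 (ne_zero_of_rhp hκ hs)
    have hks : κ ≤ ‖s‖ := hs.le.trans ((le_abs_self _).trans (Complex.abs_re_le_norm s))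
    have hb := h.bound n s hs
    have hCM := (norm_nonneg _).trans hb
    have hCM' : 0 ≤ C * M ^ n * (n.factorial : ℝ) :=
      nonneg_of_mul_nonneg_left hCM
        (pow_pos (norm_pos_iff.2 (inv_ne_zero (ne_zero_of_rhp hκ hs))) n)
    rw [norm_mul, norm_pow]
    calc ‖s‖ ^ m * ‖rem (g s) c n s⁻¹‖
        ≤ ‖s‖ ^ m * (C * M ^ n * (n.factorial : ℝ) * ‖s⁻¹‖ ^ n) := by gcongr
      _ = C * M ^ n * (n.factorial : ℝ) * (‖s‖⁻¹ ^ (n - (m + 2)) / ‖s‖ ^ 2) := by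
          obtain ⟨j, rfl⟩ := Nat.exists_eq_add_of_le hmn
          rw [norm_inv, Nat.add_sub_cancel_left, inv_pow, inv_pow]
          field_simp
          ring
      _ ≤ C * M ^ n * (n.factorial : ℝ) * (κ⁻¹ ^ (n - (m + 2)) / ‖s‖ ^ 2) := by
          gcongr
      _ = _ := by ring

theorem quadDecay (h : GevreyRHP κ C M g c) (hκ : 0 < κ) (n : ℕ) :
    QuadDecay κ (C * M ^ (n + 2) * ((n + 2).factorial : ℝ))
      fun s => s ^ n * rem (g s) c (n + 2) s⁻¹ := by
  simpa using h.quadDecay_aux hκ n (n + 2) le_rfl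

end GevreyRHP

/-- The `n`-th derivative at `t` of the Borel transform of `g ~ ∑ c k * s ^ (-k)`. -/
def borelJet (g : ℂ → ℂ) (c : ℕ → ℂ) (a : ℝ) (n : ℕ) (t : ℝ) : ℂ :=
  c (n + 1) + invLap (fun s => s ^ n * rem (g s) c (n + 2) s⁻¹) a t

/-- The growth constant of the Borel transform. -/
def jetConst (C M a : ℝ) : ℝ := C * M + 2 * C * M ^ 2 * vlineConst a

namespace GevreyRHP

variable {κ C M : ℝ} {g : ℂ → ℂ} {c : ℕ → ℂ}

/-- The integral part vanishes at `t = 0`, so the jet there consists of the coefficients of the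
formal Borel transform. -/
theorem borelJet_zero (h : GevreyRHP κ C M g c) (hκ : 0 < κ) {a : ℝ} (ha : κ < a) (n : ℕ) :
    borelJet g c a n 0 = c (n + 1) := by
  rw [borelJet, (h.quadDecay hκ n).invLap_of_nonpos hκ ha le_rfl, add_zero]

theorem continuous_borelJet (h : GevreyRHP κ C M g c) (hκ : 0 < κ) {a : ℝ} (ha : κ < a) (n : ℕ) :
    Continuous (borelJet g c a n) :=
  continuous_const.add ((h.quadDecay hκ n).continuous_invLap hκ ha)

/-- The `n`-th derivative involves the remainder of order `n + 2`, and `(n + 2)! ≤ 2 · 4 ^ n · n!`.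
So every Taylor series along the half line converges at least up to radius `1 / (4 M)`. -/
theorem norm_borelJet_le (h : GevreyRHP κ C M g c) (hκ : 0 < κ) (hM : 0 ≤ M) {a : ℝ} (ha : κ < a)
    (n : ℕ) {t : ℝ} (ht : 0 ≤ t) :
    ‖borelJet g c a n t‖
      ≤ Real.exp (a * t) * jetConst C M a * (4 * M) ^ n * (n.factorial : ℝ) := by
  have h1 := h.norm_coeff_le (n + 1)
  have h2 := (h.quadDecay hκ n).norm_invLap_le hκ ha t
  have hC := h.const_nonneg
  have ha0 : 0 < a := hκ.trans ha
  have he : 1 ≤ Real.exp (a * t) := Real.one_le_exp (by positivity)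
  have hv := vlineConst_nonneg a
  have h24 : (2 : ℝ) ^ n ≤ 4 ^ n := by gcongr; norm_num
  calc ‖borelJet g c a n t‖ ≤ C * M ^ (n + 1) * ((n + 1).factorial : ℝ) +
        Real.exp (a * t) * (C * M ^ (n + 2) * ((n + 2).factorial : ℝ)) * vlineConst a :=
        (norm_add_le _ _).trans (add_le_add h1 h2)
    _ ≤ C * M ^ (n + 1) * (Real.exp (a * t) * (4 ^ n * (n.factorial : ℝ))) +
        Real.exp (a * t) * (C * M ^ (n + 2) * (2 * 4 ^ n * (n.factorial : ℝ))) * vlineConst a := by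
        have f1 := factorial_add_one_le n
        have f2 := factorial_add_two_le n
        have f3 : (((n + 1).factorial : ℕ) : ℝ) ≤ Real.exp (a * t) * (4 ^ n * (n.factorial : ℝ)) :=
          f1.trans ((mul_le_mul_of_nonneg_right h24 (by positivity)).trans
            (le_mul_of_one_le_left (by positivity) he))
        gcongr
    _ = _ := by rw [jetConst, mul_pow]; ring

/-- `s ^ n` times the remainder of order `n + 2` is `c (n + 2) s⁻²` plus `s ^ n` times the remainder
of order `n + 3`. The first term inverts to `c (n + 2) t` for `t ≥ 0`; the second still decays
quadratically after multiplication by `s`, so it is differentiated under the integral. -/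
theorem hasDerivAt_borelJet (h : GevreyRHP κ C M g c) (hκ : 0 < κ) {a : ℝ} (ha : κ < a) (n : ℕ)
    {t : ℝ} (ht : 0 < t) :
    HasDerivAt (borelJet g c a n) (borelJet g c a (n + 1) t) t := by
  have ha0 : 0 < a := hκ.trans ha
  have q1 := h.quadDecay_aux hκ n (n + 3) (by omega)
  have q2 := h.quadDecay hκ (n + 1)
  have hmul : (fun s => s * (s ^ n * rem (g s) c (n + 3) s⁻¹)) =
      fun s => s ^ (n + 1) * rem (g s) c (n + 1 + 2) s⁻¹ := by
    ext s; rw [pow_succ]; ring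
  have hd := q1.hasDerivAt_invLap (by rw [hmul]; exact q2) hκ ha t
  rw [hmul] at hd
  have h0 : HasDerivAt (fun t : ℝ => (t : ℂ)) 1 t := Complex.ofRealCLM.hasDerivAt (x := t)
  have hd2 := ((h0.const_mul (c (n + 2))).add hd).const_add (c (n + 1))
  rw [mul_one] at hd2
  refine hd2.congr_of_eventuallyEq ?_
  filter_upwards [lt_mem_nhds ht] with τ hτ
  simp only [borelJet, Pi.add_apply]
  congr 1
  rw [← invLap_inv_sq ha0 hτ.le, invLap, invLap, invLap, ← MeasureTheory.integral_const_mul,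
    ← MeasureTheory.integral_add]
  · refine MeasureTheory.integral_congr_ae (Eventually.of_forall fun v => ?_)
    have hs : vline a v ≠ 0 := norm_pos_iff.1 (norm_vline_pos ha0 v)
    change _ = c (n + 2) * (Complex.exp (vline a v * τ) * ((vline a v) ^ 2)⁻¹) +
      Complex.exp (vline a v * τ) * ((vline a v) ^ n * rem (g (vline a v)) c (n + 2 + 1) (vline a v)⁻¹)
    rw [rem_succ, inv_pow]
    field_simp
    ring
  · exact ((quadDecay_inv_sq hκ).integrable hκ ha τ).const_mul _
  · exact q1.integrable hκ ha τ

theorem eq_laplace_borelJet (h : GevreyRHP κ C M g c) (hκ : 0 < κ) {a : ℝ} (ha : κ < a) {ζ : ℂ}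
    (hζ : a < ζ.re) :
    g ζ = c 0 + ∫ t in Ioi (0 : ℝ), Complex.exp (-(ζ * t)) * borelJet g c a 0 t := by
  have ha0 : 0 < a := hκ.trans ha
  have hζ0 : ζ ≠ 0 := ne_zero_of_rhp hκ (ha.trans hζ)
  have q := h.quadDecay hκ 0
  have h1 := q.laplace_invLap hκ ha hζ
  have hnorm : ∀ t : ℝ, ‖Complex.exp (-(ζ * t))‖ = Real.exp (-(ζ.re * t)) := by
    intro t; rw [Complex.norm_exp]; simp
  have i1 : MeasureTheory.IntegrableOn (fun t : ℝ => Complex.exp (-(ζ * t)) * c 1) (Ioi 0) := by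
    refine MeasureTheory.Integrable.mul_const ?_ _
    refine MeasureTheory.Integrable.mono'
      (integrableOn_exp_mul_Ioi (a := -ζ.re) (by linarith) 0)
      (Continuous.aestronglyMeasurable (by fun_prop)) (Eventually.of_forall fun t => ?_)
    rw [hnorm, neg_mul]
  have i2 : MeasureTheory.IntegrableOn (fun t : ℝ => Complex.exp (-(ζ * t)) *
      invLap (fun s => s ^ 0 * rem (g s) c (0 + 2) s⁻¹) a t) (Ioi 0) := by
    refine MeasureTheory.Integrable.mono'
      ((integrableOn_exp_mul_Ioi (a := a - ζ.re) (by linarith) 0).mul_const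
        (C * M ^ (0 + 2) * ((0 + 2).factorial : ℝ) * vlineConst a)) ?_
      (Eventually.of_forall fun t => ?_)
    · have := q.continuous_invLap hκ ha
      exact Continuous.aestronglyMeasurable (Continuous.mul (by fun_prop) this)
    · rw [norm_mul, hnorm]
      refine (mul_le_mul_of_nonneg_left (q.norm_invLap_le hκ ha t) (Real.exp_pos _).le).trans ?_
      rw [mul_assoc (Real.exp (a * t)), ← mul_assoc (Real.exp (-(ζ.re * t))), ← Real.exp_add]
      refine le_of_eq ?_
      congr 2
      ring
  have h2 : ∫ t in Ioi (0 : ℝ), Complex.exp (-(ζ * t)) * borelJet g c a 0 t =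
      c 1 * ζ⁻¹ + rem (g ζ) c 2 ζ⁻¹ := by
    simp only [borelJet, mul_add]
    rw [MeasureTheory.integral_add i1 i2, ← h1, MeasureTheory.integral_mul_const]
    have := integral_exp_mul_complex_Ioi (a := -ζ) (by simp; linarith) 0
    simp only [neg_mul] at this
    rw [this]
    simp
    ring
  rw [h2]
  simp [rem, Finset.sum_range_succ]
  ring

end GevreyRHP

/-! ### Analytic continuation along the positive axis -/

/-- A function on the half line, given with its derivatives, whose Taylor series have radii of
convergence bounded below. -/
structure JetFamily (A L M : ℝ) (b : ℕ → ℝ → ℂ) : Prop where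
  cont : ∀ n, Continuous (b n)
  deriv : ∀ n t, 0 < t → HasDerivAt (b n) (b (n + 1) t) t
  bound : ∀ n t, 0 ≤ t → ‖b n t‖ ≤ Real.exp (L * t) * A * M ^ n * (n.factorial : ℝ)

/-- The Taylor series at `t`. -/
def taylorAt (b : ℕ → ℝ → ℂ) (t : ℝ) (ξ : ℂ) : ℂ :=
  ∑' n : ℕ, b n t * (ξ - t) ^ n / (n.factorial : ℂ)

/-- The analytic continuation to a neighbourhood of the half line. -/
def borelExt (b : ℕ → ℝ → ℂ) (ξ : ℂ) : ℂ := taylorAt b (max ξ.re 0) ξ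

namespace JetFamily

variable {A L M : ℝ} {b : ℕ → ℝ → ℂ}

theorem const_nonneg (h : JetFamily A L M b) : 0 ≤ A := by
  have := h.bound 0 0 le_rfl
  simpa using (norm_nonneg _).trans this

theorem norm_term_le (h : JetFamily A L M b) (hM : 0 < M) {t : ℝ} (ht : 0 ≤ t) {ξ : ℂ} {ρ : ℝ}
    (hξ : ‖ξ - t‖ ≤ ρ) (n : ℕ) :
    ‖b n t * (ξ - t) ^ n / (n.factorial : ℂ)‖ ≤ Real.exp (L * t) * A * (M * ρ) ^ n := by
  have hn : (0 : ℝ) < n.factorial := by exact_mod_cast n.factorial_pos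
  rw [norm_div, norm_mul, norm_pow, Complex.norm_natCast, div_le_iff₀ hn]
  have hA := h.const_nonneg
  calc ‖b n t‖ * ‖ξ - t‖ ^ n ≤ (Real.exp (L * t) * A * M ^ n * (n.factorial : ℝ)) * ρ ^ n := by
        have := h.bound n t ht
        gcongr
    _ = _ := by rw [mul_pow]; ring

theorem summable_term (h : JetFamily A L M b) (hM : 0 < M) {t : ℝ} (ht : 0 ≤ t) {ξ : ℂ}
    (hξ : M * ‖ξ - t‖ < 1) :
    Summable fun n : ℕ => b n t * (ξ - t) ^ n / (n.factorial : ℂ) := by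
  refine Summable.of_norm_bounded ?_ (h.norm_term_le hM ht le_rfl)
  exact (summable_geometric_of_lt_one (by positivity) hξ).mul_left _

theorem norm_taylorAt_le (h : JetFamily A L M b) (hM : 0 < M) {t : ℝ} (ht : 0 ≤ t) {ξ : ℂ} {ρ : ℝ}
    (hρ : M * ρ < 1) (hξ : ‖ξ - t‖ ≤ ρ) :
    ‖taylorAt b t ξ‖ ≤ Real.exp (L * t) * A * (1 - M * ρ)⁻¹ := by
  have hρ0 : 0 ≤ ρ := (norm_nonneg _).trans hξ
  exact tsum_of_norm_bounded ((hasSum_geometric_of_lt_one (by positivity) hρ).mul_left _)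
    (h.norm_term_le hM ht hξ)

theorem differentiableOn_taylorAt (h : JetFamily A L M b) (hM : 0 < M) {t : ℝ} (ht : 0 ≤ t)
    {ρ : ℝ} (hρ0 : 0 ≤ ρ) (hρ : M * ρ < 1) :
    DifferentiableOn ℂ (taylorAt b t) (Metric.ball (t : ℂ) ρ) := by
  refine Complex.differentiableOn_tsum_of_summable_norm
    ((summable_geometric_of_lt_one (by positivity) hρ).mul_left (Real.exp (L * t) * A))
    (fun n => by fun_prop) Metric.isOpen_ball fun n ξ hξ => ?_
  exact h.norm_term_le hM ht (by rw [← dist_eq_norm]; exact (Metric.mem_ball.1 hξ).le) n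

theorem hasSum_taylorAt_zero (h : JetFamily A L M b) (hM : 0 < M) {ξ : ℂ} (hξ : M * ‖ξ‖ < 1) :
    HasSum (fun n : ℕ => b n 0 * ξ ^ n / (n.factorial : ℂ)) (taylorAt b 0 ξ) := by
  have := (h.summable_term hM le_rfl (ξ := ξ) (by simpa using hξ)).hasSum
  simpa [taylorAt] using this

theorem taylorAt_self (b : ℕ → ℝ → ℂ) (t : ℝ) : taylorAt b t t = b 0 t := by
  rw [taylorAt, tsum_eq_single 0]
  · simp
  · intro n hn
    simp [hn]

/-- The Taylor series at different points agree. -/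
theorem taylorAt_eq (h : JetFamily A L M b) (hM : 0 < M) (hL : 0 ≤ L) {s t : ℝ} (hs : 0 ≤ s)
    (hst : s ≤ t) {ξ : ℂ} (h1 : M * ‖ξ - s‖ < 1) (h2 : M * ‖ξ - t‖ < 1) :
    taylorAt b s ξ = taylorAt b t ξ := by
  rcases hst.eq_or_lt with rfl | hlt
  · rfl
  -- By convexity every point between `s` and `t` is within `ρ` of `ξ`, so all the Taylor series on
  -- the way share one geometric majorant.
  set ρ := max ‖ξ - s‖ ‖ξ - t‖ with hρdef
  have hρ : M * ρ < 1 := by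
    rw [hρdef]; rcases max_cases ‖ξ - s‖ ‖ξ - t‖ with h | h <;> rw [h.1] <;> assumption
  have hρ0 : 0 ≤ ρ := (norm_nonneg _).trans (le_max_left _ _)
  have hA := h.const_nonneg
  have hseg : ∀ τ ∈ Icc s t, ‖ξ - τ‖ ≤ ρ := by
    intro τ hτ
    have hc := (convex_closedBall ξ ρ).segment_subset (x := (s : ℂ)) (y := (t : ℂ))
      (by rw [mem_closedBall_iff_norm']; exact le_max_left _ _)
      (by rw [mem_closedBall_iff_norm']; exact le_max_right _ _)
    have hmem : (τ : ℂ) ∈ segment ℝ (s : ℂ) (t : ℂ) := by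
      have : τ ∈ segment ℝ s t := by rwa [segment_eq_Icc hst]
      obtain ⟨u, v, hu, hv, huv, rfl⟩ := this
      exact ⟨u, v, hu, hv, huv, by simp⟩
    exact mem_closedBall_iff_norm'.1 (hc hmem)
  have hbd : ∀ n τ, τ ∈ Icc s t → ‖b n τ * (ξ - τ) ^ n / (n.factorial : ℂ)‖
      ≤ Real.exp (L * t) * A * (M * ρ) ^ n := by
    intro n τ hτ
    refine (h.norm_term_le hM (hs.trans hτ.1) (hseg τ hτ) n).trans ?_
    have := hτ.2
    gcongr
  have hgeo := summable_geometric_of_lt_one (by positivity : 0 ≤ M * ρ) hρ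
  have hcont : ContinuousOn (fun τ : ℝ => taylorAt b τ ξ) (Icc s t) := by
    refine continuousOn_tsum (fun n => ?_) (hgeo.mul_left (Real.exp (L * t) * A)) hbd
    have := h.cont n
    fun_prop
  -- the derivative of a term is a difference of consecutive terms
  set G : ℝ → ℕ → ℂ := fun τ n => b n τ * (n * (ξ - τ) ^ (n - 1)) / (n.factorial : ℂ) with hG
  have hGsucc : ∀ τ n, G τ (n + 1) = b (n + 1) τ * (ξ - τ) ^ n / (n.factorial : ℂ) := by
    intro τ n
    have : (n.factorial : ℂ) ≠ 0 := by exact_mod_cast n.factorial_ne_zero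
    have : (n : ℂ) + 1 ≠ 0 := by exact_mod_cast n.succ_ne_zero
    simp only [hG, Nat.factorial_succ, Nat.add_sub_cancel]
    push_cast
    field_simp
  have hGbd : ∀ n τ, τ ∈ Icc s t →
      ‖G τ (n + 1)‖ ≤ Real.exp (L * t) * A * M * ((n + 1) * (M * ρ) ^ n) := by
    intro n τ hτ
    have hn : (0 : ℝ) < n.factorial := by exact_mod_cast n.factorial_pos
    rw [hGsucc, norm_div, norm_mul, norm_pow, Complex.norm_natCast, div_le_iff₀ hn]
    have hb := h.bound (n + 1) τ (hs.trans hτ.1)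
    have := hτ.2
    have := hseg τ hτ
    calc ‖b (n + 1) τ‖ * ‖ξ - τ‖ ^ n ≤
          (Real.exp (L * t) * A * M ^ (n + 1) * ((n + 1).factorial : ℝ)) * ρ ^ n := by
          refine mul_le_mul (hb.trans ?_) (by gcongr) (by positivity) (by positivity)
          gcongr
      _ = _ := by
          rw [Nat.factorial_succ, mul_pow]; push_cast; ring
  have hsum1 : Summable fun n : ℕ => Real.exp (L * t) * A * M * (((n : ℝ) + 1) * (M * ρ) ^ n) := by
    refine Summable.mul_left _ ?_
    have := summable_pow_mul_geometric_of_norm_lt_one 1 (r := M * ρ)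
      (by rwa [Real.norm_of_nonneg (by positivity)])
    refine (this.add hgeo).congr fun n => ?_
    simp only [pow_one]
    ring
  set u : ℕ → ℝ := fun n => Real.exp (L * t) * A * M * (((n : ℝ) + 1) * (M * ρ) ^ n) with hu
  have hu0 : ∀ n, 0 ≤ u n := fun n => by simp only [hu]; positivity
  set u' : ℕ → ℝ := fun n => u n + (if n = 0 then 0 else u (n - 1)) with hu'
  have hsum2 : Summable u' := by
    refine hsum1.add ((summable_nat_add_iff 1).1 ?_)
    simpa using hsum1
  have hGbd' : ∀ n τ, τ ∈ Icc s t → ‖G τ n‖ ≤ if n = 0 then 0 else u (n - 1) := by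
    intro n τ hτ
    rcases n with _ | n
    · simp [hG]
    · simpa using hGbd n τ hτ
  have hderiv : ∀ n : ℕ, ∀ τ ∈ Ioo s t, HasDerivAt
      (fun τ : ℝ => b n τ * (ξ - τ) ^ n / (n.factorial : ℂ)) (G τ (n + 1) - G τ n) τ := by
    intro n τ hτ
    have h0 : HasDerivAt (fun t : ℝ => (t : ℂ)) 1 τ := Complex.ofRealCLM.hasDerivAt (x := τ)
    have hp := ((h0.const_sub ξ).pow n)
    have := ((h.deriv n τ (hs.trans_lt hτ.1)).mul hp).div_const (n.factorial : ℂ)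
    refine this.congr_deriv ?_
    rw [hGsucc]
    simp only [hG, Pi.pow_apply]
    ring
  -- Moving the centre of a Taylor series does not change its sum: the derivative in `τ` telescopes
  -- to `-G τ 0 = 0`.
  have hconst : ∀ τ ∈ Ioo s t, HasDerivAt (fun τ : ℝ => taylorAt b τ ξ) 0 τ := by
    intro τ hτ
    have hd := hasDerivAt_tsum_of_isPreconnected hsum2 isOpen_Ioo isPreconnected_Ioo hderiv
      (fun n τ hτ => (norm_sub_le _ _).trans (add_le_add (hGbd n τ (Ioo_subset_Icc_self hτ))
        (hGbd' n τ (Ioo_subset_Icc_self hτ)))) hτ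
      (Summable.of_norm_bounded (hgeo.mul_left (Real.exp (L * t) * A))
        fun n => hbd n τ (Ioo_subset_Icc_self hτ)) hτ
    refine hd.congr_deriv ?_
    have s1 : Summable fun n => G τ (n + 1) :=
      Summable.of_norm_bounded hsum1 fun n => hGbd n τ (Ioo_subset_Icc_self hτ)
    have s0 : Summable (G τ) := (summable_nat_add_iff 1).1 s1
    rw [s1.tsum_sub s0, s0.tsum_eq_zero_add]
    simp [hG]
  have hIoo : ∀ x ∈ Ioo s t, ∀ y ∈ Ioo s t, taylorAt b x ξ = taylorAt b y ξ := by
    intro x hx y hy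
    have := (convex_Ioo s t).norm_image_sub_le_of_norm_hasDerivWithin_le
      (f := fun τ : ℝ => taylorAt b τ ξ) (C := 0)
      (fun τ hτ => (hconst τ hτ).hasDerivWithinAt) (by simp) hy hx
    rw [zero_mul] at this
    exact sub_eq_zero.1 (norm_le_zero_iff.1 this)
  obtain ⟨m, hm⟩ := exists_between hlt
  -- The jets are differentiable only at positive arguments, so the endpoints are reached by
  -- continuity.
  have heq : EqOn (fun τ : ℝ => taylorAt b τ ξ) (fun _ => taylorAt b m ξ) (Icc s t) :=
    EqOn.of_subset_closure (fun x hx => hIoo x hx m hm) hcont continuousOn_const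
      Ioo_subset_Icc_self (by rw [closure_Ioo hlt.ne])
  exact (heq (left_mem_Icc.2 hst)).trans (heq (right_mem_Icc.2 hst)).symm

/-- The nearest point of the ray is at least as good a centre as `t`, so its series converges at `ξ`
too and the two agree. Near a given point the extension is therefore one fixed power series,
although its centre moves with `ξ`. -/
theorem borelExt_eq_taylorAt (h : JetFamily A L M b) (hM : 0 < M) (hL : 0 ≤ L) {t : ℝ}
    (ht : 0 ≤ t) {ξ : ℂ} (h1 : M * ‖ξ - t‖ < 1) : borelExt b ξ = taylorAt b t ξ := by
  have hle : ‖ξ - ((max ξ.re 0 : ℝ) : ℂ)‖ ≤ ‖ξ - t‖ := by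
    refine le_of_forall_gt_imp_ge_of_dense fun ρ hρ => ?_
    exact (norm_sub_max_lt_of_mem_strip ⟨t, ht, hρ⟩).le
  have h2 : M * ‖ξ - ((max ξ.re 0 : ℝ) : ℂ)‖ < 1 :=
    (mul_le_mul_of_nonneg_left hle hM.le).trans_lt h1
  rcases le_total (max ξ.re 0) t with h3 | h3
  · exact h.taylorAt_eq hM hL (le_max_right _ _) h3 h2 h1
  · exact (h.taylorAt_eq hM hL ht h3 h1 h2).symm

theorem borelExt_ofReal (b : ℕ → ℝ → ℂ) {t : ℝ} (ht : 0 ≤ t) : borelExt b t = b 0 t := by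
  rw [borelExt, Complex.ofReal_re, max_eq_left ht, taylorAt_self]

theorem norm_borelExt_le (h : JetFamily A L M b) (hM : 0 < M) (hL : 0 ≤ L) {ρ : ℝ}
    (hρ : M * ρ < 1) {ξ : ℂ} (hξ : ξ ∈ strip ρ) :
    ‖borelExt b ξ‖ ≤ A * (1 - M * ρ)⁻¹ * Real.exp (L * ‖ξ‖) := by
  have h1 := h.norm_taylorAt_le hM (le_max_right ξ.re 0) hρ (norm_sub_max_lt_of_mem_strip hξ).le
  have hA := h.const_nonneg
  have hinv : 0 ≤ (1 - M * ρ)⁻¹ := inv_nonneg.2 (by linarith)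
  have hmax : max ξ.re 0 ≤ ‖ξ‖ :=
    max_le ((le_abs_self _).trans (Complex.abs_re_le_norm ξ)) (norm_nonneg _)
  calc ‖borelExt b ξ‖ ≤ Real.exp (L * max ξ.re 0) * A * (1 - M * ρ)⁻¹ := h1
    _ ≤ Real.exp (L * ‖ξ‖) * A * (1 - M * ρ)⁻¹ := by gcongr
    _ = _ := by ring

theorem differentiableOn_borelExt (h : JetFamily A L M b) (hM : 0 < M) (hL : 0 ≤ L) {ρ : ℝ}
    (hρ : M * ρ < 1) : DifferentiableOn ℂ (borelExt b) (strip ρ) := by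
  rintro ξ ⟨t, ht, hξ⟩
  have hρ0 : 0 ≤ ρ := (norm_nonneg _).trans hξ.le
  have hmem : ξ ∈ Metric.ball (t : ℂ) ρ := by rwa [mem_ball_iff_norm]
  have hd := (h.differentiableOn_taylorAt hM ht hρ0 hρ).differentiableAt
    (Metric.isOpen_ball.mem_nhds hmem)
  refine (hd.congr_of_eventuallyEq ?_).differentiableWithinAt
  filter_upwards [Metric.isOpen_ball.mem_nhds hmem] with η hη
  rw [mem_ball_iff_norm] at hη
  exact h.borelExt_eq_taylorAt hM hL ht
    ((mul_le_mul_of_nonneg_left hη.le hM.le).trans_lt hρ)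

end JetFamily

/-! ### Borel transforms of Gevrey functions and Watson's lemma -/

theorem GevreyRHP.jetFamily {κ C M : ℝ} {g : ℂ → ℂ} {c : ℕ → ℂ} (h : GevreyRHP κ C M g c)
    (hκ : 0 < κ) (hM : 0 ≤ M) {a : ℝ} (ha : κ < a) :
    JetFamily (jetConst C M a) a (4 * M) (borelJet g c a) where
  cont := h.continuous_borelJet hκ ha
  deriv n _ ht := h.hasDerivAt_borelJet hκ ha n ht
  bound n _ ht := h.norm_borelJet_le hκ hM ha n ht

theorem isPreconnected_strip (r : ℝ) : IsPreconnected (strip r) := (convex_strip r).isPreconnected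

/-- Watson's lemma: a function on a right half plane is determined by its Gevrey expansion. -/
theorem GevreyRHP.eq_zero {κ C M : ℝ} {g : ℂ → ℂ} (h : GevreyRHP κ C M g 0)
    (hκ : 0 < κ) (hM : 0 < M) {ζ : ℂ} (hζ : κ < ζ.re) : g ζ = 0 := by
  obtain ⟨a, ha, haζ⟩ := exists_between hζ
  have hj := h.jetFamily hκ hM.le ha
  have hM4 : 0 < 4 * M := by positivity
  have ha0 : 0 ≤ a := (hκ.trans ha).le
  -- Half of the guaranteed radius of convergence `1 / (4 M)`.
  set ρ : ℝ := 1 / (8 * M) with hρ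
  have hρ0 : 0 < ρ := by positivity
  have hMρ : 4 * M * ρ < 1 := by rw [hρ]; field_simp; norm_num
  have hd := hj.differentiableOn_borelExt hM4 ha0 hMρ
  have han := hd.analyticOnNhd (isOpen_strip ρ)
  have h0 : (0 : ℂ) ∈ strip ρ := by simpa using ofReal_mem_strip hρ0 le_rfl
  -- All Taylor coefficients at `0` vanish, hence so does the Borel transform near `0`; the identity
  -- theorem carries this along the strip, and `g` is the Laplace transform of zero.
  have hz : borelExt (borelJet g 0 a) =ᶠ[𝓝 0] 0 := by
    filter_upwards [Metric.ball_mem_nhds (0 : ℂ) hρ0] with ξ hξ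
    have hξ' : 4 * M * ‖ξ‖ < 1 :=
      (mul_le_mul_of_nonneg_left (mem_ball_zero_iff.1 hξ).le hM4.le).trans_lt hMρ
    rw [hj.borelExt_eq_taylorAt hM4 ha0 le_rfl (by simpa using hξ'), taylorAt]
    have : ∀ n, borelJet g 0 a n 0 = 0 := fun n => by rw [h.borelJet_zero hκ ha]; rfl
    simp [this]
  have heq := han.eqOn_zero_of_preconnected_of_eventuallyEq_zero (isPreconnected_strip ρ) h0 hz
  rw [h.eq_laplace_borelJet hκ ha haζ]
  have : ∀ t ∈ Ioi (0 : ℝ), Complex.exp (-(ζ * t)) * borelJet g 0 a 0 t = 0 := by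
    intro t ht
    rw [← JetFamily.borelExt_ofReal (borelJet g 0 a) (le_of_lt ht),
      heq (ofReal_mem_strip hρ0 (le_of_lt ht))]
    simp
  rw [MeasureTheory.setIntegral_eq_zero_of_forall_eq_zero this]
  simp

theorem GevreyRHP.sub {κ C M C' M' : ℝ} {g g' : ℂ → ℂ} {c : ℕ → ℂ} (h : GevreyRHP κ C M g c)
    (h' : GevreyRHP κ C' M' g' c) (hM : 0 ≤ M) (hM' : 0 ≤ M') :
    GevreyRHP κ (C + C') (max M M') (fun s => g s - g' s) 0 where
  diff := h.diff.sub h'.diff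
  bound := by
    intro n s hs
    have e : rem (g s - g' s) 0 n s⁻¹ = rem (g s) c n s⁻¹ - rem (g' s) c n s⁻¹ := by simp [rem]
    have h1 := h.const_nonneg
    have h2 := h'.const_nonneg
    rw [e]
    calc _ ≤ C * M ^ n * (n.factorial : ℝ) * ‖s⁻¹‖ ^ n + C' * M' ^ n * (n.factorial : ℝ) * ‖s⁻¹‖ ^ n :=
          (norm_sub_le _ _).trans (add_le_add (h.bound n s hs) (h'.bound n s hs))
      _ ≤ C * (max M M') ^ n * (n.factorial : ℝ) * ‖s⁻¹‖ ^ n +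
          C' * (max M M') ^ n * (n.factorial : ℝ) * ‖s⁻¹‖ ^ n := by
          gcongr
          · exact le_max_left _ _
          · exact le_max_right _ _
      _ = _ := by ring

theorem GevreyRHP.unique {κ C M C' M' : ℝ} {g g' : ℂ → ℂ} {c : ℕ → ℂ} (h : GevreyRHP κ C M g c)
    (h' : GevreyRHP κ C' M' g' c) (hκ : 0 < κ) (hM : 0 < M) (hM' : 0 < M') {ζ : ℂ}
    (hζ : κ < ζ.re) : g ζ = g' ζ :=
  sub_eq_zero.1 ((h.sub h' hM.le hM'.le).eq_zero hκ (lt_max_of_lt_left hM) hζ)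

/-! ### Uniform convergence of truncated integrals -/

/-- The tail of the common majorant bounds all the tails at once. -/
theorem tendstoUniformlyOn_setIntegral {ι : Type*} {μ : MeasureTheory.Measure ℝ} {F : ι → ℝ → ℂ}
    {bd : ℝ → ℝ} {I : Set ι} (hF : ∀ i ∈ I, MeasureTheory.AEStronglyMeasurable (F i) μ)
    (hb : ∀ i ∈ I, ∀ᵐ y ∂μ, ‖F i y‖ ≤ bd y) (hbd : MeasureTheory.Integrable bd μ) :
    TendstoUniformlyOn (fun (T : ℝ) i => ∫ y in (-T)..T, F i y ∂μ) (fun i => ∫ y, F i y ∂μ)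
      atTop I := by
  have hlim := MeasureTheory.intervalIntegral_tendsto_integral hbd tendsto_neg_atTop_atBot
    tendsto_id
  rw [Metric.tendstoUniformlyOn_iff]
  intro η hη
  have h1 : ∀ᶠ T : ℝ in atTop, (∫ y, bd y ∂μ) - (∫ y in (-T)..T, bd y ∂μ) < η := by
    have := (hlim.const_sub (∫ y, bd y ∂μ))
    rw [sub_self] at this
    exact this.eventually_lt_const hη
  filter_upwards [h1, eventually_ge_atTop 0] with T hT hT0 i hi
  have hFi : MeasureTheory.Integrable (F i) μ := hbd.mono' (hF i hi) (hb i hi)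
  have hle : -T ≤ T := by linarith
  rw [intervalIntegral.integral_of_le hle] at hT ⊢
  rw [dist_eq_norm]
  have e1 := MeasureTheory.integral_add_compl (measurableSet_Ioc (a := -T) (b := T)) hFi
  have e2 := MeasureTheory.integral_add_compl (measurableSet_Ioc (a := -T) (b := T)) hbd
  rw [← e1, add_sub_cancel_left]
  rw [← e2, add_sub_cancel_left] at hT
  refine lt_of_le_of_lt ?_ hT
  exact MeasureTheory.norm_integral_le_of_norm_le hbd.integrableOn
    (MeasureTheory.ae_restrict_of_ae (hb i hi))

theorem tendstoUniformlyOn_invLap {ι : Type*} {E : ι → ℂ → ℂ} {I : Set ι} {κ K b α β : ℝ}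
    (hE : ∀ i ∈ I, QuadDecay κ K (E i)) (hκ : 0 < κ) (hb : κ < b) :
    TendstoUniformlyOn (fun (T : ℝ) (w : ι × ℝ) =>
        ∫ v in (-T)..T, Complex.exp (vline b v * w.2) * E w.1 (vline b v))
      (fun w => invLap (E w.1) b w.2) atTop (I ×ˢ Icc α β) := by
  refine tendstoUniformlyOn_setIntegral
    (F := fun (w : ι × ℝ) v => Complex.exp (vline b v * w.2) * E w.1 (vline b v))
    (bd := fun v => Real.exp (b * β) * |K| * (1 / ‖vline b v‖ ^ 2)) ?_ ?_ ?_
  · intro w hw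
    exact ((hE w.1 hw.1).continuous_integrand hb w.2).aestronglyMeasurable
  · intro w hw
    refine Eventually.of_forall fun v => ((hE w.1 hw.1).norm_integrand_le hb w.2 v).trans ?_
    have h1 : b * w.2 ≤ b * β := mul_le_mul_of_nonneg_left hw.2.2 (hκ.trans hb).le
    have h2 := abs_nonneg K
    have h3 := le_abs_self K
    exact mul_le_mul_of_nonneg_right (mul_le_mul (Real.exp_le_exp.2 h1) h3
      (hE w.1 hw.1).const_nonneg (Real.exp_pos _).le) (by positivity)
  · exact (integrable_norm_vline (hκ.trans hb)).const_mul _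

/-- The inverse Laplace transform of `s⁻¹`, as a principal value. -/
theorem tendstoUniformlyOn_invLap_inv {b α β : ℝ} (hb : 0 < b) (hα : 0 < α) :
    TendstoUniformlyOn (fun (T r : ℝ) =>
        ∫ v in (-T)..T, Complex.exp (vline b v * r) * (vline b v)⁻¹)
      (fun _ => (1 : ℂ)) atTop (Icc α β) := by
  have hne : ∀ v, vline b v ≠ 0 := fun v => norm_pos_iff.1 (norm_vline_pos hb v)
  have hvc := continuous_vline b
  have hpi : (2 * Real.pi : ℂ) ≠ 0 := by
    have : (2 * Real.pi) ≠ 0 := by positivity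
    exact_mod_cast this
  -- `s⁻¹` is not absolutely integrable on the line. Integration by parts leaves boundary terms of
  -- order `1 / T` and `r⁻¹` times the integral for `s⁻²`, which tends to `r`. The division by `r`
  -- is why `r` must stay above `α > 0`.
  have hparts : ∀ T r : ℝ, 0 < r → (∫ v in (-T)..T, Complex.exp (vline b v * r) * (vline b v)⁻¹) =
      (Complex.exp (vline b T * r) * (vline b T)⁻¹ -
        Complex.exp (vline b (-T) * r) * (vline b (-T))⁻¹) / (2 * Real.pi * Complex.I * r) +
      (r : ℂ)⁻¹ * ∫ v in (-T)..T, Complex.exp (vline b v * r) * ((vline b v) ^ 2)⁻¹ := by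
    intro T r hr
    have hr0 : (r : ℂ) ≠ 0 := Complex.ofReal_ne_zero.2 hr.ne'
    have hden : (2 * Real.pi * Complex.I * r : ℂ) ≠ 0 :=
      mul_ne_zero (mul_ne_zero hpi Complex.I_ne_zero) hr0
    have hd : ∀ v : ℝ, HasDerivAt (fun v : ℝ => Complex.exp (vline b v * r) * (vline b v)⁻¹ /
        (2 * Real.pi * Complex.I * r)) (Complex.exp (vline b v * r) * (vline b v)⁻¹ -
        (r : ℂ)⁻¹ * (Complex.exp (vline b v * r) * ((vline b v) ^ 2)⁻¹)) v := by
      intro v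
      have h0 : HasDerivAt (vline b) (2 * Real.pi * Complex.I) v := by
        have h1 : HasDerivAt (fun v : ℝ => (v : ℂ)) 1 v := Complex.ofRealCLM.hasDerivAt (x := v)
        have := ((h1.const_mul (2 * Real.pi : ℂ)).mul_const Complex.I).const_add (b : ℂ)
        refine (this.congr_deriv (by ring)).congr_of_eventuallyEq
          (Eventually.of_forall fun y => ?_)
        simp [vline]
      have := (((h0.mul_const (r : ℂ)).cexp).mul (h0.inv (hne v))).div_const
        (2 * Real.pi * Complex.I * r)
      refine this.congr_deriv ?_
      have := hne v
      have hI := Complex.I_ne_zero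
      have : (Real.pi : ℂ) ≠ 0 := by exact_mod_cast Real.pi_ne_zero
      field_simp
      simp only [Pi.inv_apply]
      field_simp
      ring
    have c1 : Continuous fun v : ℝ => Complex.exp (vline b v * r) * (vline b v)⁻¹ := by
      have := hvc.inv₀ hne
      fun_prop
    have c2 : Continuous fun v : ℝ => Complex.exp (vline b v * r) * ((vline b v) ^ 2)⁻¹ := by
      exact (Continuous.cexp (by fun_prop)).mul ((hvc.pow 2).inv₀ fun v => pow_ne_zero 2 (hne v))
    have c3 : Continuous fun v : ℝ =>
        (r : ℂ)⁻¹ * (Complex.exp (vline b v * r) * ((vline b v) ^ 2)⁻¹) := continuous_const.mul c2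
    have := intervalIntegral.integral_eq_sub_of_hasDerivAt (a := -T) (b := T)
      (fun v _ => hd v) ((c1.sub c3).intervalIntegrable _ _)
    rw [intervalIntegral.integral_sub (c1.intervalIntegrable _ _)
      (c3.intervalIntegrable _ _),
      intervalIntegral.integral_const_mul] at this
    rw [sub_div, ← this]
    ring
  have hquad := tendstoUniformlyOn_invLap (ι := Unit) (I := univ) (κ := b / 2) (K := 1) (b := b)
    (α := α) (β := β) (E := fun _ s => (s ^ 2)⁻¹) (fun _ _ => quadDecay_inv_sq (half_pos hb))
    (half_pos hb) (half_lt_self hb)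
  rw [Metric.tendstoUniformlyOn_iff] at hquad ⊢
  intro η hη
  have hbound : Tendsto (fun T : ℝ => 2 * Real.exp (b * β) * (T⁻¹ * α⁻¹)) atTop (𝓝 0) := by
    have := ((tendsto_inv_atTop_zero (𝕜 := ℝ)).mul_const α⁻¹).const_mul (2 * Real.exp (b * β))
    simpa using this
  filter_upwards [hquad (η / 2 * α) (by positivity), hbound.eventually_lt_const (half_pos hη),
    eventually_gt_atTop 0] with T h1 h2 hT r hr
  have hr0 : 0 < r := hα.trans_le hr.1
  have h3 := h1 ((), r) ⟨mem_univ _, hr⟩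
  rw [invLap_inv_sq hb hr0.le, dist_eq_norm] at h3
  have hrc : (r : ℂ) ≠ 0 := Complex.ofReal_ne_zero.2 hr0.ne'
  rw [dist_eq_norm, hparts T r hr0]
  set J := ∫ v in (-T)..T, Complex.exp (vline b v * r) * ((vline b v) ^ 2)⁻¹
  have e : (1 : ℂ) - ((Complex.exp (vline b T * r) * (vline b T)⁻¹ -
        Complex.exp (vline b (-T) * r) * (vline b (-T))⁻¹) / (2 * Real.pi * Complex.I * r) +
      (r : ℂ)⁻¹ * J) = (r : ℂ)⁻¹ * (r - J) - (Complex.exp (vline b T * r) * (vline b T)⁻¹ -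
        Complex.exp (vline b (-T) * r) * (vline b (-T))⁻¹) / (2 * Real.pi * Complex.I * r) := by
    field_simp
    ring
  rw [e]
  have hA : ‖(r : ℂ)⁻¹ * (r - J)‖ < η / 2 := by
    rw [norm_mul, norm_inv, Complex.norm_real, Real.norm_of_nonneg hr0.le]
    calc r⁻¹ * ‖(r : ℂ) - J‖ ≤ α⁻¹ * ‖(r : ℂ) - J‖ := by
          have := hr.1
          gcongr
      _ < α⁻¹ * (η / 2 * α) := by gcongr
      _ = η / 2 := by field_simp
  have hone : ∀ σ : ℝ, |σ| = T → ‖Complex.exp (vline b σ * r) * (vline b σ)⁻¹‖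
      ≤ Real.exp (b * β) * T⁻¹ := by
    intro σ hσ
    rw [norm_mul, Complex.norm_exp, Complex.re_mul_ofReal, vline_re, norm_inv]
    have h4 := Complex.abs_im_le_norm (vline b σ)
    rw [vline_im, abs_mul, hσ, abs_of_pos (by positivity)] at h4
    have h5 : T ≤ 2 * Real.pi * T := by
      have := Real.pi_gt_three
      nlinarith
    have h6 : b * r ≤ b * β := mul_le_mul_of_nonneg_left hr.2 hb.le
    have h7 := h5.trans h4
    gcongr
  have hB : ‖(Complex.exp (vline b T * r) * (vline b T)⁻¹ -
        Complex.exp (vline b (-T) * r) * (vline b (-T))⁻¹) / (2 * Real.pi * Complex.I * r)‖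
        ≤ 2 * Real.exp (b * β) * (T⁻¹ * α⁻¹) := by
    rw [norm_div, div_eq_mul_inv]
    have h4 := (norm_sub_le _ _).trans
      (add_le_add (hone T (abs_of_pos hT)) (hone (-T) (by rw [abs_neg, abs_of_pos hT])))
    have h5 : ‖(2 * Real.pi * Complex.I * r : ℂ)‖⁻¹ ≤ α⁻¹ := by
      refine inv_anti₀ hα ?_
      simp only [norm_mul, Complex.norm_I, mul_one, Complex.norm_real,
        Real.norm_of_nonneg hr0.le, Real.norm_of_nonneg Real.pi_pos.le]
      have := Real.pi_gt_three
      have := hr.1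
      norm_num
      nlinarith
    calc _ ≤ (Real.exp (b * β) * T⁻¹ + Real.exp (b * β) * T⁻¹) * α⁻¹ := by gcongr
      _ = _ := by ring
  calc _ ≤ _ := norm_sub_le _ _
    _ < η / 2 + η / 2 := add_lt_add_of_lt_of_le hA (hB.trans h2.le)
    _ = η := by ring

/-! ### Uniform Gevrey asymptotics and Borel summability -/

/-- Uniform Gevrey asymptotics on the product of `U` with a Borel disc. -/
structure UnifGevrey (θ δ C M : ℝ) (U : Set ℂ) (f : ℂ → ℂ → ℂ) (fhat : ℕ → ℂ → ℂ) : Prop where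
  coeff : ∀ k, DifferentiableOn ℂ (fhat k) U
  left : ∀ ħ ∈ borelDisc θ δ, DifferentiableOn ℂ (fun x => f x ħ) U
  right : ∀ x ∈ U, DifferentiableOn ℂ (f x) (borelDisc θ δ)
  bound : ∀ n, ∀ x ∈ U, ∀ ħ ∈ borelDisc θ δ,
    ‖remainder f fhat n x ħ‖ ≤ C * M ^ n * (n.factorial : ℝ) * ‖ħ‖ ^ n

theorem remainder_eq_rem (f : ℂ → ℂ → ℂ) (fhat : ℕ → ℂ → ℂ) (n : ℕ) (x : ℂ) (θ : ℝ) (s : ℂ) :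
    remainder f fhat n x (dir θ / s) =
      rem (f x (dir θ / s)) (fun k => fhat k x * dir θ ^ k) n s⁻¹ := by
  simp only [remainder, rem, div_eq_mul_inv, mul_pow, mul_assoc]

theorem norm_dir_div (θ : ℝ) (s : ℂ) : ‖dir θ / s‖ = ‖s⁻¹‖ := by
  rw [norm_div, norm_dir, norm_inv, one_div]

/-- Pointwise Gevrey asymptotics on a Borel disc, in the coordinate `s = e^{iθ} / ħ`. -/
theorem gevreyRHP_of_bound {θ δ C M : ℝ} (hδ : 0 < δ) {f : ℂ → ℂ → ℂ} {fhat : ℕ → ℂ → ℂ} {x : ℂ}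
    (hd : DifferentiableOn ℂ (f x) (borelDisc θ δ))
    (hb : ∀ n, ∀ ħ ∈ borelDisc θ δ,
      ‖remainder f fhat n x ħ‖ ≤ C * M ^ n * (n.factorial : ℝ) * ‖ħ‖ ^ n) :
    GevreyRHP (1 / δ) C M (fun s => f x (dir θ / s)) fun k => fhat k x * dir θ ^ k where
  diff := by
    refine hd.comp (fun s hs => ?_) fun s hs => dir_div_mem_borelDisc hs
    exact ((differentiableAt_const _).div differentiableAt_id
      (ne_zero_of_rhp (one_div_pos.2 hδ) (show 1 / δ < s.re from hs))).differentiableWithinAt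
  bound n s hs := by
    have := hb n _ (dir_div_mem_borelDisc hs)
    rwa [remainder_eq_rem, norm_dir_div] at this

namespace UnifGevrey

variable {θ δ C M : ℝ} {U : Set ℂ} {f : ℂ → ℂ → ℂ} {fhat : ℕ → ℂ → ℂ}

theorem gevreyRHP (h : UnifGevrey θ δ C M U f fhat) (hδ : 0 < δ) {x : ℂ} (hx : x ∈ U) :
    GevreyRHP (1 / δ) C M (fun s => f x (dir θ / s)) fun k => fhat k x * dir θ ^ k :=
  gevreyRHP_of_bound hδ (h.right x hx) fun n => h.bound n x hx

theorem norm_coeff_le (h : UnifGevrey θ δ C M U f fhat) (hδ : 0 < δ) {x : ℂ} (hx : x ∈ U)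
    (n : ℕ) : ‖fhat n x‖ ≤ C * M ^ n * (n.factorial : ℝ) := by
  simpa [norm_dir] using (h.gevreyRHP hδ hx).norm_coeff_le n

theorem mono (h : UnifGevrey θ δ C M U f fhat) {V : Set ℂ} (hV : V ⊆ U) {δ' : ℝ} (hδ' : 0 < δ')
    (hd : δ' ≤ δ) : UnifGevrey θ δ' C M V f fhat where
  coeff k := (h.coeff k).mono hV
  left ħ hħ := (h.left ħ (borelDisc_mono hδ' hd hħ)).mono hV
  right x hx := (h.right x (hV hx)).mono (borelDisc_mono hδ' hd)
  bound n x hx ħ hħ := h.bound n x (hV hx) ħ (borelDisc_mono hδ' hd hħ)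

/-- The Taylor coefficients of the Borel transform along the ray. -/
def jet (θ a : ℝ) (f : ℂ → ℂ → ℂ) (fhat : ℕ → ℂ → ℂ) (x : ℂ) : ℕ → ℝ → ℂ :=
  borelJet (fun s => f x (dir θ / s)) (fun k => fhat k x * dir θ ^ k) a

/-- The analytic Borel transform. -/
def borel (θ a : ℝ) (f : ℂ → ℂ → ℂ) (fhat : ℕ → ℂ → ℂ) (x ξ : ℂ) : ℂ :=
  borelExt (jet θ a f fhat x) (ξ / dir θ) / dir θ

theorem differentiableOn_jet (h : UnifGevrey θ δ C M U f fhat) (hU : IsOpen U) (hδ : 0 < δ)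
    {a : ℝ} (ha : 1 / δ < a) (n : ℕ) (t : ℝ) :
    DifferentiableOn ℂ (fun x => jet θ a f fhat x n t) U := by
  have hκ : 0 < 1 / δ := one_div_pos.2 hδ
  unfold jet borelJet
  refine ((h.coeff _).mul_const _).add ?_
  unfold invLap
  refine differentiableOn_integral_param hU
    (bound := fun v => Real.exp (a * t) * (C * M ^ (n + 2) * ((n + 2).factorial : ℝ)) *
      (1 / ‖vline a v‖ ^ 2)) ?_ ?_ ?_ ?_
  · intro x hx
    exact (((h.gevreyRHP hδ hx).quadDecay hκ n).continuous_integrand ha t).aestronglyMeasurable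
  · refine Eventually.of_forall fun v => ?_
    refine DifferentiableOn.const_mul (DifferentiableOn.const_mul ?_ _) _
    unfold rem
    refine (h.left _ (dir_div_mem_borelDisc (by simpa using ha))).sub ?_
    exact DifferentiableOn.fun_sum fun k _ => ((h.coeff k).mul_const _).mul_const _
  · refine Eventually.of_forall fun v x hx => ?_
    exact ((h.gevreyRHP hδ hx).quadDecay hκ n).norm_integrand_le ha t v
  · exact (integrable_norm_vline (hκ.trans ha)).const_mul _

theorem jetFamily (h : UnifGevrey θ δ C M U f fhat) (hδ : 0 < δ) (hM : 0 ≤ M) {a : ℝ}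
    (ha : 1 / δ < a) {x : ℂ} (hx : x ∈ U) :
    JetFamily (jetConst C M a) a (4 * M) (jet θ a f fhat x) :=
  (h.gevreyRHP hδ hx).jetFamily (one_div_pos.2 hδ) hM ha

theorem mem_tube_iff {τ : ℝ} {ξ : ℂ} : ξ ∈ tube θ τ ↔ ξ / dir θ ∈ strip τ := by
  rw [tube, mem_ofPred_eq, infDist_ray_lt_iff_strip (norm_dir θ), sub_zero]

theorem isOpen_tube (θ τ : ℝ) : IsOpen (tube θ τ) :=
  isOpen_lt (Metric.continuous_infDist_pt _) continuous_const

theorem norm_borel_le (h : UnifGevrey θ δ C M U f fhat) (hδ : 0 < δ) (hM : 0 < M) {a : ℝ}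
    (ha : 1 / δ < a) {τ : ℝ} (hτ : 4 * M * τ < 1) {x ξ : ℂ} (hx : x ∈ U) (hξ : ξ ∈ tube θ τ) :
    ‖borel θ a f fhat x ξ‖ ≤ jetConst C M a * (1 - 4 * M * τ)⁻¹ * Real.exp (a * ‖ξ‖) := by
  have hκ : 0 < 1 / δ := one_div_pos.2 hδ
  have := (h.jetFamily hδ hM.le ha hx).norm_borelExt_le (by positivity) (hκ.trans ha).le hτ
    (mem_tube_iff.1 hξ)
  rw [norm_div, norm_dir, div_one] at this
  rwa [borel, norm_div, norm_dir, div_one]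

/-- Osgood's lemma. For fixed `ξ` the centre of the Taylor series is fixed, so in `x` the function
is a uniformly convergent series of holomorphic jets. -/
theorem differentiableOn_borel (h : UnifGevrey θ δ C M U f fhat) (hU : IsOpen U) (hδ : 0 < δ)
    (hM : 0 < M) {a : ℝ} (ha : 1 / δ < a) {τ : ℝ} (hτ : 4 * M * τ < 1) :
    DifferentiableOn ℂ (fun w : ℂ × ℂ => borel θ a f fhat w.1 w.2) (U ×ˢ tube θ τ) := by
  have hκ : 0 < 1 / δ := one_div_pos.2 hδ
  have ha0 : 0 < a := hκ.trans ha
  refine differentiableOn_of_separately (hU.prod (isOpen_tube θ τ)) ?_ ?_ ?_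
  · rintro ⟨x, ξ⟩ ⟨hx, hξ⟩
    have hξ' := mem_tube_iff.1 hξ
    have hn := (norm_sub_max_lt_of_mem_strip hξ').le
    have hτ0 : 0 ≤ τ := (norm_nonneg _).trans hn
    refine DifferentiableOn.differentiableAt (s := U) ?_ (hU.mem_nhds hx)
    refine DifferentiableOn.div_const ?_ _
    unfold borelExt taylorAt
    refine Complex.differentiableOn_tsum_of_summable_norm
      ((summable_geometric_of_lt_one (by positivity) hτ).mul_left
        (Real.exp (a * max (ξ / dir θ).re 0) * jetConst C M a)) (fun n => ?_) hU ?_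
    · exact ((h.differentiableOn_jet hU hδ ha n _).mul_const _).div_const _
    · intro n y hy
      exact (h.jetFamily hδ hM.le ha hy).norm_term_le (by positivity) (le_max_right _ _) hn n
  · rintro ⟨x, ξ⟩ ⟨hx, hξ⟩
    have hd := ((h.jetFamily hδ hM.le ha hx).differentiableOn_borelExt (by positivity)
      ha0.le hτ).differentiableAt ((isOpen_strip τ).mem_nhds (mem_tube_iff.1 hξ))
    exact (hd.comp ξ (differentiableAt_id.div_const (dir θ))).div_const _
  · rintro ⟨x, ξ⟩ hw
    refine ⟨jetConst C M a * (1 - 4 * M * τ)⁻¹ * Real.exp (a * (‖ξ‖ + 1)), ?_⟩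
    have hnear : ∀ᶠ u : ℂ × ℂ in 𝓝 (x, ξ), ‖u.2‖ < ‖ξ‖ + 1 :=
      (continuous_snd.norm.tendsto (x, ξ)).eventually_lt_const (by simp)
    filter_upwards [(hU.prod (isOpen_tube θ τ)).mem_nhds hw, hnear] with u hu hu2
    refine (h.norm_borel_le hδ hM ha hτ hu.1 hu.2).trans ?_
    have := (h.jetFamily hδ hM.le ha hu.1).const_nonneg
    have : 0 ≤ (1 - 4 * M * τ)⁻¹ := inv_nonneg.2 (by linarith)
    gcongr

/-- In the coordinate `s = e^{iθ} / ħ` the coefficients are `e^{ikθ} f_k`. The division by `e^{iθ}`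
and the rotation of the argument in `borel` remove exactly the factor `e^{i(n+1)θ}`. -/
theorem hasSum_borel (h : UnifGevrey θ δ C M U f fhat) (hδ : 0 < δ) (hM : 0 < M) {a : ℝ}
    (ha : 1 / δ < a) {x ξ : ℂ} (hx : x ∈ U) (hξ : 4 * M * ‖ξ‖ < 1) :
    HasSum (fun n => formalBorel fhat n x * ξ ^ n) (borel θ a f fhat x ξ) := by
  have hκ : 0 < 1 / δ := one_div_pos.2 hδ
  have hj := h.jetFamily hδ hM.le ha hx
  have hξ' : 4 * M * ‖ξ / dir θ‖ < 1 := by rwa [norm_div, norm_dir, div_one]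
  have h1 := (hj.hasSum_taylorAt_zero (by positivity) hξ').div_const (dir θ)
  rw [← hj.borelExt_eq_taylorAt (by positivity) (hκ.trans ha).le le_rfl (by simpa using hξ')] at h1
  refine h1.congr_fun fun n => ?_
  have : jet θ a f fhat x n 0 = fhat (n + 1) x * dir θ ^ (n + 1) :=
    (h.gevreyRHP hδ hx).borelJet_zero hκ ha n
  have hd := dir_ne_zero θ
  rw [this, formalBorel, div_pow, pow_succ]
  field_simp

theorem uniformlyGevrey (h : UnifGevrey θ δ C M U f fhat) (hδ : 0 < δ) (hC : 0 < C) (hM : 0 < M) :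
    UniformlyGevrey U fhat :=
  ⟨C, M, hC, hM, fun k _ hx => h.norm_coeff_le hδ hx k⟩

/-- This is the substance of Nevanlinna's theorem. The thickness `1 / (8 M)` is half the radius of
the Taylor series, and any abscissa `a > 1 / δ` serves as exponential type. -/
theorem isBorelSummable (h : UnifGevrey θ δ C M U f fhat) (hU : IsOpen U) (hδ : 0 < δ)
    (hC : 0 < C) (hM : 0 < M) {a : ℝ} (ha : 1 / δ < a) :
    IsBorelSummable θ (1 / (8 * M)) U fhat (borel θ a f fhat) := by
  have hκ : 0 < 1 / δ := one_div_pos.2 hδ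
  have hτ : 4 * M * (1 / (8 * M)) < 1 := by field_simp; norm_num
  refine ⟨by positivity, h.coeff, h.uniformlyGevrey hδ hC hM,
    ⟨h.differentiableOn_borel hU hδ hM ha hτ, 1 / (8 * M), by positivity, fun x hx ξ hξ => ?_⟩,
    jetConst C M a * (1 - 4 * M * (1 / (8 * M)))⁻¹, a, ?_, hκ.trans ha,
    fun x hx ξ hξ => h.norm_borel_le hδ hM ha hτ hx hξ⟩
  · refine h.hasSum_borel hδ hM ha hx (lt_trans ?_ hτ)
    exact mul_lt_mul_of_pos_left (mem_ball_zero_iff.1 hξ) (by positivity)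
  · have := vlineConst_nonneg a
    have h2 : 0 < (1 - 4 * M * (1 / (8 * M)))⁻¹ := inv_pos.2 (by linarith)
    have h3 : 0 < jetConst C M a := by unfold jetConst; positivity
    positivity

theorem formalBorelConverges (h : UnifGevrey θ δ C M U f fhat) (hU : IsOpen U) (hδ : 0 < δ)
    (hC : 0 < C) (hM : 0 < M) : FormalBorelConverges U fhat := by
  have hκ : 0 < 1 / δ := one_div_pos.2 hδ
  have ha : 1 / δ < 1 / δ + 1 := by linarith
  have hτ : 4 * M * (1 / (8 * M)) < 1 := by field_simp; norm_num
  refine ⟨1 / (8 * M), by positivity, borel θ (1 / δ + 1) f fhat, ?_, ?_⟩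
  · refine (h.differentiableOn_borel hU hδ hM ha hτ).mono (prod_mono subset_rfl ?_)
    intro ξ hξ
    rw [mem_tube_iff]
    refine ⟨0, le_rfl, ?_⟩
    simpa [norm_dir] using mem_ball_zero_iff.1 hξ
  -- From `(n + 1)! ≤ 2 ^ n n!` and `‖ξ‖ < 1 / (8 M)` the ratio is `2 M / (8 M) = 1 / 4`.
  · have hu : Summable fun n : ℕ => C * M * (1 / 4 : ℝ) ^ n :=
      (summable_geometric_of_lt_one (by norm_num) (by norm_num)).mul_left _
    have key := tendstoUniformlyOn_tsum_nat hu (f := fun (n : ℕ) (w : ℂ × ℂ) =>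
      formalBorel fhat n w.1 * w.2 ^ n) (s := U ×ˢ Metric.ball 0 (1 / (8 * M))) ?_
    · refine key.congr_right fun w hw => ?_
      refine (h.hasSum_borel hδ hM ha hw.1 (lt_trans ?_ hτ)).tsum_eq
      exact mul_lt_mul_of_pos_left (mem_ball_zero_iff.1 hw.2) (by positivity)
    · intro n w hw
      have h1 := h.norm_coeff_le hδ hw.1 (n + 1)
      have h2 := mem_ball_zero_iff.1 hw.2
      have hn : (0 : ℝ) < n.factorial := by exact_mod_cast n.factorial_pos
      rw [formalBorel, norm_mul, norm_div, norm_pow, Complex.norm_natCast]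
      calc ‖fhat (n + 1) w.1‖ / (n.factorial : ℝ) * ‖w.2‖ ^ n
          ≤ (C * M ^ (n + 1) * (2 ^ n * (n.factorial : ℝ))) / (n.factorial : ℝ) *
            (1 / (8 * M)) ^ n := by
            have := factorial_add_one_le n
            gcongr
            refine h1.trans ?_
            gcongr
        _ = C * M * (1 / 4 : ℝ) ^ n := by
            have e : (M * 2 * (1 / (8 * M))) ^ n = (1 / 4 : ℝ) ^ n := by
              congr 1; field_simp; norm_num
            rw [← e, mul_pow, mul_pow, pow_succ]
            field_simp

theorem borel_ofReal_mul_dir {a t : ℝ} (ht : 0 ≤ t) (x : ℂ) :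
    borel θ a f fhat x (t * dir θ) = jet θ a f fhat x 0 t / dir θ := by
  rw [borel, mul_div_cancel_right₀ _ (dir_ne_zero θ), JetFamily.borelExt_ofReal _ ht]

theorem laplaceIntegrand_borel {a t : ℝ} (ht : 0 ≤ t) (x ħ : ℂ) :
    laplaceIntegrand θ (borel θ a f fhat) x ħ t =
      Complex.exp (-(dir θ / ħ * t)) * jet θ a f fhat x 0 t := by
  have hd := dir_ne_zero θ
  rw [laplaceIntegrand, borel_ofReal_mul_dir ht]
  have : -((t : ℂ) * dir θ) / ħ = -(dir θ / ħ * t) := by ring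
  rw [this]
  field_simp

theorem eq_laplace (h : UnifGevrey θ δ C M U f fhat) (hδ : 0 < δ) {a : ℝ}
    (ha : 1 / δ < a) {x ħ : ℂ} (hx : x ∈ U) (hħ : a < (dir θ / ħ).re) :
    f x ħ = fhat 0 x + laplace θ (borel θ a f fhat) x ħ := by
  have h1 := (h.gevreyRHP hδ hx).eq_laplace_borelJet (one_div_pos.2 hδ) ha hħ
  rw [div_div_cancel₀ (dir_ne_zero θ), pow_zero, mul_one] at h1
  rw [h1, laplace]
  congr 1
  refine MeasureTheory.setIntegral_congr_fun measurableSet_Ioi fun t ht => ?_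
  exact (laplaceIntegrand_borel (le_of_lt ht) x ħ).symm

/-- The gap `a < 1 / δ₁` between the growth `e^{at}` of the Borel transform and the decay of the
kernel gives one integrable majorant for the whole disc; this costs a strict decrease of the
diameter from `δ` to `δ₁`. -/
theorem laplaceConverges (h : UnifGevrey θ δ C M U f fhat) (hδ : 0 < δ) (hM : 0 < M) {a δ₁ : ℝ}
    (ha : 1 / δ < a) (hδ₁ : a < 1 / δ₁) :
    LaplaceConverges θ U (borelDisc θ δ₁) (borel θ a f fhat) := by
  have hκ : 0 < 1 / δ := one_div_pos.2 hδ
  set bd : ℝ → ℝ := fun t => Real.exp ((a - 1 / δ₁) * t) * jetConst C M a with hbd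
  have hbdi : MeasureTheory.IntegrableOn bd (Ioi 0) :=
    (integrableOn_exp_mul_Ioi (by linarith) 0).mul_const _
  have hle : ∀ x ∈ U, ∀ ħ ∈ borelDisc θ δ₁, ∀ t ∈ Ioi (0 : ℝ),
      ‖laplaceIntegrand θ (borel θ a f fhat) x ħ t‖ ≤ bd t := by
    intro x hx ħ hħ t ht
    have ht : 0 < t := ht
    have hj := (h.jetFamily hδ hM.le ha hx)
    have hb := hj.bound 0 t ht.le
    have hA := hj.const_nonneg
    have hħ : 1 / δ₁ < (dir θ / ħ).re := hħ
    rw [laplaceIntegrand_borel ht.le, norm_mul, Complex.norm_exp]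
    have e : (-(dir θ / ħ * (t : ℂ))).re = -((dir θ / ħ).re * t) := by
      rw [Complex.neg_re, Complex.re_mul_ofReal]
    simp only [pow_zero, Nat.factorial_zero, Nat.cast_one, mul_one] at hb
    rw [e]
    calc Real.exp (-((dir θ / ħ).re * t)) * ‖jet θ a f fhat x 0 t‖
        ≤ Real.exp (-(1 / δ₁ * t)) * (Real.exp (a * t) * jetConst C M a) := by gcongr
      _ = bd t := by
          rw [hbd, ← mul_assoc, ← Real.exp_add]
          ring_nf
  have hmeas : ∀ x ∈ U, ∀ ħ ∈ borelDisc θ δ₁, MeasureTheory.AEStronglyMeasurable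
      (laplaceIntegrand θ (borel θ a f fhat) x ħ) (MeasureTheory.volume.restrict (Ioi 0)) := by
    intro x hx ħ _
    have hc : Continuous (jet θ a f fhat x 0) := (h.jetFamily hδ hM.le ha hx).cont 0
    have : Continuous fun t : ℝ => Complex.exp (-(dir θ / ħ * t)) * jet θ a f fhat x 0 t :=
      Continuous.mul (by fun_prop) hc
    refine this.aestronglyMeasurable.congr ?_
    filter_upwards [MeasureTheory.ae_restrict_mem measurableSet_Ioi] with t ht
    exact (laplaceIntegrand_borel (le_of_lt ht) x ħ).symm
  have hae : ∀ x ∈ U, ∀ ħ ∈ borelDisc θ δ₁, ∀ᵐ t ∂(MeasureTheory.volume.restrict (Ioi (0 : ℝ))),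
      ‖laplaceIntegrand θ (borel θ a f fhat) x ħ t‖ ≤ bd t := by
    intro x hx ħ hħ
    filter_upwards [MeasureTheory.ae_restrict_mem measurableSet_Ioi] with t ht
    exact hle x hx ħ hħ t ht
  refine ⟨fun x hx ħ hħ => hbdi.mono' (hmeas x hx ħ hħ) (hae x hx ħ hħ), ?_⟩
  have key := tendstoUniformlyOn_setIntegral (ι := ℂ × ℂ) (I := U ×ˢ borelDisc θ δ₁)
    (F := fun w => laplaceIntegrand θ (borel θ a f fhat) w.1 w.2)
    (fun w hw => hmeas w.1 hw.1 w.2 hw.2) (fun w hw => hae w.1 hw.1 w.2 hw.2) hbdi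
  -- The measure is carried by `(0, ∞)`, so the integral over `-T..T` is the one over `0..T`.
  refine key.congr ?_
  filter_upwards [eventually_ge_atTop 0] with T hT w hw
  beta_reduce
  rw [intervalIntegral.integral_of_le (by linarith), intervalIntegral.integral_of_le hT,
    MeasureTheory.Measure.restrict_restrict measurableSet_Ioc]
  congr 2
  ext t
  simp only [mem_inter_iff, mem_Ioc, mem_Ioi]
  constructor
  · rintro ⟨⟨_, h2⟩, h3⟩; exact ⟨h3, h2⟩
  · rintro ⟨h1, h2⟩; exact ⟨⟨by linarith, h2⟩, h1⟩

/-- In the coordinate `s = e^{iθ} / ħ` the boundary circle is the line `Re s = 1 / δ'`, run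
downwards by `borelPath`. The substitution `t = -2πv` reverses it, and this sign cancels the one in
`dħ / ħ² = -e^{-iθ} ds`. -/
theorem truncatedBorel_eq {δ' : ℝ} (hδ' : 0 < δ') (g : ℂ → ℂ → ℂ) (T : ℝ) (x : ℂ) (r : ℝ) :
    truncatedBorel θ δ' g T x (r * dir θ) = (dir θ)⁻¹ *
      ∫ v in (-(T / (2 * Real.pi)))..(T / (2 * Real.pi)),
        Complex.exp (vline (1 / δ') v * r) * g x (dir θ / vline (1 / δ') v) := by
  have hd := dir_ne_zero θ
  have hb : 0 < 1 / δ' := one_div_pos.2 hδ'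
  set b : ℝ := 1 / δ' with hbdef
  have hpi : (2 * Real.pi) ≠ 0 := by positivity
  set s : ℝ → ℂ := fun t => (b : ℂ) - Complex.I * t with hs
  have hs0 : ∀ t, s t ≠ 0 := fun t =>
    ne_zero_of_rhp (half_pos hb) (lt_of_lt_of_le (half_lt_self hb) (by simp [hs]))
  set H : ℝ → ℂ := fun t => Complex.exp (s t * r) * g x (dir θ / s t) with hH
  have hpath : borelPath θ δ' = fun t => dir θ / s t := rfl
  have hderiv : ∀ t, deriv (borelPath θ δ') t = dir θ * Complex.I / (s t) ^ 2 := by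
    intro t
    have h1 : HasDerivAt (fun t : ℝ => (t : ℂ)) 1 t := Complex.ofRealCLM.hasDerivAt (x := t)
    have h2 : HasDerivAt s (-Complex.I) t := by
      simpa using (h1.const_mul Complex.I).const_sub (b : ℂ)
    rw [hpath]
    refine ((hasDerivAt_const t (dir θ)).div h2 (hs0 t)).deriv.trans ?_
    simp
  have hint : ∀ t, g x (borelPath θ δ' t) * Complex.exp (r * dir θ / borelPath θ δ' t) /
      borelPath θ δ' t ^ 2 * deriv (borelPath θ δ') t = H t * (Complex.I / dir θ) := by
    intro t
    rw [hderiv, hpath, hH]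
    have e : (r : ℂ) * dir θ / (dir θ / s t) = s t * r := by
      have := hs0 t
      field_simp
    simp only [e]
    have := hs0 t
    field_simp
  have hsub := intervalIntegral.integral_comp_mul_left (a := -(T / (2 * Real.pi)))
    (b := T / (2 * Real.pi)) H (c := -(2 * Real.pi)) (neg_ne_zero.2 hpi)
  have e1 : -(2 * Real.pi) * -(T / (2 * Real.pi)) = T := by field_simp
  have e2 : -(2 * Real.pi) * (T / (2 * Real.pi)) = -T := by field_simp
  rw [e1, e2, intervalIntegral.integral_symm (-T) T] at hsub
  have hv : ∀ v, s (-(2 * Real.pi) * v) = vline b v := by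
    intro v
    simp [hs, vline]
    ring
  simp only [hH, hv] at hsub
  rw [hsub, truncatedBorel]
  simp only [hint, hH]
  rw [intervalIntegral.integral_mul_const, Complex.real_smul]
  push_cast
  have : (Real.pi : ℂ) ≠ 0 := by exact_mod_cast Real.pi_ne_zero
  have := Complex.I_ne_zero
  generalize (∫ t in (-T)..T, Complex.exp (s t * r) * g x (dir θ / s t)) = J
  field_simp

/-- Split `f - f₀` into `f₁ ħ` and the remainder of order two. The first part converges only as a
principal value, to `f₁`; the second converges absolutely. Both limits are uniform, because `f₁` is
bounded on `U`. -/
theorem isAnalyticBorelTransform (h : UnifGevrey θ δ C M U f fhat) (hδ : 0 < δ)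
    {a δ₁ : ℝ} (ha : 1 / δ < a) (hδ₁ : a < 1 / δ₁) (hδ₁0 : 0 < δ₁) :
    IsAnalyticBorelTransform θ U (borelDisc θ δ₁) (fun x ħ => f x ħ - fhat 0 x)
      (borel θ a f fhat) := by
  have hκ : 0 < 1 / δ := one_div_pos.2 hδ
  refine ⟨δ₁, hδ₁0, subset_rfl, fun δ' hδ' hlt α β hα hαβ => ?_⟩
  set b : ℝ := 1 / δ' with hbdef
  have hab : a < b := hδ₁.trans (one_div_lt_one_div_of_lt hδ' hlt)
  have hb : 0 < b := (hκ.trans ha).trans hab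
  have u1 := tendstoUniformlyOn_invLap_inv (β := β) hb hα
  set E : ℂ → ℂ → ℂ := fun x s =>
    s ^ 0 * rem (f x (dir θ / s)) (fun k => fhat k x * dir θ ^ k) (0 + 2) s⁻¹ with hE
  have hq : ∀ x ∈ U, QuadDecay (1 / δ) (C * M ^ (0 + 2) * ((0 + 2).factorial : ℝ)) (E x) :=
    fun x hx => (h.gevreyRHP hδ hx).quadDecay hκ 0
  have u2 := tendstoUniformlyOn_invLap (α := α) (β := β) hq hκ (ha.trans hab)
  rw [Metric.tendstoUniformlyOn_iff] at u1 u2 ⊢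
  intro η hη
  have hT : Tendsto (fun T : ℝ => T / (2 * Real.pi)) atTop atTop :=
    tendsto_id.atTop_div_const (by positivity)
  have hCM : 0 < |C * M| + 1 := by positivity
  filter_upwards [hT.eventually (u1 (η / (2 * (|C * M| + 1))) (by positivity)),
    hT.eventually (u2 (η / 2) (by positivity))] with T h1 h2
  rintro ⟨x, r⟩ ⟨hx, hr⟩
  have hx : x ∈ U := hx
  have hr : r ∈ Icc α β := hr
  have h1 := h1 r hr
  have h2 := h2 (x, r) ⟨hx, hr⟩
  have hr0 : 0 ≤ r := hα.le.trans hr.1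
  rw [borel_ofReal_mul_dir hr0, truncatedBorel_eq hδ', ← hbdef]
  have hc1 : ‖fhat 1 x * dir θ ^ 1‖ ≤ |C * M| := by
    have := h.norm_coeff_le hδ hx 1
    simp only [pow_one, Nat.factorial_one, Nat.cast_one, mul_one] at this
    rw [pow_one, norm_mul, norm_dir, mul_one]
    exact this.trans (le_abs_self _)
  have hjet : jet θ a f fhat x 0 r = fhat 1 x * dir θ ^ 1 + invLap (E x) b r := by
    rw [← (hq x hx).invLap_eq hκ ha hab.le]
    rfl
  have hne : ∀ v, vline b v ≠ 0 := fun v => norm_pos_iff.1 (norm_vline_pos hb v)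
  have hsplit : ∀ v, Complex.exp (vline b v * r) * (f x (dir θ / vline b v) - fhat 0 x) =
      fhat 1 x * dir θ ^ 1 * (Complex.exp (vline b v * r) * (vline b v)⁻¹) +
        Complex.exp (vline b v * r) * E x (vline b v) := by
    intro v
    simp only [hE, rem, Finset.sum_range_succ, Finset.sum_range_zero]
    ring
  have c1 : Continuous fun v : ℝ => fhat 1 x * dir θ ^ 1 *
      (Complex.exp (vline b v * r) * (vline b v)⁻¹) := by
    have := continuous_vline b
    have := this.inv₀ hne
    fun_prop
  have c2 := (hq x hx).continuous_integrand (ha.trans hab) r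
  simp only [hsplit]
  rw [intervalIntegral.integral_add (c1.intervalIntegrable _ _) (c2.intervalIntegrable _ _),
    intervalIntegral.integral_const_mul, hjet, dist_eq_norm, div_eq_inv_mul, ← mul_sub, norm_mul,
    norm_inv, norm_dir, inv_one, one_mul]
  rw [dist_eq_norm] at h1 h2
  set J1 := ∫ v in (-(T / (2 * Real.pi)))..(T / (2 * Real.pi)),
    Complex.exp (vline b v * r) * (vline b v)⁻¹
  set J2 := ∫ v in (-(T / (2 * Real.pi)))..(T / (2 * Real.pi)),
    Complex.exp (vline b v * r) * E x (vline b v)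
  have e : fhat 1 x * dir θ ^ 1 + invLap (E x) b r - (fhat 1 x * dir θ ^ 1 * J1 + J2) =
      fhat 1 x * dir θ ^ 1 * (1 - J1) + (invLap (E x) b r - J2) := by ring
  rw [e]
  calc _ ≤ ‖fhat 1 x * dir θ ^ 1‖ * ‖1 - J1‖ + ‖invLap (E x) b r - J2‖ := by
        rw [← norm_mul]; exact norm_add_le _ _
    _ < (|C * M| + 1) * (η / (2 * (|C * M| + 1))) + η / 2 := by
        refine add_lt_add_of_le_of_lt ?_ h2
        refine mul_le_mul ?_ h1.le (norm_nonneg _) hCM.le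
        linarith
    _ = η := by field_simp; norm_num

/-- Borel summability of a uniform Gevrey expansion on a Borel disc. -/
theorem exists_borelSummable (h : UnifGevrey θ δ C M U f fhat) (hU : IsOpen U) (hδ : 0 < δ)
    (hC : 0 < C) (hM : 0 < M) {δ₁ : ℝ} (hδ₁0 : 0 < δ₁) (hδ₁ : δ₁ < δ) :
    ∃ (τ : ℝ) (φ : ℂ → ℂ → ℂ), IsBorelSummable θ τ U fhat φ ∧
      IsAnalyticBorelTransform θ U (borelDisc θ δ₁) (fun x ħ => f x ħ - fhat 0 x) φ ∧
      LaplaceConverges θ U (borelDisc θ δ₁) φ ∧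
      ∀ x ∈ U, ∀ ħ ∈ borelDisc θ δ₁, f x ħ = fhat 0 x + laplace θ φ x ħ := by
  -- The abscissa of inversion lies to the right of the half plane's boundary `1 / δ` and to the
  -- left of all the points `e^{iθ} / ħ` with `ħ` in the smaller disc.
  obtain ⟨a, ha, ha'⟩ := exists_between (one_div_lt_one_div_of_lt hδ₁0 hδ₁)
  exact ⟨_, _, h.isBorelSummable hU hδ hC hM ha, h.isAnalyticBorelTransform hδ ha ha' hδ₁0,
    h.laplaceConverges hδ hM ha ha', fun x hx ħ hħ => h.eq_laplace hδ ha hx (ha'.trans hħ)⟩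

theorem isBorelResummation (h : UnifGevrey θ δ C M U f fhat) (hU : IsOpen U) (hδ : 0 < δ)
    (hC : 0 < C) (hM : 0 < M) {δ₁ : ℝ} (hδ₁0 : 0 < δ₁) (hδ₁ : δ₁ < δ) :
    IsBorelResummation θ U (borelDisc θ δ₁) fhat f := by
  obtain ⟨τ, φ, h1, _, h2, h3⟩ := h.exists_borelSummable hU hδ hC hM hδ₁0 hδ₁
  exact ⟨τ, φ, h1, h2, h3⟩

end UnifGevrey

/-! ### The singularly perturbed linear equation -/

theorem integral_exp_neg_mul_Ioi {κ : ℝ} (hκ : 0 < κ) (B : ℝ) :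
    ∫ s in Ioi (0 : ℝ), Real.exp (-κ * s) * B = B / κ := by
  rw [MeasureTheory.integral_mul_const, integral_exp_mul_Ioi (by linarith)]
  simp
  ring

/-- Bounded separately holomorphic functions on the product of a strip and a half plane. -/
structure SepHol (r κ B : ℝ) (k : ℂ → ℂ → ℂ) : Prop where
  left : ∀ ζ : ℂ, κ < ζ.re → DifferentiableOn ℂ (fun z => k z ζ) (strip r)
  right : ∀ z ∈ strip r, DifferentiableOn ℂ (k z) {ζ | κ < ζ.re}
  bound : ∀ z ∈ strip r, ∀ ζ : ℂ, κ < ζ.re → ‖k z ζ‖ ≤ B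

/-- The bounded solution operator of `u' = ζ u - k`. -/
def lap (k : ℂ → ℂ → ℂ) (z ζ : ℂ) : ℂ := ∫ s in Ioi (0 : ℝ), Complex.exp (-(ζ * s)) * k (z + s) ζ

theorem continuousOn_shift {r : ℝ} {u : ℂ → ℂ} (hu : ContinuousOn u (strip r)) {z : ℂ}
    (hz : z ∈ strip r) : ContinuousOn (fun s : ℝ => u (z + s)) (Ici 0) :=
  hu.comp (by fun_prop) fun _ hs => add_mem_strip hz hs

theorem norm_exp_neg_mul (ζ : ℂ) (s : ℝ) : ‖Complex.exp (-(ζ * s))‖ = Real.exp (-ζ.re * s) := by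
  rw [Complex.norm_exp]; simp

theorem aestronglyMeasurable_lap {r : ℝ} {u : ℂ → ℂ} (hu : ContinuousOn u (strip r)) {z : ℂ}
    (hz : z ∈ strip r) (ζ : ℂ) :
    MeasureTheory.AEStronglyMeasurable (fun s : ℝ => Complex.exp (-(ζ * s)) * u (z + s))
      (MeasureTheory.volume.restrict (Ioi 0)) := by
  refine ContinuousOn.aestronglyMeasurable ?_ measurableSet_Ioi
  exact (Continuous.continuousOn (by fun_prop)).mul
    ((continuousOn_shift hu hz).mono Ioi_subset_Ici_self)

theorem integrableOn_lap {r : ℝ} {u : ℂ → ℂ} (hu : ContinuousOn u (strip r)) {z : ℂ}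
    (hz : z ∈ strip r) {B : ℝ} (hB : ∀ s : ℝ, 0 < s → ‖u (z + s)‖ ≤ B) {ζ : ℂ} (hζ : 0 < ζ.re) :
    MeasureTheory.IntegrableOn (fun s : ℝ => Complex.exp (-(ζ * s)) * u (z + s)) (Ioi 0) := by
  refine MeasureTheory.Integrable.mono' ((integrableOn_exp_mul_Ioi (a := -ζ.re)
    (by linarith) 0).mul_const B) (aestronglyMeasurable_lap hu hz ζ) ?_
  filter_upwards [MeasureTheory.ae_restrict_mem measurableSet_Ioi] with s hs
  rw [norm_mul, norm_exp_neg_mul]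
  exact mul_le_mul_of_nonneg_left (hB s hs) (Real.exp_pos _).le

theorem norm_lap_le {k : ℂ → ℂ → ℂ} {z ζ : ℂ} {B : ℝ} (hζ : 0 < ζ.re)
    (hB : ∀ s : ℝ, 0 < s → ‖k (z + s) ζ‖ ≤ B) : ‖lap k z ζ‖ ≤ B / ζ.re := by
  rw [← integral_exp_neg_mul_Ioi hζ]
  refine MeasureTheory.norm_integral_le_of_norm_le
    ((integrableOn_exp_mul_Ioi (a := -ζ.re) (by linarith) 0).mul_const B) ?_
  filter_upwards [MeasureTheory.ae_restrict_mem measurableSet_Ioi] with s hs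
  rw [norm_mul, norm_exp_neg_mul]
  exact mul_le_mul_of_nonneg_left (hB s hs) (Real.exp_pos _).le

theorem hasDerivAt_shift {r : ℝ} {u : ℂ → ℂ} (hu : DifferentiableOn ℂ u (strip r)) {z : ℂ}
    (hz : z ∈ strip r) {s : ℝ} (hs : 0 ≤ s) :
    HasDerivAt (fun s : ℝ => u (z + s)) (deriv u (z + s)) s := by
  have h1 := (hu.differentiableAt ((isOpen_strip r).mem_nhds (add_mem_strip hz hs))).hasDerivAt
  have h2 : HasDerivAt (fun s : ℝ => z + (s : ℂ)) 1 s :=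
    (Complex.ofRealCLM.hasDerivAt (x := s)).const_add z
  have h3 := HasDerivAt.comp s h1 h2
  rw [mul_one] at h3
  exact h3

/-- Integration by parts for the Laplace integral along a horizontal ray. -/
theorem integral_deriv_sub {r : ℝ} {u : ℂ → ℂ} (hu : DifferentiableOn ℂ u (strip r)) {z : ℂ}
    (hz : z ∈ strip r) {B : ℝ} (hB : ∀ w ∈ strip r, ‖u w‖ ≤ B) {ζ : ℂ} (hζ : 0 < ζ.re) {N : ℝ}
    (hN : ∀ s : ℝ, 0 < s → ‖deriv u (z + s) - ζ * u (z + s)‖ ≤ N) :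
    ∫ s in Ioi (0 : ℝ), Complex.exp (-(ζ * s)) * (deriv u (z + s) - ζ * u (z + s)) = -u z := by
  have hd : ∀ s ∈ Ici (0 : ℝ), HasDerivAt (fun s : ℝ => Complex.exp (-(ζ * s)) * u (z + s))
      (Complex.exp (-(ζ * s)) * (deriv u (z + s) - ζ * u (z + s))) s := by
    intro s hs
    have h0 : HasDerivAt (fun s : ℝ => (s : ℂ)) 1 s := Complex.ofRealCLM.hasDerivAt (x := s)
    refine (((h0.const_mul ζ).neg.cexp).mul (hasDerivAt_shift hu hz hs)).congr_deriv ?_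
    simp only [Pi.neg_apply]
    ring
  have hlim : Tendsto (fun s : ℝ => Complex.exp (-(ζ * s)) * u (z + s)) atTop (𝓝 0) := by
    have h1 : Tendsto (fun s : ℝ => Real.exp (-ζ.re * s) * B) atTop (𝓝 0) := by
      have : Tendsto (fun s : ℝ => -ζ.re * s) atTop atBot :=
        tendsto_id.const_mul_atTop_of_neg (by linarith)
      simpa using (Real.tendsto_exp_atBot.comp this).mul_const B
    refine squeeze_zero_norm' ?_ h1
    filter_upwards [eventually_ge_atTop 0] with s hs
    rw [norm_mul, norm_exp_neg_mul]
    exact mul_le_mul_of_nonneg_left (hB _ (add_mem_strip hz hs)) (Real.exp_pos _).le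
  have hcont : ContinuousOn (fun w => deriv u w - ζ * u w) (strip r) :=
    ((hu.deriv (isOpen_strip r)).sub (hu.const_mul ζ)).continuousOn
  rw [MeasureTheory.integral_Ioi_of_hasDerivAt_of_tendsto' hd
    (integrableOn_lap (u := fun w => deriv u w - ζ * u w) hcont hz hN hζ) hlim]
  simp

/-- A bounded solution of `u' = ζ u + h` is bounded by `sup |h| / Re ζ`. -/
theorem norm_le_of_bounded_solution {r : ℝ} {u : ℂ → ℂ} (hu : DifferentiableOn ℂ u (strip r))
    {B : ℝ} (hB : ∀ w ∈ strip r, ‖u w‖ ≤ B) {ζ : ℂ} (hζ : 0 < ζ.re) {N : ℝ}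
    (hN : ∀ w ∈ strip r, ‖deriv u w - ζ * u w‖ ≤ N) {z : ℂ} (hz : z ∈ strip r) :
    ‖u z‖ ≤ N / ζ.re := by
  have hN' : ∀ s : ℝ, 0 < s → ‖deriv u (z + s) - ζ * u (z + s)‖ ≤ N :=
    fun s hs => hN _ (add_mem_strip hz hs.le)
  have h1 := integral_deriv_sub hu hz hB hζ hN'
  have h2 := norm_lap_le (k := fun w ζ => deriv u w - ζ * u w) hζ hN'
  rw [lap, h1, norm_neg] at h2
  exact h2

namespace SepHol

variable {r κ B : ℝ} {k : ℂ → ℂ → ℂ}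

theorem norm_deriv_le (h : SepHol r κ B k) {ρ : ℝ} (hρ : ρ < r) {z ζ : ℂ} (hz : z ∈ strip ρ)
    (hζ : κ < ζ.re) : ‖deriv (fun z => k z ζ) z‖ ≤ B / (r - ρ) :=
  norm_deriv_le_of_ball (sub_pos.2 hρ) ((h.left ζ hζ).mono (ball_subset_strip hz))
    fun w hw => h.bound w (ball_subset_strip hz hw) ζ hζ

theorem lap (h : SepHol r κ B k) (hκ : 0 < κ) (hB : 0 ≤ B) : SepHol r κ (B / κ) (lap k) where
  left := by
    intro ζ hζ
    unfold Riccati.lap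
    refine differentiableOn_integral_param (isOpen_strip r)
      (bound := fun s => Real.exp (-ζ.re * s) * B) ?_ ?_ ?_ ?_
    · intro z hz
      exact aestronglyMeasurable_lap (u := fun z => k z ζ) (h.left ζ hζ).continuousOn hz ζ
    · filter_upwards [MeasureTheory.ae_restrict_mem measurableSet_Ioi] with s hs
      refine DifferentiableOn.const_mul ?_ _
      exact (h.left ζ hζ).comp (by fun_prop) fun z hz => add_mem_strip hz (le_of_lt hs)
    · filter_upwards [MeasureTheory.ae_restrict_mem measurableSet_Ioi] with s hs z hz
      rw [norm_mul, norm_exp_neg_mul]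
      exact mul_le_mul_of_nonneg_left (h.bound _ (add_mem_strip hz (le_of_lt hs)) ζ hζ)
        (Real.exp_pos _).le
    · exact (integrableOn_exp_mul_Ioi (a := -ζ.re) (by linarith) 0).mul_const B
  right := by
    intro z hz
    unfold Riccati.lap
    refine differentiableOn_integral_param (isOpen_rhp κ)
      (bound := fun s => Real.exp (-κ * s) * B) ?_ ?_ ?_ ?_
    · intro ζ hζ
      exact aestronglyMeasurable_lap (u := fun z => k z ζ) (h.left ζ hζ).continuousOn hz ζ
    · filter_upwards [MeasureTheory.ae_restrict_mem measurableSet_Ioi] with s hs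
      refine DifferentiableOn.mul (by fun_prop) ?_
      exact h.right _ (add_mem_strip hz (le_of_lt hs))
    · filter_upwards [MeasureTheory.ae_restrict_mem measurableSet_Ioi] with s hs ζ hζ
      have hs : 0 < s := hs
      have hζ : κ < ζ.re := hζ
      rw [norm_mul, norm_exp_neg_mul]
      have h1 := h.bound _ (add_mem_strip hz hs.le) ζ hζ
      have h2 : -ζ.re * s ≤ -κ * s := by nlinarith
      gcongr
    · exact (integrableOn_exp_mul_Ioi (a := -κ) (by linarith) 0).mul_const B
  bound := by
    intro z hz ζ hζ
    refine (norm_lap_le (hκ.trans hζ) fun s hs => h.bound _ (add_mem_strip hz hs.le) ζ hζ).trans ?_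
    gcongr

/-- Differentiation under the integral falls on `k (z + s)`, where the derivative in `z` is the
derivative in `s`; integration by parts then gives the equation. The bound on `deriv k` comes from a
smaller strip that contains `z`, and this strip is stable under `z ↦ z + s`. -/
theorem hasDerivAt_lap (h : SepHol r κ B k) (hκ : 0 < κ) {z ζ : ℂ} (hz : z ∈ strip r)
    (hζ : κ < ζ.re) :
    HasDerivAt (fun z => Riccati.lap k z ζ) (ζ * Riccati.lap k z ζ - k z ζ) z := by
  have hζ0 : 0 < ζ.re := hκ.trans hζ
  have hk := h.left ζ hζ
  obtain ⟨ρ, hρ, hzρ⟩ := exists_mem_strip_lt hz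
  have hmain := (hasDerivAt_integral_param (F := fun z (s : ℝ) => Complex.exp (-(ζ * s)) * k (z + s) ζ)
    (μ := MeasureTheory.volume.restrict (Ioi 0)) (isOpen_strip r)
    (bound := fun s => Real.exp (-ζ.re * s) * B)
    (fun z hz => aestronglyMeasurable_lap (u := fun z => k z ζ) hk.continuousOn hz ζ) (by
      filter_upwards [MeasureTheory.ae_restrict_mem measurableSet_Ioi] with s hs
      refine DifferentiableOn.const_mul ?_ _
      exact hk.comp (by fun_prop) fun z hz => add_mem_strip hz (le_of_lt hs)) (by
      filter_upwards [MeasureTheory.ae_restrict_mem measurableSet_Ioi] with s hs z hz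
      rw [norm_mul, norm_exp_neg_mul]
      exact mul_le_mul_of_nonneg_left (h.bound _ (add_mem_strip hz (le_of_lt hs)) ζ hζ)
        (Real.exp_pos _).le)
    ((integrableOn_exp_mul_Ioi (a := -ζ.re) (by linarith) 0).mul_const B) hz).2
  refine hmain.congr_deriv ?_
  set u : ℂ → ℂ := fun z => k z ζ with hu
  have hb1 : ∀ s : ℝ, 0 < s → ‖deriv u (z + s)‖ ≤ B / (r - ρ) := fun s hs =>
    h.norm_deriv_le hρ (add_mem_strip hzρ hs.le) hζ
  have hb2 : ∀ s : ℝ, 0 < s → ‖u (z + s)‖ ≤ B := fun s hs =>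
    h.bound _ (add_mem_strip hz hs.le) ζ hζ
  have e1 : ∫ s in Ioi (0 : ℝ), deriv (fun z => Complex.exp (-(ζ * s)) * k (z + s) ζ) z =
      ∫ s in Ioi (0 : ℝ), Complex.exp (-(ζ * s)) * deriv u (z + s) := by
    refine MeasureTheory.setIntegral_congr_fun measurableSet_Ioi fun s hs => ?_
    have hd := (hk.differentiableAt ((isOpen_strip r).mem_nhds
      (add_mem_strip hz (le_of_lt hs)))).hasDerivAt
    have h2 : HasDerivAt (fun z : ℂ => z + (s : ℂ)) 1 z := (hasDerivAt_id z).add_const _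
    have h3 := (hd.comp z h2).const_mul (Complex.exp (-(ζ * s)))
    rw [mul_one] at h3
    exact h3.deriv
  rw [e1]
  have i1 := integrableOn_lap (u := deriv u) (hk.deriv (isOpen_strip r)).continuousOn hz hb1 hζ0
  have i2 := (integrableOn_lap (u := u) hk.continuousOn hz hb2 hζ0).const_mul ζ
  have hN : ∀ s : ℝ, 0 < s → ‖deriv u (z + s) - ζ * u (z + s)‖ ≤ B / (r - ρ) + ‖ζ‖ * B := by
    intro s hs
    refine (norm_sub_le _ _).trans (add_le_add (hb1 s hs) ?_)
    rw [norm_mul]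
    exact mul_le_mul_of_nonneg_left (hb2 s hs) (norm_nonneg _)
  have h4 := integral_deriv_sub hk hz (fun w hw => h.bound w hw ζ hζ) hζ0 hN
  have h5 : ∫ s in Ioi (0 : ℝ), Complex.exp (-(ζ * s)) * (deriv u (z + s) - ζ * u (z + s)) =
      (∫ s in Ioi (0 : ℝ), Complex.exp (-(ζ * s)) * deriv u (z + s)) -
        ∫ s in Ioi (0 : ℝ), ζ * (Complex.exp (-(ζ * s)) * u (z + s)) := by
    rw [← MeasureTheory.integral_sub i1 i2]
    congr 1
    ext s
    ring
  rw [h4, MeasureTheory.integral_const_mul] at h5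
  rw [Riccati.lap]
  linear_combination -h5

theorem lap_sub {k' : ℂ → ℂ → ℂ} {B' : ℝ} (h : SepHol r κ B k) (h' : SepHol r κ B' k')
    (hκ : 0 < κ) {z ζ : ℂ} (hz : z ∈ strip r) (hζ : κ < ζ.re) :
    Riccati.lap k z ζ - Riccati.lap k' z ζ = Riccati.lap (fun z ζ => k z ζ - k' z ζ) z ζ := by
  unfold Riccati.lap
  rw [← MeasureTheory.integral_sub]
  · congr 1
    ext s
    ring
  · exact integrableOn_lap (u := fun z => k z ζ) (h.left ζ hζ).continuousOn hz
      (fun s hs => h.bound _ (add_mem_strip hz hs.le) ζ hζ) (hκ.trans hζ)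
  · exact integrableOn_lap (u := fun z => k' z ζ) (h'.left ζ hζ).continuousOn hz
      (fun s hs => h'.bound _ (add_mem_strip hz hs.le) ζ hζ) (hκ.trans hζ)

end SepHol

/-! ### Bounded solutions of the singularly perturbed Riccati equation -/

/-- The iterates of `y ↦ - lap (y² + β y + γ)`. -/
def iterY (β γ : ℂ → ℂ → ℂ) : ℕ → ℂ → ℂ → ℂ
  | 0 => fun _ _ => 0
  | n + 1 => fun z ζ => -lap (fun z ζ => iterY β γ n z ζ ^ 2 + β z ζ * iterY β γ n z ζ + γ z ζ) z ζ

section FixedPoint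

variable {r κ B : ℝ} {β γ : ℂ → ℂ → ℂ}

theorem SepHol.quadratic (hβ : SepHol r κ B β) (hγ : SepHol r κ B γ) {y : ℂ → ℂ → ℂ}
    (hy : SepHol r κ 1 y) :
    SepHol r κ (1 + 2 * B) fun z ζ => y z ζ ^ 2 + β z ζ * y z ζ + γ z ζ where
  left ζ hζ := (((hy.left ζ hζ).pow 2).add ((hβ.left ζ hζ).mul (hy.left ζ hζ))).add (hγ.left ζ hζ)
  right z hz := (((hy.right z hz).pow 2).add ((hβ.right z hz).mul (hy.right z hz))).add
    (hγ.right z hz)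
  bound z hz ζ hζ := by
    have h1 := hy.bound z hz ζ hζ
    have h2 := hβ.bound z hz ζ hζ
    have h3 := hγ.bound z hz ζ hζ
    have h4 : ‖y z ζ‖ ^ 2 ≤ 1 := pow_le_one₀ (norm_nonneg _) h1
    have h5 : ‖β z ζ‖ * ‖y z ζ‖ ≤ B * 1 := mul_le_mul h2 h1 (norm_nonneg _)
      ((norm_nonneg _).trans h2)
    calc _ ≤ ‖y z ζ‖ ^ 2 + ‖β z ζ‖ * ‖y z ζ‖ + ‖γ z ζ‖ := by
          rw [← norm_pow, ← norm_mul]; exact norm_add₃_le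
      _ ≤ _ := by linarith

theorem norm_quadratic_sub_le {b c y y' : ℂ} {B X : ℝ} (hb : ‖b‖ ≤ B) (hy : ‖y‖ ≤ 1)
    (hy' : ‖y'‖ ≤ 1) (h : ‖y - y'‖ ≤ X) :
    ‖(y ^ 2 + b * y + c) - (y' ^ 2 + b * y' + c)‖ ≤ (2 + B) * X := by
  have e : (y ^ 2 + b * y + c) - (y' ^ 2 + b * y' + c) = (y + y' + b) * (y - y') := by ring
  rw [e, norm_mul]
  have h1 : ‖y + y' + b‖ ≤ 2 + B := norm_add₃_le.trans (by linarith)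
  exact mul_le_mul h1 h (norm_nonneg _) ((norm_nonneg _).trans h1)

/-- Existence of a bounded solution of `y' = ζ y + y² + β y + γ`. -/
theorem exists_bounded_solution (hB : 0 ≤ B) (hκ : 4 * (1 + B) ≤ κ) (hβ : SepHol r κ B β)
    (hγ : SepHol r κ B γ) :
    ∃ y : ℂ → ℂ → ℂ, SepHol r κ 1 y ∧ ∀ z ∈ strip r, ∀ ζ : ℂ, κ < ζ.re →
      HasDerivAt (fun z => y z ζ) (ζ * y z ζ + y z ζ ^ 2 + β z ζ * y z ζ + γ z ζ) z := by
  have hκ0 : 0 < κ := by linarith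
  set F : (ℂ → ℂ → ℂ) → ℂ → ℂ → ℂ := fun y z ζ => y z ζ ^ 2 + β z ζ * y z ζ + γ z ζ with hF
  -- On the unit ball the quadratic expression is at most `1 + 2 B ≤ κ`, so the map preserves the
  -- ball.
  have hstep : ∀ y, SepHol r κ 1 y → SepHol r κ 1 fun z ζ => -lap (F y) z ζ := by
    intro y hy
    have h1 := (hβ.quadratic hγ hy).lap hκ0 (by linarith)
    refine ⟨fun ζ hζ => (h1.left ζ hζ).neg, fun z hz => (h1.right z hz).neg, fun z hz ζ hζ => ?_⟩
    rw [norm_neg]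
    refine (h1.bound z hz ζ hζ).trans ?_
    rw [div_le_one hκ0]
    linarith
  -- The Lipschitz constant is `(2 + B) / κ ≤ 1 / 2`. Each `ζ` is treated separately, but the
  -- constant does not depend on it, so the limit is uniform and stays holomorphic in both
  -- variables.
  have hlip : ∀ y y', SepHol r κ 1 y → SepHol r κ 1 y' → ∀ ζ : ℂ, κ < ζ.re → ∀ X : ℝ,
      (∀ z ∈ strip r, ‖y z ζ - y' z ζ‖ ≤ X) →
      ∀ z ∈ strip r, ‖lap (F y) z ζ - lap (F y') z ζ‖ ≤ 1 / 2 * X := by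
    intro y y' hy hy' ζ hζ X hX z hz
    rw [(hβ.quadratic hγ hy).lap_sub (hβ.quadratic hγ hy') hκ0 hz hζ]
    have hX0 : 0 ≤ X := (norm_nonneg _).trans (hX z hz)
    refine (norm_lap_le (B := (2 + B) * X) (hκ0.trans hζ) fun s hs => ?_).trans ?_
    · have hz' := add_mem_strip hz hs.le
      exact norm_quadratic_sub_le (hβ.bound _ hz' ζ hζ) (hy.bound _ hz' ζ hζ)
        (hy'.bound _ hz' ζ hζ) (hX _ hz')
    · rw [div_le_iff₀ (hκ0.trans hζ)]
      nlinarith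
  have hY : ∀ n, SepHol r κ 1 (iterY β γ n) := by
    intro n
    induction n with
    | zero =>
      refine ⟨fun ζ _ => ?_, fun z _ => ?_, fun z _ ζ _ => ?_⟩
      · exact differentiableOn_const _
      · exact differentiableOn_const _
      · simp [iterY]
    | succ n ih => exact hstep _ ih
  have hdiff : ∀ n, ∀ ζ : ℂ, κ < ζ.re → ∀ z ∈ strip r,
      ‖iterY β γ (n + 1) z ζ - iterY β γ n z ζ‖ ≤ 1 * (1 / 2) ^ n := by
    intro n ζ hζ
    induction n with
    | zero =>
      intro z hz
      have := (hY 1).bound z hz ζ hζ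
      simpa [iterY] using this
    | succ n ih =>
      intro z hz
      have := hlip _ _ (hY (n + 1)) (hY n) ζ hζ _ ih z hz
      have e : iterY β γ (n + 1 + 1) z ζ - iterY β γ (n + 1) z ζ =
        -(lap (F (iterY β γ (n + 1))) z ζ - lap (F (iterY β γ n)) z ζ) := by
        change -lap (F (iterY β γ (n + 1))) z ζ - -lap (F (iterY β γ n)) z ζ = _
        ring
      rw [e, norm_neg, pow_succ]
      linarith
  have hcau : ∀ ζ : ℂ, κ < ζ.re → ∀ z ∈ strip r,
      ∃ L, Tendsto (fun n => iterY β γ n z ζ) atTop (𝓝 L) := by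
    intro ζ hζ z hz
    refine cauchySeq_tendsto_of_complete (cauchySeq_of_le_geometric (1 / 2) 1 (by norm_num) ?_)
    intro n
    rw [dist_comm, dist_eq_norm]
    exact hdiff n ζ hζ z hz
  choose! y₀ hy₀ using hcau
  set y : ℂ → ℂ → ℂ := fun z ζ => y₀ ζ z with hy
  have hlim : ∀ ζ : ℂ, κ < ζ.re → ∀ z ∈ strip r,
      Tendsto (fun n => iterY β γ n z ζ) atTop (𝓝 (y z ζ)) := hy₀
  have hrate : ∀ n, ∀ ζ : ℂ, κ < ζ.re → ∀ z ∈ strip r,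
      ‖iterY β γ n z ζ - y z ζ‖ ≤ 2 * (1 / 2) ^ n := by
    intro n ζ hζ z hz
    have := dist_le_of_le_geometric_of_tendsto (1 / 2) 1 (by norm_num) (fun n => by
      rw [dist_comm, dist_eq_norm]
      exact hdiff n ζ hζ z hz) (hlim ζ hζ z hz) n
    rw [dist_eq_norm] at this
    refine this.trans (le_of_eq ?_)
    ring
  have hgeo : Tendsto (fun n : ℕ => 2 * (1 / 2 : ℝ) ^ n) atTop (𝓝 0) := by
    simpa using (tendsto_pow_atTop_nhds_zero_of_lt_one (by norm_num : (0 : ℝ) ≤ 1 / 2)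
      (by norm_num)).const_mul 2
  have hys : SepHol r κ 1 y := by
    refine ⟨fun ζ hζ => ?_, fun z hz => ?_, fun z hz ζ hζ => ?_⟩
    · refine TendstoLocallyUniformlyOn.differentiableOn (φ := atTop)
        (F := fun n z => iterY β γ n z ζ) ?_
        (Eventually.of_forall fun n => (hY n).left ζ hζ) (isOpen_strip r)
      refine TendstoUniformlyOn.tendstoLocallyUniformlyOn ?_
      rw [Metric.tendstoUniformlyOn_iff]
      intro η hη
      filter_upwards [hgeo.eventually_lt_const hη] with n hn z hz
      rw [dist_comm, dist_eq_norm]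
      exact (hrate n ζ hζ z hz).trans_lt hn
    · refine TendstoLocallyUniformlyOn.differentiableOn (φ := atTop)
        (F := fun n ζ => iterY β γ n z ζ) ?_
        (Eventually.of_forall fun n => (hY n).right z hz) (isOpen_rhp κ)
      refine TendstoUniformlyOn.tendstoLocallyUniformlyOn ?_
      rw [Metric.tendstoUniformlyOn_iff]
      intro η hη
      filter_upwards [hgeo.eventually_lt_const hη] with n hn ζ hζ
      rw [dist_comm, dist_eq_norm]
      exact (hrate n ζ hζ z hz).trans_lt hn
    · exact le_of_tendsto (hlim ζ hζ z hz).norm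
        (Eventually.of_forall fun n => (hY n).bound z hz ζ hζ)
  have hfix : ∀ z ∈ strip r, ∀ ζ : ℂ, κ < ζ.re → y z ζ = -lap (F y) z ζ := by
    intro z hz ζ hζ
    have h1 : Tendsto (fun n => iterY β γ (n + 1) z ζ) atTop (𝓝 (-lap (F y) z ζ)) := by
      rw [tendsto_iff_norm_sub_tendsto_zero]
      refine squeeze_zero (fun _ => norm_nonneg _) (fun n => ?_) hgeo
      have := hlip _ _ (hY n) hys ζ hζ _ (fun z hz => hrate n ζ hζ z hz) z hz
      change ‖-lap (F (iterY β γ n)) z ζ - -lap (F y) z ζ‖ ≤ _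
      rw [neg_sub_neg, ← norm_neg, neg_sub]
      refine this.trans ?_
      have : (0 : ℝ) ≤ 2 * (1 / 2) ^ n := by positivity
      linarith
    exact tendsto_nhds_unique ((tendsto_add_atTop_iff_nat 1).2 (hlim ζ hζ z hz)) h1
  refine ⟨y, hys, fun z hz ζ hζ => ?_⟩
  have h1 := ((hβ.quadratic hγ hys).hasDerivAt_lap hκ0 hz hζ).neg
  have h2 : (fun z => y z ζ) =ᶠ[𝓝 z] -fun z => lap (F y) z ζ := by
    filter_upwards [(isOpen_strip r).mem_nhds hz] with w hw using hfix w hw ζ hζ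
  refine (h1.congr_of_eventuallyEq h2).congr_deriv ?_
  rw [show lap (fun z ζ => y z ζ ^ 2 + β z ζ * y z ζ + γ z ζ) z ζ = -y z ζ by
    rw [hfix z hz ζ hζ, neg_neg]]
  ring

end FixedPoint

/-! ### Gevrey estimates for the Riccati equation on a strip -/

/-- The coefficients of the product of two series. -/
def conv (c d : ℕ → ℂ) (n : ℕ) : ℂ := ∑ ij ∈ Finset.HasAntidiagonal.antidiagonal n, c ij.1 * d ij.2

theorem conv_eq_sum_range (c d : ℕ → ℂ) (n : ℕ) :
    conv c d n = ∑ k ∈ Finset.range (n + 1), c k * d (n - k) :=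
  Finset.Nat.sum_antidiagonal_eq_sum_range_succ_mk _ n

/-- A Leibniz rule for remainders. In the estimates below its sum involves remainders of order less
than `n`, apart from the term `k = 0`. -/
theorem rem_mul (f g : ℂ) (c d : ℕ → ℂ) (n : ℕ) (η : ℂ) :
    rem (f * g) (conv c d) n η =
      g * rem f c n η + ∑ k ∈ Finset.range n, c k * η ^ k * rem g d (n - k) η := by
  induction n with
  | zero => simp [rem_zero]; ring
  | succ n ih =>
    have e : ∑ k ∈ Finset.range n, c k * η ^ k * rem g d (n + 1 - k) η =
        ∑ k ∈ Finset.range n, c k * η ^ k * rem g d (n - k) η -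
          (∑ k ∈ Finset.range n, c k * d (n - k)) * η ^ n := by
      rw [Finset.sum_mul, ← Finset.sum_sub_distrib]
      refine Finset.sum_congr rfl fun k hk => ?_
      have hk' := (Finset.mem_range.1 hk).le
      rw [Nat.succ_sub hk', rem_succ]
      have : η ^ n = η ^ k * η ^ (n - k) := by rw [← pow_add, Nat.add_sub_cancel' hk']
      rw [this]; ring
    rw [rem_succ, rem_succ, Finset.sum_range_succ, e, ih, conv_eq_sum_range,
      Finset.sum_range_succ, Nat.add_sub_cancel_left, Nat.sub_self, rem_succ, rem_zero]
    ring

theorem rem_add (f g : ℂ) (c d : ℕ → ℂ) (n : ℕ) (η : ℂ) :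
    rem (f + g) (fun k => c k + d k) n η = rem f c n η + rem g d n η := by
  simp only [rem, add_mul, Finset.sum_add_distrib]; ring

theorem factorial_mul_factorial_sub_le {k n : ℕ} (h : k ≤ n) :
    ((k.factorial : ℝ) * ((n - k).factorial : ℝ)) ≤ (n.factorial : ℝ) := by
  exact_mod_cast Nat.le_of_dvd (Nat.factorial_pos n) (Nat.factorial_mul_factorial_dvd_factorial h)

theorem norm_conv_le {c d : ℕ → ℂ} {A B M : ℝ} (hA : 0 ≤ A) (hB : 0 ≤ B) (hM : 0 ≤ M)
    (hc : ∀ k, ‖c k‖ ≤ A * M ^ k * (k.factorial : ℝ))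
    (hd : ∀ k, ‖d k‖ ≤ B * M ^ k * (k.factorial : ℝ)) (n : ℕ) :
    ‖conv c d n‖ ≤ A * B * (2 * M) ^ n * (n.factorial : ℝ) := by
  rw [conv_eq_sum_range]
  have h1 : ∀ k ∈ Finset.range (n + 1), ‖c k * d (n - k)‖ ≤ A * B * M ^ n * (n.factorial : ℝ) := by
    intro k hk
    have hk' : k ≤ n := Nat.lt_succ_iff.1 (Finset.mem_range.1 hk)
    rw [norm_mul]
    calc ‖c k‖ * ‖d (n - k)‖
        ≤ (A * M ^ k * (k.factorial : ℝ)) * (B * M ^ (n - k) * ((n - k).factorial : ℝ)) :=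
          mul_le_mul (hc k) (hd _) (norm_nonneg _) (by positivity)
      _ = A * B * (M ^ k * M ^ (n - k)) * ((k.factorial : ℝ) * ((n - k).factorial : ℝ)) := by ring
      _ ≤ A * B * (M ^ k * M ^ (n - k)) * (n.factorial : ℝ) := by
          gcongr; exact factorial_mul_factorial_sub_le hk'
      _ = _ := by rw [← pow_add, Nat.add_sub_cancel' hk']
  refine (norm_sum_le_of_le _ h1).trans ?_
  rw [Finset.sum_const, Finset.card_range, nsmul_eq_mul, mul_pow]
  have := add_one_le_two_pow n
  push_cast
  calc ((n : ℝ) + 1) * (A * B * M ^ n * (n.factorial : ℝ))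
      ≤ 2 ^ n * (A * B * M ^ n * (n.factorial : ℝ)) := by gcongr
    _ = _ := by ring

/-- The coefficients of the formal solution of a singularly perturbed Riccati equation are
factorially bounded. -/
theorem norm_formal_le {r r₀ C M : ℝ} (hr : r₀ < r) (hC : 0 < C) (hM : 0 < M)
    {ah bh w : ℕ → ℂ → ℂ} (ha : ∀ k, ∀ z ∈ strip r, ‖ah k z‖ ≤ C * M ^ k * (k.factorial : ℝ))
    (hb : ∀ k, ∀ z ∈ strip r, ‖bh k z‖ ≤ C * M ^ k * (k.factorial : ℝ))
    (hw : ∀ k, DifferentiableOn ℂ (w k) (strip r)) (hw0 : ∀ z ∈ strip r, w 0 z = -ah 0 z)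
    (hws : ∀ k, ∀ z ∈ strip r, w (k + 1) z =
      deriv (w k) z - conv (fun i => bh i z + w i z) (fun i => w i z) k - ah (k + 1) z) (n : ℕ) :
    ∀ z ∈ strip r₀, ‖w n z‖ ≤
      2 * C * (Real.exp 1 * (M + 1 / (r - r₀) + 3 * C)) ^ n * (n.factorial : ℝ) := by
  have hd0 : 0 < r - r₀ := sub_pos.2 hr
  set L : ℝ := M + 1 / (r - r₀) + 3 * C with hL
  have hL0 : 0 < L := by positivity
  rcases Nat.eq_zero_or_pos n with rfl | hn
  · intro z hz
    have hz' := strip_mono hr.le hz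
    rw [hw0 z hz', norm_neg]
    have := ha 0 z hz'
    simp at this ⊢
    linarith
  have hn0 : (0 : ℝ) < n := by exact_mod_cast hn
  have hn1 : (1 : ℝ) ≤ n := by exact_mod_cast hn
  have hfac : ∀ k ≤ n, (k.factorial : ℝ) ≤ (n : ℝ) ^ k := fun k hk => by
    exact_mod_cast (Nat.factorial_le_pow k).trans (Nat.pow_le_pow_left hk k)
  -- Nagumo's device: `n` is fixed, and each of the `n` differentiations gives up a width `d`. A
  -- derivative then costs a factor `n / (r - r₀)`, and the total `n ^ n` is at most `e ^ n n!`,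
  -- whence the factor `Real.exp 1`.
  set d : ℝ := (r - r₀) / n with hd
  have hdpos : 0 < d := by positivity
  have hML : M ≤ L := by rw [hL]; have : 0 < 1 / (r - r₀) := by positivity
                         linarith
  have hco : ∀ {x : ℝ} {k : ℕ}, k ≤ n → x ≤ C * M ^ k * (k.factorial : ℝ) →
      x ≤ C * (L * n) ^ k := by
    intro x k hk hx
    refine hx.trans ?_
    rw [mul_pow, ← mul_assoc]
    have := hfac k hk
    gcongr
  -- With `n` fixed, `k!` is replaced by `n ^ k` and a convolution has at most `n` terms, so each of
  -- the three contributions to `w (k + 1)` gains one factor `n`; `L` collects their constants.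
  have key : ∀ k ≤ n, ∀ z ∈ strip (r - k * d), ‖w k z‖ ≤ 2 * C * (L * n) ^ k := by
    intro k
    induction k using Nat.strong_induction_on with
    | _ k ih =>
      intro hk z hz
      have hsub : ∀ j ≤ k, z ∈ strip (r - j * d) := fun j hj => strip_mono (by
        have : (j : ℝ) ≤ k := by exact_mod_cast hj
        nlinarith) hz
      have hzr : z ∈ strip r := by simpa using hsub 0 (Nat.zero_le _)
      cases k with
      | zero =>
        rw [hw0 z hzr, norm_neg]
        have := ha 0 z hzr
        simp at this ⊢
        linarith
      | succ k =>
        have hkn : k < n := hk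
        have h1 : ‖deriv (w k) z‖ ≤ 2 * C * (L * n) ^ k / d := by
          have hz' : z ∈ strip (r - k * d - d) := by
            have e : r - k * d - d = r - ((k + 1 : ℕ) : ℝ) * d := by push_cast; ring
            rw [e]; exact hz
          have hball : Metric.ball z d ⊆ strip (r - k * d) := by
            simpa using ball_subset_strip (r := r - k * d) hz'
          refine norm_deriv_le_of_ball hdpos ((hw k).mono (hball.trans (strip_mono ?_))) ?_
          · have : (0 : ℝ) ≤ k * d := by positivity
            linarith
          · exact fun y hy => ih k (Nat.lt_succ_self k) hkn.le y (hball hy)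
        have h2 : ‖conv (fun i => bh i z + w i z) (fun i => w i z) k‖ ≤
            n * (3 * C * (2 * C) * (L * n) ^ k) := by
          rw [conv_eq_sum_range]
          have h3 : ∀ j ∈ Finset.range (k + 1), ‖(bh j z + w j z) * w (k - j) z‖ ≤
              3 * C * (2 * C) * (L * n) ^ k := by
            intro j hj
            have hj' : j ≤ k := Nat.lt_succ_iff.1 (Finset.mem_range.1 hj)
            have b1 := hco (hj'.trans hkn.le) (hb j z hzr)
            have b2 := ih j (by omega) (by omega) z (hsub j (by omega))
            have b3 := ih (k - j) (by omega) (by omega) z (hsub (k - j) (by omega))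
            have b4 : ‖bh j z + w j z‖ ≤ 3 * C * (L * n) ^ j := by
              refine (norm_add_le _ _).trans ((add_le_add b1 b2).trans (le_of_eq ?_)); ring
            rw [norm_mul]
            refine (mul_le_mul b4 b3 (norm_nonneg _) (by positivity)).trans (le_of_eq ?_)
            have : (L * n) ^ k = (L * n) ^ j * (L * n) ^ (k - j) := by
              rw [← pow_add, Nat.add_sub_cancel' hj']
            rw [this]; ring
          refine (norm_sum_le_of_le _ h3).trans ?_
          rw [Finset.sum_const, Finset.card_range, nsmul_eq_mul]
          gcongr
        have h3 : ‖ah (k + 1) z‖ ≤ C * M * n * (L * n) ^ k := by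
          refine (ha (k + 1) z hzr).trans ?_
          have := hfac (k + 1) hk
          calc C * M ^ (k + 1) * ((k + 1).factorial : ℝ)
              ≤ C * M ^ (k + 1) * (n : ℝ) ^ (k + 1) := by gcongr
            _ = C * M * n * (M * n) ^ k := by rw [mul_pow]; ring
            _ ≤ _ := by gcongr
        rw [hws k z hzr]
        refine (norm_sub_le _ _).trans ((add_le_add ((norm_sub_le _ _).trans
          (add_le_add h1 h2)) h3).trans ?_)
        have e : 2 * C * (L * n) ^ k / d + n * (3 * C * (2 * C) * (L * n) ^ k) +
            C * M * n * (L * n) ^ k =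
            2 * C * (L * n) ^ k * n * (1 / (r - r₀) + 3 * C + M / 2) := by
          rw [hd]; field_simp
        rw [e, pow_succ]
        have : 1 / (r - r₀) + 3 * C + M / 2 ≤ L := by rw [hL]; linarith
        calc 2 * C * (L * n) ^ k * n * (1 / (r - r₀) + 3 * C + M / 2)
            ≤ 2 * C * (L * n) ^ k * n * L := by gcongr
          _ = _ := by ring
  intro z hz
  have h1 := key n le_rfl z (by
    have e : r - n * d = r₀ := by rw [hd]; field_simp; ring
    rw [e]; exact hz)
  refine h1.trans ?_
  have h2 := Real.pow_div_factorial_le_exp (n : ℝ) hn0.le n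
  rw [div_le_iff₀ (by positivity), ← Real.exp_one_pow] at h2
  calc 2 * C * (L * n) ^ n = 2 * C * L ^ n * (n : ℝ) ^ n := by rw [mul_pow]; ring
    _ ≤ 2 * C * L ^ n * (Real.exp 1 ^ n * (n.factorial : ℝ)) := by gcongr
    _ = _ := by rw [mul_pow]; ring

/-- The bound `B` only makes the supremum finite; then `sup ≤ P + sup / 2` can be absorbed. -/
theorem le_of_self_improving {s : Set ℂ} {u : ℂ → ℂ} {B P : ℝ} (hB : ∀ z ∈ s, ‖u z‖ ≤ B)
    (h : ∀ X : ℝ, 0 ≤ X → (∀ z ∈ s, ‖u z‖ ≤ X) → ∀ z ∈ s, ‖u z‖ ≤ P + X / 2) :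
    ∀ z ∈ s, ‖u z‖ ≤ 2 * P := by
  intro z hz
  have hbdd : BddAbove ((fun z => ‖u z‖) '' s) := ⟨B, by rintro _ ⟨y, hy, rfl⟩; exact hB y hy⟩
  have hle : ∀ y ∈ s, ‖u y‖ ≤ sSup ((fun z => ‖u z‖) '' s) :=
    fun y hy => le_csSup hbdd ⟨y, hy, rfl⟩
  have h2 := h _ ((norm_nonneg _).trans (hle z hz)) hle
  have h3 : sSup ((fun z => ‖u z‖) '' s) ≤ P + sSup ((fun z => ‖u z‖) '' s) / 2 :=
    csSup_le ⟨_, z, hz, rfl⟩ (by rintro _ ⟨y, hy, rfl⟩; exact h2 y hy)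
  linarith [hle z hz]

theorem sum_quarter_le (m : ℕ) : ∑ j ∈ Finset.range m, (1 / 4 : ℝ) ^ (j + 1) ≤ 1 / 3 := by
  have h : ∑ j ∈ Finset.range m, (1 / 4 : ℝ) ^ (j + 1) = 1 / 3 - 1 / 3 * (1 / 4) ^ m := by
    induction m with
    | zero => norm_num
    | succ m ih => rw [Finset.sum_range_succ, ih]; ring
  rw [h]
  have : (0 : ℝ) ≤ 1 / 3 * (1 / 4) ^ m := by positivity
  linarith

/-- The equation satisfied by the remainders of a solution of a Riccati equation. -/
theorem remainder_equation {ζ η W W' a b : ℂ} (hη : ζ * η = 1) {w w' ah bh : ℕ → ℂ}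
    (hW : W' = ζ * (W + a) + W ^ 2 + b * W) (hw0 : w 0 = -ah 0)
    (hws : ∀ k, w (k + 1) = w' k - conv (fun i => bh i + w i) w k - ah (k + 1)) (n : ℕ) :
    W' - ∑ k ∈ Finset.range (n + 1), w' k * η ^ k - ζ * rem W w (n + 1) η =
      ζ * rem a ah (n + 2) η + rem ((b + W) * W) (conv (fun i => bh i + w i) w) (n + 1) η -
        w (n + 1) * η ^ n := by
  induction n with
  | zero =>
    have h0 := hws 0
    simp only [rem_succ, rem_zero, zero_add, Finset.sum_range_one, pow_zero, mul_one,
      pow_one]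
    -- The terms of order `ζ` cancel by the relation for `w 0`, those of order zero by the relation
    -- for `w 1`.
    linear_combination hW + ζ * hw0 + h0 + ah 1 * hη
  | succ n ih =>
    have h1 := hws (n + 1)
    rw [Finset.sum_range_succ, rem_succ W w (n + 1), rem_succ a ah (n + 2),
      rem_succ _ (conv (fun i => bh i + w i) w) (n + 1)]
    linear_combination ih + η ^ (n + 1) * h1 + (w (n + 1) * η ^ n + ah (n + 2) * η ^ (n + 1)) * hη

/-- The remainder of order `n + 1` is a bounded solution of a linear equation, so it is at most its
forcing divided by `Re ζ`. The forcing contains the remainder of order `n` itself, with factor `3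
A`; this is absorbed because `Re ζ > 6 A`. Lower remainders enter multiplied by coefficients of rate
`M`, whereas the claim has rate `4 M`, so their sum is geometric and the constant does not
deteriorate with `n`. -/
theorem norm_remainder_le {ρ A M κ : ℝ} (hA : 0 < A) (hM : 0 < M) (hκ : 6 * A ≤ κ) (hκ1 : 1 ≤ κ)
    {ζ : ℂ} (hζ : κ < ζ.re) {W a b : ℂ → ℂ} {w ah bh : ℕ → ℂ → ℂ}
    (hw : ∀ k, DifferentiableOn ℂ (w k) (strip ρ))
    (hwb : ∀ k, ∀ z ∈ strip ρ, ‖w k z‖ ≤ A * M ^ k * (k.factorial : ℝ))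
    (hbb : ∀ k, ∀ z ∈ strip ρ, ‖bh k z‖ ≤ A * M ^ k * (k.factorial : ℝ))
    (ha : ∀ n, ∀ z ∈ strip ρ, ‖rem (a z) (fun k => ah k z) n ζ⁻¹‖ ≤
      A * M ^ n * (n.factorial : ℝ) * ‖ζ⁻¹‖ ^ n)
    (hb : ∀ n, ∀ z ∈ strip ρ, ‖rem (b z) (fun k => bh k z) n ζ⁻¹‖ ≤
      A * M ^ n * (n.factorial : ℝ) * ‖ζ⁻¹‖ ^ n)
    (hW : ∀ z ∈ strip ρ, ‖W z‖ ≤ A)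
    (hWd : ∀ z ∈ strip ρ, HasDerivAt W (ζ * (W z + a z) + W z ^ 2 + b z * W z) z)
    (hw0 : ∀ z ∈ strip ρ, w 0 z = -ah 0 z)
    (hws : ∀ k, ∀ z ∈ strip ρ, w (k + 1) z =
      deriv (w k) z - conv (fun i => bh i z + w i z) (fun i => w i z) k - ah (k + 1) z) (n : ℕ) :
    ∀ z ∈ strip ρ, ‖rem (W z) (fun k => w k z) n ζ⁻¹‖ ≤
      4 * (A + A * M + 2 * A * M ^ 2 + 3 * A ^ 2) * (4 * M) ^ n * (n.factorial : ℝ) *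
        ‖ζ⁻¹‖ ^ n := by
  have hζre : 0 < ζ.re := by linarith
  have hζ0 : ζ ≠ 0 := by rintro rfl; simp at hζre
  have hη : ζ * ζ⁻¹ = 1 := mul_inv_cancel₀ hζ0
  set η : ℂ := ζ⁻¹ with hηdef
  set H : ℝ := ‖η‖ with hH
  have hH0 : 0 ≤ H := norm_nonneg _
  have hζH : ‖ζ‖ * H = 1 := by rw [hH, ← norm_mul, hη, norm_one]
  have hζn : ζ.re ≤ ‖ζ‖ := (le_abs_self _).trans (Complex.abs_re_le_norm ζ)
  have hH1 : H ≤ 1 := by nlinarith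
  set Q : ℝ := A + A * M + 2 * A * M ^ 2 + 3 * A ^ 2 with hQ
  have hQ0 : 0 < Q := by positivity
  induction n using Nat.strong_induction_on with
  | _ n ih =>
  set P : ℝ := (4 * M) ^ n * (n.factorial : ℝ) * H ^ n with hP
  have hP0 : 0 ≤ P := by positivity
  have hMP : M ^ n * (n.factorial : ℝ) * H ^ n ≤ P := by
    rw [hP]; gcongr; linarith
  have h2P : (2 * M) ^ n * (n.factorial : ℝ) * H ^ n ≤ P := by
    rw [hP]; gcongr; linarith
  have hgoal : ∀ z ∈ strip ρ, ‖rem (W z) (fun k => w k z) n η‖ ≤ 2 * (2 * Q * P) := by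
    -- Only the finiteness of this bound matters; its value never enters the final estimate.
    have hwsum : ∀ m, ∀ z ∈ strip ρ, ‖rem (W z) (fun k => w k z) m η‖ ≤
        A + ∑ k ∈ Finset.range m, A * M ^ k * (k.factorial : ℝ) * H ^ k := by
      intro m z hz
      refine (norm_sub_le _ _).trans (add_le_add (hW z hz) (norm_sum_le_of_le _ fun k _ => ?_))
      rw [norm_mul, norm_pow]
      exact mul_le_mul_of_nonneg_right (hwb k z hz) (by positivity)
    refine le_of_self_improving (hwsum n) fun X hX hXb z hz => ?_
    have hu : DifferentiableOn ℂ (fun z => rem (W z) (fun k => w k z) (n + 1) η) (strip ρ) := by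
      unfold rem
      exact DifferentiableOn.sub (fun z hz => (hWd z hz).differentiableAt.differentiableWithinAt)
        (DifferentiableOn.fun_sum fun k _ => (hw k).mul_const _)
    have hN : ∀ z ∈ strip ρ, ‖deriv (fun z => rem (W z) (fun k => w k z) (n + 1) η) z -
        ζ * rem (W z) (fun k => w k z) (n + 1) η‖ ≤
        (A * M + 2 * A * M ^ 2 + 3 * A ^ 2) * P + 3 * A * X + 4 * A * Q * P := by
      intro z hz
      have hder : deriv (fun z => rem (W z) (fun k => w k z) (n + 1) η) z =
          (ζ * (W z + a z) + W z ^ 2 + b z * W z) -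
            ∑ k ∈ Finset.range (n + 1), deriv (w k) z * η ^ k := by
        refine HasDerivAt.deriv ((hWd z hz).sub (HasDerivAt.fun_sum fun k _ => ?_))
        exact (((hw k).differentiableAt
          ((isOpen_strip ρ).mem_nhds hz)).hasDerivAt).mul_const _
      rw [hder, remainder_equation (w := fun k => w k z) (w' := fun k => deriv (w k) z)
        (ah := fun k => ah k z) (bh := fun k => bh k z) hη rfl (hw0 z hz)
        (fun k => hws k z hz) n,
        rem_succ _ (conv (fun i => bh i z + w i z) fun i => w i z) n, rem_mul, rem_add]
      have t1 : ‖ζ * rem (a z) (fun k => ah k z) (n + 2) η‖ ≤ 2 * A * M ^ 2 * P := by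
        rw [norm_mul]
        calc ‖ζ‖ * ‖rem (a z) (fun k => ah k z) (n + 2) η‖
            ≤ ‖ζ‖ * (A * M ^ (n + 2) * ((n + 2).factorial : ℝ) * H ^ (n + 2)) := by
              gcongr; exact ha _ z hz
          _ = (‖ζ‖ * H) * (A * M ^ (n + 2) * ((n + 2).factorial : ℝ) * (H ^ n * H)) := by ring
          _ ≤ 1 * (A * M ^ (n + 2) * (2 * 4 ^ n * (n.factorial : ℝ)) * (H ^ n * 1)) := by
              rw [hζH]; gcongr; exact factorial_add_two_le n
          _ = _ := by rw [hP, mul_pow]; ring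
      have t2 : ‖w (n + 1) z * η ^ n‖ ≤ A * M * P := by
        rw [norm_mul, norm_pow]
        calc ‖w (n + 1) z‖ * H ^ n
            ≤ A * M ^ (n + 1) * (2 ^ n * (n.factorial : ℝ)) * H ^ n := by
              gcongr
              refine (hwb _ z hz).trans ?_
              gcongr
              exact factorial_add_one_le n
          _ = A * M * ((2 * M) ^ n * (n.factorial : ℝ) * H ^ n) := by rw [mul_pow]; ring
          _ ≤ _ := by gcongr
      have hsumb : ∀ k, ‖bh k z + w k z‖ ≤ 2 * A * M ^ k * (k.factorial : ℝ) := fun k =>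
        (norm_add_le _ _).trans ((add_le_add (hbb k z hz) (hwb k z hz)).trans (le_of_eq (by ring)))
      have t3 : ‖conv (fun i => bh i z + w i z) (fun i => w i z) n * η ^ n‖ ≤
          2 * A ^ 2 * P := by
        rw [norm_mul, norm_pow]
        calc _ ≤ (2 * A * A * (2 * M) ^ n * (n.factorial : ℝ)) * H ^ n := by
              gcongr
              exact norm_conv_le (by positivity) hA.le hM.le hsumb (fun k => hwb k z hz) n
          _ = 2 * A ^ 2 * ((2 * M) ^ n * (n.factorial : ℝ) * H ^ n) := by ring
          _ ≤ _ := by gcongr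
      have t4 : ‖W z * (rem (b z) (fun k => bh k z) n η + rem (W z) (fun k => w k z) n η)‖ ≤
          A ^ 2 * P + A * X := by
        rw [norm_mul]
        calc _ ≤ A * (A * M ^ n * (n.factorial : ℝ) * H ^ n + X) := by
              refine mul_le_mul (hW z hz) ((norm_add_le _ _).trans (add_le_add (hb n z hz)
                (hXb z hz))) (norm_nonneg _) hA.le
          _ = A ^ 2 * (M ^ n * (n.factorial : ℝ) * H ^ n) + A * X := by ring
          _ ≤ _ := by gcongr
      have t5 : ‖∑ k ∈ Finset.range n, (bh k z + w k z) * η ^ k *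
          rem (W z) (fun k => w k z) (n - k) η‖ ≤ 2 * A * X + 4 * A * Q * P := by
        cases n with
        | zero => simp; positivity
        | succ m =>
          -- The term `k = 0` contains the remainder of order `n` itself and is left to absorption;
          -- the others fall under the induction hypothesis.
          rw [Finset.sum_range_succ', add_comm]
          refine (norm_add_le _ _).trans (add_le_add ?_ ?_)
          · rw [pow_zero, mul_one, Nat.sub_zero, norm_mul]
            have h0 := hsumb 0
            simp only [pow_zero, Nat.factorial_zero, Nat.cast_one, mul_one] at h0
            exact mul_le_mul h0 (hXb z hz) (norm_nonneg _) (by positivity)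
          · have hterm : ∀ k ∈ Finset.range m, ‖(bh (k + 1) z + w (k + 1) z) * η ^ (k + 1) *
                rem (W z) (fun k => w k z) (m + 1 - (k + 1)) η‖ ≤
                8 * A * Q * P * (1 / 4) ^ (k + 1) := by
              intro k hk
              have hk' : k + 1 ≤ m + 1 := by have := Finset.mem_range.1 hk; omega
              rw [norm_mul, norm_mul, norm_pow]
              have e1 := ih (m + 1 - (k + 1)) (by omega) z hz
              have e2 := hsumb (k + 1)
              have e3 := factorial_mul_factorial_sub_le hk'
              set j := m + 1 - (k + 1) with hj
              have hjk : m + 1 = (k + 1) + j := by omega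
              calc ‖bh (k + 1) z + w (k + 1) z‖ * H ^ (k + 1) *
                    ‖rem (W z) (fun k => w k z) j η‖
                  ≤ (2 * A * M ^ (k + 1) * ((k + 1).factorial : ℝ)) * H ^ (k + 1) *
                    (4 * Q * (4 * M) ^ j * (j.factorial : ℝ) * H ^ j) := by gcongr
                _ = 8 * A * Q * ((M ^ (k + 1) * (4 * M) ^ j) * (H ^ (k + 1) * H ^ j)) *
                    (((k + 1).factorial : ℝ) * (j.factorial : ℝ)) := by ring
                _ ≤ 8 * A * Q * ((M ^ (k + 1) * (4 * M) ^ j) * (H ^ (k + 1) * H ^ j)) *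
                    ((m + 1).factorial : ℝ) := by gcongr
                _ = _ := by
                    have e4 : M ^ (k + 1) = (4 * M) ^ (k + 1) * (1 / 4) ^ (k + 1) := by
                      rw [← mul_pow]; congr 1; ring
                    rw [hP, hjk, pow_add H, pow_add (4 * M), e4]
                    ring
            refine (norm_sum_le_of_le _ hterm).trans ?_
            rw [← Finset.mul_sum]
            calc _ ≤ 8 * A * Q * P * (1 / 3) := by gcongr; exact sum_quarter_le m
              _ ≤ _ := by nlinarith [mul_nonneg (mul_nonneg hA.le hQ0.le) hP0]
      refine (norm_sub_le _ _).trans ((add_le_add ((norm_add_le _ _).trans (add_le_add t1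
        ((norm_sub_le _ _).trans (add_le_add ((norm_add_le _ _).trans (add_le_add t4 t5)) t3)))) t2).trans
        (le_of_eq ?_))
      ring
    have h1 := norm_le_of_bounded_solution hu (hwsum (n + 1)) hζre hN hz
    have h2 : rem (W z) (fun k => w k z) n η =
        rem (W z) (fun k => w k z) (n + 1) η + w n z * η ^ n := by rw [rem_succ]; ring
    have h3 : ‖w n z * η ^ n‖ ≤ A * P := by
      rw [norm_mul, norm_pow]
      calc _ ≤ (A * M ^ n * (n.factorial : ℝ)) * H ^ n := by gcongr; exact hwb n z hz
        _ = A * (M ^ n * (n.factorial : ℝ) * H ^ n) := by ring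
        _ ≤ _ := by gcongr
    -- Since `6 A < Re ζ`, the term `3 A X` becomes at most `X / 2`, and `4 A Q P` at most `Q P`.
    have h4 : ((A * M + 2 * A * M ^ 2 + 3 * A ^ 2) * P + 3 * A * X + 4 * A * Q * P) / ζ.re ≤
        (A * M + 2 * A * M ^ 2 + 3 * A ^ 2) * P + X / 2 + Q * P := by
      rw [div_le_iff₀ hζre]
      have e1 : (A * M + 2 * A * M ^ 2 + 3 * A ^ 2) * P ≤
          (A * M + 2 * A * M ^ 2 + 3 * A ^ 2) * P * ζ.re :=
        le_mul_of_one_le_right (by positivity) (by linarith)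
      have e2 : 6 * A * X ≤ ζ.re * X := mul_le_mul_of_nonneg_right (by linarith) hX
      have e3 : 6 * A * (Q * P) ≤ ζ.re * (Q * P) :=
        mul_le_mul_of_nonneg_right (by linarith) (by positivity)
      have e4 : 0 ≤ A * (Q * P) := by positivity
      nlinarith
    rw [h2]
    refine (norm_add_le _ _).trans ((add_le_add (h1.trans h4) h3).trans (le_of_eq ?_))
    rw [hQ]; ring
  intro z hz
  refine (hgoal z hz).trans (le_of_eq ?_)
  rw [hP]; ring

/-- Existence of a Gevrey asymptotic solution of a singularly perturbed Riccati equation on a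
strip. -/
theorem exists_gevrey_solution {r r₀ κ C M : ℝ} (hr₀ : r₀ < r) (hC : 0 < C) (hM : 0 < M)
    (hκ : 0 < κ) {a b : ℂ → ℂ → ℂ} {ah bh w : ℕ → ℂ → ℂ}
    (hal : ∀ ζ : ℂ, κ < ζ.re → DifferentiableOn ℂ (fun z => a z ζ) (strip r))
    (hbl : ∀ ζ : ℂ, κ < ζ.re → DifferentiableOn ℂ (fun z => b z ζ) (strip r))
    (ha : ∀ z ∈ strip r, GevreyRHP κ C M (a z) fun k => ah k z)
    (hb : ∀ z ∈ strip r, GevreyRHP κ C M (b z) fun k => bh k z)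
    (hw : ∀ k, DifferentiableOn ℂ (w k) (strip r)) (hw0 : ∀ z ∈ strip r, w 0 z = -ah 0 z)
    (hws : ∀ k, ∀ z ∈ strip r, w (k + 1) z =
      deriv (w k) z - conv (fun i => bh i z + w i z) (fun i => w i z) k - ah (k + 1) z) :
    ∃ κ' C' M' : ℝ, κ ≤ κ' ∧ 0 < C' ∧ 0 < M' ∧ ∃ W : ℂ → ℂ → ℂ,
      (∀ z ∈ strip r₀, GevreyRHP κ' C' M' (W z) fun k => w k z) ∧
      ∀ z ∈ strip r₀, ∀ ζ : ℂ, κ' < ζ.re →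
        HasDerivAt (fun z => W z ζ) (ζ * (W z ζ + a z ζ) + W z ζ ^ 2 + b z ζ * W z ζ) z := by
  have hd : 0 < r - r₀ := sub_pos.2 hr₀
  have hsub := strip_mono hr₀.le
  have hform := norm_formal_le hr₀ hC hM (fun k z hz => (ha z hz).norm_coeff_le k)
    (fun k z hz => (hb z hz).norm_coeff_le k) hw hw0 hws
  set M₁ : ℝ := Real.exp 1 * (M + 1 / (r - r₀) + 3 * C) with hM₁
  have hMM : M ≤ M₁ := by
    have h1 : (1 : ℝ) ≤ Real.exp 1 := Real.one_le_exp zero_le_one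
    have h2 : 0 < 1 / (r - r₀) := by positivity
    nlinarith
  have hM₁0 : 0 < M₁ := hM.trans_le hMM
  -- The unknown is `y = W - w 0`, which solves `y' = ζ y + y² + β y + γ`. The summand `3 C` bounds
  -- `β = 2 w 0 + b`, and the rest bounds `γ`.
  set B : ℝ := 3 * C + (2 * C ^ 2 + C * M + C / (r - r₀)) with hB
  have hBt : 0 ≤ 2 * C ^ 2 + C * M + C / (r - r₀) := by positivity
  have hB0 : 0 ≤ B := by positivity
  set A : ℝ := 2 * C + 1 with hA
  -- Large enough for the contraction, `4 (1 + B)`, and for the absorption in the remainder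
  -- estimate, `6 A`.
  set κ' : ℝ := max κ (4 * (1 + B) + 6 * A) with hκ'
  have hκκ : κ ≤ κ' := le_max_left _ _
  have hκB : 4 * (1 + B) + 6 * A ≤ κ' := le_max_right _ _
  have hA0 : 0 < A := by positivity
  have hC0 : ∀ z ∈ strip r, ‖w 0 z‖ ≤ C := fun z hz => by
    rw [hw0 z hz, norm_neg]
    simpa using (ha z hz).norm_coeff_le 0
  have hb0 : ∀ z ∈ strip r, ∀ ζ : ℂ, κ < ζ.re → ‖b z ζ‖ ≤ C := fun z hz ζ hζ => by
    simpa [rem_zero] using (hb z hz).bound 0 ζ hζ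
  have hβ : SepHol r₀ κ' B fun z ζ => 2 * w 0 z + b z ζ :=
    ⟨fun ζ hζ => (((hw 0).mono hsub).const_mul 2).add ((hbl ζ (hκκ.trans_lt hζ)).mono hsub),
      fun z hz => ((hb z (hsub hz)).mono hκκ).diff.const_add _, fun z hz ζ hζ => by
      have h1 := hC0 z (hsub hz)
      have h2 := hb0 z (hsub hz) ζ (hκκ.trans_lt hζ)
      refine (norm_add_le _ _).trans ?_
      rw [norm_mul, Complex.norm_ofNat]
      linarith⟩
  have hγ : SepHol r₀ κ' B fun z ζ => w 0 z ^ 2 + b z ζ * w 0 z + ζ * (a z ζ + w 0 z) -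
      deriv (w 0) z := by
    refine ⟨fun ζ hζ => ?_, fun z hz => ?_, fun z hz ζ hζ => ?_⟩
    · exact (((((hw 0).mono hsub).pow 2).add (((hbl ζ (hκκ.trans_lt hζ)).mono hsub).mul
        ((hw 0).mono hsub))).add ((((hal ζ (hκκ.trans_lt hζ)).mono hsub).add
        ((hw 0).mono hsub)).const_mul ζ)).sub (((hw 0).deriv (isOpen_strip r)).mono hsub)
    · exact (((((hb z (hsub hz)).mono hκκ).diff.mul_const _).const_add _).add
        (differentiableOn_id.mul ((((ha z (hsub hz)).mono hκκ).diff.add_const _)))).sub_const _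
    · have h1 := hC0 z (hsub hz)
      have h2 := hb0 z (hsub hz) ζ (hκκ.trans_lt hζ)
      have h3 := (ha z (hsub hz)).bound 1 ζ (hκκ.trans_lt hζ)
      have h4 : ‖deriv (w 0) z‖ ≤ C / (r - r₀) :=
        norm_deriv_le_of_ball hd ((hw 0).mono (ball_subset_strip hz))
          fun y hy => hC0 y (ball_subset_strip hz hy)
      have hζ0 : ζ ≠ 0 := ne_zero_of_rhp hκ (hκκ.trans_lt hζ)
      -- The factor `ζ` is harmless: as `w 0 = -ah 0`, it multiplies the first-order remainder of
      -- `a`.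
      have h5 : ‖ζ * (a z ζ + w 0 z)‖ ≤ C * M := by
        rw [rem_succ, rem_zero, pow_zero, mul_one, ← neg_neg (ah 0 z), ← hw0 z (hsub hz),
          sub_neg_eq_add] at h3
        rw [norm_mul]
        calc ‖ζ‖ * ‖a z ζ + w 0 z‖
            ≤ ‖ζ‖ * (C * M ^ 1 * ((1).factorial : ℝ) * ‖ζ⁻¹‖ ^ 1) := by gcongr
          _ = C * M * (‖ζ‖ * ‖ζ⁻¹‖) := by simp; ring
          _ = C * M := by rw [← norm_mul, mul_inv_cancel₀ hζ0, norm_one, mul_one]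
      have h6 : ‖w 0 z ^ 2‖ ≤ C * C := by
        rw [pow_two, norm_mul]; gcongr
      have h7 : ‖b z ζ * w 0 z‖ ≤ C * C := by
        rw [norm_mul]; gcongr
      refine (norm_sub_le _ _).trans ((add_le_add ((norm_add_le _ _).trans (add_le_add
        ((norm_add_le _ _).trans (add_le_add h6 h7)) h5)) h4).trans ?_)
      rw [hB]; nlinarith
  obtain ⟨y, hy, hyd⟩ := exists_bounded_solution hB0 (by linarith) hβ hγ
  have hWd : ∀ z ∈ strip r₀, ∀ ζ : ℂ, κ' < ζ.re → HasDerivAt (fun z => w 0 z + y z ζ)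
      (ζ * (w 0 z + y z ζ + a z ζ) + (w 0 z + y z ζ) ^ 2 + b z ζ * (w 0 z + y z ζ)) z := by
    intro z hz ζ hζ
    have h1 := ((hw 0).differentiableAt ((isOpen_strip r).mem_nhds (hsub hz))).hasDerivAt
    exact (h1.add (hyd z hz ζ hζ)).congr_deriv (by ring)
  have hWb : ∀ z ∈ strip r₀, ∀ ζ : ℂ, κ' < ζ.re → ‖w 0 z + y z ζ‖ ≤ A := fun z hz ζ hζ => by
    refine (norm_add_le _ _).trans ?_
    linarith [hC0 z (hsub hz), hy.bound z hz ζ hζ]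
  have hup : ∀ n : ℕ, C * M ^ n * (n.factorial : ℝ) ≤ A * M₁ ^ n * (n.factorial : ℝ) := fun n => by
    have : C ≤ A := by linarith
    gcongr
  have hup2 : ∀ n : ℕ, 2 * C * M₁ ^ n * (n.factorial : ℝ) ≤ A * M₁ ^ n * (n.factorial : ℝ) :=
    fun n => by
      have : 2 * C ≤ A := by linarith
      gcongr
  refine ⟨κ', 4 * (A + A * M₁ + 2 * A * M₁ ^ 2 + 3 * A ^ 2), 4 * M₁, hκκ, by positivity,
    by positivity, fun z ζ => w 0 z + y z ζ, fun z hz => ⟨(hy.right z hz).const_add _,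
      fun n ζ hζ => ?_⟩, hWd⟩
  refine norm_remainder_le (W := fun z => w 0 z + y z ζ) (a := fun z => a z ζ)
    (b := fun z => b z ζ) (ah := ah) (bh := bh) hA0 hM₁0 (by linarith) (by linarith) hζ
    (fun k => (hw k).mono hsub) (fun k z hz => (hform k z hz).trans (hup2 k))
    (fun k z hz => ((hb z (hsub hz)).norm_coeff_le k).trans (hup k))
    (fun n z hz => ((ha z (hsub hz)).bound n ζ (hκκ.trans_lt hζ)).trans ?_)
    (fun n z hz => ((hb z (hsub hz)).bound n ζ (hκκ.trans_lt hζ)).trans ?_)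
    (fun z hz => hWb z hz ζ hζ) (fun z hz => hWd z hz ζ hζ)
    (fun z hz => hw0 z (hsub hz)) (fun k z hz => hws k z (hsub hz)) n z hz
  · exact mul_le_mul_of_nonneg_right (hup n) (by positivity)
  · exact mul_le_mul_of_nonneg_right (hup n) (by positivity)

/-! ### The distortion of univalent functions -/

/-- Grönwall's inequality for `h'` along the segment from `0` to `w`. -/
theorem norm_deriv_le_exp {h : ℂ → ℂ} {ρ : ℝ} (hh : DifferentiableOn ℂ h (Metric.ball 0 ρ))
    (h1 : deriv h 0 = 1)
    (hN : ∀ w ∈ Metric.ball (0 : ℂ) ρ, ‖deriv (deriv h) w‖ ≤ 2 * ‖deriv h w‖) {w : ℂ}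
    (hw : w ∈ Metric.ball (0 : ℂ) ρ) : ‖deriv h w‖ ≤ Real.exp (2 * ‖w‖) := by
  have hmem : ∀ t ∈ Icc (0 : ℝ) 1, (t : ℂ) * w ∈ Metric.ball (0 : ℂ) ρ := by
    intro t ht
    rw [mem_ball_zero_iff] at hw ⊢
    rw [norm_mul, Complex.norm_real, Real.norm_of_nonneg ht.1]
    exact (mul_le_of_le_one_left (norm_nonneg w) ht.2).trans_lt hw
  have hd : ∀ t ∈ Icc (0 : ℝ) 1, HasDerivAt (fun t : ℝ => deriv h (t * w))
      (deriv (deriv h) (t * w) * w) t := by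
    intro t ht
    have e1 := ((hh.deriv Metric.isOpen_ball).differentiableAt
      (Metric.isOpen_ball.mem_nhds (hmem t ht))).hasDerivAt
    have e2 : HasDerivAt (fun t : ℝ => (t : ℂ) * w) (1 * w) t :=
      (Complex.ofRealCLM.hasDerivAt (x := t)).mul_const w
    rw [one_mul] at e2
    exact HasDerivAt.comp t e1 e2
  have key := norm_le_gronwallBound_of_norm_deriv_right_le (δ := 1) (K := 2 * ‖w‖) (ε := 0)
    (f := fun t : ℝ => deriv h (t * w)) (a := 0) (b := 1)
    (fun t ht => (hd t ht).continuousAt.continuousWithinAt)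
    (fun t ht => (hd t (Ico_subset_Icc_self ht)).hasDerivWithinAt)
    (by simp [h1])
    (fun t ht => by
      have := hN _ (hmem t (Ico_subset_Icc_self ht))
      rw [norm_mul, add_zero]
      nlinarith [norm_nonneg w]) 1 (by simp)
  rw [gronwallBound_ε0] at key
  simpa using key

/-- A normalised univalent function with controlled pre-Schwarzian derivative, equal to `1` in modulus
at the centre, lives on a disc of bounded radius. -/
theorem radius_le_of_univalent {h : ℂ → ℂ} {ρ : ℝ} (hh : DifferentiableOn ℂ h (Metric.ball 0 ρ))
    (hinj : InjOn h (Metric.ball 0 ρ)) (h0 : h 0 = 0) (h1 : deriv h 0 = 1)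
    (h2 : ‖deriv (deriv h) 0‖ = 1)
    (hN : ∀ w ∈ Metric.ball (0 : ℂ) ρ, ‖deriv (deriv h) w‖ ≤ 2 * ‖deriv h w‖) :
    ρ ≤ 1024 * Real.exp 8 := by
  by_contra! hcon
  have hE1 : (1 : ℝ) ≤ Real.exp 4 := Real.one_le_exp (by norm_num)
  have hE8 : Real.exp 8 = Real.exp 4 * Real.exp 4 := by rw [← Real.exp_add]; norm_num
  set E : ℝ := Real.exp 4 with hE
  have hρ : 16 < ρ := by nlinarith
  have hρ0 : 0 < ρ := by linarith
  have hsub2 : Metric.closedBall (0 : ℂ) 2 ⊆ Metric.ball 0 ρ :=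
    Metric.closedBall_subset_ball (by linarith)
  have hd : ∀ w ∈ Metric.closedBall (0 : ℂ) 2, ‖deriv h w‖ ≤ E := fun w hw => by
    refine (norm_deriv_le_exp hh h1 hN (hsub2 hw)).trans (Real.exp_le_exp.2 ?_)
    have := mem_closedBall_zero_iff.1 hw
    linarith
  have hat : ∀ w ∈ Metric.ball (0 : ℂ) ρ, DifferentiableAt ℂ h w := fun w hw =>
    hh.differentiableAt (Metric.isOpen_ball.mem_nhds hw)
  have hh' := hh.deriv Metric.isOpen_ball
  have hat' : ∀ w ∈ Metric.ball (0 : ℂ) ρ, DifferentiableAt ℂ (deriv h) w := fun w hw =>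
    hh'.differentiableAt (Metric.isOpen_ball.mem_nhds hw)
  have hz0 : (0 : ℂ) ∈ Metric.ball (0 : ℂ) ρ := Metric.mem_ball_self hρ0
  have hz2 : (0 : ℂ) ∈ Metric.closedBall (0 : ℂ) 2 := Metric.mem_closedBall_self (by norm_num)
  have hup : ∀ w ∈ Metric.closedBall (0 : ℂ) 2, ‖h w‖ ≤ E * ‖w‖ := fun w hw => by
    simpa [h0] using (convex_closedBall (0 : ℂ) 2).norm_image_sub_le_of_norm_deriv_le
      (fun y hy => hat y (hsub2 hy)) hd hz2 hw
  -- On the disc of radius `δ` one has `‖h''‖ ≤ 2 E`, so `h'` stays within `2 E δ = 1 / 2` of `1`,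
  -- and the circle of radius `δ` is mapped at distance at least `δ / 2` from `0`.
  set δ : ℝ := 1 / (4 * E) with hδ
  have hδ0 : 0 < δ := by positivity
  have hδE : δ * E = 1 / 4 := by rw [hδ]; field_simp
  have hδ1 : δ ≤ 1 := by nlinarith
  have hsubδ : Metric.closedBall (0 : ℂ) δ ⊆ Metric.closedBall 0 2 :=
    Metric.closedBall_subset_closedBall (by linarith)
  have hd1 : ∀ w ∈ Metric.closedBall (0 : ℂ) δ, ‖deriv h w - 1‖ ≤ 1 / 2 := fun w hw => by
    have e1 := (convex_closedBall (0 : ℂ) δ).norm_image_sub_le_of_norm_deriv_le (f := deriv h)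
      (C := 2 * E)
      (fun y hy => hat' y (hsub2 (hsubδ hy)))
      (fun y hy => (hN y (hsub2 (hsubδ hy))).trans
        (mul_le_mul_of_nonneg_left (hd y (hsubδ hy)) (by norm_num)))
      (Metric.mem_closedBall_self hδ0.le) hw
    rw [h1, sub_zero] at e1
    have e2 := mem_closedBall_zero_iff.1 hw
    nlinarith
  have hlow : ∀ w ∈ Metric.sphere (0 : ℂ) δ, δ / 2 ≤ ‖h w - h 0‖ := fun w hw => by
    have hw' := Metric.sphere_subset_closedBall hw
    have e1 := (convex_closedBall (0 : ℂ) δ).norm_image_sub_le_of_norm_deriv_le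
      (f := fun w => h w - w) (C := 1 / 2)
      (fun y hy => (hat y (hsub2 (hsubδ hy))).sub differentiableAt_id)
      (fun y hy => by
        have : deriv (fun w => h w - w) y = deriv h y - 1 :=
          ((hat y (hsub2 (hsubδ hy))).hasDerivAt.sub (hasDerivAt_id y)).deriv
        rw [this]; exact hd1 y hy)
      (Metric.mem_closedBall_self hδ0.le) hw'
    have e2 : ‖w‖ = δ := mem_sphere_zero_iff_norm.1 hw
    simp only [h0, sub_zero] at e1 ⊢
    rw [e2] at e1
    have e3 := norm_sub_norm_le w (h w)
    rw [norm_sub_rev] at e3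
    linarith
  -- A quantitative open mapping theorem. By injectivity, no point outside the disc of radius `δ`
  -- can be mapped into the covered disc.
  have hcover : Metric.ball (0 : ℂ) (δ / 4) ⊆ h '' Metric.closedBall 0 δ := by
    have e1 := DiffContOnCl.ball_subset_image_closedBall (f := h) (z₀ := 0) (r := δ) (ε := δ / 2)
      ((hh.mono ((hsubδ.trans hsub2))).diffContOnCl_ball subset_rfl) hδ0 hlow
      (((hat 0 hz0).hasDerivAt.eventually_ne (by rw [h1]; exact one_ne_zero)).frequently.filter_mono
        nhdsWithin_le_nhds)
    rw [h0] at e1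
    convert e1 using 2
    ring
  have hfar : ∀ w ∈ Metric.ball (0 : ℂ) ρ, δ < ‖w‖ → δ / 4 ≤ ‖h w‖ := fun w hw hδw => by
    by_contra! hlt
    obtain ⟨w', hw', e⟩ := hcover (mem_ball_zero_iff.2 hlt)
    have := hinj (hsub2 (hsubδ hw')) hw e
    rw [this] at hw'
    exact absurd (mem_closedBall_zero_iff.1 hw') (not_le.2 hδw)
  set m : ℂ → ℂ := dslope h 0 with hm
  have hm0 : m 0 = 1 := by rw [hm, dslope_same, h1]
  have hmw : ∀ w, w * m w = h w := fun w => by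
    have := sub_smul_dslope h 0 w
    simpa [h0] using this
  have hmd : DifferentiableOn ℂ m (Metric.ball 0 ρ) :=
    (Complex.differentiableOn_dslope (Metric.ball_mem_nhds 0 hρ0)).2 hh
  have hmne : ∀ w ∈ Metric.ball (0 : ℂ) ρ, m w ≠ 0 := fun w hw hmz => by
    have e1 : h w = h 0 := by rw [← hmw, hmz, mul_zero, h0]
    have e2 := hinj hw hz0 e1
    rw [e2, hm0] at hmz
    exact one_ne_zero hmz
  -- Away from `0` this is `w / h w`. By `hfar` and the maximum principle it grows at most linearly,
  -- so Cauchy's inequality bounds `k''` by a multiple of `1 / ρ'`: for large `ρ'` the function `k`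
  -- is almost affine near `0`, with `k 0 = 1` and slope of modulus `1 / 2`.
  set k : ℂ → ℂ := fun w => (m w)⁻¹ with hk
  have hkd : DifferentiableOn ℂ k (Metric.ball 0 ρ) := hmd.inv hmne
  set ρ' : ℝ := ρ / 2 with hρ'
  have hρ'2 : 8 < ρ' := by linarith
  have hkb : ∀ w ∈ Metric.ball (0 : ℂ) ρ', ‖k w‖ ≤ 4 * ρ' / δ := by
    intro w hw
    refine Complex.norm_le_of_forall_mem_frontier_norm_le Metric.isBounded_ball
      ((hkd.mono (Metric.closedBall_subset_ball (by linarith))).diffContOnCl_ball subset_rfl)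
      ?_ (subset_closure hw)
    intro z hz
    rw [frontier_ball _ (by linarith : ρ' ≠ 0)] at hz
    have hz1 : ‖z‖ = ρ' := mem_sphere_zero_iff_norm.1 hz
    have hzb : z ∈ Metric.ball (0 : ℂ) ρ := mem_ball_zero_iff.2 (by linarith)
    have e1 := hfar z hzb (by linarith)
    rw [← hmw, norm_mul, hz1] at e1
    have e2 : 0 < ‖m z‖ := norm_pos_iff.2 (hmne z hzb)
    simp only [hk]
    rw [norm_inv, inv_le_iff_one_le_mul₀ e2, div_mul_eq_mul_div, le_div_iff₀ hδ0, one_mul]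
    linarith
  have hkat : ∀ w ∈ Metric.ball (0 : ℂ) ρ, DifferentiableAt ℂ k w := fun w hw =>
    hkd.differentiableAt (Metric.isOpen_ball.mem_nhds hw)
  have hkd' := hkd.deriv Metric.isOpen_ball
  have hk1 : ∀ w ∈ Metric.ball (0 : ℂ) (ρ' / 2), ‖deriv k w‖ ≤ 8 / δ := fun w hw => by
    have hs : Metric.ball w (ρ' / 2) ⊆ Metric.ball 0 ρ' := by
      refine Metric.ball_subset_ball' ?_
      have := Metric.mem_ball.1 hw
      linarith
    refine (norm_deriv_le_of_ball (by linarith) (hkd.mono (hs.trans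
      (Metric.ball_subset_ball (by linarith)))) fun z hz => hkb z (hs hz)).trans (le_of_eq ?_)
    have : ρ' ≠ 0 := by linarith
    field_simp; norm_num
  have hk2 : ∀ w ∈ Metric.ball (0 : ℂ) (ρ' / 4), ‖deriv (deriv k) w‖ ≤ 32 / (δ * ρ') := fun w hw => by
    have hs : Metric.ball w (ρ' / 4) ⊆ Metric.ball 0 (ρ' / 2) := by
      refine Metric.ball_subset_ball' ?_
      have := Metric.mem_ball.1 hw
      linarith
    refine (norm_deriv_le_of_ball (by linarith) (hkd'.mono (hs.trans
      (Metric.ball_subset_ball (by linarith)))) fun z hz => hk1 z (hs hz)).trans (le_of_eq ?_)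
    have : ρ' ≠ 0 := by linarith
    field_simp; norm_num
  -- the first Taylor coefficient of `k`
  have hk' : ‖deriv k 0‖ = 1 / 2 := by
    have hprod : ∀ w ∈ Metric.ball (0 : ℂ) ρ, h w * k w = w := fun w hw => by
      simp only [hk]
      rw [← hmw, mul_assoc, mul_inv_cancel₀ (hmne w hw), mul_one]
    have e1 : ∀ w ∈ Metric.ball (0 : ℂ) ρ, deriv h w * k w + h w * deriv k w = 1 := fun w hw => by
      have a1 := ((hat w hw).hasDerivAt.mul (hkat w hw).hasDerivAt)
      have a2 : HasDerivAt (h * k) 1 w := (hasDerivAt_id w).congr_of_eventuallyEq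
        (eventually_of_mem (Metric.isOpen_ball.mem_nhds hw) hprod)
      exact a1.unique a2
    have a1 := (((hat' 0 hz0).hasDerivAt.mul (hkat 0 hz0).hasDerivAt).add
      ((hat 0 hz0).hasDerivAt.mul (hkd'.differentiableAt
        (Metric.isOpen_ball.mem_nhds hz0)).hasDerivAt))
    have a2 : HasDerivAt (deriv h * k + h * deriv k) 0 0 := (hasDerivAt_const (0 : ℂ) (1 : ℂ)).congr_of_eventuallyEq
        (eventually_of_mem (Metric.isOpen_ball.mem_nhds hz0) e1)
    have a3 := a1.unique a2
    have hk0 : k 0 = 1 := by simp only [hk]; rw [hm0, inv_one]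
    rw [h0, h1, hk0] at a3
    have a4 : deriv (deriv h) 0 = -(2 * deriv k 0) := by linear_combination a3
    rw [a4, norm_neg, norm_mul, Complex.norm_ofNat] at h2
    linarith
  have hkne : deriv k 0 ≠ 0 := by intro h; rw [h] at hk'; norm_num at hk'
  -- The zero of the affine approximation; its modulus is `2`, hence the disc of radius `2` above.
  -- There `k` is small if `ρ'` is large, yet `k w₁ = w₁ / h w₁` is at least `1 / E` in modulus.
  -- This bounds `ρ'`.
  set w₁ : ℂ := -(deriv k 0)⁻¹ with hw₁
  have hw₁n : ‖w₁‖ = 2 := by rw [hw₁, norm_neg, norm_inv, hk']; norm_num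
  have hcl : Metric.closedBall (0 : ℂ) 2 ⊆ Metric.ball 0 (ρ' / 4) :=
    Metric.closedBall_subset_ball (by linarith)
  have hclρ : Metric.ball (0 : ℂ) (ρ' / 4) ⊆ Metric.ball 0 ρ := Metric.ball_subset_ball (by linarith)
  have hw₁c : w₁ ∈ Metric.closedBall (0 : ℂ) 2 := mem_closedBall_zero_iff.2 hw₁n.le
  have t1 : ∀ w ∈ Metric.closedBall (0 : ℂ) 2, ‖deriv k w - deriv k 0‖ ≤ 32 / (δ * ρ') * 2 := fun w hw => by
    refine ((convex_closedBall (0 : ℂ) 2).norm_image_sub_le_of_norm_deriv_le (f := deriv k)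
      (fun y hy => hkd'.differentiableAt (Metric.isOpen_ball.mem_nhds (hclρ (hcl hy))))
      (fun y hy => hk2 y (hcl hy)) hz2 hw).trans ?_
    rw [sub_zero]
    have := mem_closedBall_zero_iff.1 hw
    gcongr
  have t2 : ‖k w₁‖ ≤ 32 / (δ * ρ') * 2 * 2 := by
    have e1 := (convex_closedBall (0 : ℂ) 2).norm_image_sub_le_of_norm_deriv_le
      (f := fun w => k w - deriv k 0 * w) (C := 32 / (δ * ρ') * 2)
      (fun y hy => (hkat y (hclρ (hcl hy))).sub (differentiableAt_id.const_mul _))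
      (fun y hy => by
        have : deriv (fun w => k w - deriv k 0 * w) y = deriv k y - deriv k 0 * 1 :=
          ((hkat y (hclρ (hcl hy))).hasDerivAt.sub ((hasDerivAt_id y).const_mul _)).deriv
        rw [this, mul_one]; exact t1 y hy) hz2 hw₁c
    have hk0 : k 0 = 1 := by simp only [hk]; rw [hm0, inv_one]
    have e2 : k w₁ - deriv k 0 * w₁ - (k 0 - deriv k 0 * 0) = k w₁ := by
      rw [hk0, hw₁, mul_neg, mul_inv_cancel₀ hkne]; ring
    rw [e2, sub_zero, hw₁n] at e1
    exact e1
  have t3 : 1 / E ≤ ‖k w₁‖ := by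
    have e1 := hup w₁ hw₁c
    have e2 : 0 < ‖m w₁‖ := norm_pos_iff.2 (hmne _ (hsub2 hw₁c))
    rw [← hmw, norm_mul, hw₁n] at e1
    simp only [hk]
    rw [norm_inv, one_div]
    exact inv_anti₀ e2 (by linarith)
  have t4 := t3.trans t2
  have hρ'0 : 0 < ρ' := by linarith
  have t5 : 32 / (δ * ρ') * 2 * 2 = 512 * E / ρ' := by rw [hδ]; field_simp; norm_num
  rw [t5, div_le_div_iff₀ (by linarith) hρ'0] at t4
  nlinarith

/-- A univalent function has bounded pre-Schwarzian derivative. -/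
theorem norm_deriv_deriv_le_of_univalent {F : ℂ → ℂ} {z₀ : ℂ} {R : ℝ} (hR : 0 < R)
    (hF : DifferentiableOn ℂ F (Metric.ball z₀ R)) (hinj : InjOn F (Metric.ball z₀ R))
    (hne : ∀ z ∈ Metric.ball z₀ R, deriv F z ≠ 0) :
    ‖deriv (deriv F) z₀‖ ≤ 4096 * Real.exp 8 / R * ‖deriv F z₀‖ := by
  set R' : ℝ := R / 2 with hR'
  have hR'0 : 0 < R' := by positivity
  have hsub : Metric.closedBall z₀ R' ⊆ Metric.ball z₀ R :=
    Metric.closedBall_subset_ball (by linarith)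
  have hF' := hF.deriv Metric.isOpen_ball
  have hF'' := hF'.deriv Metric.isOpen_ball
  -- Point picking: `F'' / F'` is maximised with the distance to the boundary as weight. Within half
  -- of that distance from the maximum point the ratio at most doubles, which is the growth
  -- condition of `radius_le_of_univalent`.
  have hcont : ContinuousOn (fun z => (R' - ‖z - z₀‖) * ‖deriv (deriv F) z / deriv F z‖)
      (Metric.closedBall z₀ R') := by
    refine ContinuousOn.mul (Continuous.continuousOn (by fun_prop)) (ContinuousOn.norm ?_)
    exact ((hF''.continuousOn.div hF'.continuousOn hne).mono hsub)
  obtain ⟨z, hz, hmax⟩ := (isCompact_closedBall z₀ R').exists_isMaxOn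
    ⟨z₀, Metric.mem_closedBall_self hR'0.le⟩ hcont
  set l : ℝ := ‖deriv (deriv F) z / deriv F z‖ with hl
  set d : ℝ := R' - ‖z - z₀‖ with hd
  have hmax' : ∀ w ∈ Metric.closedBall z₀ R',
      (R' - ‖w - z₀‖) * ‖deriv (deriv F) w / deriv F w‖ ≤ d * l := fun w hw => hmax hw
  have hd0 : 0 ≤ d := by
    have := mem_closedBall_iff_norm.1 hz
    linarith
  have hl0 : 0 ≤ l := norm_nonneg _
  have hdl : d * l ≤ 2048 * Real.exp 8 := by
    rcases hd0.eq_or_lt with h | hdpos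
    · rw [← h, zero_mul]; positivity
    rcases hl0.eq_or_lt with h | hlpos
    · rw [← h, mul_zero]; positivity
    have hlC : (l : ℂ) ≠ 0 := by exact_mod_cast hlpos.ne'
    have hzR := hsub hz
    have hmaps : ∀ w ∈ Metric.ball (0 : ℂ) (d * l / 2), z + w / l ∈ Metric.ball z (d / 2) := by
      intro w hw
      have hw' := mem_ball_zero_iff.1 hw
      rw [mem_ball_iff_norm, add_sub_cancel_left, norm_div, Complex.norm_real,
        Real.norm_of_nonneg hl0, div_lt_iff₀ hlpos]
      linarith
    have hballR' : Metric.ball z (d / 2) ⊆ Metric.closedBall z₀ R' := by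
      refine (Metric.ball_subset_ball' ?_).trans Metric.ball_subset_closedBall
      rw [dist_eq_norm]; linarith
    have hneg := hne z hzR
    -- Rescaling by `l` gives the second derivative at the centre modulus one and turns the radius
    -- `d / 2` into `d l / 2`, so the bound on the radius is a bound on the weighted maximum.
    set h : ℂ → ℂ := fun w => l * (F (z + w / l) - F z) / deriv F z with hh
    have hder : ∀ w ∈ Metric.ball (0 : ℂ) (d * l / 2),
        HasDerivAt h (deriv F (z + w / l) / deriv F z) w := by
      intro w hw
      have a1 := (hF.differentiableAt (Metric.isOpen_ball.mem_nhds
        (hsub (hballR' (hmaps w hw))))).hasDerivAt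
      have a2 : HasDerivAt (fun w : ℂ => z + w / l) (1 / l) w :=
        ((hasDerivAt_id w).div_const (l : ℂ)).const_add z
      have a3 := ((((HasDerivAt.comp w a1 a2)).sub_const (F z)).const_mul (l : ℂ)).div_const
        (deriv F z)
      exact a3.congr_deriv (by field_simp)
    have hder' : ∀ w ∈ Metric.ball (0 : ℂ) (d * l / 2),
        deriv (deriv h) w = deriv (deriv F) (z + w / l) / l / deriv F z := by
      intro w hw
      have a0 : deriv h =ᶠ[𝓝 w] fun w => deriv F (z + w / l) / deriv F z :=
        eventually_of_mem (Metric.isOpen_ball.mem_nhds hw) fun y hy => (hder y hy).deriv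
      have a1 := (hF'.differentiableAt (Metric.isOpen_ball.mem_nhds
        (hsub (hballR' (hmaps w hw))))).hasDerivAt
      have a2 : HasDerivAt (fun w : ℂ => z + w / l) (1 / l) w :=
        ((hasDerivAt_id w).div_const (l : ℂ)).const_add z
      have a3 := (HasDerivAt.comp w a1 a2).div_const (deriv F z)
      rw [a0.deriv_eq]
      refine a3.deriv.trans (by ring)
    have h00 : (0 : ℂ) ∈ Metric.ball (0 : ℂ) (d * l / 2) := Metric.mem_ball_self (by positivity)
    have key := radius_le_of_univalent (h := h) (ρ := d * l / 2)
      (fun w hw => (hder w hw).differentiableAt.differentiableWithinAt) ?_ (by simp [hh])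
      (by rw [(hder 0 h00).deriv]; simp [hneg]) ?_ ?_
    · linarith
    · intro w hw w' hw' e
      have e1 : F (z + w / l) = F (z + w' / l) := by
        simp only [hh] at e
        rw [div_left_inj' hneg, mul_right_inj' hlC] at e
        exact sub_left_inj.1 e
      have e2 := hinj (hsub (hballR' (hmaps w hw))) (hsub (hballR' (hmaps w' hw'))) e1
      have e3 := add_left_cancel e2
      field_simp at e3
      exact e3
    · rw [hder' 0 h00]
      simp only [zero_div, add_zero]
      rw [div_right_comm, norm_div, ← hl, Complex.norm_real, Real.norm_of_nonneg hl0,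
        div_self hlpos.ne']
    · intro w hw
      rw [hder' w hw, (hder w hw).deriv]
      have e1 := hmax' _ (hballR' (hmaps w hw))
      have e2 : d / 2 ≤ R' - ‖z + w / l - z₀‖ := by
        have e3 := mem_ball_iff_norm.1 (hmaps w hw)
        have e4 : z + w / l - z₀ = (z + w / l - z) + (z - z₀) := by ring
        have e5 := norm_add_le (z + w / l - z) (z - z₀)
        rw [← e4] at e5
        linarith
      have hne' := hne _ (hsub (hballR' (hmaps w hw)))
      set y := z + w / l
      have e6 : ‖deriv (deriv F) y / deriv F y‖ ≤ 2 * l := by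
        have : d / 2 * ‖deriv (deriv F) y / deriv F y‖ ≤ d * l :=
          (mul_le_mul_of_nonneg_right e2 (norm_nonneg _)).trans e1
        nlinarith
      rw [norm_div, div_le_iff₀ (norm_pos_iff.2 hne')] at e6
      rw [norm_div, norm_div, norm_div, Complex.norm_real, Real.norm_of_nonneg hl0, ← mul_div_assoc]
      gcongr
      rw [div_le_iff₀ hlpos]
      linarith
  have h1 := hmax' z₀ (Metric.mem_closedBall_self hR'0.le)
  rw [sub_self, norm_zero, sub_zero, norm_div] at h1
  have hpos : 0 < ‖deriv F z₀‖ := norm_pos_iff.2 (hne z₀ (Metric.mem_ball_self hR))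
  have h2 := h1.trans hdl
  rw [hR', ← mul_div_assoc, div_le_iff₀ hpos] at h2
  rw [div_mul_eq_mul_div, le_div_iff₀ hR]
  linarith

/-! ### The inverse of the Liouville transformation -/

theorem exists_localInverse {F : ℂ → ℂ} {S : Set ℂ} (hS : IsOpen S) (hF : DifferentiableOn ℂ F S)
    {z : ℂ} (hz : z ∈ S) (hne : deriv F z ≠ 0) :
    ∃ G : ℂ → ℂ, G (F z) = z ∧ ∀ᶠ y in 𝓝 (F z),
      F (G y) = y ∧ G y ∈ S ∧ HasDerivAt G (deriv F (G y))⁻¹ y := by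
  have hstrict : ∀ t ∈ S, HasStrictDerivAt F (deriv F t) t := fun t ht =>
    (hF.analyticAt (hS.mem_nhds ht)).hasStrictDerivAt
  have hs := hstrict z hz
  set G := hs.localInverse F (deriv F z) z hne
  have hleft : ∀ᶠ t in 𝓝 z, G (F t) = t := hs.eventually_left_inverse hne
  have hright : ∀ᶠ y in 𝓝 (F z), F (G y) = y := hs.eventually_right_inverse hne
  have hne' : ∀ᶠ t in 𝓝 z, deriv F t ≠ 0 :=
    ((hF.deriv hS).continuousOn.continuousAt (hS.mem_nhds hz)).eventually_ne hne
  refine ⟨G, hleft.self_of_nhds, hright.and ?_⟩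
  rw [← hs.map_nhds_eq hne, eventually_map]
  filter_upwards [hleft.eventually_nhds, hne', hS.mem_nhds hz] with t ht htne htS
  have e := ht.self_of_nhds
  rw [e]
  exact ⟨htS, ((hstrict t htS).to_local_left_inverse htne ht).hasDerivAt⟩

/-- Holomorphic maps on a strip satisfying `(F')² · D ∘ F = c`. -/
structure LiouvilleMap (r : ℝ) (D : ℂ → ℂ) (c : ℂ) (F : ℂ → ℂ) : Prop where
  pos : 0 < r
  const_ne : c ≠ 0
  diff : DifferentiableOn ℂ F (strip r)
  eq : ∀ t ∈ strip r, deriv F t ^ 2 * D (F t) = c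

namespace LiouvilleMap

variable {r : ℝ} {D F : ℂ → ℂ} {c : ℂ}

theorem deriv_ne (h : LiouvilleMap r D c F) {t : ℂ} (ht : t ∈ strip r) : deriv F t ≠ 0 := by
  intro h0
  have := h.eq t ht
  rw [h0] at this
  exact h.const_ne (by rw [← this]; ring)

theorem differentiableAt (h : LiouvilleMap r D c F) {t : ℂ} (ht : t ∈ strip r) :
    DifferentiableAt ℂ F t := h.diff.differentiableAt ((isOpen_strip r).mem_nhds ht)

/-- Functions which become holomorphic after composition with `F` are holomorphic. -/
theorem descent (h : LiouvilleMap r D c F) {S : Set ℂ} (hS : IsOpen S) (hSr : S ⊆ strip r)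
    {f g : ℂ → ℂ} (hg : DifferentiableOn ℂ g S)
    (hfg : ∀ t ∈ S, f (F t) = g t) {t : ℂ} (ht : t ∈ S) :
    HasDerivAt f (deriv g t / deriv F t) (F t) := by
  obtain ⟨G, hG, hev⟩ := exists_localInverse hS (h.diff.mono hSr) ht (h.deriv_ne (hSr ht))
  have h1 := hev.self_of_nhds.2.2
  rw [hG] at h1
  have h2 := (hg.differentiableAt (hS.mem_nhds ht)).hasDerivAt
  rw [← hG] at h2
  have h3 := HasDerivAt.comp (F t) h2 h1
  rw [hG] at h3
  refine (h3.congr_of_eventuallyEq ?_).congr_deriv (by rw [div_eq_mul_inv])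
  filter_upwards [hev] with y hy
  rw [Function.comp_apply, ← hfg _ hy.2.1, hy.1]

theorem isOpen_image (h : LiouvilleMap r D c F) {S : Set ℂ} (hS : IsOpen S) (hSr : S ⊆ strip r) :
    IsOpen (F '' S) := by
  rw [isOpen_iff_mem_nhds]
  rintro _ ⟨t, ht, rfl⟩
  obtain ⟨G, -, hev⟩ := exists_localInverse hS (h.diff.mono hSr) ht (h.deriv_ne (hSr ht))
  filter_upwards [hev] with y hy using ⟨G y, hy.2.1, hy.1⟩

/-- If `G` inverts `F` near `z`, then `k t = G (F (z' + t))` satisfies `F (k t) = F (z' + t)`. Both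
sides obey the Liouville equation with the same value of `D`, so `k'² = 1`; by continuity `k'` is a
constant sign. -/
theorem sign_translate (h : LiouvilleMap r D c F) {z z' : ℂ} (hz : z ∈ strip r)
    (hz' : z' ∈ strip r) (e : F z = F z') :
    ∃ σ : ℂ, (σ = 1 ∨ σ = -1) ∧ ∀ᶠ t in 𝓝 (0 : ℂ), F (z + σ * t) = F (z' + t) := by
  obtain ⟨G, hG, hev⟩ := exists_localInverse (isOpen_strip r) h.diff hz (h.deriv_ne hz)
  have hc0 : ContinuousAt (fun t => F (z' + t)) 0 := by
    have h1 : ContinuousAt F (z' + 0) := by rw [add_zero]; exact (h.differentiableAt hz').continuousAt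
    exact ContinuousAt.comp (f := fun t => z' + t) h1 (by fun_prop)
  have hev' : ∀ᶠ t in 𝓝 (0 : ℂ), z' + t ∈ strip r ∧ F (G (F (z' + t))) = F (z' + t) ∧
      G (F (z' + t)) ∈ strip r ∧
      HasDerivAt G (deriv F (G (F (z' + t))))⁻¹ (F (z' + t)) := by
    refine Eventually.and ?_ ?_
    · have : ContinuousAt (fun t : ℂ => z' + t) 0 := by fun_prop
      exact this.eventually_mem (by rw [add_zero]; exact (isOpen_strip r).mem_nhds hz')
    · rw [e, ← add_zero z'] at hev
      exact hc0.eventually hev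
  set k : ℂ → ℂ := fun t => G (F (z' + t)) with hk
  set q : ℂ → ℂ := fun t => (deriv F (k t))⁻¹ * deriv F (z' + t) with hq
  have hk0 : k 0 = z := by simp only [hk]; rw [add_zero, ← e, hG]
  have hkd : ∀ᶠ t in 𝓝 (0 : ℂ), HasDerivAt k (q t) t := by
    filter_upwards [hev'] with t ht
    have h1 : HasDerivAt (fun t => F (z' + t)) (deriv F (z' + t)) t := by
      have := (h.differentiableAt ht.1).hasDerivAt.comp t ((hasDerivAt_id t).const_add z')
      rw [mul_one] at this
      exact this
    exact ht.2.2.2.comp t h1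
  have hq2 : ∀ᶠ t in 𝓝 (0 : ℂ), q t ^ 2 = 1 := by
    filter_upwards [hev'] with t ht
    have e1 := h.eq _ ht.1
    have e2 := h.eq _ ht.2.2.1
    rw [ht.2.1, ← e1] at e2
    have hD : D (F (z' + t)) ≠ 0 := by
      intro h0; rw [h0, mul_zero] at e1; exact h.const_ne e1.symm
    have e3 := mul_right_cancel₀ hD e2
    simp only [hq, hk]
    rw [mul_pow, inv_pow, e3, inv_mul_cancel₀ (pow_ne_zero 2 (h.deriv_ne ht.1))]
  have hqc : ContinuousAt q 0 := by
    have hd := (h.diff.deriv (isOpen_strip r)).continuousOn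
    refine ContinuousAt.mul (ContinuousAt.inv₀ ?_ ?_) ?_
    · refine ContinuousAt.comp (g := deriv F) ?_ hkd.self_of_nhds.continuousAt
      rw [hk0]
      exact hd.continuousAt ((isOpen_strip r).mem_nhds hz)
    · rw [hk0]; exact h.deriv_ne hz
    · refine ContinuousAt.comp (g := deriv F) (f := fun t => z' + t) ?_ (by fun_prop)
      rw [add_zero]
      exact hd.continuousAt ((isOpen_strip r).mem_nhds hz')
  have hσ : q 0 = 1 ∨ q 0 = -1 := sq_eq_one_iff.1 hq2.self_of_nhds
  refine ⟨q 0, hσ, ?_⟩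
  have hqe : ∀ᶠ t in 𝓝 (0 : ℂ), q t = q 0 := by
    filter_upwards [hq2, hqc.eventually (Metric.ball_mem_nhds (q 0) one_pos)] with t h1 h2
    rcases sq_eq_one_iff.1 h1 with h3 | h3 <;> rcases hσ with h4 | h4
    · rw [h3, h4]
    · rw [h3, h4, dist_eq_norm] at h2; norm_num at h2
    · rw [h3, h4, dist_eq_norm] at h2; norm_num at h2
    · rw [h3, h4]
  obtain ⟨ρ, hρ, hball⟩ := Metric.eventually_nhds_iff_ball.1 ((hkd.and hqe).and hev')
  refine Metric.eventually_nhds_iff_ball.2 ⟨ρ, hρ, fun t ht => ?_⟩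
  have h1 : k t - q 0 * t = k 0 - q 0 * 0 := by
    refine (convex_ball (0 : ℂ) ρ).is_const_of_fderivWithin_eq_zero (𝕜 := ℂ)
      (f := fun t => k t - q 0 * t) (fun s hs => ?_) (fun s hs => ?_) ht (Metric.mem_ball_self hρ)
    · exact ((hball s hs).1.1.differentiableAt.sub
        (differentiableAt_id.const_mul _)).differentiableWithinAt
    · have : HasDerivAt (fun t => k t - q 0 * t) 0 s := by
        refine ((hball s hs).1.1.sub ((hasDerivAt_id s).const_mul (q 0))).congr_deriv ?_
        rw [(hball s hs).1.2]; ring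
      rw [fderivWithin_eq_fderiv (Metric.isOpen_ball.uniqueDiffWithinAt hs) this.differentiableAt]
      ext
      simp [this.deriv]
  have h2 : z + q 0 * t = k t := by rw [← hk0]; linear_combination -h1
  rw [h2]
  exact (hball t ht).2.2.1

theorem analyticOnNhd_comp (h : LiouvilleMap r D c F) (z σ : ℂ) {T : Set ℂ}
    (hT : ∀ t ∈ T, z + σ * t ∈ strip r) : AnalyticOnNhd ℂ (fun t => F (z + σ * t)) T := fun t ht => by
  have h1 : AnalyticAt ℂ F (z + σ * t) := h.diff.analyticAt ((isOpen_strip r).mem_nhds (hT t ht))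
  exact h1.comp (f := fun t => z + σ * t) (analyticAt_const.add (analyticAt_const.mul analyticAt_id))

theorem convex_affine_preimage (r : ℝ) (z σ : ℂ) : Convex ℝ {t : ℂ | z + σ * t ∈ strip r} := by
  intro s hs t ht a b ha hb hab
  have := convex_strip r hs ht ha hb hab
  have e : a • (z + σ * s) + b • (z + σ * t) = z + σ * (a • s + b • t) := by
    have : (a : ℂ) + b = 1 := by exact_mod_cast hab
    simp only [Complex.real_smul]
    linear_combination z * this
  rwa [e] at this

/-- Two points with the same image differ by a period. -/
theorem translate (h : LiouvilleMap r D c F) {z z' : ℂ} (hz : z ∈ strip r)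
    (hz' : z' ∈ strip r) (e : F z = F z') {t : ℂ} (ht : z + t ∈ strip r) (ht' : z' + t ∈ strip r) :
    F (z + t) = F (z' + t) := by
  obtain ⟨σ, hσ, hev⟩ := h.sign_translate hz hz' e
  set T : Set ℂ := {t | z + σ * t ∈ strip r} ∩ {t | z' + 1 * t ∈ strip r} with hTdef
  have hconv : Convex ℝ T := (convex_affine_preimage r z σ).inter (convex_affine_preimage r z' 1)
  have h0 : (0 : ℂ) ∈ T := ⟨by simpa using hz, by simpa using hz'⟩
  have key : EqOn (fun t => F (z + σ * t)) (fun t => F (z' + 1 * t)) T :=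
    (h.analyticOnNhd_comp z σ fun t ht => ht.1).eqOn_of_preconnected_of_eventuallyEq
      (h.analyticOnNhd_comp z' 1 fun t ht => ht.2) hconv.isPreconnected h0
      (by simpa [EventuallyEq] using hev)
  rcases hσ with rfl | rfl
  · have := key (x := t) ⟨by simpa using ht, by simpa using ht'⟩
    simpa using this
  -- A reflection would give `F (z - t) = F (z' + t)`. At `t = (z - z') / 2` both arguments are the
  -- midpoint `m`, which lies in the convex strip, and differentiation yields `-F' m = F' m`,
  -- although `F'` has no zero.
  · exfalso
    set m : ℂ := (z + z') / 2 with hm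
    have hmS : m ∈ strip r := by
      have := convex_strip r hz hz' (by norm_num : (0 : ℝ) ≤ 1 / 2) (by norm_num : (0 : ℝ) ≤ 1 / 2)
        (by norm_num)
      convert this using 1
      simp only [Complex.real_smul]; push_cast; rw [hm]; ring
    have e1 : z + -1 * ((z - z') / 2) = m := by rw [hm]; ring
    have e2 : z' + 1 * ((z - z') / 2) = m := by rw [hm]; ring
    have hmT : (z - z') / 2 ∈ T := ⟨show _ ∈ strip r by rw [e1]; exact hmS,
      show _ ∈ strip r by rw [e2]; exact hmS⟩
    have hTo : T ∈ 𝓝 ((z - z') / 2) := by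
      refine IsOpen.mem_nhds (IsOpen.inter ?_ ?_) hmT
      · exact (isOpen_strip r).preimage (by fun_prop)
      · exact (isOpen_strip r).preimage (by fun_prop)
    have hFm := (h.differentiableAt hmS).hasDerivAt
    have d1 : HasDerivAt (fun t => F (z + -1 * t)) (deriv F m * (-1 * 1)) ((z - z') / 2) := by
      refine HasDerivAt.comp (h₂ := F) _ (by rw [e1]; exact hFm) ?_
      exact ((hasDerivAt_id _).const_mul (-1 : ℂ)).const_add z
    have d2 : HasDerivAt (fun t => F (z' + 1 * t)) (deriv F m * (1 * 1)) ((z - z') / 2) := by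
      refine HasDerivAt.comp (h₂ := F) _ (by rw [e2]; exact hFm) ?_
      exact ((hasDerivAt_id _).const_mul (1 : ℂ)).const_add z'
    have d3 := d1.unique (d2.congr_of_eventuallyEq (eventually_of_mem hTo key))
    exact h.deriv_ne hmS (by linear_combination -d3 / 2)

/-- Thus `F'` depends only on the image point, which is what makes a branch of `√D` single valued on
the image. -/
theorem deriv_eq (h : LiouvilleMap r D c F) {z z' : ℂ} (hz : z ∈ strip r)
    (hz' : z' ∈ strip r) (e : F z = F z') : deriv F z = deriv F z' := by
  have hcont : ∀ w : ℂ, w ∈ strip r → ∀ᶠ t in 𝓝 (0 : ℂ), w + t ∈ strip r := fun w hw => by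
    have : ContinuousAt (fun t : ℂ => w + t) 0 := by fun_prop
    exact this.eventually_mem (by rw [add_zero]; exact (isOpen_strip r).mem_nhds hw)
  have hev : (fun t => F (z + t)) =ᶠ[𝓝 0] fun t => F (z' + t) := by
    filter_upwards [hcont z hz, hcont z' hz'] with t h1 h2 using h.translate hz hz' e h1 h2
  have := hev.deriv_eq
  rwa [deriv_comp_const_add, deriv_comp_const_add, add_zero, add_zero] at this

/-- The map is uniformly locally injective. -/
theorem exists_uniform_injective (h : LiouvilleMap r D c F) :
    ∃ η : ℝ, 0 < η ∧ ∀ z ∈ strip r, ∀ z' ∈ strip r, ‖z - z'‖ < η → F z = F z' → z = z' := by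
  have h0 : (0 : ℂ) ∈ strip r := by simpa using ofReal_mem_strip h.pos le_rfl
  have hs : HasStrictDerivAt F (deriv F 0) 0 :=
    (h.diff.analyticAt ((isOpen_strip r).mem_nhds h0)).hasStrictDerivAt
  obtain ⟨η, hη, hball⟩ := Metric.eventually_nhds_iff_ball.1
    ((hs.eventually_left_inverse (h.deriv_ne h0)).and ((isOpen_strip r).mem_nhds h0))
  refine ⟨η, hη, fun z hz z' hz' hlt e => ?_⟩
  have hmem : z' - z ∈ Metric.ball (0 : ℂ) η := by
    rw [mem_ball_zero_iff, norm_sub_rev]; exact hlt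
  -- Translation by `-z` moves the coincidence to `F 0 = F (z' - z)`, so the radius of injectivity
  -- at `0` serves at every point.
  have e1 := h.translate hz hz' e (t := -z) (by simpa using h0)
    (by rw [← sub_eq_add_neg]; exact (hball _ hmem).2)
  rw [add_neg_cancel, ← sub_eq_add_neg] at e1
  have e2 := (hball _ hmem).1
  rw [← e1, (hball 0 (Metric.mem_ball_self hη)).1] at e2
  exact (sub_eq_zero.1 e2.symm).symm

/-- `F` is univalent on balls of one fixed radius around the points of the smaller strip, and the
distortion theorem applies on each of them. -/
theorem exists_norm_deriv_deriv_le (h : LiouvilleMap r D c F) {ρ : ℝ} (hρ : ρ < r) :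
    ∃ K : ℝ, 0 < K ∧ ∀ z ∈ strip ρ, ‖deriv (deriv F) z / deriv F z‖ ≤ K := by
  obtain ⟨η, hη, hinj⟩ := h.exists_uniform_injective
  set R : ℝ := min (η / 2) (r - ρ) with hR
  have hR0 : 0 < R := lt_min (by positivity) (sub_pos.2 hρ)
  refine ⟨4096 * Real.exp 8 / R, by positivity, fun z hz => ?_⟩
  have hsub : Metric.ball z R ⊆ strip r :=
    (Metric.ball_subset_ball (min_le_right _ _)).trans (ball_subset_strip hz)
  have hzr : z ∈ strip r := strip_mono hρ.le hz
  rw [norm_div, div_le_iff₀ (norm_pos_iff.2 (h.deriv_ne hzr))]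
  refine norm_deriv_deriv_le_of_univalent hR0 (h.diff.mono hsub) ?_ fun w hw => h.deriv_ne (hsub hw)
  intro w hw w' hw' e
  refine hinj w (hsub hw) w' (hsub hw') ?_ e
  have h1 := Metric.mem_ball.1 hw
  have h2 := Metric.mem_ball'.1 hw'
  have h3 := dist_triangle w z w'
  have h4 : R ≤ η / 2 := min_le_left _ _
  rw [dist_eq_norm w w'] at h3
  linarith

end LiouvilleMap

/-! ### The formal solution -/

theorem sum_antidiagonal_succ_split (c d : ℕ → ℂ) (k : ℕ) :
    ∑ ij ∈ Finset.HasAntidiagonal.antidiagonal (k + 2), c ij.1 * d ij.2 =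
      c 0 * d (k + 2) + c (k + 2) * d 0 +
        conv (fun i => c (i + 1)) (fun i => d (i + 1)) k := by
  rw [Finset.Nat.sum_antidiagonal_succ, Finset.Nat.sum_antidiagonal_succ', conv]
  ring

/-- The coefficients of the formal solution with leading term `f₀` of a monic Riccati equation. -/
def formalCoeff (phat qhat : ℕ → ℂ → ℂ) (f₀ : ℂ → ℂ) : ℕ → ℂ → ℂ
  | 0 => f₀
  | k + 1 => fun x => (deriv (formalCoeff phat qhat f₀ k) x -
      ∑ i : Fin k, formalCoeff phat qhat f₀ (i + 1) x * formalCoeff phat qhat f₀ (k - i) x -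
      ∑ i : Fin (k + 1), phat (i + 1) x * formalCoeff phat qhat f₀ (k - i) x - qhat (k + 1) x) /
        (2 * f₀ x + phat 0 x)
termination_by k => k
decreasing_by all_goals omega

/-- At order `k + 1` the new coefficient enters linearly with factor `2 f₀ + p₀`, which is `±√D` in
the application and has no zero. Division by it gives existence and, in `formalSolution_unique`,
uniqueness. -/
theorem exists_formalSolution {phat qhat : ℕ → ℂ → ℂ} {U : Set ℂ} (hU : IsOpen U)
    (hp : ∀ k, DifferentiableOn ℂ (phat k) U) (hq : ∀ k, DifferentiableOn ℂ (qhat k) U)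
    {f₀ : ℂ → ℂ} (hf₀ : DifferentiableOn ℂ f₀ U)
    (heq : ∀ x ∈ U, f₀ x ^ 2 + phat 0 x * f₀ x + qhat 0 x = 0)
    (hne : ∀ x ∈ U, 2 * f₀ x + phat 0 x ≠ 0) :
    ∃ fhat : ℕ → ℂ → ℂ, IsFormalSolution phat qhat U fhat ∧ fhat 0 = f₀ := by
  set f := formalCoeff phat qhat f₀ with hf
  have h0 : f 0 = f₀ := by rw [hf, formalCoeff]
  have hs : ∀ k x, f (k + 1) x = (deriv (f k) x -
      ∑ i ∈ Finset.range k, f (i + 1) x * f (k - i) x -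
      ∑ i ∈ Finset.range (k + 1), phat (i + 1) x * f (k - i) x - qhat (k + 1) x) /
        (2 * f₀ x + phat 0 x) := by
    intro k x
    rw [hf, formalCoeff, ← Fin.sum_univ_eq_sum_range (fun i => formalCoeff phat qhat f₀ (i + 1) x *
      formalCoeff phat qhat f₀ (k - i) x), ← Fin.sum_univ_eq_sum_range (fun i => phat (i + 1) x *
      formalCoeff phat qhat f₀ (k - i) x)]
  have hd : ∀ k, DifferentiableOn ℂ (f k) U := by
    intro k
    induction k using Nat.strong_induction_on with
    | _ k ih =>
      cases k with
      | zero => rw [h0]; exact hf₀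
      | succ k =>
        have e : f (k + 1) = fun x => (deriv (f k) x -
            ∑ i ∈ Finset.range k, f (i + 1) x * f (k - i) x -
            ∑ i ∈ Finset.range (k + 1), phat (i + 1) x * f (k - i) x - qhat (k + 1) x) /
              (2 * f₀ x + phat 0 x) := funext (hs k)
        rw [e]
        refine DifferentiableOn.div ((((((ih k (by omega)).deriv hU).sub
          (DifferentiableOn.fun_sum fun i hi => ?_)).sub
          (DifferentiableOn.fun_sum fun i hi => ?_)).sub (hq _))) ((hf₀.const_mul 2).add (hp 0)) hne
        · have := Finset.mem_range.1 hi
          exact (ih _ (by omega)).mul (ih _ (by omega))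
        · exact (hp _).mul (ih _ (by omega))
  refine ⟨f, ⟨hd, fun k x hx => ?_⟩, h0⟩
  cases k with
  | zero =>
    simp only [if_true, Finset.Nat.antidiagonal_zero, Finset.sum_singleton, h0]
    linear_combination -heq x hx
  | succ k =>
    simp only [Nat.succ_ne_zero, if_false, Nat.add_sub_cancel]
    have e := hs k x
    rw [eq_div_iff (hne x hx)] at e
    rw [Finset.Nat.sum_antidiagonal_eq_sum_range_succ_mk,
      Finset.Nat.sum_antidiagonal_eq_sum_range_succ_mk, Finset.sum_range_succ,
      Finset.sum_range_succ', Finset.sum_range_succ' _ (k + 1)]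
    simp only [Nat.sub_self, Nat.sub_zero, h0, Nat.add_sub_add_right]
    linear_combination -e

theorem formalSolution_unique {phat qhat : ℕ → ℂ → ℂ} {U : Set ℂ} (hU : IsOpen U)
    {f g : ℕ → ℂ → ℂ} (hf : IsFormalSolution phat qhat U f) (hg : IsFormalSolution phat qhat U g)
    (hne : ∀ x ∈ U, 2 * f 0 x + phat 0 x ≠ 0) (h0 : EqOn (g 0) (f 0) U) (k : ℕ) :
    EqOn (g k) (f k) U := by
  induction k using Nat.strong_induction_on with
  | _ k ih =>
    cases k with
    | zero => exact h0
    | succ k =>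
      intro x hx
      have e1 := hf.2 (k + 1) x hx
      have e2 := hg.2 (k + 1) x hx
      have ed : deriv (g k) x = deriv (f k) x :=
        ((ih k (by omega)).eventuallyEq_of_mem (hU.mem_nhds hx)).deriv_eq
      have hi : ∀ i ∈ Finset.range k, g (i + 1) x * g (k + 1 - (i + 1)) x =
          f (i + 1) x * f (k + 1 - (i + 1)) x := fun i hi => by
        have := Finset.mem_range.1 hi
        rw [ih (i + 1) (by omega) hx, ih (k + 1 - (i + 1)) (by omega) hx]
      have hj : ∀ i ∈ Finset.range (k + 1), phat (i + 1) x * g (k + 1 - (i + 1)) x =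
          phat (i + 1) x * f (k + 1 - (i + 1)) x := fun i hi => by
        rw [ih (k + 1 - (i + 1)) (by omega) hx]
      simp only [Nat.succ_ne_zero, if_false, Nat.add_sub_cancel] at e1 e2
      rw [Finset.Nat.sum_antidiagonal_eq_sum_range_succ_mk,
        Finset.Nat.sum_antidiagonal_eq_sum_range_succ_mk, Finset.sum_range_succ,
        Finset.sum_range_succ', Finset.sum_range_succ' _ (k + 1)] at e1 e2
      rw [Finset.sum_congr rfl hi, Finset.sum_congr rfl hj, ed] at e2
      simp only [Nat.sub_self, Nat.sub_zero, h0 hx] at e1 e2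
      have : (2 * f 0 x + phat 0 x) * (g (k + 1) x - f (k + 1) x) = 0 := by
        linear_combination e1 - e2
      exact sub_eq_zero.1 ((mul_eq_zero.1 this).resolve_left (hne x hx))

/-! ### Gevrey calculus on a half plane -/

namespace GevreyRHP

variable {κ C C' M : ℝ} {g g' : ℂ → ℂ} {c c' : ℕ → ℂ}

theorem add (h : GevreyRHP κ C M g c) (h' : GevreyRHP κ C' M g' c') :
    GevreyRHP κ (C + C') M (fun s => g s + g' s) fun k => c k + c' k where
  diff := h.diff.add h'.diff
  bound n s hs := by
    rw [rem_add]
    refine (norm_add_le _ _).trans ((add_le_add (h.bound n s hs) (h'.bound n s hs)).trans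
      (le_of_eq (by ring)))

theorem const_mul (h : GevreyRHP κ C M g c) (a : ℂ) :
    GevreyRHP κ (‖a‖ * C) M (fun s => a * g s) fun k => a * c k where
  diff := h.diff.const_mul a
  bound n s hs := by
    have e : rem (a * g s) (fun k => a * c k) n s⁻¹ = a * rem (g s) c n s⁻¹ := by
      simp only [rem, mul_sub, Finset.mul_sum, mul_assoc]
    rw [e, norm_mul]
    refine (mul_le_mul_of_nonneg_left (h.bound n s hs) (norm_nonneg a)).trans (le_of_eq (by ring))

theorem mono_const (h : GevreyRHP κ C M g c) {M' : ℝ} (hM : 0 ≤ M) (hC : C ≤ C') (hM' : M ≤ M') :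
    GevreyRHP κ C' M' g c where
  diff := h.diff
  bound n s hs := by
    have h1 := h.const_nonneg
    have h2 := h1.trans hC
    refine (h.bound n s hs).trans ?_
    gcongr

theorem const (κ : ℝ) (hM : 0 ≤ M) (a : ℂ) :
    GevreyRHP κ ‖a‖ M (fun _ => a) fun k => if k = 0 then a else 0 where
  diff := differentiableOn_const _
  bound n s hs := by
    cases n with
    | zero => simp [rem_zero]
    | succ n =>
      have e : rem a (fun k => if k = 0 then a else 0) (n + 1) s⁻¹ = 0 := by
        rw [rem, Finset.sum_range_succ']; simp
      rw [e, norm_zero]; positivity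

/-- Removal of the leading term. -/
theorem shift (h : GevreyRHP κ C M g c) (hκ : 0 < κ) (hM : 0 ≤ M) :
    GevreyRHP κ (C * M) (2 * M) (fun s => s * (g s - c 0)) fun k => c (k + 1) where
  diff := differentiableOn_id.mul (h.diff.sub_const _)
  bound n s hs := by
    have hs0 := ne_zero_of_rhp hκ hs
    have hC := h.const_nonneg
    have e : rem (s * (g s - c 0)) (fun k => c (k + 1)) n s⁻¹ = s * rem (g s) c (n + 1) s⁻¹ := by
      simp only [rem, Finset.sum_range_succ', mul_sub, mul_add, Finset.mul_sum]
      have : ∀ k, s * (c (k + 1) * s⁻¹ ^ (k + 1)) = c (k + 1) * s⁻¹ ^ k := fun k => by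
        rw [pow_succ]; field_simp
      simp only [this]
      ring
    rw [e, norm_mul]
    calc ‖s‖ * ‖rem (g s) c (n + 1) s⁻¹‖
        ≤ ‖s‖ * (C * M ^ (n + 1) * ((n + 1).factorial : ℝ) * ‖s⁻¹‖ ^ (n + 1)) := by
          gcongr; exact h.bound _ s hs
      _ = (‖s‖ * ‖s⁻¹‖) * (C * M ^ (n + 1) * ((n + 1).factorial : ℝ) * ‖s⁻¹‖ ^ n) := by ring
      _ ≤ 1 * (C * M ^ (n + 1) * (2 ^ n * (n.factorial : ℝ)) * ‖s⁻¹‖ ^ n) := by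
          rw [← norm_mul, mul_inv_cancel₀ hs0, norm_one]
          gcongr; exact factorial_add_one_le n
      _ = _ := by rw [mul_pow]; ring

end GevreyRHP

/-! ### Reduction to the normal form on a strip -/

/-- A monic Riccati equation on the image of a strip, with Gevrey coefficients. -/
structure RiccatiData (θ δ C M r : ℝ) (D F : ℂ → ℂ) (p q : ℂ → ℂ → ℂ) (phat qhat : ℕ → ℂ → ℂ) :
    Prop where
  map : LiouvilleMap r D (dir θ ^ 2) F
  discr_eq : ∀ x ∈ F '' strip r, D x = discr phat qhat x
  disc_pos : 0 < δ
  const_pos : 0 < C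
  rate_pos : 0 < M
  p_coeff : ∀ k, DifferentiableOn ℂ (phat k) (F '' strip r)
  q_coeff : ∀ k, DifferentiableOn ℂ (qhat k) (F '' strip r)
  p_left : ∀ ħ ∈ borelDisc θ δ, DifferentiableOn ℂ (fun x => p x ħ) (F '' strip r)
  q_left : ∀ ħ ∈ borelDisc θ δ, DifferentiableOn ℂ (fun x => q x ħ) (F '' strip r)
  p_right : ∀ x ∈ F '' strip r, DifferentiableOn ℂ (p x) (borelDisc θ δ)
  q_right : ∀ x ∈ F '' strip r, DifferentiableOn ℂ (q x) (borelDisc θ δ)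
  p_bound : ∀ n, ∀ x ∈ F '' strip r, ∀ ħ ∈ borelDisc θ δ,
    ‖remainder p phat n x ħ‖ ≤ √‖D x‖ * (C * M ^ n * (n.factorial : ℝ) * ‖ħ‖ ^ n)
  q_bound : ∀ n, ∀ x ∈ F '' strip r, ∀ ħ ∈ borelDisc θ δ,
    ‖remainder q qhat n x ħ‖ ≤ ‖D x‖ * (C * M ^ n * (n.factorial : ℝ) * ‖ħ‖ ^ n)

/-- Bounds with respect to the scale `√D` become plain bounds after multiplication by `F'`, and
those with respect to `D` after multiplication by `F'²`. -/
theorem LiouvilleMap.sqrt_norm_eq {r : ℝ} {D F : ℂ → ℂ} {θ : ℝ}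
    (h : LiouvilleMap r D (dir θ ^ 2) F) {t : ℂ} (ht : t ∈ strip r) :
    √‖D (F t)‖ = ‖deriv F t‖⁻¹ := by
  have h1 := congrArg norm (h.eq t ht)
  rw [norm_mul, norm_pow, norm_pow, norm_dir, one_pow] at h1
  have h2 : 0 < ‖deriv F t‖ := norm_pos_iff.2 (h.deriv_ne ht)
  rw [Real.sqrt_eq_iff_mul_self_eq (norm_nonneg _) (by positivity)]
  field_simp
  linarith

theorem remainder_const_mul (a : ℂ) (f : ℂ → ℂ → ℂ) (fhat : ℕ → ℂ → ℂ) (n : ℕ) (x ħ : ℂ) :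
    remainder (fun x ħ => a * f x ħ) (fun k x => a * fhat k x) n x ħ =
      a * remainder f fhat n x ħ := by
  simp only [remainder, mul_sub, Finset.mul_sum, mul_assoc]

theorem norm_lt_of_mem_borelDisc {θ δ : ℝ} (hδ : 0 < δ) {ħ : ℂ} (hħ : ħ ∈ borelDisc θ δ) :
    ‖ħ‖ < δ := by
  have h1 : 1 / δ < (dir θ / ħ).re := hħ
  have h0 : 0 < ‖ħ‖ := norm_pos_iff.2 (ne_zero_of_mem_borelDisc hδ hħ)
  have h2 := h1.trans_le ((le_abs_self _).trans (Complex.abs_re_le_norm _))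
  rw [norm_div, norm_dir] at h2
  exact (one_div_lt_one_div hδ h0).1 h2

/-- The algebra behind the reduction of a Riccati equation to its normal form. -/
theorem normalForm_identity {e ħ ζ V L f₀ f₀' G' p q p₀ q₀ w a b : ℂ} (hħ : ħ ≠ 0) (hV : V ≠ 0)
    (hζ : ζ = e / ħ) (h0 : f₀ ^ 2 + p₀ * f₀ + q₀ = 0) (he : V * (2 * f₀ + p₀) = e)
    (hG' : G' = L * V * f₀ + V ^ 2 * f₀') (hb : b = L + V * (p - p₀) / ħ)
    (ha : e * a = V * f₀ * b + V ^ 2 * (q - q₀) / ħ - G') :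
    f₀' * V + (ħ * (ζ * (w + a) + w ^ 2 + b * w) / V - ħ * w * (L * V) / V ^ 2) =
      V * ((f₀ + ħ * w / V) ^ 2 + p * (f₀ + ħ * w / V) + q) / ħ := by
  have e1 : ζ * (w + a) = (V * (2 * f₀ + p₀) * w +
      (V * f₀ * b + V ^ 2 * (q - q₀) / ħ - G')) / ħ := by
    rw [hζ, he, ← ha]; ring
  have e2 : q₀ = -(f₀ ^ 2 + p₀ * f₀) := by linear_combination h0
  rw [e1, hG', hb, e2]
  field_simp
  ring

namespace RiccatiData

variable {θ δ C M r : ℝ} {D F : ℂ → ℂ} {p q : ℂ → ℂ → ℂ} {phat qhat : ℕ → ℂ → ℂ}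

theorem gevrey_p (h : RiccatiData θ δ C M r D F p q phat qhat) {t : ℂ} (ht : t ∈ strip r) :
    GevreyRHP (1 / δ) C M (fun s => deriv F t * p (F t) (dir θ / s))
      fun k => deriv F t * phat k (F t) * dir θ ^ k := by
  have hx := mem_image_of_mem F ht
  refine gevreyRHP_of_bound (f := fun x ħ => deriv F t * p x ħ)
    (fhat := fun k x => deriv F t * phat k x) h.disc_pos ((h.p_right _ hx).const_mul _)
    fun n ħ hħ => ?_
  have h2 : ‖deriv F t‖ ≠ 0 := norm_ne_zero_iff.2 (h.map.deriv_ne ht)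
  rw [remainder_const_mul, norm_mul]
  refine (mul_le_mul_of_nonneg_left (h.p_bound n _ hx ħ hħ) (norm_nonneg _)).trans (le_of_eq ?_)
  rw [h.map.sqrt_norm_eq ht, ← mul_assoc, mul_inv_cancel₀ h2, one_mul]

theorem gevrey_q (h : RiccatiData θ δ C M r D F p q phat qhat) {t : ℂ} (ht : t ∈ strip r) :
    GevreyRHP (1 / δ) C M (fun s => deriv F t ^ 2 * q (F t) (dir θ / s))
      fun k => deriv F t ^ 2 * qhat k (F t) * dir θ ^ k := by
  have hx := mem_image_of_mem F ht
  refine gevreyRHP_of_bound (f := fun x ħ => deriv F t ^ 2 * q x ħ)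
    (fhat := fun k x => deriv F t ^ 2 * qhat k x) h.disc_pos ((h.q_right _ hx).const_mul _)
    fun n ħ hħ => ?_
  have h1 := congrArg norm (h.map.eq t ht)
  rw [norm_mul, norm_pow (dir θ), norm_dir, one_pow] at h1
  rw [remainder_const_mul, norm_mul]
  refine (mul_le_mul_of_nonneg_left (h.q_bound n _ hx ħ hħ) (norm_nonneg _)).trans (le_of_eq ?_)
  rw [← mul_assoc, h1, one_mul]

/-- The second identity makes the linear part of the equation on the strip equal to `e^{iθ} / ħ`
exactly, with no dependence on `t`. The sign of the branch has been absorbed into `F`. -/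
theorem leading (h : RiccatiData θ δ C M r D F p q phat qhat) {t f₀ : ℂ} (ht : t ∈ strip r)
    (hf : f₀ = (-phat 0 (F t) + dir θ / deriv F t) / 2) :
    f₀ ^ 2 + phat 0 (F t) * f₀ + qhat 0 (F t) = 0 ∧
      deriv F t * (2 * f₀ + phat 0 (F t)) = dir θ := by
  have hV := h.map.deriv_ne ht
  have h1 := h.map.eq t ht
  rw [h.discr_eq _ (mem_image_of_mem F ht), discr] at h1
  refine ⟨?_, by rw [hf]; field_simp; ring⟩
  have h2 : (dir θ / deriv F t) ^ 2 = phat 0 (F t) ^ 2 - 4 * qhat 0 (F t) := by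
    rw [div_pow, ← h1]; field_simp
  rw [hf]
  linear_combination h2 / 4

/-- Existence of exact solutions on smaller strips, in the coordinate of the strip. -/
theorem exists_solution_strip (h : RiccatiData θ δ C M r D F p q phat qhat) {fhat : ℕ → ℂ → ℂ}
    (hf : IsFormalSolution phat qhat (F '' strip r) fhat)
    (hf0 : ∀ t ∈ strip r, fhat 0 (F t) = (-phat 0 (F t) + dir θ / deriv F t) / 2)
    {r₀ : ℝ} (hr₀ : r₀ < r) :
    ∃ δ' C' M' : ℝ, 0 < δ' ∧ δ' ≤ δ ∧ 0 < C' ∧ 0 < M' ∧ ∃ y : ℂ → ℂ → ℂ,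
      (∀ t ∈ strip r₀, DifferentiableOn ℂ (y t) (borelDisc θ δ')) ∧
      (∀ n, ∀ t ∈ strip r₀, ∀ ħ ∈ borelDisc θ δ',
        ‖y t ħ - ∑ k ∈ Finset.range n, fhat k (F t) * ħ ^ k‖ ≤
          ‖deriv F t‖⁻¹ * (C' * M' ^ n * (n.factorial : ℝ) * ‖ħ‖ ^ n)) ∧
      ∀ t ∈ strip r₀, ∀ ħ ∈ borelDisc θ δ', HasDerivAt (fun t => y t ħ)
        (deriv F t * (y t ħ ^ 2 + p (F t) ħ * y t ħ + q (F t) ħ) / ħ) t := by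
  set e : ℂ := dir θ with he
  have he0 : e ≠ 0 := dir_ne_zero θ
  have hen : ‖e⁻¹‖ = 1 := by rw [norm_inv, he, norm_dir, inv_one]
  have hκ : 0 < 1 / δ := one_div_pos.2 h.disc_pos
  have hC := h.const_pos
  have hM := h.rate_pos
  obtain ⟨r₁, hr₀₁, hr₁⟩ := exists_between hr₀
  obtain ⟨K, hK0, hK⟩ := h.map.exists_norm_deriv_deriv_le hr₁
  have hsub : strip r₁ ⊆ strip r := strip_mono hr₁.le
  have hopen := isOpen_strip r
  have hmaps : MapsTo F (strip r) (F '' strip r) := mapsTo_image F _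
  have hUo : IsOpen (F '' strip r) := h.map.isOpen_image hopen subset_rfl
  have hF' : DifferentiableOn ℂ (deriv F) (strip r) := h.map.diff.deriv hopen
  have hF'' : DifferentiableOn ℂ (deriv (deriv F)) (strip r) := hF'.deriv hopen
  -- This term arises when the weight in `f = f₀ + ħ W / F'` is differentiated. It is bounded by `K`
  -- on the intermediate strip `r₁`, the first reason for shrinking.
  set lam : ℂ → ℂ := fun t => deriv (deriv F) t / deriv F t with hlam
  have hlamd : DifferentiableOn ℂ lam (strip r) := hF''.div hF' fun t ht => h.map.deriv_ne ht
  set G₀ : ℂ → ℂ := fun t => deriv F t * fhat 0 (F t) with hG₀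
  have hcomp : ∀ k, DifferentiableOn ℂ (fun t => fhat k (F t)) (strip r) := fun k =>
    (hf.1 k).comp h.map.diff hmaps
  have hcompd : ∀ k, ∀ t ∈ strip r, HasDerivAt (fun t => fhat k (F t))
      (deriv (fhat k) (F t) * deriv F t) t := fun k t ht =>
    (((hf.1 k).differentiableAt (hUo.mem_nhds (hmaps ht))).hasDerivAt).comp t
      (h.map.differentiableAt ht).hasDerivAt
  have hF'd : ∀ t ∈ strip r, HasDerivAt (deriv F) (lam t * deriv F t) t := fun t ht => by
    refine (hF'.differentiableAt (hopen.mem_nhds ht)).hasDerivAt.congr_deriv ?_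
    rw [hlam]; have := h.map.deriv_ne ht; field_simp
  have hG₀d : DifferentiableOn ℂ G₀ (strip r) := hF'.mul (hcomp 0)
  have hG₀' : ∀ t ∈ strip r, deriv G₀ t =
      lam t * deriv F t * fhat 0 (F t) + deriv F t ^ 2 * deriv (fhat 0) (F t) := fun t ht => by
    refine ((hF'd t ht).mul (hcompd 0 t ht)).deriv.trans (by ring)
  set B₀ : ℝ := C + 1 with hB₀
  have hG₀b : ∀ t ∈ strip r, ‖G₀ t‖ ≤ B₀ := fun t ht => by
    have h1 := (h.gevrey_p ht).norm_coeff_le 0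
    have h2 := (h.leading ht (hf0 t ht)).2
    have h3 : G₀ t = (e - deriv F t * phat 0 (F t)) / 2 := by
      rw [hG₀]; linear_combination h2 / 2
    simp only [pow_zero, mul_one, Nat.factorial_zero, Nat.cast_one] at h1
    rw [h3, norm_div, Complex.norm_ofNat]
    have h4 := norm_sub_le e (deriv F t * phat 0 (F t))
    rw [he, norm_dir] at h4
    have := norm_nonneg (e - deriv F t * phat 0 (F t))
    linarith
  set B₁ : ℝ := B₀ / (r - r₁) with hB₁
  have hB₁0 : 0 ≤ B₁ := div_nonneg (by positivity) (sub_pos.2 hr₁).le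
  have hG₀'b : ∀ t ∈ strip r₁, ‖deriv G₀ t‖ ≤ B₁ := fun t ht =>
    norm_deriv_le_of_ball (sub_pos.2 hr₁) (hG₀d.mono (ball_subset_strip ht))
      fun w hw => hG₀b w (ball_subset_strip ht hw)
  -- With `s = e / ħ` one has `1 / ħ = e⁻¹ s`, so `b` is `lam + F' (p - p₀) / ħ`, and `a` is `(F' f₀
  -- b + F'² (q - q₀) / ħ - G₀') / e`. The division by `ħ` is paid for by the removal of the leading
  -- terms (`GevreyRHP.shift`), which doubles the rate `M`.
  set b : ℂ → ℂ → ℂ := fun t s => lam t +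
    e⁻¹ * (s * (deriv F t * p (F t) (e / s) - deriv F t * phat 0 (F t) * e ^ 0)) with hb
  set bh : ℕ → ℂ → ℂ := fun k t => (if k = 0 then lam t else 0) +
    e⁻¹ * (deriv F t * phat (k + 1) (F t) * e ^ (k + 1)) with hbh
  set a : ℂ → ℂ → ℂ := fun t s => e⁻¹ * (G₀ t * b t s) +
    (e⁻¹ * (e⁻¹ * (s * (deriv F t ^ 2 * q (F t) (e / s) -
      deriv F t ^ 2 * qhat 0 (F t) * e ^ 0))) + -(e⁻¹ * deriv G₀ t)) with ha
  set ah : ℕ → ℂ → ℂ := fun k t => e⁻¹ * (G₀ t * bh k t) +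
    (e⁻¹ * (e⁻¹ * (deriv F t ^ 2 * qhat (k + 1) (F t) * e ^ (k + 1))) +
      if k = 0 then -(e⁻¹ * deriv G₀ t) else 0) with hah
  set C₁ : ℝ := (K + C * M) + (B₀ * (K + C * M) + (C * M + B₁)) with hC₁
  have hbG' : ∀ t ∈ strip r₁, GevreyRHP (1 / δ) (K + C * M) (2 * M) (b t) fun k => bh k t :=
    fun t ht => by
      refine ((GevreyRHP.const (1 / δ) (by positivity : 0 ≤ 2 * M) (lam t)).add
        (((h.gevrey_p (hsub ht)).shift hκ hM.le).const_mul e⁻¹)).mono_const (by positivity) ?_ le_rfl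
      rw [hen, one_mul]
      gcongr
      exact hK t ht
  have hbG : ∀ t ∈ strip r₁, GevreyRHP (1 / δ) C₁ (2 * M) (b t) fun k => bh k t := fun t ht =>
    (hbG' t ht).mono_const (by positivity) (by
      rw [hC₁]; exact le_add_of_nonneg_right (by positivity)) le_rfl
  have haG : ∀ t ∈ strip r₁, GevreyRHP (1 / δ) C₁ (2 * M) (a t) fun k => ah k t := fun t ht => by
    refine ((((hbG' t ht).const_mul (G₀ t)).const_mul e⁻¹).add
      ((((((h.gevrey_q (hsub ht)).shift hκ hM.le).const_mul e⁻¹).const_mul e⁻¹)).add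
        (GevreyRHP.const (1 / δ) (by positivity : 0 ≤ 2 * M) (-(e⁻¹ * deriv G₀ t))))).mono_const
        (by positivity) ?_ le_rfl
    have h0 : ‖-(e⁻¹ * deriv G₀ t)‖ = ‖deriv G₀ t‖ := by rw [norm_neg, norm_mul, hen, one_mul]
    simp only [h0, hen, one_mul]
    rw [hC₁]
    have h1 : ‖G₀ t‖ * (K + C * M) ≤ B₀ * (K + C * M) :=
      mul_le_mul_of_nonneg_right (hG₀b t (hsub ht)) (by positivity)
    have h2 := hG₀'b t ht
    have h3 : 0 ≤ K + C * M := by positivity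
    linarith
  have hediv : ∀ s : ℂ, 1 / δ < s.re → e / s ∈ borelDisc θ δ := fun s hs => dir_div_mem_borelDisc hs
  have hbl : ∀ s : ℂ, 1 / δ < s.re → DifferentiableOn ℂ (fun t => b t s) (strip r) := fun s hs =>
    hlamd.add (((((hF'.mul ((h.p_left _ (hediv s hs)).comp h.map.diff hmaps)).sub
      ((hF'.mul ((h.p_coeff 0).comp h.map.diff hmaps)).mul_const _)).const_mul s)).const_mul _)
  have hal : ∀ s : ℂ, 1 / δ < s.re → DifferentiableOn ℂ (fun t => a t s) (strip r) := fun s hs => by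
    have h1 := ((hF'.pow 2).mul ((h.q_left _ (hediv s hs)).comp h.map.diff hmaps)).sub
      (((hF'.pow 2).mul ((h.q_coeff 0).comp h.map.diff hmaps)).mul_const (e ^ 0))
    exact ((hG₀d.mul (hbl s hs)).const_mul _).add
      ((((h1.const_mul s).const_mul _).const_mul _).add ((hG₀d.deriv hopen).const_mul _).neg)
  -- The coefficients of `W = F' (f - f₀) / ħ` in powers of `s⁻¹`: as `ħ = e / s`, the power `ħ ^ k`
  -- contributes `e ^ k`. The equations of order `1` and `k + 2` of the formal solution become the
  -- recursion `hw0`, `hws`.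
  set w : ℕ → ℂ → ℂ := fun k t => e ^ k * (deriv F t * fhat (k + 1) (F t)) with hw
  have hwd : ∀ k, DifferentiableOn ℂ (w k) (strip r) := fun k =>
    (hF'.mul (hcomp (k + 1))).const_mul _
  have hw' : ∀ k, ∀ t ∈ strip r, deriv (w k) t = e ^ k * (lam t * deriv F t * fhat (k + 1) (F t) +
      deriv F t ^ 2 * deriv (fhat (k + 1)) (F t)) := fun k t ht => by
    refine (((hF'd t ht).mul (hcompd (k + 1) t ht)).const_mul (e ^ k)).deriv.trans (by ring)
  have hw0 : ∀ t ∈ strip r, w 0 t = -ah 0 t := fun t ht => by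
    have h1 := hf.2 1 (F t) (hmaps ht)
    have h2 := (h.leading ht (hf0 t ht)).2
    simp only [one_ne_zero, if_false, Nat.sub_self] at h1
    rw [Finset.Nat.sum_antidiagonal_succ, Finset.Nat.sum_antidiagonal_succ] at h1
    simp only [Finset.Nat.antidiagonal_zero, Finset.sum_singleton, zero_add] at h1
    simp only [hw, hah, hbh, hG₀, if_true]
    rw [hG₀' t ht]
    field_simp
    rw [← he] at h2
    linear_combination -(e * deriv F t ^ 2) * h1 - e * deriv F t * fhat 1 (F t) * h2
  have hws : ∀ k, ∀ t ∈ strip r, w (k + 1) t =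
      deriv (w k) t - conv (fun i => bh i t + w i t) (fun i => w i t) k - ah (k + 1) t := by
    intro k t ht
    have h1 := hf.2 (k + 2) (F t) (hmaps ht)
    have h2 := (h.leading ht (hf0 t ht)).2
    rw [← he] at h2
    simp only [Nat.add_eq_zero_iff, OfNat.ofNat_ne_zero, and_false, if_false,
      show k + 2 - 1 = k + 1 by omega] at h1
    rw [sum_antidiagonal_succ_split (fun i => fhat i (F t)) (fun i => fhat i (F t)),
      sum_antidiagonal_succ_split (fun i => phat i (F t)) (fun i => fhat i (F t))] at h1
    have h3 : conv (fun i => bh i t + w i t) (fun i => w i t) k =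
        lam t * w k t + e ^ k * deriv F t ^ 2 *
          (conv (fun i => phat (i + 1) (F t)) (fun i => fhat (i + 1) (F t)) k +
            conv (fun i => fhat (i + 1) (F t)) (fun i => fhat (i + 1) (F t)) k) := by
      have h4 : ∀ ij ∈ Finset.HasAntidiagonal.antidiagonal k,
          (bh ij.1 t + w ij.1 t) * w ij.2 t = (if ij.1 = 0 then lam t else 0) * w ij.2 t +
            e ^ k * deriv F t ^ 2 * (phat (ij.1 + 1) (F t) * fhat (ij.2 + 1) (F t) +
              fhat (ij.1 + 1) (F t) * fhat (ij.2 + 1) (F t)) := by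
        rintro ⟨i, j⟩ hij
        have h5 : e ^ k = e ^ i * e ^ j := by
          rw [← pow_add, Finset.HasAntidiagonal.mem_antidiagonal.1 hij]
        simp only [hbh, hw]
        rw [h5, pow_succ]
        field_simp
        ring
      rw [conv, Finset.sum_congr rfl h4, Finset.sum_add_distrib, ← Finset.mul_sum,
        Finset.sum_add_distrib, conv, conv]
      congr 1
      rw [Finset.Nat.sum_antidiagonal_eq_sum_range_succ_mk, Finset.sum_range_succ']
      simp
    rw [h3, hw' k t ht]
    simp only [hw, hah, hbh, hG₀, Nat.succ_ne_zero, if_false, pow_succ]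
    field_simp
    linear_combination -(e * deriv F t ^ 2 * e ^ k) * h1 -
      e * deriv F t * e ^ k * fhat (k + 2) (F t) * h2
  obtain ⟨κ', C', M', hκ', hC', hM', W, hWG, hWd⟩ := exists_gevrey_solution hr₀₁ (C := C₁)
    (M := 2 * M) (by positivity) (by positivity) hκ (fun s hs => (hal s hs).mono hsub)
    (fun s hs => (hbl s hs).mono hsub) haG hbG (fun k => (hwd k).mono hsub)
    (fun t ht => hw0 t (hsub ht)) (fun k t ht => hws k t (hsub ht))
  have hκ'0 : 0 < κ' := hκ.trans_le hκ'
  have hδ' : 0 < 1 / κ' := one_div_pos.2 hκ'0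
  have hδ'le : 1 / κ' ≤ δ := by
    rw [one_div_le hκ'0 h.disc_pos]; exact hκ'
  have hsub₀ : strip r₀ ⊆ strip r := strip_mono hr₀.le
  have hre : ∀ ħ ∈ borelDisc θ (1 / κ'), κ' < (e / ħ).re := fun ħ hħ => by
    have : 1 / (1 / κ') < (e / ħ).re := hħ
    rwa [one_div_one_div] at this
  -- The order zero estimate of `f₀ + ħ W / F'` needs `B₀ + C' / κ'`. Order `n + 1` for `f` is order
  -- `n` for `W`, and the shift of the power of `M'` costs `C' / M'`.
  refine ⟨1 / κ', B₀ + 1 / κ' * C' + C' / M', M', hδ', hδ'le, by positivity, hM',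
    fun t ħ => fhat 0 (F t) + ħ * W t (e / ħ) / deriv F t, fun t ht => ?_, fun n t ht ħ hħ => ?_,
    fun t ht ħ hħ => ?_⟩
  · refine ((differentiableOn_id.mul ((hWG t ht).diff.comp ?_ hre)).div_const _).const_add _
    exact fun ħ hħ => ((differentiableAt_const _).div differentiableAt_id
      (ne_zero_of_mem_borelDisc hδ' hħ)).differentiableWithinAt
  · have hħ0 : ħ ≠ 0 := ne_zero_of_mem_borelDisc hδ' hħ
    have hV : deriv F t ≠ 0 := h.map.deriv_ne (hsub₀ ht)
    have hVn : 0 < ‖deriv F t‖ := norm_pos_iff.2 hV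
    have hinv : (e / ħ)⁻¹ = ħ / e := inv_div _ _
    have hninv : ‖(e / ħ)⁻¹‖ = ‖ħ‖ := by rw [hinv, norm_div, he, norm_dir, div_one]
    cases n with
    | zero =>
      have h1 := (hWG t ht).bound 0 _ (hre ħ hħ)
      simp only [rem_zero, pow_zero, mul_one, Nat.factorial_zero, Nat.cast_one] at h1
      have h2 : fhat 0 (F t) + ħ * W t (e / ħ) / deriv F t =
          (deriv F t)⁻¹ * (G₀ t + ħ * W t (e / ħ)) := by rw [hG₀]; field_simp
      simp only [Finset.range_zero, Finset.sum_empty, sub_zero, pow_zero, mul_one,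
        Nat.factorial_zero, Nat.cast_one]
      rw [h2, norm_mul, norm_inv]
      have h3 : ‖ħ * W t (e / ħ)‖ ≤ 1 / κ' * C' := by
        rw [norm_mul]
        have := (norm_lt_of_mem_borelDisc hδ' hħ).le
        gcongr
      gcongr
      refine (norm_add_le _ _).trans ((add_le_add (hG₀b t (hsub₀ ht)) h3).trans ?_)
      exact le_add_of_nonneg_right (by positivity)
    | succ n =>
      have h1 := (hWG t ht).bound n _ (hre ħ hħ)
      have h2 : fhat 0 (F t) + ħ * W t (e / ħ) / deriv F t -
          ∑ k ∈ Finset.range (n + 1), fhat k (F t) * ħ ^ k =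
          (deriv F t)⁻¹ * (ħ * rem (W t (e / ħ)) (fun k => w k t) n (e / ħ)⁻¹) := by
        have h3 : ∑ k ∈ Finset.range n, w k t * (e / ħ)⁻¹ ^ k =
            deriv F t * ∑ k ∈ Finset.range n, fhat (k + 1) (F t) * ħ ^ k := by
          rw [Finset.mul_sum]
          refine Finset.sum_congr rfl fun k _ => ?_
          simp only [hw]; rw [hinv, div_pow]; field_simp
        have h4 : ∑ k ∈ Finset.range n, fhat (k + 1) (F t) * ħ ^ (k + 1) =
            (∑ k ∈ Finset.range n, fhat (k + 1) (F t) * ħ ^ k) * ħ := by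
          rw [Finset.sum_mul]
          exact Finset.sum_congr rfl fun k _ => by rw [pow_succ]; ring
        rw [rem, h3, Finset.sum_range_succ', h4]
        field_simp
        ring
      rw [h2, norm_mul, norm_inv, norm_mul]
      rw [hninv] at h1
      refine mul_le_mul_of_nonneg_left ?_ (by positivity)
      have h4 : (n.factorial : ℝ) ≤ ((n + 1).factorial : ℝ) := by
        exact_mod_cast Nat.factorial_le (Nat.le_succ n)
      have h5 : C' / M' ≤ B₀ + 1 / κ' * C' + C' / M' :=
        le_add_of_nonneg_left (by positivity)
      calc ‖ħ‖ * ‖rem (W t (e / ħ)) (fun k => w k t) n (e / ħ)⁻¹‖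
          ≤ ‖ħ‖ * (C' * M' ^ n * (n.factorial : ℝ) * ‖ħ‖ ^ n) := by gcongr
        _ = C' / M' * M' ^ (n + 1) * (n.factorial : ℝ) * ‖ħ‖ ^ (n + 1) := by
            rw [pow_succ, pow_succ]; field_simp
        _ ≤ _ := by gcongr
  · have hħ0 : ħ ≠ 0 := ne_zero_of_mem_borelDisc hδ' hħ
    have hV : deriv F t ≠ 0 := h.map.deriv_ne (hsub₀ ht)
    have h1 := (hcompd 0 t (hsub₀ ht)).add
      (((hWd t ht (e / ħ) (hre ħ hħ)).const_mul ħ).div (hF'd t (hsub₀ ht)) hV)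
    have hediv : e / (e / ħ) = ħ := div_div_cancel₀ he0
    refine h1.congr_deriv ?_
    rw [← normalForm_identity (e := e) (ζ := e / ħ) (a := a t (e / ħ)) (b := b t (e / ħ))
      (L := lam t) (G' := deriv G₀ t) (f₀' := deriv (fhat 0) (F t)) hħ0 hV rfl
      (h.leading (hsub₀ ht) (hf0 t (hsub₀ ht))).1 (h.leading (hsub₀ ht) (hf0 t (hsub₀ ht))).2
      (hG₀' t (hsub₀ ht)) ?_ ?_]
    · field_simp
    · simp only [hb]; rw [hediv]; field_simp
    · simp only [ha, hG₀]; rw [hediv]; field_simp; ring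

end RiccatiData

/-! ### The exact solution on the halfstrip -/

/-- An exact solution on the product of `V` with a Borel disc, with Gevrey asymptotics with respect to
a scale. -/
structure ExactOn (θ δ C M : ℝ) (scale : ℂ → ℝ) (V : Set ℂ) (p q : ℂ → ℂ → ℂ) (fhat : ℕ → ℂ → ℂ)
    (f : ℂ → ℂ → ℂ) : Prop where
  right : ∀ x ∈ V, DifferentiableOn ℂ (f x) (borelDisc θ δ)
  bound : ∀ n, ∀ x ∈ V, ∀ ħ ∈ borelDisc θ δ,
    ‖remainder f fhat n x ħ‖ ≤ scale x * (C * M ^ n * (n.factorial : ℝ) * ‖ħ‖ ^ n)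
  equation : ∀ x ∈ V, ∀ ħ ∈ borelDisc θ δ,
    HasDerivAt (fun x => f x ħ) ((f x ħ ^ 2 + p x ħ * f x ħ + q x ħ) / ħ) x

/-- Watson's lemma for functions of `ħ` alone; `x` is only a dummy variable in `gevreyRHP_of_bound`.
It is the source of all the gluing and uniqueness below. -/
theorem eq_of_gevrey_bound {θ δ C M C' M' : ℝ} (hδ : 0 < δ) (hM : 0 < M) (hM' : 0 < M')
    {g g' : ℂ → ℂ} {c : ℕ → ℂ} (hg : DifferentiableOn ℂ g (borelDisc θ δ))
    (hg' : DifferentiableOn ℂ g' (borelDisc θ δ))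
    (hb : ∀ n, ∀ ħ ∈ borelDisc θ δ, ‖g ħ - ∑ k ∈ Finset.range n, c k * ħ ^ k‖ ≤
      C * M ^ n * (n.factorial : ℝ) * ‖ħ‖ ^ n)
    (hb' : ∀ n, ∀ ħ ∈ borelDisc θ δ, ‖g' ħ - ∑ k ∈ Finset.range n, c k * ħ ^ k‖ ≤
      C' * M' ^ n * (n.factorial : ℝ) * ‖ħ‖ ^ n) : EqOn g g' (borelDisc θ δ) := by
  intro ħ hħ
  have h1 := gevreyRHP_of_bound (x := 0) (f := fun _ => g) (fhat := fun k _ => c k) hδ hg hb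
  have h2 := gevreyRHP_of_bound (x := 0) (f := fun _ => g') (fhat := fun k _ => c k) hδ hg' hb'
  have h3 := h1.unique h2 (one_div_pos.2 hδ) hM hM' (ζ := dir θ / ħ) hħ
  simpa only [div_div_cancel₀ (dir_ne_zero θ)] using h3

/-- The solutions are built on strips, for each `r₀` separately. Their expansions at `t` depend only
on `F t`, so Watson's lemma makes their values agree over points with the same image and for
different `r₀`, and one function descends to the image. -/
theorem RiccatiData.exists_exact_solution {θ δ C M r : ℝ} {D F : ℂ → ℂ} {p q : ℂ → ℂ → ℂ}
    {phat qhat fhat : ℕ → ℂ → ℂ} (h : RiccatiData θ δ C M r D F p q phat qhat)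
    (hf : IsFormalSolution phat qhat (F '' strip r) fhat)
    (hf0 : ∀ t ∈ strip r, fhat 0 (F t) = (-phat 0 (F t) + dir θ / deriv F t) / 2) :
    ∃ (Δ : ℝ → ℝ) (f : ℂ → ℂ → ℂ), ∀ r₀ < r, 0 < Δ r₀ ∧ Δ r₀ ≤ δ ∧
      ∃ C' M' : ℝ, 0 < C' ∧ 0 < M' ∧
        ExactOn θ (Δ r₀) C' M' (fun x => √‖D x‖) (F '' strip r₀) p q fhat f := by
  have hall := fun (r₀ : ℝ) (hr₀ : r₀ < r) => h.exists_solution_strip hf hf0 hr₀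
  choose! Δ C' M' hΔ hΔδ hC' hM' y hyd hyb hye using hall
  have hcons : ∀ a < r, ∀ a' < r, ∀ t ∈ strip a, ∀ t' ∈ strip a', F t = F t' →
      ∀ ħ ∈ borelDisc θ (Δ a), ħ ∈ borelDisc θ (Δ a') → y a t ħ = y a' t' ħ := by
    intro a ha a' ha' t ht t' ht' e ħ hħ hħ'
    have hmin : 0 < min (Δ a) (Δ a') := lt_min (hΔ a ha) (hΔ a' ha')
    have hs : borelDisc θ (min (Δ a) (Δ a')) ⊆ borelDisc θ (Δ a) :=
      borelDisc_mono hmin (min_le_left _ _)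
    have hs' : borelDisc θ (min (Δ a) (Δ a')) ⊆ borelDisc θ (Δ a') :=
      borelDisc_mono hmin (min_le_right _ _)
    have hmem : ħ ∈ borelDisc θ (min (Δ a) (Δ a')) := by
      rcases min_choice (Δ a) (Δ a') with h1 | h1 <;> rw [h1] <;> assumption
    refine eq_of_gevrey_bound (C := ‖deriv F t‖⁻¹ * C' a) (C' := ‖deriv F t'‖⁻¹ * C' a')
      (c := fun k => fhat k (F t)) hmin (hM' a ha) (hM' a' ha')
      ((hyd a ha t ht).mono hs) ((hyd a' ha' t' ht').mono hs') (fun n x hx => ?_)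
      (fun n x hx => ?_) hmem
    · exact (hyb a ha n t ht x (hs hx)).trans (le_of_eq (by ring))
    · rw [e]
      exact (hyb a' ha' n t' ht' x (hs' hx)).trans (le_of_eq (by ring))
  classical
  -- By `hcons` the value does not depend on the chosen strip and preimage. The default `0` occurs
  -- only off the domain of the solution.
  set f : ℂ → ℂ → ℂ := fun x ħ =>
    if hx : ∃ a : ℝ × ℂ, a.1 < r ∧ a.2 ∈ strip a.1 ∧ F a.2 = x ∧ ħ ∈ borelDisc θ (Δ a.1) then
      y hx.choose.1 hx.choose.2 ħ else 0 with hfdef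
  have hfy : ∀ a < r, ∀ t ∈ strip a, ∀ ħ ∈ borelDisc θ (Δ a), f (F t) ħ = y a t ħ := by
    intro a ha t ht ħ hħ
    have hx : ∃ b : ℝ × ℂ, b.1 < r ∧ b.2 ∈ strip b.1 ∧ F b.2 = F t ∧ ħ ∈ borelDisc θ (Δ b.1) :=
      ⟨(a, t), ha, ht, rfl, hħ⟩
    simp only [hfdef]
    rw [dif_pos hx]
    obtain ⟨h1, h2, h3, h4⟩ := hx.choose_spec
    exact hcons _ h1 a ha _ h2 t ht h3 ħ h4 hħ
  refine ⟨Δ, f, fun a ha => ⟨hΔ a ha, hΔδ a ha, C' a, M' a, hC' a ha, hM' a ha, ?_, ?_, ?_⟩⟩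
  · rintro _ ⟨t, ht, rfl⟩
    exact (hyd a ha t ht).congr fun ħ hħ => hfy a ha t ht ħ hħ
  · rintro n _ ⟨t, ht, rfl⟩ ħ hħ
    rw [h.map.sqrt_norm_eq (strip_mono ha.le ht), remainder, hfy a ha t ht ħ hħ]
    exact hyb a ha n t ht ħ hħ
  · rintro _ ⟨t, ht, rfl⟩ ħ hħ
    have h1 := h.map.descent (isOpen_strip a) (strip_mono ha.le) (f := fun x => f x ħ)
      (g := fun t => y a t ħ)
      (fun t ht => (hye a ha t ht ħ hħ).differentiableAt.differentiableWithinAt)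
      (fun t ht => hfy a ha t ht ħ hħ) ht
    rw [(hye a ha t ht ħ hħ).deriv] at h1
    have hV := h.map.deriv_ne (strip_mono ha.le ht)
    refine h1.congr_deriv ?_
    rw [hfy a ha t ht ħ hħ]
    field_simp

namespace ExactOn

variable {θ δ C M : ℝ} {scale : ℂ → ℝ} {V : Set ℂ} {p q : ℂ → ℂ → ℂ} {fhat : ℕ → ℂ → ℂ}
  {f : ℂ → ℂ → ℂ}

theorem mono (h : ExactOn θ δ C M scale V p q fhat f) {V' : Set ℂ} (hV : V' ⊆ V) {δ' : ℝ}
    (hδ' : 0 < δ') (hd : δ' ≤ δ) : ExactOn θ δ' C M scale V' p q fhat f where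
  right x hx := (h.right x (hV hx)).mono (borelDisc_mono hδ' hd)
  bound n x hx ħ hħ := h.bound n x (hV hx) ħ (borelDisc_mono hδ' hd hħ)
  equation x hx ħ hħ := h.equation x (hV hx) ħ (borelDisc_mono hδ' hd hħ)

/-- Osgood's lemma: the order zero bound, with a continuous scale, gives local boundedness. -/
theorem isSolution (h : ExactOn θ δ C M scale V p q fhat f) (hV : IsOpen V) (hδ : 0 < δ)
    (hs : ContinuousOn scale V) : IsSolution p q (V ×ˢ borelDisc θ δ) f := by
  refine ⟨differentiableOn_of_separately (hV.prod (isOpen_borelDisc hδ))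
    (fun w hw => (h.equation _ hw.1 _ hw.2).differentiableAt)
    (fun w hw => (h.right _ hw.1).differentiableAt ((isOpen_borelDisc hδ).mem_nhds hw.2))
    fun w hw => ⟨scale w.1 * C + 1, ?_⟩, fun x ħ hw => ?_⟩
  · have hC : ∀ u ∈ V ×ˢ borelDisc θ δ, ‖f u.1 u.2‖ ≤ scale u.1 * C := fun u hu => by
      simpa [remainder] using h.bound 0 _ hu.1 _ hu.2
    have hcont : ContinuousAt (fun u : ℂ × ℂ => scale u.1 * C) w := by
      refine ContinuousAt.mul ?_ continuousAt_const
      exact ContinuousAt.comp (g := scale) (hs.continuousAt (hV.mem_nhds hw.1)) continuousAt_fst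
    filter_upwards [hcont.tendsto.eventually_le_const (lt_add_one (scale w.1 * C)),
      (hV.prod (isOpen_borelDisc hδ)).mem_nhds hw] with u hu1 hu2 using (hC u hu2).trans hu1
  · rw [(h.equation x hw.1 ħ hw.2).deriv]
    have := ne_zero_of_mem_borelDisc hδ hw.2
    field_simp

theorem gevreyUnif (h : ExactOn θ δ C M scale V p q fhat f) (hδ : 0 < δ) (hC : 0 < C)
    (hM : 0 < M) {𝕌 : Set (ℂ × ℂ)} (hsub : V ×ˢ borelDisc θ δ ⊆ 𝕌) : GevreyUnif θ V 𝕌 scale f fhat :=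
  ⟨borelDisc θ δ, isSectorialDomain_borelDisc hδ, hsub, C, M, hC, hM, h.bound⟩

theorem unifGevrey (h : ExactOn θ δ C M scale V p q fhat f) {K : ℝ} (hK : ∀ x ∈ V, scale x ≤ K)
    (hC : 0 ≤ C) (hM : 0 ≤ M) (hc : ∀ k, DifferentiableOn ℂ (fhat k) V) :
    UnifGevrey θ δ (K * C) M V f fhat where
  coeff := hc
  left ħ hħ x hx := (h.equation x hx ħ hħ).differentiableAt.differentiableWithinAt
  right := h.right
  bound n x hx ħ hħ := by
    refine (h.bound n x hx ħ hħ).trans ?_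
    calc scale x * (C * M ^ n * (n.factorial : ℝ) * ‖ħ‖ ^ n)
        ≤ K * (C * M ^ n * (n.factorial : ℝ) * ‖ħ‖ ^ n) :=
          mul_le_mul_of_nonneg_right (hK x hx) (by positivity)
      _ = _ := by ring

end ExactOn

theorem UnifGevrey.gevreyUnif {θ δ C M : ℝ} {U : Set ℂ} {f : ℂ → ℂ → ℂ} {fhat : ℕ → ℂ → ℂ}
    (h : UnifGevrey θ δ C M U f fhat) (hδ : 0 < δ) (hC : 0 < C) (hM : 0 < M) {𝕌 : Set (ℂ × ℂ)}
    (hsub : U ×ˢ borelDisc θ δ ⊆ 𝕌) : GevreyUnif θ U 𝕌 (fun _ => 1) f fhat :=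
  ⟨borelDisc θ δ, isSectorialDomain_borelDisc hδ, hsub, C, M, hC, hM, fun n x hx ħ hħ => by
    rw [one_mul]; exact h.bound n x hx ħ hħ⟩

theorem IsSolution.mono {p q f : ℂ → ℂ → ℂ} {𝕌 𝕍 : Set (ℂ × ℂ)} (h : IsSolution p q 𝕌 f)
    (hs : 𝕍 ⊆ 𝕌) : IsSolution p q 𝕍 f :=
  ⟨h.1.mono hs, fun x ħ hw => h.2 x ħ (hs hw)⟩

/-- Holomorphic functions on a Borel disc which share a Gevrey asymptotic expansion on smaller
sectorial domains coincide. -/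
theorem eqOn_of_gevreyUnif {θ δ : ℝ} (hδ : 0 < δ) {U U' : Set ℂ} {𝕌 𝕌' : Set (ℂ × ℂ)}
    {f g : ℂ → ℂ → ℂ} {fhat : ℕ → ℂ → ℂ} {x : ℂ} (hx : x ∈ U) (hx' : x ∈ U')
    (hf : DifferentiableOn ℂ (f x) (borelDisc θ δ)) (hg : DifferentiableOn ℂ (g x) (borelDisc θ δ))
    (hfG : GevreyUnif θ U 𝕌 (fun _ => 1) f fhat) (hgG : GevreyUnif θ U' 𝕌' (fun _ => 1) g fhat) :
    EqOn (g x) (f x) (borelDisc θ δ) := by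
  obtain ⟨S₁, hS₁, -, C₁, M₁, -, hM₁, hb₁⟩ := hfG
  obtain ⟨S₂, hS₂, -, C₂, M₂, -, hM₂, hb₂⟩ := hgG
  obtain ⟨δ₁, hδ₁, hs₁⟩ := hS₁.borelDisc_subset
  obtain ⟨δ₂, hδ₂, hs₂⟩ := hS₂.borelDisc_subset
  have hδ' : 0 < min δ (min δ₁ δ₂) := lt_min hδ (lt_min hδ₁ hδ₂)
  have hs : borelDisc θ (min δ (min δ₁ δ₂)) ⊆ borelDisc θ δ := borelDisc_mono hδ' (min_le_left _ _)
  have h1 : borelDisc θ (min δ (min δ₁ δ₂)) ⊆ S₁ := (borelDisc_mono hδ'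
    ((min_le_right _ _).trans (min_le_left _ _))).trans hs₁
  have h2 : borelDisc θ (min δ (min δ₁ δ₂)) ⊆ S₂ := (borelDisc_mono hδ'
    ((min_le_right _ _).trans (min_le_right _ _))).trans hs₂
  -- The two expansions may hold only on smaller sectorial domains. Watson's lemma applies on a
  -- common Borel disc, and the identity theorem extends the equality.
  have key : EqOn (g x) (f x) (borelDisc θ (min δ (min δ₁ δ₂))) :=
    eq_of_gevrey_bound (c := fun k => fhat k x) hδ' hM₂ hM₁ (hg.mono hs) (hf.mono hs)
      (fun n ħ hħ => by simpa only [one_mul, remainder] using hb₂ n x hx' ħ (h2 hħ))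
      (fun n ħ hħ => by simpa only [one_mul, remainder] using hb₁ n x hx ħ (h1 hħ))
  obtain ⟨ħ₀, hħ₀⟩ := nonempty_borelDisc (θ := θ) hδ'
  exact (hg.analyticOnNhd (isOpen_borelDisc hδ)).eqOn_of_preconnected_of_eventuallyEq
    (hf.analyticOnNhd (isOpen_borelDisc hδ)) (convex_borelDisc hδ).isPreconnected (hs hħ₀)
    (eventually_of_mem ((isOpen_borelDisc hδ').mem_nhds hħ₀) key)

/-- The `ħ`-slices of a solution are holomorphic. -/
theorem differentiableOn_slice {f : ℂ → ℂ → ℂ} {𝕌 : Set (ℂ × ℂ)} {x : ℂ} {T : Set ℂ}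
    (hf : DifferentiableOn ℂ (fun w : ℂ × ℂ => f w.1 w.2) 𝕌) (h : ∀ ħ ∈ T, (x, ħ) ∈ 𝕌) :
    DifferentiableOn ℂ (f x) T :=
  hf.comp (f := fun ħ : ℂ => (x, ħ)) (by fun_prop) h

/-- Holomorphic solutions are Gevrey with all their derivatives. -/
theorem UnifGevrey.deriv {θ δ C M d : ℝ} {U V : Set ℂ} {f : ℂ → ℂ → ℂ} {fhat : ℕ → ℂ → ℂ}
    (h : UnifGevrey θ δ C M V f fhat) (hd : 0 < d) (hU : IsOpen U)
    (hUV : ∀ x ∈ U, Metric.ball x d ⊆ V)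
    (hr : ∀ x ∈ U, DifferentiableOn ℂ (fun ħ => _root_.deriv (fun y => f y ħ) x) (borelDisc θ δ)) :
    UnifGevrey θ δ (C / d) M U (fun x ħ => _root_.deriv (fun y => f y ħ) x) fun k => _root_.deriv (fhat k) := by
  have hsub : U ⊆ V := fun x hx => hUV x hx (Metric.mem_ball_self hd)
  refine ⟨fun k => ((h.coeff k).mono hsub).deriv hU, fun ħ hħ => ((h.left ħ hħ).mono hsub).deriv hU,
    hr, fun n x hx ħ hħ => ?_⟩
  have hdiff : DifferentiableOn ℂ (fun y => remainder f fhat n y ħ) V :=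
    (h.left ħ hħ).sub (DifferentiableOn.fun_sum fun k _ => (h.coeff k).mul_const _)
  have hder : remainder (fun x ħ => _root_.deriv (fun y => f y ħ) x) (fun k => _root_.deriv (fhat k)) n x ħ =
      _root_.deriv (fun y => remainder f fhat n y ħ) x := by
    have hxV : V ∈ 𝓝 x := mem_of_superset (Metric.ball_mem_nhds x hd) (hUV x hx)
    refine (HasDerivAt.deriv (HasDerivAt.sub ?_ (HasDerivAt.fun_sum fun k _ => ?_))).symm
    · exact ((h.left ħ hħ).differentiableAt hxV).hasDerivAt
    · exact (((h.coeff k).differentiableAt hxV).hasDerivAt).mul_const _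
  rw [hder]
  refine (norm_deriv_le_of_ball hd (hdiff.mono (hUV x hx))
    fun y hy => h.bound n y (hUV x hx hy) ħ hħ).trans (le_of_eq (by ring))

/-! ### Integration of Gevrey asymptotic solutions -/

/-- Gevrey asymptotics on a Borel disc, for a function of `ħ` alone. -/
structure DiscGevrey (θ δ C M : ℝ) (g : ℂ → ℂ) (c : ℕ → ℂ) : Prop where
  diff : DifferentiableOn ℂ g (borelDisc θ δ)
  bound : ∀ n, ∀ ħ ∈ borelDisc θ δ, ‖g ħ - ∑ k ∈ Finset.range n, c k * ħ ^ k‖ ≤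
    C * M ^ n * (n.factorial : ℝ) * ‖ħ‖ ^ n

theorem DiscGevrey.mono {θ δ C C' M : ℝ} {g : ℂ → ℂ} {c : ℕ → ℂ} (h : DiscGevrey θ δ C M g c)
    (hM : 0 ≤ M) (hC : C ≤ C') : DiscGevrey θ δ C' M g c :=
  ⟨h.diff, fun n ħ hħ => (h.bound n ħ hħ).trans (by gcongr)⟩

theorem DiscGevrey.unique {θ δ C C' M : ℝ} {g g' : ℂ → ℂ} {c : ℕ → ℂ}
    (h : DiscGevrey θ δ C M g c) (h' : DiscGevrey θ δ C' M g' c) (hδ : 0 < δ) (hM : 0 < M) :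
    EqOn g g' (borelDisc θ δ) :=
  eq_of_gevrey_bound hδ hM hM h.diff h'.diff h.bound h'.bound

theorem segment_mem_ball {x y : ℂ} {d : ℝ} (hy : y ∈ Metric.ball x d) {s : ℝ} (hs : s ∈ Icc (0 : ℝ) 1) :
    x + s * (y - x) ∈ Metric.ball x d := by
  rw [mem_ball_iff_norm] at hy ⊢
  rw [add_sub_cancel_left, norm_mul, Complex.norm_real, Real.norm_of_nonneg hs.1]
  exact (mul_le_of_le_one_left (norm_nonneg _) hs.2).trans_lt hy

theorem segment_integral_eq {x y : ℂ} {d : ℝ} (hy : y ∈ Metric.ball x d) {g G : ℂ → ℂ}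
    (hg : ContinuousOn g (Metric.ball x d)) (hG : ∀ z ∈ Metric.ball x d, HasDerivAt G (g z) z) :
    (y - x) * ∫ s in (0 : ℝ)..1, g (x + s * (y - x)) = G y - G x := by
  have hc : ContinuousOn (fun s : ℝ => g (x + s * (y - x))) (Icc 0 1) :=
    hg.comp (by fun_prop) fun s hs => segment_mem_ball hy hs
  have h1 : ∀ s ∈ uIcc (0 : ℝ) 1, HasDerivAt (fun s : ℝ => G (x + s * (y - x)))
      (g (x + s * (y - x)) * (y - x)) s := by
    intro s hs
    rw [uIcc_of_le zero_le_one] at hs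
    have h2 : HasDerivAt (fun s : ℝ => x + (s : ℂ) * (y - x)) (1 * (y - x)) s :=
      ((Complex.ofRealCLM.hasDerivAt (x := s)).mul_const (y - x)).const_add x
    rw [one_mul] at h2
    exact HasDerivAt.comp s (hG _ (segment_mem_ball hy hs)) h2
  have h3 := intervalIntegral.integral_eq_sub_of_hasDerivAt h1
    (by
      refine ContinuousOn.intervalIntegrable ?_
      rw [uIcc_of_le zero_le_one]
      exact hc.mul continuousOn_const)
  rw [intervalIntegral.integral_mul_const] at h3
  rw [mul_comm, h3]
  simp

namespace UnifGevrey

variable {θ δ C M : ℝ} {U : Set ℂ} {f : ℂ → ℂ → ℂ} {fhat Fhat : ℕ → ℂ → ℂ}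

/-- The remainder of the primitive has the remainder of `f` as its derivative, so a step of length
`‖y - x‖` adds `C ‖y - x‖` to the constant and leaves the rate `M` unchanged. -/
theorem discGevrey_step (h : UnifGevrey θ δ C M U f fhat) (hδ : 0 < δ)
    (hF : ∀ k, ∀ x ∈ U, HasDerivAt (Fhat k) (fhat k x) x) {x y : ℂ} {d : ℝ}
    (hball : Metric.ball x d ⊆ U) (hy : y ∈ Metric.ball x d) {c : ℝ} {g : ℂ → ℂ}
    (hg : DiscGevrey θ δ c M g fun k => Fhat k x) :
    DiscGevrey θ δ (c + C * ‖y - x‖) M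
      (fun ħ => g ħ + (y - x) * ∫ s in (0 : ℝ)..1, f (x + s * (y - x)) ħ) fun k => Fhat k y where
  diff := by
    refine hg.diff.add (DifferentiableOn.const_mul ?_ _)
    simp only [intervalIntegral.integral_of_le zero_le_one]
    have hIoc : ∀ᵐ s ∂(MeasureTheory.volume.restrict (Ioc (0 : ℝ) 1)), s ∈ Ioc (0 : ℝ) 1 :=
      MeasureTheory.ae_restrict_mem measurableSet_Ioc
    refine differentiableOn_integral_param (isOpen_borelDisc hδ) (bound := fun _ => C)
      (fun ħ hħ => ?_) ?_ ?_ (MeasureTheory.integrable_const _)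
    · refine ContinuousOn.aestronglyMeasurable ?_ measurableSet_Ioc
      exact ((h.left ħ hħ).continuousOn.mono hball).comp (Continuous.continuousOn (by fun_prop))
        fun s hs => segment_mem_ball hy (Ioc_subset_Icc_self hs)
    · filter_upwards [hIoc] with s hs
      exact h.right _ (hball (segment_mem_ball hy (Ioc_subset_Icc_self hs)))
    · filter_upwards [hIoc] with s hs ħ hħ
      simpa [remainder] using
        h.bound 0 _ (hball (segment_mem_ball hy (Ioc_subset_Icc_self hs))) ħ hħ
  bound n ħ hħ := by
    obtain ⟨P, hP⟩ := ((h.left ħ hħ).mono hball).isExactOn_ball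
    have hx : x ∈ Metric.ball x d := Metric.mem_ball_self (Metric.pos_of_mem_ball hy)
    rw [segment_integral_eq (g := fun z => f z ħ) hy ((h.left ħ hħ).mono hball).continuousOn hP]
    have hd : ∀ z ∈ Metric.ball x d, HasDerivAt
        (fun z => P z - ∑ k ∈ Finset.range n, Fhat k z * ħ ^ k) (remainder f fhat n z ħ) z :=
      fun z hz => (hP z hz).sub (HasDerivAt.fun_sum fun k _ => (hF k z (hball hz)).mul_const _)
    have h1 := (convex_ball x d).norm_image_sub_le_of_norm_hasDerivWithin_le
      (fun z hz => (hd z hz).hasDerivWithinAt) (fun z hz => h.bound n z (hball hz) ħ hħ) hx hy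
    have e : g ħ + (P y - P x) - ∑ k ∈ Finset.range n, Fhat k y * ħ ^ k =
        (g ħ - ∑ k ∈ Finset.range n, Fhat k x * ħ ^ k) +
        (P y - ∑ k ∈ Finset.range n, Fhat k y * ħ ^ k -
          (P x - ∑ k ∈ Finset.range n, Fhat k x * ħ ^ k)) := by ring
    rw [e]
    refine (norm_add_le _ _).trans ((add_le_add (hg.bound n ħ hħ) h1).trans (le_of_eq (by ring)))

/-- The path keeps a distance `d` from the complement of `U`. Cut into `N` pieces with `K / N < d`,
it is covered by steps inside balls, of total cost `C K` whatever the end point. -/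
theorem exists_discGevrey (h : UnifGevrey θ δ C M U f fhat) (hU : IsOpen U) (hδ : 0 < δ)
    (hC : 0 ≤ C) (hM : 0 ≤ M) {x' : ℂ} (hF : IsFormalIntegral U x' fhat Fhat)
    {K : NNReal} {γ : ℝ → ℂ} (hγ : LipschitzOnWith K γ (Icc 0 1)) (h0 : γ 0 = x')
    (hmaps : MapsTo γ (Icc 0 1) U) :
    ∃ g, DiscGevrey θ δ (C * K) M g fun k => Fhat k (γ 1) := by
  have hcomp : IsCompact (γ '' Icc 0 1) := isCompact_Icc.image_of_continuousOn hγ.continuousOn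
  obtain ⟨d, hd, hthick⟩ := hcomp.exists_thickening_subset_open hU hmaps.image_subset
  obtain ⟨N, hN⟩ := exists_nat_gt ((K : ℝ) / d)
  have hN0 : (0 : ℝ) < N := (div_nonneg K.coe_nonneg hd.le).trans_lt hN
  have hKN : (K : ℝ) / N < d := by
    rw [div_lt_iff₀ hd] at hN
    rw [div_lt_iff₀ hN0]
    linarith
  have hmem : ∀ i : ℕ, i ≤ N → (i : ℝ) / N ∈ Icc (0 : ℝ) 1 := fun i hi =>
    ⟨by positivity, by rw [div_le_one hN0]; exact_mod_cast hi⟩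
  have key : ∀ i : ℕ, i ≤ N → ∃ g, DiscGevrey θ δ (C * (K * (i / N))) M g
      fun k => Fhat k (γ (i / N)) := by
    intro i
    induction i with
    | zero =>
      intro _
      refine ⟨fun _ => 0, differentiableOn_const _, fun n ħ _ => ?_⟩
      simp [h0, (hF _).1]
    | succ i ih =>
      intro hi
      obtain ⟨g, hg⟩ := ih (by omega)
      have h1 := hmem i (by omega)
      have h2 := hmem (i + 1) hi
      have hdist : dist (γ (((i + 1 : ℕ) : ℝ) / N)) (γ (i / N)) ≤ K / N := by
        refine (hγ.dist_le_mul _ h2 _ h1).trans (le_of_eq ?_)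
        have : ((i + 1 : ℕ) : ℝ) / N - i / N = 1 / N := by push_cast; ring
        rw [Real.dist_eq, this, abs_of_pos (by positivity)]
        ring
      have hball : Metric.ball (γ (i / N)) d ⊆ U :=
        (Metric.ball_subset_thickening (mem_image_of_mem γ h1) d).trans hthick
      refine ⟨_, (h.discGevrey_step hδ (fun k => (hF k).2) hball
        (Metric.mem_ball.2 (hdist.trans_lt hKN)) hg).mono hM ?_⟩
      rw [dist_eq_norm] at hdist
      calc C * (K * (i / N)) + C * ‖γ (((i + 1 : ℕ) : ℝ) / N) - γ (i / N)‖
          ≤ C * (K * (i / N)) + C * (K / N) := by gcongr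
        _ = _ := by push_cast; ring
  obtain ⟨g, hg⟩ := key N le_rfl
  have e : (N : ℝ) / N = 1 := div_self hN0.ne'
  rw [e, mul_one] at hg
  exact ⟨g, hg⟩

/-- At each `x` the integral is taken to be any function of `ħ` whose Gevrey expansion is `Fhat k
x`. Watson's lemma makes it unique, so the exact integral inherits path independence from the formal
one; the bounded lengths of the paths make the constants uniform. -/
theorem exists_integral (h : UnifGevrey θ δ C M U f fhat) (hU : IsOpen U) (hδ : 0 < δ)
    (hC : 0 < C) (hM : 0 < M) {x' : ℂ} (hx' : x' ∈ U) (hF : IsFormalIntegral U x' fhat Fhat)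
    (hpath : BoundedPaths U x') :
    ∃ (F : ℂ → ℂ → ℂ) (C' : ℝ), 0 < C' ∧ IsIntegral U (borelDisc θ δ) x' f F ∧
      UnifGevrey θ δ C' M U F Fhat := by
  obtain ⟨K, hK⟩ := hpath
  have hall : ∀ x ∈ U, ∃ g, DiscGevrey θ δ (C * K) M g fun k => Fhat k x := by
    intro x hx
    obtain ⟨γ, hγ, h0, h1, hmaps⟩ := hK x hx
    rw [← h1]
    exact h.exists_discGevrey hU hδ hC.le hM.le hF hγ h0 hmaps
  choose! F hFd using hall
  have hzero : ∀ ħ ∈ borelDisc θ δ, F x' ħ = 0 := by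
    have h1 : DiscGevrey θ δ 0 M (fun _ => 0) fun k => Fhat k x' :=
      ⟨differentiableOn_const _, fun n ħ _ => by simp [(hF _).1]⟩
    exact (hFd x' hx').unique h1 hδ hM
  have hder : ∀ ħ ∈ borelDisc θ δ, ∀ x ∈ U, HasDerivAt (fun y => F y ħ) (f x ħ) x := by
    intro ħ hħ x hx
    obtain ⟨d, hd, hball⟩ := Metric.isOpen_iff.1 hU x hx
    obtain ⟨P, hP⟩ := ((h.left ħ hħ).mono hball).isExactOn_ball
    have hev : (fun y => F y ħ) =ᶠ[𝓝 x] fun y => F x ħ + (P y - P x) := by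
      refine eventually_of_mem (Metric.ball_mem_nhds x hd) fun y hy => ?_
      have h1 := h.discGevrey_step hδ (fun k => (hF k).2) hball hy (hFd x hx)
      have h2 := (hFd y (hball hy)).unique h1 hδ hM hħ
      have h3 := segment_integral_eq (g := fun z => f z ħ) hy
        ((h.left ħ hħ).mono hball).continuousOn hP
      exact h2.trans (congrArg (F x ħ + ·) h3)
    exact (((hP x (Metric.mem_ball_self hd)).sub_const _).const_add _).congr_of_eventuallyEq hev
  refine ⟨F, C * K + 1, by positivity, fun ħ hħ => ⟨hzero ħ hħ, hder ħ hħ⟩,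
    fun k x hx => ((hF k).2 x hx).differentiableAt.differentiableWithinAt,
    fun ħ hħ x hx => (hder ħ hħ x hx).differentiableAt.differentiableWithinAt,
    fun x hx => (hFd x hx).diff, fun n x hx ħ hħ => ?_⟩
  exact ((hFd x hx).mono hM.le (by linarith)).bound n ħ hħ

theorem congr_coeff (h : UnifGevrey θ δ C M U f fhat) {fhat' : ℕ → ℂ → ℂ}
    (he : ∀ k, EqOn (fhat' k) (fhat k) U) : UnifGevrey θ δ C M U f fhat' where
  coeff k := (h.coeff k).congr (he k)
  left := h.left
  right := h.right
  bound n x hx ħ hħ := by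
    have : remainder f fhat' n x ħ = remainder f fhat n x ħ := by
      simp only [remainder, he _ hx]
    rw [this]
    exact h.bound n x hx ħ hħ

end UnifGevrey

/-- Formal integrals on connected domains are unique. -/
theorem IsFormalIntegral.eqOn {U : Set ℂ} (hU : IsOpen U) (hUc : IsPreconnected U) {x' : ℂ}
    (hx' : x' ∈ U) {fhat Fhat Fhat' : ℕ → ℂ → ℂ} (h : IsFormalIntegral U x' fhat Fhat)
    (h' : IsFormalIntegral U x' fhat Fhat') (k : ℕ) : EqOn (Fhat k) (Fhat' k) U := by
  refine hU.eqOn_of_deriv_eq hUc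
    (fun x hx => ((h k).2 x hx).differentiableAt.differentiableWithinAt)
    (fun x hx => ((h' k).2 x hx).differentiableAt.differentiableWithinAt)
    (fun x hx => by rw [((h k).2 x hx).deriv, ((h' k).2 x hx).deriv]) hx' ?_
  rw [(h k).1, (h' k).1]

theorem IsFormalIntegral.mono {U V : Set ℂ} (hV : V ⊆ U) {x' : ℂ} {fhat Fhat : ℕ → ℂ → ℂ}
    (h : IsFormalIntegral U x' fhat Fhat) : IsFormalIntegral V x' fhat Fhat :=
  fun k => ⟨(h k).1, fun x hx => (h k).2 x (hV hx)⟩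

namespace LiouvilleMap

variable {r : ℝ} {D F : ℂ → ℂ} {c : ℂ}

/-- On the injective image of a convex domain the terms of a series have primitives. -/
theorem exists_formalIntegral (h : LiouvilleMap r D c F) (hinj : InjOn F (strip r)) {T : Set ℂ}
    (hT : IsOpen T) (hTc : Convex ℝ T) (hTr : T ⊆ strip r) {fhat : ℕ → ℂ → ℂ}
    (hf : ∀ k, DifferentiableOn ℂ (fhat k) (F '' T)) (x' : ℂ) :
    ∃ Fhat, IsFormalIntegral (F '' T) x' fhat Fhat := by
  have hVo := h.isOpen_image hT hTr
  have hd : ∀ k, DifferentiableOn ℂ (fun t => fhat k (F t) * deriv F t) T := fun k =>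
    ((hf k).comp (h.diff.mono hTr) (mapsTo_image F T)).mul
      ((h.diff.deriv (isOpen_strip r)).mono hTr)
  -- Primitives exist in the coordinate `t` because `T` is convex; injectivity carries them to the
  -- image.
  have hprim : ∀ k, ∃ P : ℂ → ℂ, ∀ t ∈ T, HasDerivAt P (fhat k (F t) * deriv F t) t := fun k => by
    obtain ⟨P, hP⟩ := hTc.exists_forall_hasDerivWithinAt (hd k)
    exact ⟨P, fun t ht => (hP t ht).hasDerivAt (hT.mem_nhds ht)⟩
  choose P hP using hprim
  have hleft : ∀ t ∈ T, Function.invFunOn F T (F t) = t := fun t ht =>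
    (hinj.mono hTr).leftInvOn_invFunOn ht
  refine ⟨fun k x => P k (Function.invFunOn F T x) - P k (Function.invFunOn F T x'), fun k => ⟨sub_self _, ?_⟩⟩
  rintro _ ⟨t, ht, rfl⟩
  have h1 := h.descent hT hTr (f := fun x => P k (Function.invFunOn F T x)) (g := P k)
    (fun t ht => (hP k t ht).differentiableAt.differentiableWithinAt)
    (fun t ht => by rw [hleft t ht]) ht
  rw [(hP k t ht).deriv, mul_div_cancel_right₀ _ (h.deriv_ne (hTr ht))] at h1
  exact h1.sub_const _

/-- Images of segments: in `T` they have length at most `2 R`, and `F` stretches by at most `L`. -/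
theorem boundedPaths (h : LiouvilleMap r D c F) {T : Set ℂ} (hTc : Convex ℝ T)
    (hTr : T ⊆ strip r) {L R : ℝ} (hL : ∀ t ∈ T, ‖deriv F t‖ ≤ L) (hR : ∀ t ∈ T, ‖t‖ ≤ R)
    {x' : ℂ} (hx' : x' ∈ F '' T) : BoundedPaths (F '' T) x' := by
  obtain ⟨t', ht', rfl⟩ := hx'
  have hL0 : 0 ≤ L := (norm_nonneg _).trans (hL t' ht')
  have hR0 : 0 ≤ R := (norm_nonneg _).trans (hR t' ht')
  refine ⟨⟨L * (2 * R), by positivity⟩, ?_⟩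
  rintro _ ⟨t, ht, rfl⟩
  have hmem : ∀ s ∈ Icc (0 : ℝ) 1, t' + s * (t - t') ∈ T := fun s hs => by
    have := hTc ht' ht (sub_nonneg.2 hs.2) hs.1 (by ring)
    convert this using 1
    simp only [Complex.real_smul]; push_cast; ring
  refine ⟨fun s => F (t' + s * (t - t')), ?_, by simp, by simp, fun s hs => ⟨_, hmem s hs, rfl⟩⟩
  refine LipschitzOnWith.of_dist_le_mul fun s hs s' hs' => ?_
  rw [dist_eq_norm, Real.dist_eq]
  have h1 := hTc.norm_image_sub_le_of_norm_deriv_le (fun z hz => h.differentiableAt (hTr hz)) hL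
    (hmem s' hs') (hmem s hs)
  refine h1.trans ?_
  have e : t' + s * (t - t') - (t' + s' * (t - t')) = ((s - s' : ℝ) : ℂ) * (t - t') := by
    push_cast; ring
  rw [e, norm_mul, Complex.norm_real, Real.norm_eq_abs]
  have h2 : ‖t - t'‖ ≤ 2 * R := (norm_sub_le _ _).trans (by linarith [hR t ht, hR t' ht'])
  calc L * (|s - s'| * ‖t - t'‖) ≤ L * (|s - s'| * (2 * R)) := by gcongr
    _ = L * (2 * R) * |s - s'| := by ring

end LiouvilleMap

/-! ### Halfstrips, branches and exhaustion -/

/-- An affine change of variable. The sign disappears, since `(ε e^{iθ})² = e^{2iθ}`; it reappears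
in `IsWKBHalfstrip.exists_base`, which ties `F'` to the given branch of the root. -/
theorem IsWKBHalfstrip.liouvilleMap {X : Set ℂ} {D Ψ : ℂ → ℂ} {x₀ s₀ z₁ : ℂ} {θ ε r : ℝ}
    (h : IsWKBHalfstrip X D x₀ s₀ θ ε z₁ r Ψ) (hε : ε = 1 ∨ ε = -1) :
    LiouvilleMap r D (dir θ ^ 2) (fun t => Ψ (z₁ + ε * dir θ * t)) := by
  have hu : ‖(ε : ℂ) * dir θ‖ = 1 := by rcases hε with rfl | rfl <;> simp [norm_dir]
  have hu0 : (ε : ℂ) * dir θ ≠ 0 := by rintro h0; simp [h0] at hu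
  have hmem : ∀ t ∈ strip r, z₁ + ε * dir θ * t ∈ halfstrip θ ε z₁ r := fun t ht => by
    refine (infDist_ray_lt_iff_strip hu).2 ?_
    rwa [add_sub_cancel_left, mul_div_cancel_left₀ _ hu0]
  have hopen : IsOpen (halfstrip θ ε z₁ r) := isOpen_lt (Metric.continuous_infDist_pt _) continuous_const
  have hder : ∀ t ∈ strip r, HasDerivAt (fun t => Ψ (z₁ + ε * dir θ * t))
      (deriv Ψ (z₁ + ε * dir θ * t) * (ε * dir θ)) t := fun t ht => by
    have h1 : HasDerivAt (fun t : ℂ => z₁ + ε * dir θ * t) (ε * dir θ) t := by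
      simpa using ((hasDerivAt_id t).const_mul ((ε : ℂ) * dir θ)).const_add z₁
    exact HasDerivAt.comp t
      (h.differentiableOn.differentiableAt (hopen.mem_nhds (hmem t ht))).hasDerivAt h1
  refine ⟨h.radius_pos, pow_ne_zero _ (dir_ne_zero θ),
    fun t ht => (hder t ht).differentiableAt.differentiableWithinAt, fun t ht => ?_⟩
  rw [(hder t ht).deriv, mul_pow, mul_right_comm, h.liouville _ (hmem t ht)]
  rcases hε with rfl | rfl <;> push_cast <;> ring

theorem IsWKBHalfstrip.exists_base {X : Set ℂ} {D Ψ : ℂ → ℂ} {x₀ s₀ z₁ : ℂ} {θ ε r : ℝ}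
    (h : IsWKBHalfstrip X D x₀ s₀ θ ε z₁ r Ψ) (hε : ε = 1 ∨ ε = -1) :
    ∃ t ∈ strip r, Ψ (z₁ + ε * dir θ * t) = x₀ ∧
      deriv (fun t => Ψ (z₁ + ε * dir θ * t)) t * s₀ = ε * dir θ := by
  have hu : ‖(ε : ℂ) * dir θ‖ = 1 := by rcases hε with rfl | rfl <;> simp [norm_dir]
  have hu0 : (ε : ℂ) * dir θ ≠ 0 := by rintro h0; simp [h0] at hu
  have hopen : IsOpen (halfstrip θ ε z₁ r) := isOpen_lt (Metric.continuous_infDist_pt _) continuous_const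
  have e : z₁ + ε * dir θ * ((0 - z₁) / (ε * dir θ)) = 0 := by
    rw [mul_div_cancel₀ _ hu0, add_sub_cancel]
  have hmem : (0 - z₁) / (ε * dir θ) ∈ strip r := (infDist_ray_lt_iff_strip hu).1 h.zero_mem
  obtain ⟨τ, hτ⟩ : ∃ τ, τ = (0 - z₁) / (ε * dir θ) := ⟨_, rfl⟩
  rw [← hτ] at e hmem
  refine ⟨τ, hmem, by rw [e, h.base], ?_⟩
  have h1 : HasDerivAt (fun t : ℂ => z₁ + ε * dir θ * t) (ε * dir θ) τ := by
    simpa using ((hasDerivAt_id τ).const_mul ((ε : ℂ) * dir θ)).const_add z₁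
  have h2 := (h.differentiableOn.differentiableAt (hopen.mem_nhds h.zero_mem)).hasDerivAt
  have h3 : HasDerivAt (fun t => Ψ (z₁ + ε * dir θ * t)) (deriv Ψ 0 * (ε * dir θ)) τ :=
    HasDerivAt.comp τ (by rw [e]; exact h2) h1
  rw [h3.deriv, mul_right_comm, h.branch, one_mul]

theorem image_halfstrip {θ ε : ℝ} (hε : ε = 1 ∨ ε = -1) (z₁ : ℂ) (Ψ : ℂ → ℂ) (ρ : ℝ) :
    Ψ '' halfstrip θ ε z₁ ρ = (fun t => Ψ (z₁ + ε * dir θ * t)) '' strip ρ := by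
  have hu : ‖(ε : ℂ) * dir θ‖ = 1 := by rcases hε with rfl | rfl <;> simp [norm_dir]
  have hu0 : (ε : ℂ) * dir θ ≠ 0 := by rintro h0; simp [h0] at hu
  ext x
  constructor
  · rintro ⟨z, hz, rfl⟩
    refine ⟨_, (infDist_ray_lt_iff_strip hu).1 hz, ?_⟩
    beta_reduce
    rw [mul_div_cancel₀ _ hu0, add_sub_cancel]
  · rintro ⟨t, ht, rfl⟩
    refine ⟨_, (infDist_ray_lt_iff_strip hu).2 ?_, rfl⟩
    rwa [add_sub_cancel_left, mul_div_cancel_left₀ _ hu0]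

theorem injOn_strip_of_halfstrip {θ ε : ℝ} (hε : ε = 1 ∨ ε = -1) {z₁ : ℂ} {Ψ : ℂ → ℂ} {ρ : ℝ}
    (h : InjOn Ψ (halfstrip θ ε z₁ ρ)) : InjOn (fun t => Ψ (z₁ + ε * dir θ * t)) (strip ρ) := by
  have hu : ‖(ε : ℂ) * dir θ‖ = 1 := by rcases hε with rfl | rfl <;> simp [norm_dir]
  have hu0 : (ε : ℂ) * dir θ ≠ 0 := by rintro h0; simp [h0] at hu
  have hmem : ∀ t ∈ strip ρ, z₁ + ε * dir θ * t ∈ halfstrip θ ε z₁ ρ := fun t ht => by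
    refine (infDist_ray_lt_iff_strip hu).2 ?_
    rwa [add_sub_cancel_left, mul_div_cancel_left₀ _ hu0]
  intro t ht t' ht' e
  exact mul_left_cancel₀ hu0 (add_left_cancel (h (hmem t ht) (hmem t' ht') e))

namespace LiouvilleMap

variable {r : ℝ} {D F : ℂ → ℂ} {c : ℂ}

/-- The square root of `D` has a holomorphic branch on the image of the strip. -/
theorem exists_branch (h : LiouvilleMap r D c F) {u : ℂ} (hu : u ^ 2 = c) :
    ∃ σ : ℂ → ℂ, (∀ t ∈ strip r, σ (F t) = u / deriv F t) ∧
      DifferentiableOn ℂ σ (F '' strip r) ∧ ∀ x ∈ F '' strip r, σ x ^ 2 = D x := by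
  classical
  -- The choice of the preimage is immaterial by `deriv_eq`.
  set σ : ℂ → ℂ := fun x =>
    if hx : ∃ t, t ∈ strip r ∧ F t = x then u / deriv F hx.choose else 0 with hσ
  have key : ∀ t ∈ strip r, σ (F t) = u / deriv F t := by
    intro t ht
    have hx : ∃ t', t' ∈ strip r ∧ F t' = F t := ⟨t, ht, rfl⟩
    simp only [hσ]
    rw [dif_pos hx, h.deriv_eq hx.choose_spec.1 ht hx.choose_spec.2]
  refine ⟨σ, key, ?_, ?_⟩
  · rintro _ ⟨t, ht, rfl⟩
    exact (h.descent (isOpen_strip r) subset_rfl (f := σ) (g := fun t => u / deriv F t)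
      ((differentiableOn_const u).div (h.diff.deriv (isOpen_strip r)) fun t ht => h.deriv_ne ht)
      key ht).differentiableAt.differentiableWithinAt
  · rintro _ ⟨t, ht, rfl⟩
    have := h.deriv_ne ht
    rw [key t ht, div_pow, hu, ← h.eq t ht]
    field_simp

/-- Compact subsets of the image of the strip are covered by images of bounded convex domains. -/
theorem exists_convex_cover (h : LiouvilleMap r D c F) {K : Set ℂ} (hK : IsCompact K)
    (hKr : K ⊆ F '' strip r) :
    ∃ (ρ : ℝ) (T : Set ℂ), 0 < ρ ∧ ρ < r ∧ T ⊆ strip ρ ∧ IsOpen T ∧ Convex ℝ T ∧ K ⊆ F '' T ∧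
      ∃ L : ℝ, ∀ t ∈ T, ‖t‖ ≤ L ∧ ‖deriv F t‖ ≤ L ∧ ‖deriv F t‖⁻¹ ≤ L := by
  -- An increasing exhaustion of the strip by bounded convex open sets; the `2` keeps `ρ 0 = r / 2`
  -- positive.
  set ρ : ℕ → ℝ := fun n => r - r / (n + 2) with hρ
  set T : ℕ → Set ℂ := fun n => strip (ρ n) ∩ Metric.ball 0 n with hT
  have hr := h.pos
  have hρr : ∀ n, ρ n < r := fun n => sub_lt_self _ (by positivity)
  have hρ0 : ∀ n, 0 < ρ n := fun n => by
    refine sub_pos.2 (div_lt_self hr ?_)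
    have : (0 : ℝ) ≤ n := n.cast_nonneg
    linarith
  have hTo : ∀ n, IsOpen (T n) := fun n => (isOpen_strip _).inter Metric.isOpen_ball
  have hTr : ∀ n, T n ⊆ strip r := fun n => inter_subset_left.trans (strip_mono (hρr n).le)
  have hmono : Monotone T := fun m n hmn => by
    have h1 : (m : ℝ) ≤ n := by exact_mod_cast hmn
    refine inter_subset_inter (strip_mono ?_) (Metric.ball_subset_ball h1)
    refine sub_le_sub_left (div_le_div_of_nonneg_left hr.le (by positivity) (by linarith)) _
  obtain ⟨n, hn⟩ := hK.elim_directed_cover (fun n => F '' T n)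
    (fun n => h.isOpen_image (hTo n) (hTr n)) (by
      intro x hx
      obtain ⟨t, ht, rfl⟩ := hKr hx
      obtain ⟨a, ha, hta⟩ := exists_mem_strip_lt ht
      obtain ⟨n, hn⟩ := exists_nat_gt (max ‖t‖ (r / (r - a)))
      refine mem_iUnion.2 ⟨n, t, ⟨strip_mono ?_ hta, ?_⟩, rfl⟩
      · have h1 : r / (r - a) < n := (le_max_right _ _).trans_lt hn
        have h2 : 0 < r - a := sub_pos.2 ha
        rw [div_lt_iff₀ h2] at h1
        have h3 : r / (n + 2) ≤ r - a := by
          rw [div_le_iff₀ (by positivity)]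
          nlinarith
        simp only [hρ]; linarith
      · exact mem_ball_zero_iff.2 ((le_max_left _ _).trans_lt hn))
    (Monotone.directed_le fun m n hmn => image_mono (hmono hmn))
  -- So `closure (T n)` is compact in the open strip, and both `F'` and `1 / F'` are bounded on it.
  have hcl : closure (T n) ⊆ strip r := fun z hz => by
    obtain ⟨w, hw, hd⟩ := Metric.mem_closure_iff.1 hz (r - ρ n) (sub_pos.2 (hρr n))
    exact ball_subset_strip hw.1 hd
  have hcomp : IsCompact (closure (T n)) :=
    (Metric.isBounded_ball.subset inter_subset_right).isCompact_closure
  have hdc : ContinuousOn (deriv F) (closure (T n)) :=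
    ((h.diff.deriv (isOpen_strip r)).mono hcl).continuousOn
  obtain ⟨L₁, hL₁⟩ := hcomp.exists_bound_of_continuousOn hdc
  obtain ⟨L₂, hL₂⟩ := hcomp.exists_bound_of_continuousOn
    (hdc.inv₀ fun t ht => h.deriv_ne (hcl ht))
  refine ⟨ρ n, T n, hρ0 n, hρr n, inter_subset_left, hTo n,
    (convex_strip _).inter (convex_ball _ _), hn, max n (max L₁ L₂), fun t ht => ⟨?_, ?_, ?_⟩⟩
  · exact (mem_ball_zero_iff.1 ht.2).le.trans (le_max_left _ _)
  · exact (hL₁ t (subset_closure ht)).trans ((le_max_left _ _).trans (le_max_right _ _))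
  · rw [← norm_inv]
    exact (hL₂ t (subset_closure ht)).trans ((le_max_right _ _).trans (le_max_right _ _))

end LiouvilleMap

/-- Continuous functions with equal squares which agree at a point where they do not vanish agree
near that point. -/
theorem eventuallyEq_of_sq_eq {f g : ℂ → ℂ} {x : ℂ} (hf : ContinuousAt f x) (hg : ContinuousAt g x)
    (hfg : f x = g x) (h0 : g x ≠ 0) (hsq : ∀ᶠ y in 𝓝 x, f y ^ 2 = g y ^ 2) : f =ᶠ[𝓝 x] g := by
  have hne : ∀ᶠ y in 𝓝 x, f y + g y ≠ 0 :=
    (hf.add hg).eventually_ne (by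
      change f x + g x ≠ 0
      rw [hfg, ← two_mul]; exact mul_ne_zero two_ne_zero h0)
  filter_upwards [hsq, hne] with y h1 h2
  have : (f y - g y) * (f y + g y) = 0 := by linear_combination h1
  exact sub_eq_zero.1 ((mul_eq_zero.1 this).resolve_right h2)

/-! ### Uniform data on one Borel disc, and resummation of derivatives and integrals -/

theorem exists_riccatiData {X S : Set ℂ} {θ r : ℝ} {D F : ℂ → ℂ} {p q : ℂ → ℂ → ℂ}
    {phat qhat : ℕ → ℂ → ℂ} (hF : LiouvilleMap r D (dir θ ^ 2) F) (hD : D = discr phat qhat)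
    (hp : DifferentiableOn ℂ (fun w : ℂ × ℂ => p w.1 w.2) (X ×ˢ S))
    (hq : DifferentiableOn ℂ (fun w : ℂ × ℂ => q w.1 w.2) (X ×ˢ S))
    (hpa : ∀ k, DifferentiableOn ℂ (phat k) X) (hqa : ∀ k, DifferentiableOn ℂ (qhat k) X)
    (hX : F '' strip r ⊆ X)
    (hpG : GevreyUnif θ (F '' strip r) (X ×ˢ S) (fun x => √‖D x‖) p phat)
    (hqG : GevreyUnif θ (F '' strip r) (X ×ˢ S) (fun x => ‖D x‖) q qhat) :
    ∃ δ C M : ℝ, borelDisc θ δ ⊆ S ∧ RiccatiData θ δ C M r D F p q phat qhat := by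
  obtain ⟨S₁, hS₁, hsub₁, C₁, M₁, hC₁, hM₁, hb₁⟩ := hpG
  obtain ⟨S₂, hS₂, -, C₂, M₂, hC₂, hM₂, hb₂⟩ := hqG
  obtain ⟨δ₁, hδ₁, hd₁⟩ := hS₁.borelDisc_subset
  obtain ⟨δ₂, hδ₂, hd₂⟩ := hS₂.borelDisc_subset
  have hδ : 0 < min δ₁ δ₂ := lt_min hδ₁ hδ₂
  have h1 : borelDisc θ (min δ₁ δ₂) ⊆ S₁ := (borelDisc_mono hδ (min_le_left _ _)).trans hd₁
  have h2 : borelDisc θ (min δ₁ δ₂) ⊆ S₂ := (borelDisc_mono hδ (min_le_right _ _)).trans hd₂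
  have hx : (F '' strip r).Nonempty :=
    ⟨F 0, 0, ⟨0, le_rfl, by simpa using hF.pos⟩, rfl⟩
  obtain ⟨x, hx⟩ := hx
  have hsub : borelDisc θ (min δ₁ δ₂) ⊆ S := fun ħ hħ => (hsub₁ (mk_mem_prod hx (h1 hħ))).2
  have hpoly : ∀ {C M : ℝ}, 0 < C → 0 < M → C ≤ max C₁ C₂ → M ≤ max M₁ M₂ → ∀ (n : ℕ) (ħ : ℂ),
      C * M ^ n * (n.factorial : ℝ) * ‖ħ‖ ^ n ≤
        max C₁ C₂ * max M₁ M₂ ^ n * (n.factorial : ℝ) * ‖ħ‖ ^ n := by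
    intro C M hC hM hCC hMM n ħ
    have : M ^ n ≤ max M₁ M₂ ^ n := pow_le_pow_left₀ hM.le hMM n
    gcongr
  refine ⟨min δ₁ δ₂, max C₁ C₂, max M₁ M₂, hsub, hF, fun x _ => by rw [hD], hδ,
    lt_max_of_lt_left hC₁, lt_max_of_lt_left hM₁, fun k => (hpa k).mono hX,
    fun k => (hqa k).mono hX, fun ħ hħ => ?_, fun ħ hħ => ?_, fun x hx => ?_, fun x hx => ?_,
    fun n x hx ħ hħ => ?_, fun n x hx ħ hħ => ?_⟩
  · exact hp.comp (f := fun x : ℂ => (x, ħ)) (by fun_prop) fun x hx => ⟨hX hx, hsub hħ⟩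
  · exact hq.comp (f := fun x : ℂ => (x, ħ)) (by fun_prop) fun x hx => ⟨hX hx, hsub hħ⟩
  · exact differentiableOn_slice hp fun ħ hħ => ⟨hX hx, hsub hħ⟩
  · exact differentiableOn_slice hq fun ħ hħ => ⟨hX hx, hsub hħ⟩
  · exact (hb₁ n x hx ħ (h1 hħ)).trans (mul_le_mul_of_nonneg_left
      (hpoly hC₁ hM₁ (le_max_left _ _) (le_max_left _ _) n ħ) (Real.sqrt_nonneg _))
  · exact (hb₂ n x hx ħ (h2 hħ)).trans (mul_le_mul_of_nonneg_left
      (hpoly hC₂ hM₂ (le_max_right _ _) (le_max_right _ _) n ħ) (norm_nonneg _))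

/-- Derivatives of exact solutions are Borel resummations. -/
theorem UnifGevrey.isBorelResummation_deriv {θ δ δ₁ C M : ℝ} {U V : Set ℂ} {p q f : ℂ → ℂ → ℂ}
    {fhat : ℕ → ℂ → ℂ} (h : UnifGevrey θ δ C M V f fhat) (hδ : 0 < δ) (hC : 0 < C) (hM : 0 < M)
    (hδ₁0 : 0 < δ₁) (hδ₁ : δ₁ < δ) (hU : IsOpen U) (hUc : IsCompact (closure U)) (hV : IsOpen V)
    (hUV : closure U ⊆ V) (hp : ∀ x ∈ V, DifferentiableOn ℂ (p x) (borelDisc θ δ))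
    (hq : ∀ x ∈ V, DifferentiableOn ℂ (q x) (borelDisc θ δ))
    (hsol : IsSolution p q (V ×ˢ borelDisc θ δ) f) :
    IsBorelResummation θ U (borelDisc θ δ₁) (fun k => _root_.deriv (fhat k))
      fun x ħ => _root_.deriv (fun y => f y ħ) x := by
  obtain ⟨d, hd, hdV⟩ := hUc.exists_thickening_subset_open hV hUV
  have hball : ∀ x ∈ U, Metric.ball x d ⊆ V := fun x hx =>
    (Metric.ball_subset_thickening (subset_closure hx) d).trans hdV
  refine (h.deriv hd hU hball fun x hx => ?_).isBorelResummation hU hδ (div_pos hC hd) hM hδ₁0 hδ₁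
  have hxV : x ∈ V := hUV (subset_closure hx)
  have hfx := h.right x hxV
  -- Holomorphy in `ħ` of the `x`-derivative is read off from the equation, as `(f² + p f + q) / ħ`.
  refine (((hfx.pow 2).add ((hp x hxV).mul hfx)).add (hq x hxV)).div differentiableOn_id
    (fun ħ hħ => ne_zero_of_mem_borelDisc hδ hħ) |>.congr fun ħ hħ => ?_
  have h0 := ne_zero_of_mem_borelDisc hδ hħ
  have h1 := hsol.2 x ħ ⟨hxV, hħ⟩
  exact (eq_div_iff h0).2 ((mul_comm _ _).trans h1)

/-- Integrals of functions with Gevrey asymptotics are Borel resummations. -/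
theorem UnifGevrey.exists_integral_resummation {θ δ δ₁ C M r L : ℝ} {D F : ℂ → ℂ} {c : ℂ}
    {f : ℂ → ℂ → ℂ} {fhat Fhat : ℕ → ℂ → ℂ} {U T : Set ℂ} (hF : LiouvilleMap r D c F)
    (hT : IsOpen T) (hTc : Convex ℝ T) (hTr : T ⊆ strip r) (hTL : ∀ t ∈ T, ‖t‖ ≤ L ∧ ‖_root_.deriv F t‖ ≤ L)
    (h : UnifGevrey θ δ C M (F '' T) f fhat) (hδ : 0 < δ) (hC : 0 < C) (hM : 0 < M)
    (hδ₁0 : 0 < δ₁) (hδ₁ : δ₁ < δ) (hU : IsOpen U) (hUc : IsPreconnected U) (hUT : U ⊆ F '' T)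
    {x' : ℂ} (hx' : x' ∈ U) (hFhat : IsFormalIntegral U x' fhat Fhat)
    (hpath : InjOn F (strip r) ∨ BoundedPaths U x') :
    ∃ G : ℂ → ℂ → ℂ, IsIntegral U (borelDisc θ δ₁) x' f G ∧
      IsBorelResummation θ U (borelDisc θ δ₁) Fhat G := by
  have hV : IsOpen (F '' T) := hF.isOpen_image hT hTr
  have hsub : borelDisc θ δ₁ ⊆ borelDisc θ δ := borelDisc_mono hδ₁0 hδ₁.le
  obtain ⟨G, C', hC', hG, hGG⟩ : ∃ (G : ℂ → ℂ → ℂ) (C' : ℝ), 0 < C' ∧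
      IsIntegral U (borelDisc θ δ) x' f G ∧ UnifGevrey θ δ C' M U G Fhat := by
    rcases hpath with hinj | hpath
    -- Paths inside `U` may have unbounded length, so the integral is built on the larger domain `F
    -- '' T` and restricted; connectedness of `U` identifies its formal series with `Fhat`.
    · obtain ⟨Ghat, hGhat⟩ := hF.exists_formalIntegral hinj hT hTc hTr h.coeff x'
      obtain ⟨G, C', hC', hG, hGG⟩ := h.exists_integral hV hδ hC hM (hUT hx') hGhat
        (hF.boundedPaths hTc hTr (fun t ht => (hTL t ht).2) (fun t ht => (hTL t ht).1) (hUT hx'))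
      exact ⟨G, C', hC', fun ħ hħ => ⟨(hG ħ hħ).1, fun x hx => (hG ħ hħ).2 x (hUT hx)⟩,
        (hGG.mono hUT hδ le_rfl).congr_coeff
          (hFhat.eqOn hU hUc hx' (hGhat.mono hUT))⟩
    · exact (h.mono hUT hδ le_rfl).exists_integral hU hδ hC hM hx' hFhat hpath
  exact ⟨G, fun ħ hħ => hG ħ (hsub hħ), hGG.isBorelResummation hU hδ hC' hM hδ₁0 hδ₁⟩

end Riccati

end

/-! ### The theorem: the canonical solution on the halfstrip and on compactly contained domains -/

theorem mainTheorem5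
    -- a domain `X`, a direction `θ`, and a sectorial domain `S` with opening `A_θ`
    (X S : Set ℂ) (θ : ℝ) (hXo : IsOpen X) (hXc : IsConnected X)
    (hS : Riccati.IsSectorialDomain θ S)
    -- the coefficients and their asymptotic expansions
    (p q : ℂ → ℂ → ℂ) (phat qhat : ℕ → ℂ → ℂ)
    (hp : DifferentiableOn ℂ (fun w : ℂ × ℂ => p w.1 w.2) (X ×ˢ S))
    (hq : DifferentiableOn ℂ (fun w : ℂ × ℂ => q w.1 w.2) (X ×ˢ S))
    (hpa : Riccati.PoincareLoc θ X S p phat) (hqa : Riccati.PoincareLoc θ X S q qhat)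
    -- the leading-order discriminant, a regular point, a branch of its square root, a sign
    (D : ℂ → ℂ) (hD : D = Riccati.discr phat qhat)
    (x₀ : ℂ) (hx₀ : x₀ ∈ X) (hreg : D x₀ ≠ 0)
    (s : ℂ → ℂ) (hs : ∀ᶠ x in 𝓝 x₀, DifferentiableAt ℂ s x ∧ s x ^ 2 = D x)
    (ε : ℝ) (hε : ε = 1 ∨ ε = -1)
    -- hypothesis (1): the WKB halfstrips `W r₀` for `0 < r₀ ≤ r`; the given one is `W r`
    (z₁ : ℂ) (r : ℝ) (Ψ : ℂ → ℂ)
    (hΨ : Riccati.IsWKBHalfstrip X D x₀ (s x₀) θ ε z₁ r Ψ)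
    (W : ℝ → Set ℂ) (hW : ∀ r₀, W r₀ = Ψ '' Riccati.halfstrip θ ε z₁ r₀)
    -- hypothesis (2)
    (hpG : Riccati.GevreyUnif θ (W r) (X ×ˢ S) (fun x => √‖D x‖) p phat)
    (hqG : Riccati.GevreyUnif θ (W r) (X ×ˢ S) (fun x => ‖D x‖) q qhat)
    -- hypothesis (3)
    (hlog : ∃ C : ℝ, ∀ x ∈ W r, ‖logDeriv D x‖ ≤ C * ‖D x‖) :
    ∃ (sW : ℂ → ℂ) (fhat : ℕ → ℂ → ℂ) (SS : ℝ → Set ℂ) (𝕎 : Set (ℂ × ℂ)) (f : ℂ → ℂ → ℂ),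
      -- the branch of the square root on the halfstrip
      DifferentiableOn ℂ sW (W r) ∧ (∀ x ∈ W r, sW x ^ 2 = D x) ∧ sW =ᶠ[𝓝 x₀] s ∧
      -- the formal solution
      Riccati.IsFormalSolution phat qhat (W r) fhat ∧
      (∀ x ∈ W r, fhat 0 x = (-phat 0 x + (ε : ℂ) * sW x) / 2) ∧
      (∀ g : ℕ → ℂ → ℂ, Riccati.IsFormalSolution phat qhat (W r) g →
        EqOn (g 0) (fhat 0) (W r) → ∀ k, EqOn (g k) (fhat k) (W r)) ∧
      -- the canonical exact solution on the halfstrip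
      (∀ r₀ ∈ Ioo 0 r, Riccati.IsSectorialDomain θ (SS r₀) ∧ SS r₀ ⊆ S) ∧
      𝕎 = ⋃ r₀ ∈ Ioo 0 r, W r₀ ×ˢ SS r₀ ∧
      Riccati.IsSolution p q 𝕎 f ∧
      Riccati.GevreyLoc θ (W r) 𝕎 f fhat ∧
      (∀ g : ℂ → ℂ → ℂ, Riccati.IsSolution p q 𝕎 g → Riccati.GevreyLoc θ (W r) 𝕎 g fhat →
        ∀ w ∈ 𝕎, g w.1 w.2 = f w.1 w.2) ∧
      (∀ r₀ ∈ Ioo 0 r,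
        Riccati.GevreyUnif θ (W r₀) (W r₀ ×ˢ SS r₀) (fun x => √‖D x‖) f fhat) ∧
      -- compactly contained domains
      ∀ U₀ : Set ℂ, IsOpen U₀ → IsConnected U₀ → IsCompact (closure U₀) → closure U₀ ⊆ W r →
        ∃ S₀ : Set ℂ, Riccati.IsSectorialDomain θ S₀ ∧ S₀ ⊆ S ∧ U₀ ×ˢ S₀ ⊆ 𝕎 ∧
          -- existence and uniqueness
          Riccati.IsSolution p q (U₀ ×ˢ S₀) f ∧
          Riccati.GevreyUnif θ U₀ (U₀ ×ˢ S₀) (fun _ => 1) f fhat ∧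
          (∀ g : ℂ → ℂ → ℂ, Riccati.IsSolution p q (U₀ ×ˢ S₀) g →
            Riccati.GevreyUnif θ U₀ (U₀ ×ˢ S₀) (fun _ => 1) g fhat →
            ∀ x ∈ U₀, ∀ ħ ∈ S₀, g x ħ = f x ħ) ∧
          -- Borel summability of the formal solution
          Riccati.FormalBorelConverges U₀ fhat ∧
          Riccati.UniformlyGevrey U₀ fhat ∧
          (∃ (τ : ℝ) (φ : ℂ → ℂ → ℂ), Riccati.IsBorelSummable θ τ U₀ fhat φ ∧
            Riccati.IsAnalyticBorelTransform θ U₀ S₀ (fun x ħ => f x ħ - fhat 0 x) φ ∧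
            Riccati.LaplaceConverges θ U₀ S₀ φ ∧
            ∀ x ∈ U₀, ∀ ħ ∈ S₀, f x ħ = fhat 0 x + Riccati.laplace θ φ x ħ) ∧
          Riccati.IsBorelResummation θ U₀ S₀ fhat f ∧
          -- derivatives
          Riccati.IsBorelResummation θ U₀ S₀ (fun k => deriv (fhat k))
            (fun x ħ => deriv (fun y => f y ħ) x) ∧
          -- integrals
          ∀ x' ∈ U₀,
            (InjOn Ψ (Riccati.halfstrip θ ε z₁ r) →
              ∃ Fhat : ℕ → ℂ → ℂ, Riccati.IsFormalIntegral U₀ x' fhat Fhat) ∧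
            ∀ Fhat : ℕ → ℂ → ℂ, Riccati.IsFormalIntegral U₀ x' fhat Fhat →
              (InjOn Ψ (Riccati.halfstrip θ ε z₁ r) ∨ Riccati.BoundedPaths U₀ x') →
              ∃ F : ℂ → ℂ → ℂ, Riccati.IsIntegral U₀ S₀ x' f F ∧
                Riccati.IsBorelResummation θ U₀ S₀ Fhat F := by
  set F : ℂ → ℂ := fun t => Ψ (z₁ + ε * Riccati.dir θ * t) with hFdef
  have hF : Riccati.LiouvilleMap r D (Riccati.dir θ ^ 2) F := hΨ.liouvilleMap hε
  have hWF : ∀ ρ, W ρ = F '' Riccati.strip ρ := fun ρ => (hW ρ).trans (Riccati.image_halfstrip hε z₁ Ψ ρ)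
  have hX : F '' Riccati.strip r ⊆ X := by
    rw [← hWF, hW]; exact hΨ.mapsTo.image_subset
  have hinj : InjOn Ψ (Riccati.halfstrip θ ε z₁ r) → InjOn F (Riccati.strip r) :=
    Riccati.injOn_strip_of_halfstrip hε
  have hεε : (ε : ℂ) * ε = 1 := by rcases hε with rfl | rfl <;> norm_num
  rw [hWF] at hpG hqG
  obtain ⟨δ, C, M, hδS, hR⟩ :=
    Riccati.exists_riccatiData hF hD hp hq hpa.1 hqa.1 hX hpG hqG
  -- With this `u` one has `ε sW ∘ F = e^{iθ} / F'`, so the leading coefficient with sign `ε` is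
  -- exactly the root required in `RiccatiData.exists_exact_solution`.
  obtain ⟨sW, hsW, hsWd, hsW2⟩ := hF.exists_branch (u := ε * Riccati.dir θ) (by
    rw [mul_pow, sq (ε : ℂ), hεε, one_mul])
  have hWo : IsOpen (F '' Riccati.strip r) := hF.isOpen_image (Riccati.isOpen_strip r) subset_rfl
  have hne : ∀ x ∈ F '' Riccati.strip r, (ε : ℂ) * sW x ≠ 0 := by
    rintro _ ⟨t, ht, rfl⟩
    rw [hsW t ht, ← mul_div_assoc, ← mul_assoc, hεε, one_mul]
    exact div_ne_zero (Riccati.dir_ne_zero θ) (hF.deriv_ne ht)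
  -- the germ of the branch
  have hbranch : sW =ᶠ[𝓝 x₀] s := by
    obtain ⟨t, ht, htx, hts⟩ := hΨ.exists_base hε
    have hx : x₀ ∈ F '' Riccati.strip r := ⟨t, ht, htx⟩
    have hx' := hWo.mem_nhds hx
    have hval : sW x₀ = s x₀ := by
      have h1 : sW x₀ = ε * Riccati.dir θ / deriv F t := by rw [← hsW t ht, ← htx]
      rw [h1, ← hts, mul_div_cancel_left₀ _ (hF.deriv_ne ht)]
    refine Riccati.eventuallyEq_of_sq_eq (hsWd.differentiableAt hx').continuousAt
      hs.self_of_nhds.1.continuousAt hval ?_ ?_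
    · intro h0
      exact hreg (by rw [← hs.self_of_nhds.2, h0, zero_pow two_ne_zero])
    · filter_upwards [hs, hx'] with y h1 h2 using (hsW2 y h2).trans h1.2.symm
  obtain ⟨fhat, hfhat, hf0⟩ := Riccati.exists_formalSolution hWo hR.p_coeff hR.q_coeff
    (f₀ := fun x => (-phat 0 x + ε * sW x) / 2)
    (((hR.p_coeff 0).neg.add (hsWd.const_mul _)).div_const 2)
    (fun x hx => by
      have h1 := hsW2 x hx
      rw [hD, Riccati.discr] at h1
      linear_combination (1 / 4 : ℂ) * h1 + (sW x ^ 2 / 4) * hεε)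
    (fun x hx => by
      have h1 := hne x hx
      intro h2
      exact h1 (by linear_combination h2))
  have hf0' : ∀ x, fhat 0 x = (-phat 0 x + ε * sW x) / 2 := fun x => by rw [hf0]
  obtain ⟨Δ, f, hΔ⟩ := hR.exists_exact_solution hfhat fun t ht => by
    rw [hf0', hsW t ht, ← mul_div_assoc, ← mul_assoc, hεε, one_mul]
  have hpos : ∀ r₀ < r, 0 < Δ r₀ := fun r₀ h => (hΔ r₀ h).1
  have hDisc : ∀ r₀ < r, Riccati.borelDisc θ (Δ r₀) ⊆ Riccati.borelDisc θ δ := fun r₀ h =>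
    Riccati.borelDisc_mono (hpos r₀ h) (hΔ r₀ h).2.1
  have hVo : ∀ r₀ < r, IsOpen (F '' Riccati.strip r₀) := fun r₀ h =>
    hF.isOpen_image (Riccati.isOpen_strip r₀) (Riccati.strip_mono h.le)
  have hscale : ContinuousOn (fun x => √‖D x‖) (F '' Riccati.strip r) := by
    have : DifferentiableOn ℂ D (F '' Riccati.strip r) := by
      rw [hD]; exact ((hR.p_coeff 0).pow 2).sub ((hR.q_coeff 0).const_mul 4)
    exact this.continuousOn.norm.sqrt
  have hsol : ∀ r₀ < r, Riccati.IsSolution p q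
      ((F '' Riccati.strip r₀) ×ˢ Riccati.borelDisc θ (Δ r₀)) f := fun r₀ h => by
    obtain ⟨h0, -, C', M', -, -, hE⟩ := hΔ r₀ h
    exact hE.isSolution (hVo r₀ h) h0 (hscale.mono (image_mono (Riccati.strip_mono h.le)))
  have hsub𝕎 : ∀ r₀ ∈ Ioo 0 r, (F '' Riccati.strip r₀) ×ˢ Riccati.borelDisc θ (Δ r₀) ⊆
      ⋃ r₀ ∈ Ioo 0 r, (F '' Riccati.strip r₀) ×ˢ Riccati.borelDisc θ (Δ r₀) := fun r₀ h =>
    subset_biUnion_of_mem (u := fun r₀ => (F '' Riccati.strip r₀) ×ˢ Riccati.borelDisc θ (Δ r₀)) h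
  have hsolW : Riccati.IsSolution p q
      (⋃ r₀ ∈ Ioo 0 r, (F '' Riccati.strip r₀) ×ˢ Riccati.borelDisc θ (Δ r₀)) f := by
    refine ⟨fun w hw => ?_, fun x ħ hw => ?_⟩
    · obtain ⟨r₀, hr₀, hw⟩ := mem_iUnion₂.1 hw
      exact ((hsol r₀ hr₀.2).1.differentiableAt (((hVo r₀ hr₀.2).prod
        (Riccati.isOpen_borelDisc (hpos r₀ hr₀.2))).mem_nhds hw)).differentiableWithinAt
    · obtain ⟨r₀, hr₀, hw⟩ := mem_iUnion₂.1 hw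
      exact (hsol r₀ hr₀.2).2 x ħ hw
  -- uniform Gevrey asymptotics near compact sets
  have hcompact : ∀ K : Set ℂ, IsCompact K → K ⊆ F '' Riccati.strip r →
      ∃ (ρ : ℝ) (T : Set ℂ), ρ ∈ Ioo 0 r ∧ T ⊆ Riccati.strip ρ ∧ IsOpen T ∧ Convex ℝ T ∧
        K ⊆ F '' T ∧ (∃ L : ℝ, ∀ t ∈ T, ‖t‖ ≤ L ∧ ‖deriv F t‖ ≤ L) ∧
        ∃ C' M' : ℝ, 0 < C' ∧ 0 < M' ∧
          Riccati.UnifGevrey θ (Δ ρ) C' M' (F '' T) f fhat := by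
    intro K hK hKr
    obtain ⟨ρ, T, hρ0, hρr, hTρ, hTo, hTc, hKT, L, hL⟩ := hF.exists_convex_cover hK hKr
    obtain ⟨h0, -, C', M', hC', hM', hE⟩ := hΔ ρ hρr
    have hTr : T ⊆ Riccati.strip r := hTρ.trans (Riccati.strip_mono hρr.le)
    -- On `F '' T` the scale `√‖D‖ = 1 / ‖F'‖` is bounded by `L`, so it can be dropped; `|L| + 1`
    -- keeps the constant positive.
    refine ⟨ρ, T, ⟨hρ0, hρr⟩, hTρ, hTo, hTc, hKT, ⟨L, fun t ht => ⟨(hL t ht).1, (hL t ht).2.1⟩⟩,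
      (|L| + 1) * C', M', by positivity, hM',
      (hE.mono (image_mono hTρ) h0 le_rfl).unifGevrey ?_ hC'.le hM'.le
        fun k => (hfhat.1 k).mono (image_mono hTr)⟩
    rintro _ ⟨t, ht, rfl⟩
    rw [hF.sqrt_norm_eq (hTr ht)]
    exact (hL t ht).2.2.trans ((le_abs_self L).trans (lt_add_one _).le)
  have hloc : Riccati.GevreyLoc θ (F '' Riccati.strip r)
      (⋃ r₀ ∈ Ioo 0 r, (F '' Riccati.strip r₀) ×ˢ Riccati.borelDisc θ (Δ r₀)) f fhat := by
    intro x hx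
    obtain ⟨ρ, T, hρ, hTρ, hTo, -, hxT, -, C', M', hC', hM', hG⟩ :=
      hcompact {x} isCompact_singleton (singleton_subset_iff.2 hx)
    have hTr : T ⊆ Riccati.strip r := hTρ.trans (Riccati.strip_mono hρ.2.le)
    exact ⟨F '' T, hF.isOpen_image hTo hTr, singleton_subset_iff.1 hxT, image_mono hTr,
      hG.gevreyUnif (hpos ρ hρ.2) hC' hM'
        ((prod_mono (image_mono hTρ) subset_rfl).trans (hsub𝕎 ρ hρ))⟩
  simp only [hWF]
  refine ⟨sW, fhat, fun r₀ => Riccati.borelDisc θ (Δ r₀), _, f, hsWd, hsW2, hbranch, hfhat,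
    fun x _ => hf0' x, fun g hg h0 => Riccati.formalSolution_unique hWo hfhat hg (fun x hx => ?_) h0,
    fun r₀ hr₀ => ⟨Riccati.isSectorialDomain_borelDisc (hpos r₀ hr₀.2), (hDisc r₀ hr₀.2).trans hδS⟩,
    rfl, hsolW, hloc, ?_, ?_, ?_⟩
  · rw [hf0']
    intro h1
    exact hne x hx (by linear_combination h1)
  · intro g hg hgG w hw
    obtain ⟨r₀, hr₀, hw'⟩ := mem_iUnion₂.1 hw
    have hx : w.1 ∈ F '' Riccati.strip r := image_mono (Riccati.strip_mono hr₀.2.le) hw'.1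
    obtain ⟨U₁, -, hxU₁, -, hf₁⟩ := hloc w.1 hx
    obtain ⟨U₂, -, hxU₂, -, hg₂⟩ := hgG w.1 hx
    have hslice : ∀ ħ ∈ Riccati.borelDisc θ (Δ r₀), (w.1, ħ) ∈
        ⋃ r₀ ∈ Ioo 0 r, (F '' Riccati.strip r₀) ×ˢ Riccati.borelDisc θ (Δ r₀) := fun ħ hħ =>
      hsub𝕎 r₀ hr₀ ⟨hw'.1, hħ⟩
    exact Riccati.eqOn_of_gevreyUnif (hpos r₀ hr₀.2) hxU₁ hxU₂
      (Riccati.differentiableOn_slice hsolW.1 hslice) (Riccati.differentiableOn_slice hg.1 hslice)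
      hf₁ hg₂ hw'.2
  · intro r₀ hr₀
    obtain ⟨h0, -, C', M', hC', hM', hE⟩ := hΔ r₀ hr₀.2
    exact hE.gevreyUnif h0 hC' hM' subset_rfl
  intro U₀ hU₀o hU₀c hU₀K hU₀W
  obtain ⟨ρ, T, hρ, hTρ, hTo, hTc, hUT, ⟨L, hL⟩, C', M', hC', hM', hG⟩ := hcompact _ hU₀K hU₀W
  have hTr : T ⊆ Riccati.strip r := hTρ.trans (Riccati.strip_mono hρ.2.le)
  have h0 := hpos ρ hρ.2
  -- `S₀` is the Borel disc of half the diameter: uniform convergence of the Laplace integral and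
  -- the analytic Borel transform were derived with a strict gap to the disc that carries the
  -- asymptotics.
  have h20 : 0 < Δ ρ / 2 := half_pos h0
  have h2 : Δ ρ / 2 < Δ ρ := half_lt_self h0
  have hVT : IsOpen (F '' T) := hF.isOpen_image hTo hTr
  have hUT' : U₀ ⊆ F '' T := subset_closure.trans hUT
  have hdisc : Riccati.borelDisc θ (Δ ρ / 2) ⊆ Riccati.borelDisc θ (Δ ρ) :=
    Riccati.borelDisc_mono h20 h2.le
  have hG₀ := hG.mono hUT' h0 le_rfl
  have hsol₀ := (hsol ρ hρ.2).mono (prod_mono (hUT'.trans (image_mono hTρ)) hdisc)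
  have hGU : Riccati.GevreyUnif θ U₀ (U₀ ×ˢ Riccati.borelDisc θ (Δ ρ / 2)) (fun _ => 1) f fhat :=
    (hG₀.mono subset_rfl h20 h2.le).gevreyUnif h20 hC' hM' subset_rfl
  refine ⟨Riccati.borelDisc θ (Δ ρ / 2), Riccati.isSectorialDomain_borelDisc h20,
    hdisc.trans ((hDisc ρ hρ.2).trans hδS),
    (prod_mono (hUT'.trans (image_mono hTρ)) hdisc).trans (hsub𝕎 ρ hρ), hsol₀, hGU, ?_,
    hG₀.formalBorelConverges hU₀o h0 hC' hM', hG₀.uniformlyGevrey h0 hC' hM',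
    hG₀.exists_borelSummable hU₀o h0 hC' hM' h20 h2,
    hG₀.isBorelResummation hU₀o h0 hC' hM' h20 h2, ?_, fun x' hx' => ⟨fun hi => ?_, ?_⟩⟩
  · intro g hg hgG x hx
    exact Riccati.eqOn_of_gevreyUnif h20 hx hx
      (Riccati.differentiableOn_slice hsol₀.1 fun ħ hħ => ⟨hx, hħ⟩)
      (Riccati.differentiableOn_slice hg.1 fun ħ hħ => ⟨hx, hħ⟩) hGU hgG
  · exact hG.isBorelResummation_deriv h0 hC' hM' h20 h2 hU₀o hU₀K hVT hUT
      (fun x hx => (hR.p_right x (image_mono hTr hx)).mono (hDisc ρ hρ.2))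
      (fun x hx => (hR.q_right x (image_mono hTr hx)).mono (hDisc ρ hρ.2))
      ((hsol ρ hρ.2).mono (prod_mono (image_mono hTρ) subset_rfl))
  · obtain ⟨Fhat, hFhat⟩ := hF.exists_formalIntegral (hinj hi) hTo hTc hTr hG.coeff x'
    exact ⟨Fhat, hFhat.mono hUT'⟩
  · intro Fhat hFhat hpath
    exact hG.exists_integral_resummation hF hTo hTc hTr hL h0 hC' hM' h20 h2 hU₀o
      hU₀c.isPreconnected hUT' hx' hFhat (hpath.imp_left hinj)
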